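/- Let $k=\mathbb F_q$ be a finite field with $q=2^a$ elements, $\mathbb Z_q=W(k)$, $\mathbb Q_q=\mathrm{Frac}(\mathbb Z_q)$, $\sigma$ the Frobenius automorphism, and let $g\ge 1$. Setting. Let $h_1,\dots,h_m$ and $Q_f$ in $\mathbb Z_q[\Gamma][X]$ be monic in $X$ with $\deg_X h_i\ge 1$ ($m=0$ is allowed), let $r_i\ge 1$ be integers and $c\in\mathbb Z_q^\times$. Put $H=\prod h_i$, $h=c\prod h_i^{r_i}$, $f=HQ_f$, and suppose $\deg_X f=2g+1$, $\deg_X h\le g$, and that $r(\Gamma)=\mathrm{Res}_X(H,Q_f\cdot\partial H/\partial X)$ satisfies $r(0)\not\equiv 0\bmod 2$ (for $m=0$, $r=1$). Put $\tilde D=\max r_i$ (and $\tilde D=1$ for $m=0$) and $\kappa=\max(\deg_\Gamma f,\deg_\Gamma h^2)$. Let $$S=\mathbb Q_q[\Gamma,1/r]^\dagger,\qquad T=\mathbb Q_q[\Gamma,1/r,X,Y,1/H]^\dagger/(Y^2+hY-f)$$ be the overconvergent (dagger) algebras, write $\mathrm{ord}_2(s)\ge n$ if $s\in 2^n\,\mathbb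 Z_q[\Gamma,1/r]^\dagger$ (similarly on $T$), let $\partial/\partial X$ be the $S$-linear derivation of $T$ with $\partial X/\partial X=1$ and $(2Y+h)\,\partial Y/\partial X=f'-h'Y$, where $'$ is the derivative in $X$ of polynomials, and let $H_{MW}=T\,dX/dT$ with $dt=(\partial t/\partial X)\,dX$. Let $f^\sigma,h^\sigma$ be obtained from $f,h$ by applying $\sigma$ to the coefficients and $X\mapsto X^2$, $\Gamma\mapsto\Gamma^2$. Claim. There are an absolute constant $A$ and natural numbers $\chi_1$ depending only on $(g,\tilde D,N)$, $\chi_2$ depending only on $(g,\kappa,\tilde D,N)$ and $\varphi$ depending only on $g$, with $$\chi_1\le A\,\tilde D\max(N,\log_2(g+1)),\quad \chi_2\le A\,g\kappa\tilde D\max(N,\log_2(g+1)),\quad \varphi\le A\log_2(g+1)$$ (so $\chi_1\le AN\tilde D$ and $\chi_2\le A\,g\kappa N\tilde D$ as soon as $N\ge\log_2(g+1)$), such that for all data as above the following holds. (1) There is a unique $F_2(Y)\in T$ with $F_2(Y)^2+h^\sigma F_2(Y)-f^\sigma=0$ and $F_2(Y)\equiv Y^2\bmod 2$. (2) There is a unique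 $2g\times 2g$ matrix $F(\Gamma)=(F_{ij})_{0\le i,j\le 2g-1}$ over $S$ with $F_2(X^iY\,dX):=X^{2i}F_2(Y)\cdot 2X\,dX=\sum_j F_{ij}\,X^jY\,dX$ in $H_{MW}$ for all $i$. (3) For all integers $N\ge 0$ and all $i,j$ there is a polynomial $p\in\mathbb Q_q[\Gamma]$ of degree at most $\chi_2$ with $r^{\chi_1}F_{ij}\equiv p\bmod 2^N$, that is, $\mathrm{ord}_2(r^{\chi_1}F_{ij}-p)\ge N$. (4) $\mathrm{ord}_2(F_{ij})\ge-\varphi$ for all $i,j$. -/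

import Mathlib

noncomputable section

namespace DeformedCurve

open Polynomial

/-! ### The unramified `2`-adic field and overconvergent power series -/

/-- The ring of integers `ℤ_q` of `ℚ_q`, where `k = 𝔽_q`. -/
abbrev Zq (k : Type*) [Field k] [CharP k 2] : Type _ := WittVector 2 k

/-- The unramified extension `ℚ_q` of `ℚ_2` with residue field `k = 𝔽_q`. -/
abbrev Qq (k : Type*) [Field k] [CharP k 2] : Type _ := FractionRing (WittVector 2 k)

section Order

variable {k : Type*} [Field k] [CharP k 2]

/-- `OrdGE t x` says that `ord₂ x ≥ t` (as `ord₂` takes values in `ℤ ∪ {∞}`, this means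
`x ∈ 2 ^ ⌈t⌉ ℤ_q`). -/
def OrdGE (t : ℝ) (x : Qq k) : Prop :=
  ∃ z : Zq k, x = (2 : Qq k) ^ ⌈t⌉ * algebraMap (Zq k) (Qq k) z

theorem two_ne_zero_Qq : (2 : Qq k) ≠ 0 := by
  exact_mod_cast WittVector.FractionRing.p_nonzero 2 k

theorem map_two_Qq : algebraMap (Zq k) (Qq k) 2 = 2 := map_ofNat _ 2

theorem OrdGE.of_zpow {t : ℝ} {n : ℤ} (h : t ≤ n) (z : Zq k) :
    OrdGE t ((2 : Qq k) ^ n * algebraMap (Zq k) (Qq k) z) := by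
  have hn : ⌈t⌉ ≤ n := Int.ceil_le.2 h
  obtain ⟨m, rfl⟩ := Int.le.dest hn
  refine ⟨2 ^ m * z, ?_⟩
  rw [zpow_add₀ two_ne_zero_Qq, map_mul, map_pow, map_two_Qq, zpow_natCast, mul_assoc]

theorem OrdGE.mono {s t : ℝ} (h : s ≤ t) {x : Qq k} (hx : OrdGE t x) : OrdGE s x := by
  obtain ⟨z, rfl⟩ := hx
  exact OrdGE.of_zpow (h.trans (Int.le_ceil t)) z

theorem OrdGE.zero (t : ℝ) : OrdGE t (0 : Qq k) := ⟨0, by simp⟩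

theorem OrdGE.add {t : ℝ} {x y : Qq k} (hx : OrdGE t x) (hy : OrdGE t y) :
    OrdGE t (x + y) := by
  obtain ⟨z, rfl⟩ := hx
  obtain ⟨w, rfl⟩ := hy
  exact ⟨z + w, by rw [map_add, mul_add]⟩

theorem OrdGE.mul {s t : ℝ} {x y : Qq k} (hx : OrdGE s x) (hy : OrdGE t y) :
    OrdGE (s + t) (x * y) := by
  obtain ⟨z, rfl⟩ := hx
  obtain ⟨w, rfl⟩ := hy
  have h := OrdGE.of_zpow (t := s + t) (n := ⌈s⌉ + ⌈t⌉)
    (by push_cast; exact add_le_add (Int.le_ceil s) (Int.le_ceil t)) (z * w)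
  rw [zpow_add₀ two_ne_zero_Qq, map_mul] at h
  convert h using 1
  ring

theorem OrdGE.integral (z : Zq k) : OrdGE 0 (algebraMap (Zq k) (Qq k) z) :=
  ⟨z, by simp⟩

theorem OrdGE.exists [PerfectRing k 2] (x : Qq k) : ∃ t : ℝ, OrdGE t x := by
  obtain ⟨a, b, hb, rfl⟩ := IsFractionRing.div_surjective (A := Zq k) x
  obtain ⟨m, u, rfl⟩ := WittVector.exists_eq_pow_p_mul' (p := 2) b (nonZeroDivisors.ne_zero hb)
  refine ⟨((-m : ℤ) : ℝ), a * ((u⁻¹ : (Zq k)ˣ) : Zq k), ?_⟩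
  have hu : algebraMap (Zq k) (Qq k) u * algebraMap (Zq k) (Qq k) ((u⁻¹ : (Zq k)ˣ) : Zq k) = 1 := by
    rw [← map_mul]; simp
  have hu0 : algebraMap (Zq k) (Qq k) u ≠ 0 := left_ne_zero_of_mul_eq_one hu
  have h2 : algebraMap (Zq k) (Qq k) ((2 : ℕ) : Zq k) = 2 := by simpa using map_two_Qq
  rw [Int.ceil_intCast, map_mul, map_mul, map_pow, h2, zpow_neg, zpow_natCast,
    div_eq_iff (mul_ne_zero (pow_ne_zero _ two_ne_zero_Qq) hu0)]
  have h3 : (2 : Qq k) ^ m ≠ 0 := pow_ne_zero _ two_ne_zero_Qq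
  calc algebraMap (Zq k) (Qq k) a
      = ((2 : Qq k) ^ m)⁻¹ * (2 : Qq k) ^ m * algebraMap (Zq k) (Qq k) a *
        (algebraMap (Zq k) (Qq k) u * algebraMap (Zq k) (Qq k) ((u⁻¹ : (Zq k)ˣ) : Zq k)) := by
          rw [hu, inv_mul_cancel₀ h3, one_mul, mul_one]
    _ = _ := by ring

theorem OrdGE.sum {ι : Type*} {t : ℝ} (s : Finset ι) (x : ι → Qq k)
    (h : ∀ i ∈ s, OrdGE t (x i)) : OrdGE t (∑ i ∈ s, x i) := by
  classical
  induction s using Finset.induction_on with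
  | empty => simpa using OrdGE.zero t
  | insert a s ha ih =>
    rw [Finset.sum_insert ha]
    exact (h a (Finset.mem_insert_self a s)).add
      (ih fun i hi => h i (Finset.mem_insert_of_mem hi))

end Order

section Dagger

variable {k : Type*} [Field k] [CharP k 2]

/-- A power series `∑ a_m x^m` over `ℚ_q` is overconvergent if `ord₂ a_m ≥ δ |m| + ε` for some
real `δ > 0` and `ε`. -/
def IsOverconvergent {τ : Type*} (P : MvPowerSeries τ (Qq k)) : Prop :=
  ∃ δ > (0 : ℝ), ∃ ε : ℝ, ∀ m : τ →₀ ℕ,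
    OrdGE (δ * (m.degree : ℝ) + ε) (MvPowerSeries.coeff m P)

theorem IsOverconvergent.add {τ : Type*} {P Q : MvPowerSeries τ (Qq k)}
    (hP : IsOverconvergent P) (hQ : IsOverconvergent Q) : IsOverconvergent (P + Q) := by
  obtain ⟨δ, hδ, ε, h⟩ := hP
  obtain ⟨δ', hδ', ε', h'⟩ := hQ
  refine ⟨min δ δ', lt_min hδ hδ', min ε ε', fun m => ?_⟩
  have hm : (0 : ℝ) ≤ (m.degree : ℝ) := Nat.cast_nonneg _
  rw [map_add]
  refine ((h m).mono ?_).add ((h' m).mono ?_)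
  · exact add_le_add (mul_le_mul_of_nonneg_right (min_le_left _ _) hm) (min_le_left _ _)
  · exact add_le_add (mul_le_mul_of_nonneg_right (min_le_right _ _) hm) (min_le_right _ _)

theorem IsOverconvergent.mul {τ : Type*} {P Q : MvPowerSeries τ (Qq k)}
    (hP : IsOverconvergent P) (hQ : IsOverconvergent Q) : IsOverconvergent (P * Q) := by
  classical
  obtain ⟨δ, hδ, ε, h⟩ := hP
  obtain ⟨δ', hδ', ε', h'⟩ := hQ
  refine ⟨min δ δ', lt_min hδ hδ', ε + ε', fun m => ?_⟩
  rw [MvPowerSeries.coeff_mul]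
  refine OrdGE.sum _ _ fun p hp => ((h p.1).mul (h' p.2)).mono ?_
  have hp' : p.1 + p.2 = m := by simpa using hp
  have hd : (m.degree : ℝ) = (p.1.degree : ℝ) + (p.2.degree : ℝ) := by
    rw [← hp', map_add]; push_cast; ring
  have h1 : (0 : ℝ) ≤ (p.1.degree : ℝ) := Nat.cast_nonneg _
  have h2 : (0 : ℝ) ≤ (p.2.degree : ℝ) := Nat.cast_nonneg _
  have h3 := mul_le_mul_of_nonneg_right (min_le_left δ δ') h1
  have h4 := mul_le_mul_of_nonneg_right (min_le_right δ δ') h2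
  rw [hd]
  linarith

theorem IsOverconvergent.monomial [PerfectRing k 2] {τ : Type*} (n : τ →₀ ℕ) (a : Qq k) :
    IsOverconvergent (MvPowerSeries.monomial n a) := by
  classical
  obtain ⟨t, ht⟩ := OrdGE.exists a
  refine ⟨1, one_pos, t - (n.degree : ℝ), fun m => ?_⟩
  rw [MvPowerSeries.coeff_monomial]
  split_ifs with h
  · subst h
    exact ht.mono (by linarith)
  · exact OrdGE.zero _

theorem IsOverconvergent.pderiv {τ : Type*} (i : τ) {P : MvPowerSeries τ (Qq k)}
    (hP : IsOverconvergent P) : IsOverconvergent (MvPowerSeries.pderiv (Qq k) i P) := by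
  obtain ⟨δ, hδ, ε, h⟩ := hP
  refine ⟨δ, hδ, ε, fun m => ?_⟩
  rw [MvPowerSeries.coeff_pderiv]
  have h1 := (h (m + Finsupp.single i 1)).mul (OrdGE.integral (k := k) ((m i : Zq k) + 1))
  rw [map_add (algebraMap (Zq k) (Qq k)), map_one, map_natCast] at h1
  refine h1.mono ?_
  rw [map_add, Finsupp.degree_single]
  push_cast
  linarith

theorem IsOverconvergent.rename {τ υ : Type*} (e : τ ↪ υ) {P : MvPowerSeries τ (Qq k)}
    (hP : IsOverconvergent P) : IsOverconvergent (MvPowerSeries.rename e P) := by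
  obtain ⟨δ, hδ, ε, h⟩ := hP
  refine ⟨δ, hδ, ε, fun m => ?_⟩
  by_cases hm : m ∈ Set.range (Finsupp.mapDomain e)
  · obtain ⟨n, rfl⟩ := hm
    rw [← Finsupp.embDomain_eq_mapDomain, MvPowerSeries.coeff_embDomain_rename,
      Finsupp.embDomain_eq_mapDomain, Finsupp.degree_mapDomain]
    exact h n
  · rw [MvPowerSeries.coeff_rename_eq_zero _ _ hm]
    exact OrdGE.zero _

variable (k) [PerfectRing k 2]

/-- The overconvergent power series, as a subalgebra of all power series. -/
def daggerSubalgebra (τ : Type*) : Subalgebra (Qq k) (MvPowerSeries τ (Qq k)) where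
  carrier := {P | IsOverconvergent P}
  mul_mem' := IsOverconvergent.mul
  add_mem' := IsOverconvergent.add
  algebraMap_mem' a := IsOverconvergent.monomial 0 a

/-- The dagger algebra `ℚ_q⟨x_i : i ∈ τ⟩†` of overconvergent power series. -/
def Dagger (τ : Type*) : Type _ := daggerSubalgebra k τ

instance (τ : Type*) : CommRing (Dagger k τ) := inferInstanceAs (CommRing (daggerSubalgebra k τ))

instance (τ : Type*) : Algebra (Qq k) (Dagger k τ) :=
  inferInstanceAs (Algebra (Qq k) (daggerSubalgebra k τ))

/-- The inclusion of the overconvergent power series into all power series. -/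
def Dagger.val (τ : Type*) : Dagger k τ →ₐ[Qq k] MvPowerSeries τ (Qq k) :=
  (daggerSubalgebra k τ).val

variable {k}

/-- The variable `x_i`, as an overconvergent power series. -/
def Dagger.var {τ : Type*} (i : τ) : Dagger k τ :=
  ⟨MvPowerSeries.X i, IsOverconvergent.monomial (Finsupp.single i 1) 1⟩

/-- The partial derivative `∂/∂x_i` on overconvergent power series. -/
def Dagger.pderiv {τ : Type*} (i : τ) (P : Dagger k τ) : Dagger k τ :=
  ⟨MvPowerSeries.pderiv (Qq k) i P.1, IsOverconvergent.pderiv i P.2⟩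

/-- The inclusion of dagger algebras induced by an inclusion of sets of variables. -/
def Dagger.rename {τ υ : Type*} (e : τ ↪ υ) : Dagger k τ →+* Dagger k υ :=
  (((MvPowerSeries.rename (R := Qq k) e).comp (Dagger.val k τ)).codRestrict
    (daggerSubalgebra k υ) fun P => IsOverconvergent.rename e P.2).toRingHom

theorem Dagger.rename_algebraMap {τ υ : Type*} (e : τ ↪ υ) (a : Qq k) :
    Dagger.rename e (algebraMap (Qq k) (Dagger k τ) a) = algebraMap (Qq k) (Dagger k υ) a :=
  (((MvPowerSeries.rename (R := Qq k) e).comp (Dagger.val k τ)).codRestrict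
    (daggerSubalgebra k υ) fun P => IsOverconvergent.rename e P.2).commutes a

theorem Dagger.rename_var {τ υ : Type*} (e : τ ↪ υ) (i : τ) :
    Dagger.rename (k := k) e (Dagger.var i) = Dagger.var (e i) :=
  Subtype.ext (MvPowerSeries.rename_X _ i)

/-- `Dagger.GaussGE n P` says that all coefficients of `P` have order at least `n`. -/
def Dagger.GaussGE {τ : Type*} (n : ℤ) (P : Dagger k τ) : Prop :=
  ∀ m : τ →₀ ℕ, OrdGE (n : ℝ) (MvPowerSeries.coeff m P.1)

theorem Dagger.pderiv_add {τ : Type*} (i : τ) (P Q : Dagger k τ) :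
    Dagger.pderiv i (P + Q) = Dagger.pderiv i P + Dagger.pderiv i Q :=
  Subtype.ext (map_add _ _ _)

theorem Dagger.pderiv_zero {τ : Type*} (i : τ) : Dagger.pderiv i (0 : Dagger k τ) = 0 :=
  Subtype.ext (map_zero _)

theorem Dagger.pderiv_mul {τ : Type*} (i : τ) (P Q : Dagger k τ) :
    Dagger.pderiv i (P * Q) = P * Dagger.pderiv i Q + Q * Dagger.pderiv i P :=
  Subtype.ext ((MvPowerSeries.pderiv (Qq k) i).leibniz P.1 Q.1)

theorem Dagger.pderiv_rename {τ υ : Type*} (e : τ ↪ υ) (i : υ) (hi : i ∉ Set.range e)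
    (P : Dagger k τ) : Dagger.pderiv i (Dagger.rename e P) = 0 := by
  refine Subtype.ext (MvPowerSeries.ext fun m => ?_)
  change MvPowerSeries.coeff m (MvPowerSeries.pderiv (Qq k) i (MvPowerSeries.rename e P.1)) = 0
  rw [MvPowerSeries.coeff_pderiv, MvPowerSeries.coeff_rename_eq_zero, zero_mul]
  rintro ⟨n, hn⟩
  have h : Finsupp.mapDomain e n i = 0 := Finsupp.mapDomain_of_notMem_range _ _ hi
  rw [hn] at h
  simp at h

end Dagger

/-! ### The family of curves -/

section Family

/-- Evaluation of a two-variable polynomial `p(X, Γ)` over `ℤ_q` at `Γ = γ`, `X = x`, where the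
coefficients are mapped by `ψ`. Elements of `(Zq k)[X][X]` are read as polynomials in `X` (outer
variable) whose coefficients are polynomials in `Γ` (inner variable). -/
def evalXΓ {k : Type*} [Field k] [CharP k 2] {A : Type*} [CommRing A] (ψ : Zq k →+* A)
    (γ x : A) (p : (Zq k)[X][X]) : A :=
  p.eval₂ (eval₂RingHom ψ γ) x

/-- The degree in `Γ` of a polynomial `p(X, Γ)`. -/
def degΓ {R : Type*} [CommRing R] (p : R[X][X]) : ℕ :=
  p.support.sup fun n => (p.coeff n).natDegree

/-- The canonical map from `ℤ_q` to a `ℚ_q`-algebra. -/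
def coeffMap (k : Type*) [Field k] [CharP k 2] (A : Type*) [CommRing A] [Algebra (Qq k) A] :
    Zq k →+* A :=
  (algebraMap (Qq k) A).comp (algebraMap (Zq k) (Qq k))

/-- The data of a family `Y² + h Y = f` over `ℤ_q[Γ]` of genus `g`:
`h = c ∏ hᵢ^rᵢ`, `H = ∏ hᵢ`, `f = H Q_f`, with the resultant `r(Γ) = Res_X (H, Q_f H')`
nonzero modulo `2` at `Γ = 0`. -/
structure Family (k : Type*) [Field k] [CharP k 2] (g : ℕ) where
  /-- the number of factors `hᵢ` -/
  num : ℕ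
  /-- the factors `hᵢ` of `h` -/
  fac : Fin num → (Zq k)[X][X]
  /-- the multiplicities `rᵢ` -/
  mult : Fin num → ℕ
  /-- the leading coefficient of `h` -/
  c : (Zq k)ˣ
  /-- the cofactor `Q_f` of `H` in `f` -/
  Qf : (Zq k)[X][X]
  fac_monic : ∀ i, (fac i).Monic
  fac_natDegree_pos : ∀ i, 0 < (fac i).natDegree
  mult_pos : ∀ i, 0 < mult i
  Qf_monic : Qf.Monic
  natDegree_f : ((∏ i, fac i) * Qf).natDegree = 2 * g + 1
  natDegree_h : (C (C (c : Zq k)) * ∏ i, fac i ^ mult i).natDegree ≤ g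
  resultant_ne_zero :
    WittVector.constantCoeff
      ((resultant (∏ i, fac i) (Qf * derivative (∏ i, fac i))).eval 0) ≠ 0

namespace Family

variable {k : Type*} [Field k] [CharP k 2] {g : ℕ} (E : Family k g)

/-- `H = ∏ hᵢ` -/
def H : (Zq k)[X][X] := ∏ i, E.fac i

/-- `h = c ∏ hᵢ^rᵢ` -/
def h : (Zq k)[X][X] := C (C (E.c : Zq k)) * ∏ i, E.fac i ^ E.mult i

/-- `f = H Q_f` -/
def f : (Zq k)[X][X] := E.H * E.Qf

/-- `r(Γ) = Res_X (H, Q_f H')`. If `h` is constant in `X`, this is `1`. -/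
def r : (Zq k)[X] := resultant E.H (E.Qf * derivative E.H)

/-- `D̃ = max rᵢ`, with the convention `D̃ = 1` if `h` is constant in `X`. -/
def D : ℕ := max 1 (Finset.univ.sup E.mult)

/-- `κ = max (deg_Γ f, deg_Γ h²)` -/
def κ : ℕ := max (degΓ E.f) (degΓ (E.h ^ 2))

variable [PerfectRing k 2]

/-! #### The ring `S = ℚ_q[Γ, 1/r(Γ)]†` -/

/-- The ideal `(z r(Γ) - 1)` of `ℚ_q⟨Γ, z⟩†`. -/
def idealS : Ideal (Dagger k (Fin 2)) :=
  Ideal.span {Dagger.var 1 * E.r.eval₂ (coeffMap k (Dagger k (Fin 2))) (Dagger.var 0) - 1}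

/-- `S = ℚ_q[Γ, 1/r(Γ)]† = ℚ_q⟨Γ, z⟩† / (z r(Γ) - 1)` -/
def S : Type _ := Dagger k (Fin 2) ⧸ E.idealS

instance : CommRing E.S := inferInstanceAs (CommRing (Dagger k (Fin 2) ⧸ E.idealS))

instance : Algebra (Qq k) E.S := inferInstanceAs (Algebra (Qq k) (Dagger k (Fin 2) ⧸ E.idealS))

/-- The quotient map `ℚ_q⟨Γ, z⟩† → S`. -/
def mkS : Dagger k (Fin 2) →+* E.S := Ideal.Quotient.mk E.idealS

/-- `Γ ∈ S` -/
def ΓS : E.S := E.mkS (Dagger.var 0)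

/-- `r(Γ) ∈ S` -/
def rS : E.S := E.r.eval₂ (coeffMap k E.S) E.ΓS

/-- `E.SOrdGE n s` says that `ord₂ s ≥ n` in `S`: `s` lies in `2 ^ n ℤ_q[Γ, 1/r(Γ)]†`. -/
def SOrdGE (n : ℤ) (s : E.S) : Prop :=
  ∃ P : Dagger k (Fin 2), Dagger.GaussGE n P ∧ E.mkS P = s

/-! #### The ring `T = ℚ_q[Γ, 1/r(Γ), X, Y, 1/H(X, Γ)]† / (Y² + h Y - f)` -/

/-- The ambient dagger algebra `ℚ_q⟨Γ, z, X, Y, w⟩†` of `T`; its variables, in this order, are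
`inl 0`, `inl 1`, `inr 0`, `inr 1`, `inr 2`. -/
abbrev W (k : Type*) [Field k] [CharP k 2] [PerfectRing k 2] : Type _ :=
  Dagger k (Fin 2 ⊕ Fin 3)

/-- The ideal `(z r - 1, w H - 1, Y² + h Y - f)` of `ℚ_q⟨Γ, z, X, Y, w⟩†`. -/
def idealT : Ideal (W k) :=
  Ideal.span
    {Dagger.var (.inl 1) * E.r.eval₂ (coeffMap k (W k)) (Dagger.var (.inl 0)) - 1,
      Dagger.var (.inr 2) *
        evalXΓ (coeffMap k (W k)) (Dagger.var (.inl 0)) (Dagger.var (.inr 0)) E.H - 1,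
      Dagger.var (.inr 1) ^ 2
        + evalXΓ (coeffMap k (W k)) (Dagger.var (.inl 0)) (Dagger.var (.inr 0)) E.h
            * Dagger.var (.inr 1)
        - evalXΓ (coeffMap k (W k)) (Dagger.var (.inl 0)) (Dagger.var (.inr 0)) E.f}

/-- `T = ℚ_q⟨Γ, z, X, Y, w⟩† / (z r - 1, w H - 1, Y² + h Y - f)` -/
def T : Type _ := W k ⧸ E.idealT

instance : CommRing E.T := inferInstanceAs (CommRing (W k ⧸ E.idealT))

instance : Algebra (Qq k) E.T := inferInstanceAs (Algebra (Qq k) (W k ⧸ E.idealT))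

/-- The quotient map `ℚ_q⟨Γ, z, X, Y, w⟩† → T`. -/
def mkT : W k →+* E.T := Ideal.Quotient.mk E.idealT

/-- `Γ ∈ T` -/
def ΓT : E.T := E.mkT (Dagger.var (.inl 0))

/-- `X ∈ T` -/
def x : E.T := E.mkT (Dagger.var (.inr 0))

/-- `Y ∈ T` -/
def y : E.T := E.mkT (Dagger.var (.inr 1))

/-- `1/H ∈ T` -/
def invH : E.T := E.mkT (Dagger.var (.inr 2))

/-- The value `p(X, Γ) ∈ T` of a polynomial `p`. -/
def ev (p : (Zq k)[X][X]) : E.T := evalXΓ (coeffMap k E.T) E.ΓT E.x p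

/-- The value in `T` of `p^σ`: `σ` acts on the coefficients as the Frobenius automorphism of
`ℤ_q` and on the variables by `X ↦ X²`, `Γ ↦ Γ²`. -/
def evσ (p : (Zq k)[X][X]) : E.T :=
  evalXΓ ((coeffMap k E.T).comp WittVector.frobenius) (E.ΓT ^ 2) (E.x ^ 2) p

/-- `E.TOrdGE n t` says that `ord₂ t ≥ n` in `T`: `t` lies in
`2 ^ n (ℤ_q[Γ, 1/r, X, Y, 1/H]† / (Y² + h Y - f))`. -/
def TOrdGE (n : ℤ) (t : E.T) : Prop :=
  ∃ P : W k, Dagger.GaussGE n P ∧ E.mkT P = t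

/-- The inclusion `ℚ_q⟨Γ, z⟩† → ℚ_q⟨Γ, z, X, Y, w⟩†`. -/
def incl (k : Type*) [Field k] [CharP k 2] [PerfectRing k 2] : Dagger k (Fin 2) →+* W k :=
  Dagger.rename Function.Embedding.inl

theorem incl_eval₂ (p : (Zq k)[X]) :
    incl k (p.eval₂ (coeffMap k (Dagger k (Fin 2))) (Dagger.var 0)) =
      p.eval₂ (coeffMap k (W k)) (Dagger.var (.inl 0)) := by
  have hc : (incl k).comp (coeffMap k (Dagger k (Fin 2))) = coeffMap k (W k) :=
    RingHom.ext fun a => Dagger.rename_algebraMap _ _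
  have hv : incl k (Dagger.var 0) = Dagger.var (.inl 0) := Dagger.rename_var _ _
  rw [Polynomial.hom_eval₂, hc, hv]

theorem idealS_le : E.idealS ≤ E.idealT.comap (incl k) := by
  rw [idealS, Ideal.span_le, Set.singleton_subset_iff, SetLike.mem_coe, Ideal.mem_comap, map_sub,
    map_mul, map_one, incl_eval₂]
  have hv : incl k (Dagger.var 1) = Dagger.var (.inl 1) := Dagger.rename_var _ _
  rw [hv]
  exact Ideal.subset_span (Set.mem_insert _ _)

/-- The structure map `S → T`. -/
def mapST : E.S →+* E.T := Ideal.quotientMap E.idealT (incl k) E.idealS_le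

instance : Algebra E.S E.T := E.mapST.toAlgebra

theorem mkS_smul (p : Dagger k (Fin 2)) (t : E.T) : E.mkS p • t =
    E.mkT (incl k p) * t := rfl

/-! #### The Monsky–Washnitzer cohomology `T dX / dT` -/

/-- For `t ∈ T` represented by `P(Γ, z, X, Y, w)`, the element `(2Y + h) ∂t/∂X` of `T`. Here
`∂/∂X` is the `S`-linear derivation of `T` with `∂X/∂X = 1`,
`(2Y + h) ∂Y/∂X = f' - h' Y` and `∂(1/H)/∂X = - H' / H²`; the element `2Y + h` is invertible in
`T`, as `(2Y + h)² = h² + 4f`. -/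
def scaledDeriv (P : W k) : E.T :=
  (2 * E.y + E.ev E.h) *
      (E.mkT (Dagger.pderiv (.inr 0) P)
        - E.ev (derivative E.H) * E.invH ^ 2 * E.mkT (Dagger.pderiv (.inr 2) P))
    + (E.ev (derivative E.f) - E.ev (derivative E.h) * E.y) * E.mkT (Dagger.pderiv (.inr 1) P)

/-- The `S`-module `dT`, where the differential form `t dX` is identified with `t ∈ T`. -/
def exactForms : Submodule E.S E.T where
  carrier := {t | ∃ P : W k, (2 * E.y + E.ev E.h) * t = E.scaledDeriv P}
  add_mem' := by
    rintro a b ⟨P, hP⟩ ⟨Q, hQ⟩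
    refine ⟨P + Q, ?_⟩
    rw [mul_add, hP, hQ]
    simp only [scaledDeriv, Dagger.pderiv_add, map_add]
    ring
  zero_mem' := ⟨0, by simp [scaledDeriv, Dagger.pderiv_zero]⟩
  smul_mem' := by
    rintro s t ⟨P, hP⟩
    obtain ⟨p, rfl⟩ : ∃ p, E.mkS p = s := Ideal.Quotient.mk_surjective s
    have hi : ∀ i : Fin 3, Dagger.pderiv (.inr i) (incl k p) = 0 := fun i =>
      Dagger.pderiv_rename _ _ (by simp) p
    refine ⟨incl k p * P, ?_⟩
    rw [mkS_smul, mul_left_comm, hP]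
    simp only [scaledDeriv, Dagger.pderiv_mul, hi, mul_zero, add_zero, map_mul]
    ring

/-- `H_MW = T dX / dT` -/
def HMW : Type _ := E.T ⧸ E.exactForms

instance : AddCommGroup E.HMW := inferInstanceAs (AddCommGroup (E.T ⧸ E.exactForms))

instance : Module E.S E.HMW := inferInstanceAs (Module E.S (E.T ⧸ E.exactForms))

/-- The class in `H_MW` of the differential form `t dX`, for `t ∈ T`. -/
def cls : E.T →ₗ[E.S] E.HMW := E.exactForms.mkQ

/-! #### The Frobenius matrix -/

/-- `t` is the image `F₂(Y)` of `Y` under the Frobenius lift: it satisfies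
`t² + h^σ t - f^σ = 0` and `t ≡ Y² mod 2`. -/
def IsFrobY (t : E.T) : Prop :=
  t ^ 2 + E.evσ E.h * t - E.evσ E.f = 0 ∧ E.TOrdGE 1 (t - E.y ^ 2)

/-- `F` is the matrix of `F₂` with respect to the forms `bᵢ = Xⁱ Y dX`, `i = 0, …, 2g - 1`:
`F₂(bᵢ) = ∑ⱼ Fᵢⱼ bⱼ` in `H_MW`. Here `t = F₂(Y)`, and as `F₂(X) = X²` and `F₂(dX) = 2X dX`, the
image of `bᵢ` is `F₂(bᵢ) = X^(2i) t · 2X dX`. -/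
def IsFrobMatrix (t : E.T) (F : Matrix (Fin (2 * g)) (Fin (2 * g)) E.S) : Prop :=
  ∀ i : Fin (2 * g), E.cls ((E.x ^ 2) ^ (i : ℕ) * t * (2 * E.x))
    = ∑ j : Fin (2 * g), F i j • E.cls (E.x ^ (j : ℕ) * E.y)

end Family

end Family

end DeformedCurve
end

/-! Put `Z = 2Y + h`, so that `Z² = Δ = h² + 4f`, and `Z` is a unit of `T`. A form `p(X) dX` with
polynomial `p` has a primitive, hence `XʲY dX` is `½ XʲZ dX` in cohomology, and `d(b Z³) = (∇b) Z
dX` with `∇b = b'Δ + (3/2) b Δ'`. Computing in cohomology therefore means writing `a / H^M = ∇(v /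
H^M) + F` with `deg F < 2g`.

Over the fraction field such an equation is solved by elimination (`CurveData.exists_reduction`).
The Bezout identity `sH + tQ_f H' = r` lowers the order of the pole along `H` by one at the price of
one factor `r`, and `∇` raises the degree in `X` by `2g` with nonzero constant leading coefficients.
Both steps respect the weights `α deg_Γ + w deg_X` with `α κ ≤ w`, because all monic factors of `f`
have coefficients of degree at most `κ` in `Γ`. This controls the degrees in `Γ` and in `X` at the
same time.

The denominators in this elimination are only logarithmic (`local_integrality`,
`CurveData.two_pow_dvd_of_nabla_eq`). Near a zero of `H`, or near infinity, the curve is `y² + hy =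
xQ` with `Q` a unit, and `y / x` has a simple pole. The polar terms of a primitive are removed one
at a time: an even term is removed by a multiple of `(y/x)^(2l)`, whose derivative is divisible by
`2l`, and an odd term costs nothing because `2l - 1` is odd. The precision of the derivative thus
never deteriorates, and the total loss is one factor `2^lam` with `2^lam` bounding twice the pole
order, plus `3` for passing from `aZ³` to `a`. A solution without poles modulo `2^n` along `H` and
with negative degree vanishes modulo `2^n`. These statements are applied over `ℤ_q⟦Γ⟧`, where `r` is
a unit.

For the Frobenius lift write `2F₂(Y) + h^σ = βZ`. Then `β² Δ = Δ^σ`, and `β` is a series `∑ 2ⁿ Bₙ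
H^(-eₙ)` with `eₙ` and the weight of `Bₙ` linear in `n` (`Family.exists_isFrobY`). Up to exact forms
`F₂(XⁱY dX)` is `X^(2i+1) β Z dX`. Reducing the `n`-th term yields `2^(n - loss)` times an integral
polynomial over `r^(eₙ)`, where the loss is logarithmic in `g` and `n`. Summing gives the matrix,
truncating at about `2N + 4 log g` terms gives the approximation modulo `2^N`, and the term-by-term
bound gives the order of the entries.

Uniqueness of `F₂(Y)` holds because the sum of two solutions plus `h^σ` is `h²` times a unit `1 +
2u`. Uniqueness of the matrix is the linear independence of the forms `XʲY dX` over `S`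
(`Family.eq_zero_of_sum_mem_exactForms`): a relation is approximated modulo `2^N` by polynomials of
degree linear in `N`, the logarithmic bound makes its coefficients divisible by `2^(N - O(log N))`
modulo `zr - 1`, and the ideal `(zr - 1)` is closed under such approximation. -/

noncomputable section

namespace DeformedCurve

/-! ### The derivation of a quadratic extension. -/

section QuadraticDerivation

variable {R A : Type*} [CommRing R] [CommRing A] [Algebra R A]

/-- The derivation `∂` of `A[y] / (y² + h y - f)` with `∂ a = (2 y + h) D a` on `A` and
`∂ y = D f - y D h`. -/
def quadDeriv (D : Derivation R A A) (f h : A) :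
    Derivation R (QuadraticAlgebra A f (-h)) (QuadraticAlgebra A f (-h)) :=
  Derivation.mk'
    { toFun := fun u => ⟨h * D u.re + 2 * f * D u.im + u.im * D f,
        2 * D u.re - h * D u.im - u.im * D h⟩
      map_add' := fun u v => by ext <;> simp <;> ring
      map_smul' := fun r u => by
        ext <;> simp [smul_add, smul_sub] }
    (by
      intro u v
      ext <;> simp <;> ring)

theorem quadDeriv_re (D : Derivation R A A) (f h : A) (u : QuadraticAlgebra A f (-h)) :
    (quadDeriv D f h u).re = h * D u.re + 2 * f * D u.im + u.im * D f := rfl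

theorem quadDeriv_im (D : Derivation R A A) (f h : A) (u : QuadraticAlgebra A f (-h)) :
    (quadDeriv D f h u).im = 2 * D u.re - h * D u.im - u.im * D h := rfl

end QuadraticDerivation

/-! ### Removal of one polar term at a Weierstrass point. -/

section Local

variable {O : Type*} [CommRing O]

/-- The Euler derivation `x d/dx` of `O⟦x⟧`. -/
def euler (O : Type*) [CommRing O] : Derivation O (PowerSeries O) (PowerSeries O) :=
  (PowerSeries.X : PowerSeries O) • PowerSeries.derivative O

theorem euler_apply (p : PowerSeries O) : euler O p = PowerSeries.X * PowerSeries.derivative O p :=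
  rfl

theorem constantCoeff_euler (p : PowerSeries O) : PowerSeries.constantCoeff (euler O p) = 0 := by
  simp [euler_apply]

theorem euler_X_pow_mul (i : ℕ) (p : PowerSeries O) :
    euler O (PowerSeries.X ^ i * p) = PowerSeries.X ^ i * ((i : PowerSeries O) * p + euler O p) := by
  rw [Derivation.leibniz, Derivation.leibniz_pow]
  cases i with
  | zero => simp
  | succ i =>
    have hX : euler O (PowerSeries.X : PowerSeries O) = PowerSeries.X := by simp [euler_apply]
    rw [hX]
    simp only [smul_eq_mul, nsmul_eq_mul, Nat.add_sub_cancel, pow_succ]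
    ring

theorem euler_C_mul (s : O) (p : PowerSeries O) :
    euler O (PowerSeries.C s * p) = PowerSeries.C s * euler O p := by
  rw [Derivation.leibniz, euler_apply (PowerSeries.C s)]
  simp

theorem two_pow_cancel (h2 : ∀ x : O, 2 * x = 0 → x = 0) (n : ℕ) {x : O}
    (hx : 2 ^ n * x = 0) : x = 0 := by
  induction n with
  | zero => simpa using hx
  | succ n ih => exact ih (h2 _ (by rw [← hx]; ring))

theorem powerSeries_two_torsionFree (h2 : ∀ x : O, 2 * x = 0 → x = 0) (x : PowerSeries O)
    (hx : 2 * x = 0) : x = 0 := by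
  ext i
  refine h2 _ ?_
  have := congrArg (PowerSeries.coeff i) hx
  rwa [two_mul, map_add, map_zero, ← two_mul] at this

theorem coeff_two_pow_mul (S i : ℕ) (x : PowerSeries O) :
    PowerSeries.coeff i (2 ^ S * x) = 2 ^ S * PowerSeries.coeff i x := by
  have : (2 : PowerSeries O) ^ S = PowerSeries.C (2 ^ S) := by
    rw [map_pow, map_ofNat]
  rw [this, PowerSeries.coeff_C_mul]

/-- If `N α` is divisible by `2 ^ (n + lam)` and `0 < N ≤ 2 ^ lam`, then `α` is divisible
by `2 ^ n`. -/
theorem two_pow_dvd_of_natCast_mul (h2 : ∀ x : O, 2 * x = 0 → x = 0) {N lam n : ℕ} (hN : 0 < N)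
    (hlam : N ≤ 2 ^ lam) {α : O} (h : (2 : O) ^ (n + lam) ∣ N * α) : (2 : O) ^ n ∣ α := by
  obtain ⟨v, o, ho, rfl⟩ := Nat.exists_eq_two_pow_mul_odd hN.ne'
  have hv : v ≤ lam := by
    have : 2 ^ v ≤ 2 ^ lam := (Nat.le_mul_of_pos_right _ ho.pos).trans hlam
    exact (Nat.pow_le_pow_iff_right (by norm_num)).1 this
  obtain ⟨c, hc⟩ := h
  have h1 : (o : O) * α = 2 ^ (n + (lam - v)) * c := by
    rw [← sub_eq_zero]
    apply two_pow_cancel h2 v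
    have : (2 : O) ^ (n + lam) = 2 ^ v * 2 ^ (n + (lam - v)) := by
      rw [← pow_add]; congr 1; omega
    push_cast at hc
    rw [this] at hc
    linear_combination hc
  have hcop : IsCoprime (o : ℤ) ((2 : ℤ) ^ n) := by
    apply IsCoprime.pow_right
    have := Nat.Coprime.symm (Nat.coprime_two_left.2 ho)
    exact_mod_cast Nat.isCoprime_iff_coprime.2 this
  obtain ⟨x, y, hxy⟩ := hcop
  have hxy' : (x : O) * o + y * 2 ^ n = 1 := by exact_mod_cast congrArg (Int.cast : ℤ → O) hxy
  refine ⟨x * (2 ^ (lam - v) * c) + y * α, ?_⟩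
  rw [pow_add] at h1
  linear_combination (-α) * hxy' + (x : O) * h1

/-- The constant coefficient of `G`, if `x ^ i G ∈ (x ^ (i + 1), 2 ^ S)`. -/
theorem two_pow_dvd_constantCoeff {i j S : ℕ} (hij : i < j) {G e₁ e₂ : PowerSeries O}
    (h : PowerSeries.X ^ i * G = PowerSeries.X ^ j * e₁ + 2 ^ S * e₂) :
    (2 : O) ^ S ∣ PowerSeries.constantCoeff G := by
  have h' := congrArg (PowerSeries.coeff i) h
  rw [map_add, coeff_two_pow_mul] at h'
  rw [PowerSeries.coeff_X_pow_mul' G i i, PowerSeries.coeff_X_pow_mul' e₁ j i, if_pos le_rfl,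
    if_neg (not_le.2 hij), Nat.sub_self] at h'
  refine ⟨PowerSeries.coeff i e₂, ?_⟩
  rw [← PowerSeries.coeff_zero_eq_constantCoeff_apply, h', zero_add]

theorem exists_eq_C_add_X_mul (p : PowerSeries O) :
    ∃ p', p = PowerSeries.C (PowerSeries.constantCoeff p) + PowerSeries.X * p' := by
  have : (PowerSeries.X : PowerSeries O) ∣ p - PowerSeries.C (PowerSeries.constantCoeff p) := by
    rw [PowerSeries.X_dvd_iff]; simp
  obtain ⟨p', hp'⟩ := this
  exact ⟨p', by rw [← hp']; ring⟩


/-- The twist `x ^ W ∘ δ ∘ x ^ (-W)` of the derivation `δ = x ∂`, where `∂ x = 2 y + h`. -/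
def twistedDeriv (f h : PowerSeries O) (W : ℤ)
    (u : QuadraticAlgebra (PowerSeries O) f (-h)) : QuadraticAlgebra (PowerSeries O) f (-h) :=
  quadDeriv (euler O) f h u - (W : QuadraticAlgebra (PowerSeries O) f (-h)) * (⟨h, 2⟩ * u)

theorem twistedDeriv_add (f h : PowerSeries O) (W : ℤ)
    (u v : QuadraticAlgebra (PowerSeries O) f (-h)) :
    twistedDeriv f h W (u + v) = twistedDeriv f h W u + twistedDeriv f h W v := by
  simp only [twistedDeriv, map_add]
  ring

theorem twistedDeriv_re (f h : PowerSeries O) (W : ℤ)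
    (u : QuadraticAlgebra (PowerSeries O) f (-h)) :
    (twistedDeriv f h W u).re = h * euler O u.re + 2 * f * euler O u.im + u.im * euler O f
      - W * (h * u.re + 2 * f * u.im) := by
  simp [twistedDeriv, quadDeriv_re]
  ring

theorem twistedDeriv_im (f h : PowerSeries O) (W : ℤ)
    (u : QuadraticAlgebra (PowerSeries O) f (-h)) :
    (twistedDeriv f h W u).im = 2 * euler O u.re - h * euler O u.im - u.im * euler O h
      - W * (2 * u.re - h * u.im) := by
  simp [twistedDeriv, quadDeriv_im]
  ring

/-- Extracting `x ^ i` lowers the order of the pole, which is the twist, by `i`. -/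
theorem twistedDeriv_X_pow_smul (f h : PowerSeries O) (W : ℤ) (i : ℕ)
    (u : QuadraticAlgebra (PowerSeries O) f (-h)) :
    twistedDeriv f h W ((PowerSeries.X : PowerSeries O) ^ i • u)
      = (PowerSeries.X : PowerSeries O) ^ i • twistedDeriv f h (W - i) u := by
  ext1
  · simp only [twistedDeriv_re, QuadraticAlgebra.re_smul, QuadraticAlgebra.im_smul, smul_eq_mul,
      euler_X_pow_mul]
    push_cast
    ring
  · simp only [twistedDeriv_im, QuadraticAlgebra.re_smul, QuadraticAlgebra.im_smul, smul_eq_mul,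
      euler_X_pow_mul]
    push_cast
    ring

theorem twistedDeriv_C_smul (f h : PowerSeries O) (W : ℤ) (s : O)
    (u : QuadraticAlgebra (PowerSeries O) f (-h)) :
    twistedDeriv f h W ((PowerSeries.C s : PowerSeries O) • u)
      = (PowerSeries.C s : PowerSeries O) • twistedDeriv f h W u := by
  ext1
  · simp only [twistedDeriv_re, QuadraticAlgebra.re_smul, QuadraticAlgebra.im_smul, smul_eq_mul,
      euler_C_mul]
    ring
  · simp only [twistedDeriv_im, QuadraticAlgebra.re_smul, QuadraticAlgebra.im_smul, smul_eq_mul,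
      euler_C_mul]
    ring

theorem euler_X_mul (p : PowerSeries O) :
    euler O (PowerSeries.X * p) = PowerSeries.X * (p + euler O p) := by
  have := euler_X_pow_mul 1 p
  simpa using this

/-- The element `y² / x`, where `f = x Q` and `h = x h₁`. -/
def ySqDivX (Q h₁ : PowerSeries O) (f h : PowerSeries O) :
    QuadraticAlgebra (PowerSeries O) f (-h) := ⟨Q, -h₁⟩

/-- The function `x ^ (-l) (y² / x) ^ l` is the `2 l`-th power of `y / x`, so its derivative carries
the factor `2 l`. It serves as a substitute for `x ^ (-l)` with the same leading term up to a unit.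
-/
theorem exists_twistedDeriv_ySqDivX_pow {f h Q h₁ : PowerSeries O} (hf : f = PowerSeries.X * Q)
    (hh : h = PowerSeries.X * h₁) (l : ℕ) :
    ∃ e, twistedDeriv f h l (ySqDivX Q h₁ f h ^ l) = (2 * l : ℕ) * e := by
  -- Modulo `2` the derivative of `y² / x` is `(y² / x)(2 y + h)`, and this is exactly the part that
  -- the twist by `l` removes from the derivative of the `l`-th power.
  have key : quadDeriv (euler O) f h (ySqDivX Q h₁ f h)
      = ySqDivX Q h₁ f h * ⟨h, 2⟩ + 2 * ⟨-f * euler O h₁, euler O Q - Q + h * euler O h₁⟩ := by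
    have hX : euler O (PowerSeries.X : PowerSeries O) = PowerSeries.X := by simp [euler_apply]
    rw [two_mul]
    ext1
    · simp [quadDeriv_re, ySqDivX, hf, hh, hX]
      ring
    · simp [quadDeriv_im, ySqDivX, hf, hh, hX]
      ring
  cases l with
  | zero => exact ⟨0, by simp [twistedDeriv]⟩
  | succ l =>
    refine ⟨ySqDivX Q h₁ f h ^ l * ⟨-f * euler O h₁, euler O Q - Q + h * euler O h₁⟩, ?_⟩
    rw [twistedDeriv, Derivation.leibniz_pow, key]
    simp only [smul_eq_mul, nsmul_eq_mul, Nat.add_sub_cancel]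
    push_cast
    ring

theorem constantCoeff_re_pow {f h : PowerSeries O} (hf : PowerSeries.constantCoeff f = 0)
    (u : QuadraticAlgebra (PowerSeries O) f (-h)) (l : ℕ) :
    PowerSeries.constantCoeff (u ^ l).re = PowerSeries.constantCoeff u.re ^ l := by
  induction l with
  | zero => simp [QuadraticAlgebra.re_one]
  | succ l ih => rw [pow_succ, QuadraticAlgebra.re_mul]; simp [hf, ih, pow_succ]

/-- One step of the removal of poles: if `x ^ i c` has a small twisted derivative, then modulo
`2 ^ n` it is a multiple of `x ^ (i + 1)`. -/
theorem exists_pole_step (h2 : ∀ x : O, 2 * x = 0 → x = 0) {f h Q h₁ : PowerSeries O}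
    (hf : f = PowerSeries.X * Q) (hQ : IsUnit (PowerSeries.constantCoeff Q))
    (hh : h = PowerSeries.X * h₁) {i l M n lam : ℕ} (hi : i ≤ M) (hl : 0 < l)
    (hlam : 2 * l ≤ 2 ^ lam) (c e₁ e₂ : QuadraticAlgebra (PowerSeries O) f (-h))
    (hc : (PowerSeries.X : PowerSeries O) ^ i • twistedDeriv f h l c
      = (PowerSeries.X : PowerSeries O) ^ (M + 2) • e₁ + (2 : PowerSeries O) ^ (n + lam) • e₂) :
    ∃ c' d e₁' e₂' : QuadraticAlgebra (PowerSeries O) f (-h),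
      c = (PowerSeries.X : PowerSeries O) • c' + (2 : PowerSeries O) ^ n • d ∧
      (PowerSeries.X : PowerSeries O) ^ (i + 1) • twistedDeriv f h ((l : ℤ) - 1) c'
      = (PowerSeries.X : PowerSeries O) ^ (M + 2) • e₁' + (2 : PowerSeries O) ^ (n + lam) • e₂' := by
  have hf0 : PowerSeries.constantCoeff f = 0 := by simp [hf]
  have hh0 : PowerSeries.constantCoeff h = 0 := by simp [hh]
  obtain ⟨q, hq⟩ := hQ
  set Q0 := PowerSeries.constantCoeff Q
  -- the even part
  have h1 : (2 : O) ^ (n + lam) ∣ ((2 * l : ℕ) : O) * PowerSeries.constantCoeff c.re := by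
    have h := two_pow_dvd_constantCoeff (i := i) (j := M + 2) (S := n + lam) (by omega)
      (congrArg QuadraticAlgebra.im hc)
    rw [twistedDeriv_im] at h
    simp only [map_sub, map_mul, constantCoeff_euler, hh0, map_ofNat, mul_zero, zero_mul, sub_zero,
      zero_sub, dvd_neg] at h
    convert h using 1
    push_cast
    simp
    ring
  -- Dividing by `2 l` costs at most `lam`. The quotient `a''` of the undivided quantity by the full
  -- power `2 ^ (n + lam)` is kept as well.
  obtain ⟨a', ha'⟩ := two_pow_dvd_of_natCast_mul h2 (by omega) hlam h1
  obtain ⟨a'', ha''⟩ := h1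
  obtain ⟨e, he⟩ := exists_twistedDeriv_ySqDivX_pow hf hh l
  set v := ySqDivX Q h₁ f h ^ l with hv
  set b : O := ((q⁻¹ : Oˣ) : O) ^ l with hb
  have hbQ : b * Q0 ^ l = 1 := by rw [hb, ← hq, ← mul_pow]; simp
  -- Subtracting a multiple of `(y² / x) ^ l` and not a constant is the main point: the derivative
  -- of the subtracted term has the factor `2 l * 2 ^ n * a' = 2 ^ (n + lam) * a''`, so the
  -- derivative stays small to the full precision `n + lam`.
  set c1 := c - (PowerSeries.C (2 ^ n * (b * a')) : PowerSeries O) • v with hc1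
  have hc1' : c = c1 + (PowerSeries.C (2 ^ n * (b * a')) : PowerSeries O) • v := by rw [hc1]; ring
  have hre : PowerSeries.constantCoeff c1.re = 0 := by
    rw [hc1, QuadraticAlgebra.re_sub, QuadraticAlgebra.re_smul, hv, map_sub, smul_eq_mul, map_mul,
      constantCoeff_re_pow hf0, PowerSeries.constantCoeff_C, ha']
    change 2 ^ n * a' - 2 ^ n * (b * a') * Q0 ^ l = 0
    linear_combination (- 2 ^ n * a') * hbQ
  have hd1 : twistedDeriv f h l c1 = twistedDeriv f h l c
      - (2 : PowerSeries O) ^ (n + lam) • ((PowerSeries.C (b * a'') : PowerSeries O) • e) := by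
    rw [hc1', twistedDeriv_add, twistedDeriv_C_smul, he]
    have : (PowerSeries.C (2 ^ n * (b * a')) : PowerSeries O) • (((2 * l : ℕ) :
        QuadraticAlgebra (PowerSeries O) f (-h)) * e)
        = (2 : PowerSeries O) ^ (n + lam) • ((PowerSeries.C (b * a'') : PowerSeries O) • e) := by
      rw [ha'] at ha''
      rw [← nsmul_eq_mul, ← Nat.cast_smul_eq_nsmul (PowerSeries O), smul_smul, smul_smul]
      congr 1
      have h3 : (2 : PowerSeries O) = PowerSeries.C 2 := (map_ofNat _ 2).symm
      have h4 : ((2 * l : ℕ) : PowerSeries O) = PowerSeries.C ((2 * l : ℕ) : O) :=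
        (map_natCast _ _).symm
      rw [h3, h4, ← map_pow, ← map_mul, ← map_mul]
      congr 1
      linear_combination b * ha''
    rw [this]; ring
  obtain ⟨p, hp⟩ := exists_eq_C_add_X_mul c1.re
  rw [hre, map_zero, zero_add] at hp
  -- the odd part
  have h5 : (2 : O) ^ (n + lam) ∣ PowerSeries.constantCoeff c1.im := by
    have h6 := congrArg QuadraticAlgebra.re hc
    have h7 : PowerSeries.X ^ (i + 1) * ((h₁ * euler O c1.re + 2 * Q * euler O c1.im
        + c1.im * (Q + euler O Q)) - (l : PowerSeries O) * (h₁ * c1.re + 2 * Q * c1.im))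
        = PowerSeries.X ^ (M + 2) * e₁.re + (2 : PowerSeries O) ^ (n + lam) *
          (e₂.re - PowerSeries.X ^ i * (PowerSeries.C (b * a'') * e.re)) := by
      have h8 := congrArg QuadraticAlgebra.re hd1
      rw [twistedDeriv_re] at h8
      simp only [QuadraticAlgebra.re_sub, QuadraticAlgebra.re_add, QuadraticAlgebra.re_smul,
        smul_eq_mul] at h8 h6
      have hθf : euler O f = PowerSeries.X * (Q + euler O Q) := by rw [hf, euler_X_mul]
      push_cast at h8
      linear_combination PowerSeries.X ^ i * h8 + h6
        - PowerSeries.X ^ i * (2 * euler O c1.im - 2 * l * c1.im) * hf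
        - PowerSeries.X ^ i * (euler O c1.re - l * c1.re) * hh
        - PowerSeries.X ^ i * c1.im * hθf
    have h9 := two_pow_dvd_constantCoeff (by omega) h7
    simp only [map_sub, map_add, map_mul, constantCoeff_euler, map_ofNat, mul_zero,
      add_zero, zero_add, hre, map_natCast] at h9
    -- In terms of the uniformizer `y`, the term `x ^ (-l) y` has the odd exponent `1 - 2 l`; hence
    -- the odd part is removed without loss.
    have h10 : (2 : O) ^ (n + lam) ∣ ((2 * l - 1 : ℕ) : O) * PowerSeries.constantCoeff c1.im := by
      obtain ⟨z, hz⟩ := h9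
      refine ⟨-(((q⁻¹ : Oˣ) : O) * z), ?_⟩
      have hqi : ((q⁻¹ : Oˣ) : O) * Q0 = 1 := by rw [← hq]; simp
      rw [Nat.cast_sub (by omega)]
      push_cast
      linear_combination (-((q⁻¹ : Oˣ) : O)) * hz
        - ((2 * l - 1) * PowerSeries.constantCoeff c1.im) * hqi
    have hodd : Odd (2 * l - 1) := ⟨l - 1, by omega⟩
    have hcop : IsCoprime ((2 * l - 1 : ℕ) : ℤ) ((2 : ℤ) ^ (n + lam)) := by
      apply IsCoprime.pow_right
      have := Nat.Coprime.symm (Nat.coprime_two_left.2 hodd)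
      exact_mod_cast Nat.isCoprime_iff_coprime.2 this
    obtain ⟨x, y, hxy⟩ := hcop
    have hxy' : (x : O) * (2 * l - 1 : ℕ) + y * 2 ^ (n + lam) = 1 := by
      exact_mod_cast congrArg (Int.cast : ℤ → O) hxy
    obtain ⟨z, hz⟩ := h10
    refine ⟨x * z + y * PowerSeries.constantCoeff c1.im, ?_⟩
    linear_combination (-PowerSeries.constantCoeff c1.im) * hxy' + (x : O) * hz
  obtain ⟨z, hz⟩ := h5
  obtain ⟨p', hp'⟩ := exists_eq_C_add_X_mul c1.im
  rw [hz] at hp'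
  have hc2 : c1 = (PowerSeries.X : PowerSeries O) • (⟨p, p'⟩ : QuadraticAlgebra _ f (-h))
      + (2 : PowerSeries O) ^ (n + lam) • (⟨0, PowerSeries.C z⟩ : QuadraticAlgebra _ f (-h)) := by
    ext1
    · simp [hp]
    · rw [QuadraticAlgebra.im_add, QuadraticAlgebra.im_smul, QuadraticAlgebra.im_smul, hp',
        map_mul, map_pow, map_ofNat, smul_eq_mul, smul_eq_mul]
      ring
  refine ⟨⟨p, p'⟩, (2 : PowerSeries O) ^ lam • (⟨0, PowerSeries.C z⟩ : QuadraticAlgebra _ f (-h))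
      + (PowerSeries.C (b * a') : PowerSeries O) • v, e₁,
      e₂ - (PowerSeries.X : PowerSeries O) ^ i • ((PowerSeries.C (b * a'') : PowerSeries O) • e)
      - (PowerSeries.X : PowerSeries O) ^ i • twistedDeriv f h l ⟨0, PowerSeries.C z⟩, ?_, ?_⟩
  · rw [hc1', hc2, smul_add, smul_smul, smul_smul, pow_add, map_mul, map_pow, map_ofNat]
    ring
  · have h11 : twistedDeriv f h l c1 = (PowerSeries.X : PowerSeries O) •
        twistedDeriv f h ((l : ℤ) - 1) ⟨p, p'⟩
        + (2 : PowerSeries O) ^ (n + lam) • twistedDeriv f h l ⟨0, PowerSeries.C z⟩ := by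
      conv_lhs => rw [hc2]
      rw [twistedDeriv_add]
      congr 1
      · simpa using twistedDeriv_X_pow_smul f h l 1 ⟨p, p'⟩
      · have h3 : (2 : PowerSeries O) ^ (n + lam) = PowerSeries.C (2 ^ (n + lam)) := by
          rw [map_pow, map_ofNat]
        rw [h3, twistedDeriv_C_smul]
    rw [pow_succ, mul_smul]
    have h12 : (PowerSeries.X : PowerSeries O) • twistedDeriv f h ((l : ℤ) - 1) ⟨p, p'⟩ =
        twistedDeriv f h l c - (2 : PowerSeries O) ^ (n + lam) •
          ((PowerSeries.C (b * a'') : PowerSeries O) • e)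
        - (2 : PowerSeries O) ^ (n + lam) • twistedDeriv f h l ⟨0, PowerSeries.C z⟩ := by
      rw [← hd1, h11]; ring
    rw [h12, smul_sub, smul_sub, hc]
    simp only [smul_sub, smul_comm ((PowerSeries.X : PowerSeries O) ^ i)
      ((2 : PowerSeries O) ^ (n + lam))]
    ring

end Local
end DeformedCurve
end

/-! ### Integrality at a Weierstrass point. -/

noncomputable section

namespace DeformedCurve

section Local

variable {O : Type*} [CommRing O]

theorem two_pow_dvd_iff_coeff (m : ℕ) (y : PowerSeries O) :
    (2 : PowerSeries O) ^ m ∣ y ↔ ∀ i, (2 : O) ^ m ∣ PowerSeries.coeff i y := by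
  constructor
  · rintro ⟨z, rfl⟩ i
    exact ⟨PowerSeries.coeff i z, coeff_two_pow_mul _ _ _⟩
  · intro h
    choose z hz using h
    refine ⟨PowerSeries.mk z, ?_⟩
    ext i
    rw [coeff_two_pow_mul, PowerSeries.coeff_mk, hz]

theorem two_pow_dvd_of_X_pow_mul {m j : ℕ} {y : PowerSeries O}
    (h : (2 : PowerSeries O) ^ m ∣ PowerSeries.X ^ j * y) : (2 : PowerSeries O) ^ m ∣ y := by
  rw [two_pow_dvd_iff_coeff] at h ⊢
  intro i
  have := h (i + j)
  rwa [PowerSeries.coeff_X_pow_mul] at this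

theorem two_pow_cancel_left {A : Type*} [CommRing A] (h2 : ∀ x : A, 2 * x = 0 → x = 0) (m : ℕ)
    {x y : A} (h : 2 ^ m * x = 2 ^ m * y) : x = y := by
  rw [← sub_eq_zero]
  exact two_pow_cancel h2 m (by rw [mul_sub, h, sub_self])

/-- Modulo `2` the discriminant is `h²`, a divisor of `x ^ (2 D)`, so it is a nonzerodivisor there.
Induction on `m` extends this to `2 ^ m`, since there is no `2`-torsion. -/
theorem two_pow_dvd_of_discr_mul (h2 : ∀ x : O, 2 * x = 0 → x = 0) {f h e : PowerSeries O} {D : ℕ}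
    (he : h * e = PowerSeries.X ^ D) (m : ℕ) {y : PowerSeries O}
    (hy : (2 : PowerSeries O) ^ m ∣ (h ^ 2 + 4 * f) * y) : (2 : PowerSeries O) ^ m ∣ y := by
  induction m generalizing y with
  | zero => simp
  | succ m ih =>
    have h1 : (2 : PowerSeries O) ^ 1 ∣ PowerSeries.X ^ (2 * D) * y := by
      obtain ⟨z, hz⟩ := hy
      refine ⟨e ^ 2 * (2 ^ m * z - 2 * f * y), ?_⟩
      rw [pow_mul', ← he, mul_pow]
      linear_combination e ^ 2 * hz
    obtain ⟨y', rfl⟩ := two_pow_dvd_of_X_pow_mul h1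
    rw [pow_one] at hy ⊢
    obtain ⟨z, hz⟩ := hy
    obtain ⟨w, rfl⟩ := ih (y := y') ⟨z, two_pow_cancel_left (powerSeries_two_torsionFree h2) 1
      (by rw [pow_one]; linear_combination hz)⟩
    exact ⟨w, by ring⟩

/-- The precision `n + lam` of the derivative is the same before and after each use of
`exists_pole_step`, so a single loss `lam` serves for all polar terms. This is where the bound
becomes logarithmic in the order of the pole. -/
theorem exists_pole_descent (h2 : ∀ x : O, 2 * x = 0 → x = 0) {f h Q h₁ : PowerSeries O}
    (hf : f = PowerSeries.X * Q) (hQ : IsUnit (PowerSeries.constantCoeff Q))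
    (hh : h = PowerSeries.X * h₁) {M W n lam : ℕ}
    (hlam : 2 * W ≤ 2 ^ lam) (u e₁ e₂ : QuadraticAlgebra (PowerSeries O) f (-h))
    (hu : twistedDeriv f h W u
      = (PowerSeries.X : PowerSeries O) ^ (M + 2) • e₁ + (2 : PowerSeries O) ^ (n + lam) • e₂)
    (J : ℕ) (hJW : J ≤ W) (hJM : J ≤ M + 1) :
    ∃ c d e₁' e₂' : QuadraticAlgebra (PowerSeries O) f (-h),
      u = (PowerSeries.X : PowerSeries O) ^ J • c + (2 : PowerSeries O) ^ n • d ∧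
      (PowerSeries.X : PowerSeries O) ^ J • twistedDeriv f h ((W : ℤ) - J) c
      = (PowerSeries.X : PowerSeries O) ^ (M + 2) • e₁' + (2 : PowerSeries O) ^ (n + lam) • e₂' := by
  induction J with
  | zero => exact ⟨u, 0, e₁, e₂, by simp, by simpa using hu⟩
  | succ J ih =>
    obtain ⟨c, d, e₁', e₂', h1, h3⟩ := ih (by omega) (by omega)
    have hl : (W : ℤ) - J = ((W - J : ℕ) : ℤ) := by rw [Nat.cast_sub (by omega)]
    rw [hl] at h3
    obtain ⟨c', d', e₁'', e₂'', h4, h5⟩ := exists_pole_step h2 hf hQ hh (i := J) (l := W - J)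
      (M := M) (n := n) (lam := lam) (by omega) (by omega) (by omega) c e₁' e₂' h3
    refine ⟨c', (PowerSeries.X : PowerSeries O) ^ J • d' + d, e₁'', e₂'', ?_, ?_⟩
    · rw [h1, h4, smul_add, smul_add, smul_smul, smul_smul, smul_smul, pow_succ, mul_comm (_ ^ J)
        (_ ^ n)]
      ring
    · rw [← h5, ← hl]
      congr 2
      push_cast
      ring

/-- The local integrality statement at a Weierstrass point: if `∇ (x ^ (-M) a)` has no pole modulo
`2 ^ (n + 3 + lam)`, where `∇` is twisted by `x ^ (-w)`, then `x ^ (-M) a` has no pole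
modulo `2 ^ n`. -/
theorem local_integrality (h2 : ∀ x : O, 2 * x = 0 → x = 0) {f h Q h₁ e : PowerSeries O} {D : ℕ}
    (hf : f = PowerSeries.X * Q) (hQ : IsUnit (PowerSeries.constantCoeff Q))
    (hh : h = PowerSeries.X * h₁) (he : h * e = PowerSeries.X ^ D) {M w n lam : ℕ}
    (hlam : 2 * (M + w) ≤ 2 ^ lam) (a c d : PowerSeries O)
    (hyp : euler O a * (h ^ 2 + 4 * f) - ((M + w : ℕ) : PowerSeries O) * a * (h ^ 2 + 4 * f)
      + 3 * a * (h * euler O h + 2 * euler O f)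
      = PowerSeries.X ^ (M + 1) * c + 2 ^ (n + 3 + lam) * d) :
    ∃ c' d', a = PowerSeries.X ^ M * c' + 2 ^ n * d' := by
  have h2' := powerSeries_two_torsionFree h2
  set Δ := h ^ 2 + 4 * f with hΔ
  have hθΔ : euler O Δ = 2 * h * euler O h + 4 * euler O f := by
    have : Δ = h ^ 2 + (f + f + (f + f)) := by rw [hΔ]; ring
    rw [this]
    simp only [map_add, Derivation.leibniz_pow]
    simp only [smul_eq_mul, nsmul_eq_mul]
    push_cast
    ring
  set b := a * Δ with hb
  have hθb : euler O b = a * euler O Δ + Δ * euler O a := by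
    rw [hb, Derivation.leibniz, smul_eq_mul, smul_eq_mul]
  have hb' : Δ * euler O b + b * (h * euler O h + 2 * euler O f) - ((M + w : ℕ) : PowerSeries O)
      * b * Δ = Δ * (PowerSeries.X ^ (M + 1) * c + 2 ^ (n + 3 + lam) * d) := by
    rw [← hyp, hθb, hθΔ, hb]
    ring
  have hΔX : Δ = PowerSeries.X * (h * h₁ + 4 * Q) := by
    rw [hΔ]; linear_combination 4 * hf + h * hh
  -- The element is `b (2 y + h) = a (2 y + h)³`. Its twisted derivative is the left side of `hyp`
  -- times the discriminant, and has no `y`-coordinate.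
  have hu : twistedDeriv f h ((M + w : ℕ) : ℤ) (⟨h * b, b + b⟩ : QuadraticAlgebra _ f (-h))
      = (PowerSeries.X : PowerSeries O) ^ (M + 2) • (⟨(h * h₁ + 4 * Q) * c, 0⟩ :
          QuadraticAlgebra _ f (-h))
        + (2 : PowerSeries O) ^ (n + 3 + lam) • (⟨Δ * d, 0⟩ : QuadraticAlgebra _ f (-h)) := by
    ext1
    · rw [twistedDeriv_re]
      simp only [QuadraticAlgebra.re_add, QuadraticAlgebra.re_smul, smul_eq_mul, map_add,
        Derivation.leibniz]
      push_cast
      push_cast at hb'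
      rw [hΔ] at hb' hΔX ⊢
      linear_combination hb' + PowerSeries.X ^ (M + 1) * c * hΔX
    · rw [twistedDeriv_im]
      simp only [QuadraticAlgebra.im_add, QuadraticAlgebra.im_smul, smul_eq_mul, map_add,
        Derivation.leibniz]
      ring
  obtain ⟨b₁, d₁, bw, hb₁, hbw⟩ : ∃ b₁ d₁ bw : PowerSeries O,
      b = PowerSeries.X ^ M * b₁ + 2 ^ (n + 2) * d₁ ∧ (w : PowerSeries O) * b₁
        = PowerSeries.X * bw := by
    -- The `y`-coordinate of the element is `2 b`; halving it turns the precision `n + 3` into `n +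
    -- 2`.
    have key : ∀ J ≤ M + w, J ≤ M + 1 → ∃ c₂ d₁ : PowerSeries O,
        b = PowerSeries.X ^ J * c₂ + 2 ^ (n + 2) * d₁ := by
      intro J hJ hJ'
      obtain ⟨c, d, -, -, h1, -⟩ := exists_pole_descent h2 hf hQ hh (M := M) (W := M + w)
        (n := n + 3) (lam := lam) hlam _ _ _ hu J hJ hJ'
      have h3 := congrArg QuadraticAlgebra.im h1
      simp only [QuadraticAlgebra.im_add, QuadraticAlgebra.im_smul, smul_eq_mul] at h3
      obtain ⟨c₂, hc₂⟩ := two_pow_dvd_of_X_pow_mul (m := 1) (j := J) (y := c.im)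
        ⟨b - 2 ^ (n + 2) * d.im, by linear_combination -h3⟩
      refine ⟨c₂, d.im, two_pow_cancel_left h2' 1 ?_⟩
      linear_combination h3 + PowerSeries.X ^ J * hc₂
    -- The twist leaves a term `w b₁` that has to be divisible by `x`. For `w > 0` the descent has
    -- room for one step more, up to `x ^ (M + 1)`, so `b₁` itself is divisible by `x`.
    rcases Nat.eq_zero_or_pos w with hw | hw
    · obtain ⟨c₂, d₁, h3⟩ := key M (by omega) (by omega)
      exact ⟨c₂, d₁, 0, h3, by simp [hw]⟩
    · obtain ⟨c₂, d₁, h3⟩ := key (M + 1) (by omega) le_rfl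
      exact ⟨PowerSeries.X * c₂, d₁, (w : PowerSeries O) * c₂, by rw [h3]; ring, by ring⟩
  have hθb₁ : euler O b = PowerSeries.X ^ M * ((M : PowerSeries O) * b₁ + PowerSeries.X *
      PowerSeries.derivative O b₁) + 2 ^ (n + 2) * euler O d₁ := by
    have h3 : (2 : PowerSeries O) ^ (n + 2) = PowerSeries.C (2 ^ (n + 2)) := by
      rw [map_pow, map_ofNat]
    rw [hb₁, map_add, euler_X_pow_mul, h3, euler_C_mul, euler_apply b₁]
  set f' := PowerSeries.derivative O f with hf'
  set h' := PowerSeries.derivative O h with hh'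
  have hef : euler O f = PowerSeries.X * f' := euler_apply f
  have heh : euler O h = PowerSeries.X * h' := euler_apply h
  set P := h * h' + 2 * f' with hP
  set ψ := c + bw - PowerSeries.derivative O b₁ with hψ
  -- With `x ^ (M + 1)` cancelled, the differential equation says that `Δ` divides `b₁ P` modulo `2
  -- ^ (n + 2)`, where `P` is half the derivative of `Δ`.
  obtain ⟨z, hz⟩ : (2 : PowerSeries O) ^ (n + 2) ∣ b₁ * P - Δ * ψ := by
    apply two_pow_dvd_of_X_pow_mul (j := M + 1)
    refine ⟨Δ * (2 ^ (lam + 1) * d) + Δ * (((M + w : ℕ) : PowerSeries O) * d₁) - d₁ * (PowerSeries.X * P)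
      - Δ * euler O d₁, ?_⟩
    rw [hθb₁, hef, heh] at hb'
    have e1 : (2 : PowerSeries O) ^ (n + 3 + lam) = 2 ^ (n + 2) * 2 ^ (lam + 1) := by ring
    rw [e1, hb₁] at hb'
    push_cast at hb' ⊢
    rw [hψ, hP]
    linear_combination hb' + Δ * PowerSeries.X ^ M * hbw
  -- This comes from `P² = h'² Δ + 4 N₀`. Multiplying the congruence by `P` shows that `Δ` divides
  -- `4 b₁ N₀` modulo `2 ^ (n + 2)`, and `N₀` is a unit because `f` has a simple zero at `0` and `h`
  -- vanishes there. So `b₁` is a multiple of the non-unit `Δ`, at the cost of the factor `4`; this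
  -- recovers `a = b / Δ`.
  set N₀ := f' ^ 2 + f' * h' * h - h' ^ 2 * f with hN₀
  set q₁ := ψ * P - h' ^ 2 * b₁ with hq₁
  have h4 : Δ * q₁ = 2 ^ 2 * (b₁ * N₀) - 2 ^ (n + 2) * (z * P) := by
    have : Δ * ψ = b₁ * P - 2 ^ (n + 2) * z := by rw [← hz]; ring
    rw [hq₁, mul_sub, ← mul_assoc, this, hN₀, hP, hΔ]
    ring
  obtain ⟨q₃, hq₃⟩ : (2 : PowerSeries O) ^ 2 ∣ q₁ := by
    refine two_pow_dvd_of_discr_mul h2 (f := f) he 2 ⟨b₁ * N₀ - 2 ^ n * (z * P), ?_⟩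
    rw [← hΔ, h4]
    ring
  have h5 : Δ * q₃ = b₁ * N₀ - 2 ^ n * (z * P) := by
    refine two_pow_cancel_left h2' 2 ?_
    rw [hq₃] at h4
    linear_combination h4
  have hN : IsUnit N₀ := by
    rw [PowerSeries.isUnit_iff_constantCoeff]
    have h6 : PowerSeries.constantCoeff f' = PowerSeries.constantCoeff Q := by
      rw [hf', hf, Derivation.leibniz]
      simp
    have hf0 : PowerSeries.constantCoeff f = 0 := by simp [hf]
    have hh0 : PowerSeries.constantCoeff h = 0 := by simp [hh]
    simp only [hN₀, map_sub, map_add, map_mul, map_pow, h6, hf0, hh0, mul_zero, add_zero, sub_zero]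
    exact hQ.pow 2
  obtain ⟨N, hN⟩ := hN
  have hNN : N₀ * ((N⁻¹ : (PowerSeries O)ˣ) : PowerSeries O) = 1 := by rw [← hN]; simp
  set N' := ((N⁻¹ : (PowerSeries O)ˣ) : PowerSeries O)
  obtain ⟨d', hd'⟩ : (2 : PowerSeries O) ^ n ∣ a - PowerSeries.X ^ M * (q₃ * N') := by
    refine two_pow_dvd_of_discr_mul h2 he n (f := f)
      ⟨PowerSeries.X ^ M * (z * P * N') + 4 * d₁, ?_⟩
    rw [← hΔ]
    have : a * Δ = PowerSeries.X ^ M * b₁ + 2 ^ (n + 2) * d₁ := hb₁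
    linear_combination this - PowerSeries.X ^ M * N' * h5 - PowerSeries.X ^ M * b₁ * hNN
  exact ⟨q₃ * N', d', by rw [← hd']; ring⟩

end Local
end DeformedCurve
end

/-! ### The operator `∇` and its integrality along `H = 0`. -/

noncomputable section

namespace DeformedCurve

open Polynomial

/-- The polynomials `H`, `Q_f`, `h / H` defining the curve `Y² + h Y = f` with `f = H Q_f`. -/
structure CurveData (R : Type*) [CommRing R] where
  /-- the polynomial `H` -/
  H : R[X]
  /-- the cofactor `f / H` -/
  Qf : R[X]
  /-- the cofactor `h / H` -/
  h₀ : R[X]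

namespace CurveData

variable {R S : Type*} [CommRing R] [CommRing S] (E : CurveData R)

/-- `f = H Q_f` -/
def f : R[X] := E.H * E.Qf

/-- `h = H h₀` -/
def h : R[X] := E.H * E.h₀

/-- `(h² + 4 f) / H` -/
def Δ₁ : R[X] := 4 * E.Qf + E.H * E.h₀ ^ 2

/-- The discriminant `Δ = h² + 4 f`. -/
def Δ : R[X] := E.h ^ 2 + 4 * E.f

theorem Δ_eq : E.Δ = E.H * E.Δ₁ := by
  simp only [Δ, Δ₁, h, f]; ring

/-- The numerator of `∇ (v / H ^ M)` over `H ^ M`, where `∇ b = b' Δ + 3/2 b Δ'`. -/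
def nabla (M : ℕ) (v : R[X]) : R[X] :=
  derivative v * E.Δ - M * v * derivative E.H * E.Δ₁
    + 3 * v * (E.h * derivative E.h + 2 * derivative E.f)

/-- The base change of the data along a ring homomorphism. -/
def map (φ : R →+* S) : CurveData S := ⟨E.H.map φ, E.Qf.map φ, E.h₀.map φ⟩

theorem map_f (φ : R →+* S) : (E.map φ).f = E.f.map φ := by simp [map, f]

theorem map_h (φ : R →+* S) : (E.map φ).h = E.h.map φ := by simp [map, h]

theorem map_Δ₁ (φ : R →+* S) : (E.map φ).Δ₁ = E.Δ₁.map φ := by simp [map, Δ₁]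

theorem map_Δ (φ : R →+* S) : (E.map φ).Δ = E.Δ.map φ := by simp [map_h, map_f, Δ]

theorem nabla_map (φ : R →+* S) (M : ℕ) (v : R[X]) :
    (E.map φ).nabla M (v.map φ) = (E.nabla M v).map φ := by
  simp only [nabla, map_f, map_h, map_Δ, map_Δ₁, derivative_map, Polynomial.map_add,
    Polynomial.map_sub, Polynomial.map_mul, Polynomial.map_natCast, Polynomial.map_ofNat]
  rw [show (E.map φ).H = E.H.map φ from rfl, derivative_map]

theorem nabla_add (M : ℕ) (v w : R[X]) : E.nabla M (v + w) = E.nabla M v + E.nabla M w := by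
  simp only [nabla, derivative_add]; ring

theorem nabla_C_mul (M : ℕ) (c : R) (v : R[X]) : E.nabla M (C c * v) = C c * E.nabla M v := by
  simp only [nabla, derivative_C_mul]; ring

/-- The function `v / H ^ M` is also `H v / H ^ (M + 1)`; the two sides are the numerators of the
same `∇`. -/
theorem nabla_succ_H_mul (M : ℕ) (v : R[X]) : E.nabla (M + 1) (E.H * v) = E.H * E.nabla M v := by
  simp only [nabla, derivative_mul, Δ_eq]
  push_cast
  ring

/-- The conditions on the degrees of `f` and `h`. -/
structure IsHyperelliptic (g : ℕ) : Prop where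
  H_monic : E.H.Monic
  f_monic : E.f.Monic
  natDegree_f : E.f.natDegree = 2 * g + 1
  natDegree_h : E.h.natDegree ≤ g
  isUnit_leadingCoeff_h : IsUnit E.h.leadingCoeff
  exists_h_mul : ∃ (e : R[X]) (D : ℕ), E.h * e = E.H ^ D

end CurveData

section TaylorAt

variable {R O : Type*} [CommRing R] [CommRing O]

theorem exists_eq_X_pow_add_two_pow_iff (M S : ℕ) (y : PowerSeries O) :
    (∃ c d, y = PowerSeries.X ^ M * c + 2 ^ S * d) ↔
      ∀ i < M, (2 : O) ^ S ∣ PowerSeries.coeff i y := by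
  constructor
  · rintro ⟨c, d, rfl⟩ i hi
    rw [map_add, coeff_two_pow_mul, PowerSeries.coeff_X_pow_mul', if_neg (not_le.2 hi), zero_add]
    exact Dvd.intro _ rfl
  · intro h
    have : ∀ i, ∃ z, i < M → PowerSeries.coeff i y = 2 ^ S * z := fun i => by
      by_cases hi : i < M
      · obtain ⟨z, hz⟩ := h i hi
        exact ⟨z, fun _ => hz⟩
      · exact ⟨0, fun h => absurd h hi⟩
    choose z hz using this
    refine ⟨PowerSeries.mk fun i => PowerSeries.coeff (i + M) y - 2 ^ S * z (i + M),
      PowerSeries.mk z, ?_⟩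
    ext i
    rw [map_add, coeff_two_pow_mul, PowerSeries.coeff_X_pow_mul', PowerSeries.coeff_mk]
    split_ifs with hi
    · rw [PowerSeries.coeff_mk, Nat.sub_add_cancel hi]; ring
    · rw [hz i (not_le.1 hi), zero_add, PowerSeries.coeff_mk]

/-- The Taylor expansion `p ↦ p(a + x)`. -/
def taylorAt (φ : R →+* O) (a : O) : R[X] →+* PowerSeries O :=
  eval₂RingHom ((PowerSeries.C (R := O)).comp φ) (PowerSeries.C a + PowerSeries.X)

theorem constantCoeff_taylorAt (φ : R →+* O) (a : O) (p : R[X]) :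
    PowerSeries.constantCoeff (taylorAt φ a p) = p.eval₂ φ a := by
  have : (PowerSeries.constantCoeff (R := O)).comp (taylorAt φ a) = eval₂RingHom φ a := by
    ext <;> simp [taylorAt]
  exact congrArg (fun ψ => ψ p) this

theorem derivative_taylorAt (φ : R →+* O) (a : O) (p : R[X]) :
    PowerSeries.derivative O (taylorAt φ a p) = taylorAt φ a (derivative p) := by
  induction p using Polynomial.induction_on' with
  | add p q hp hq => rw [map_add, map_add, hp, hq, derivative_add, map_add]
  | monomial n r =>
    rw [derivative_monomial]
    simp only [taylorAt, coe_eval₂RingHom, eval₂_monomial, Derivation.leibniz,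
      Derivation.leibniz_pow, RingHom.coe_comp, Function.comp_apply, map_add,
      PowerSeries.derivative_C, PowerSeries.derivative_X]
    simp
    ring

theorem euler_taylorAt (φ : R →+* O) (a : O) (p : R[X]) :
    euler O (taylorAt φ a p) = PowerSeries.X * taylorAt φ a (derivative p) := by
  rw [euler_apply, derivative_taylorAt]

theorem euler_pow_mul (e : PowerSeries O) (M : ℕ) :
    e * euler O (e ^ M) = (M : PowerSeries O) * e ^ M * euler O e := by
  cases M with
  | zero => simp
  | succ M =>
    rw [Derivation.leibniz_pow]
    simp only [smul_eq_mul, nsmul_eq_mul, Nat.add_sub_cancel, pow_succ]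
    ring

end TaylorAt

namespace CurveData

variable {R : Type*} [CommRing R] {E : CurveData R}

theorem eval₂_adjoinRoot (H p : R[X]) :
    p.eval₂ (AdjoinRoot.of H) (AdjoinRoot.root H) = AdjoinRoot.mk H p := by
  have : eval₂RingHom (AdjoinRoot.of H) (AdjoinRoot.root H) = AdjoinRoot.mk H := by
    ext <;> simp
  exact congrArg (fun ψ => ψ p) this

theorem adjoinRoot_two_torsionFree (h2 : ∀ x : R, 2 * x = 0 → x = 0) {H : R[X]} (hH : H.Monic)
    (x : AdjoinRoot H) (hx : 2 * x = 0) : x = 0 := by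
  obtain ⟨p, rfl⟩ := AdjoinRoot.mk_surjective x
  have h1 : H ∣ 2 * p := by
    rw [← AdjoinRoot.mk_eq_zero, map_mul, map_ofNat, hx]
  rw [AdjoinRoot.mk_eq_zero, ← modByMonic_eq_zero_iff_dvd hH]
  rw [← modByMonic_eq_zero_iff_dvd hH] at h1
  ext i
  refine h2 _ ?_
  have h3 : (2 : R[X]) * p = (2 : R) • p := by
    rw [smul_eq_C_mul, map_ofNat]
  rw [h3, smul_modByMonic] at h1
  have := congrArg (fun q => coeff q i) h1
  simpa using this

/-- A polynomial which vanishes to order `M` along `H`, modulo `2 ^ n`. -/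
theorem exists_eq_H_pow_add_two_pow {H : R[X]} {ε : PowerSeries (AdjoinRoot H)}
    (hε : IsUnit ε)
    (hHε : taylorAt (AdjoinRoot.of H) (AdjoinRoot.root H) H = PowerSeries.X * ε) (M n : ℕ)
    (β : R[X])
    (hβ : ∀ i < M, (2 : AdjoinRoot H) ^ n ∣
      PowerSeries.coeff i (taylorAt (AdjoinRoot.of H) (AdjoinRoot.root H) β)) :
    ∃ β₁ β₂ : R[X], β = H ^ M * β₁ + 2 ^ n * β₂ := by
  induction M generalizing β with
  | zero => exact ⟨β, 0, by simp⟩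
  | succ M ih =>
    obtain ⟨z, hz⟩ := hβ 0 (by omega)
    rw [PowerSeries.coeff_zero_eq_constantCoeff_apply, constantCoeff_taylorAt,
      eval₂_adjoinRoot] at hz
    obtain ⟨p, rfl⟩ := AdjoinRoot.mk_surjective z
    -- The constant term of the expansion is the class of `β` in `R[X] / H`. Once it is removed
    -- modulo `2 ^ n`, division by `H` shifts the expansion by one, up to the unit `ε`.
    obtain ⟨β', hβ'⟩ : H ∣ β - 2 ^ n * p := by
      rw [← AdjoinRoot.mk_eq_zero, map_sub, hz, map_mul, map_pow, map_ofNat, sub_self]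
    have h1 : ∀ i < M, (2 : AdjoinRoot H) ^ n ∣
        PowerSeries.coeff i (taylorAt (AdjoinRoot.of H) (AdjoinRoot.root H) β') := by
      obtain ⟨u, rfl⟩ := hε
      have h3 : taylorAt (AdjoinRoot.of H) (AdjoinRoot.root H) β' * PowerSeries.X =
          ((u⁻¹ : (PowerSeries (AdjoinRoot H))ˣ) : PowerSeries (AdjoinRoot H)) *
          (taylorAt (AdjoinRoot.of H) (AdjoinRoot.root H) β - 2 ^ n *
            taylorAt (AdjoinRoot.of H) (AdjoinRoot.root H) p) := by
        have h4 := congrArg (taylorAt (AdjoinRoot.of H) (AdjoinRoot.root H)) hβ'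
        rw [map_sub, map_mul, map_mul, map_pow, map_ofNat, hHε] at h4
        have h6 : ((u⁻¹ : (PowerSeries (AdjoinRoot H))ˣ) : PowerSeries (AdjoinRoot H)) * u = 1 := by
          simp
        rw [h4]
        linear_combination (- PowerSeries.X * taylorAt (AdjoinRoot.of H) (AdjoinRoot.root H) β') * h6
      rw [← exists_eq_X_pow_add_two_pow_iff] at hβ ⊢
      obtain ⟨c, d, hcd⟩ := hβ
      rw [exists_eq_X_pow_add_two_pow_iff]
      intro i hi
      rw [← PowerSeries.coeff_succ_mul_X, h3]
      refine (exists_eq_X_pow_add_two_pow_iff (M + 1) n _).1 ⟨((u⁻¹ : (PowerSeries (AdjoinRoot H))ˣ) : PowerSeries (AdjoinRoot H)) * c,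
        ((u⁻¹ : (PowerSeries (AdjoinRoot H))ˣ) : PowerSeries (AdjoinRoot H)) *
        (d - taylorAt (AdjoinRoot.of H) (AdjoinRoot.root H) p), ?_⟩ (i + 1) (by omega)
      rw [hcd]
      ring
    obtain ⟨β₁, β₂, h5⟩ := ih β' h1
    refine ⟨β₁, p + H * β₂, ?_⟩
    have : β = H * β' + 2 ^ n * p := by rw [← hβ']; ring
    rw [this, h5]
    ring

/-- The integrality of a solution of `∇ (β / H ^ M) + F = 2 ^ S a / H ^ M` along `H = 0`. -/
theorem exists_eq_of_nabla_eq (h2 : ∀ x : R, 2 * x = 0 → x = 0) {g : ℕ}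
    (hE : E.IsHyperelliptic g) (hcop : IsCoprime E.H (E.Qf * derivative E.H)) {M n lam : ℕ}
    (hlam : 2 * M ≤ 2 ^ lam) {a β F : R[X]}
    (heq : 2 ^ (n + 3 + lam) * a = E.nabla M β + E.H ^ M * F) :
    ∃ β₁ β₂ : R[X], β = E.H ^ M * β₁ + 2 ^ n * β₂ := by
  -- The expansion takes place at the tautological root in `R[X] / H`, which treats all zeros of `H`
  -- at once and needs no splitting of `H`.
  set τ := taylorAt (AdjoinRoot.of E.H) (AdjoinRoot.root E.H) with hτ
  have hτ0 : ∀ p, PowerSeries.constantCoeff (τ p) = AdjoinRoot.mk E.H p := by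
    intro p
    rw [hτ, constantCoeff_taylorAt, eval₂_adjoinRoot]
  obtain ⟨ε, hε⟩ : (PowerSeries.X : PowerSeries _) ∣ τ E.H := by
    rw [PowerSeries.X_dvd_iff, hτ0, AdjoinRoot.mk_self]
  have hH' : PowerSeries.X * τ (derivative E.H) = PowerSeries.X * (ε + euler _ ε) := by
    rw [← euler_taylorAt, ← hτ, hε, euler_X_mul]
  have hε0 : PowerSeries.constantCoeff ε = AdjoinRoot.mk E.H (derivative E.H) := by
    have h1 := congrArg (PowerSeries.coeff (0 + 1)) hH'
    rw [mul_comm, PowerSeries.coeff_succ_mul_X, mul_comm, PowerSeries.coeff_succ_mul_X,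
      PowerSeries.coeff_zero_eq_constantCoeff_apply, hτ0] at h1
    rw [h1, PowerSeries.coeff_zero_eq_constantCoeff_apply, map_add, constantCoeff_euler, add_zero]
  obtain ⟨s, t, hst⟩ := hcop
  have hunit : AdjoinRoot.mk E.H t * (AdjoinRoot.mk E.H E.Qf *
      AdjoinRoot.mk E.H (derivative E.H)) = 1 := by
    rw [← map_mul, ← map_mul, ← (AdjoinRoot.mk E.H).map_one, ← hst, map_add, map_mul _ s,
      AdjoinRoot.mk_self, mul_zero, zero_add]
  -- By coprimality `H'` is invertible at the root, so `H` is a local parameter there: it is `x`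
  -- times a unit.
  have hεu : IsUnit ε := by
    rw [PowerSeries.isUnit_iff_constantCoeff, hε0]
    exact IsUnit.of_mul_eq_one (AdjoinRoot.mk E.H t * AdjoinRoot.mk E.H E.Qf)
      (by rw [← hunit]; ring)
  have hf : τ E.f = PowerSeries.X * (ε * τ E.Qf) := by rw [f, map_mul, hε]; ring
  have hh : τ E.h = PowerSeries.X * (ε * τ E.h₀) := by rw [h, map_mul, hε]; ring
  have hQ : IsUnit (PowerSeries.constantCoeff (ε * τ E.Qf)) := by
    rw [map_mul, hε0, hτ0]
    exact IsUnit.of_mul_eq_one (AdjoinRoot.mk E.H t) (by rw [← hunit]; ring)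
  obtain ⟨u, hu⟩ := hεu
  have hui : ε * ((u⁻¹ : (PowerSeries (AdjoinRoot E.H))ˣ) : PowerSeries (AdjoinRoot E.H)) = 1 := by
    rw [← hu]; simp
  set η := ((u⁻¹ : (PowerSeries (AdjoinRoot E.H))ˣ) : PowerSeries (AdjoinRoot E.H))
  obtain ⟨e, D, he⟩ := hE.exists_h_mul
  have he' : τ E.h * (τ e * η ^ D) = PowerSeries.X ^ D := by
    rw [← mul_assoc, ← map_mul, he, map_pow, hε, mul_pow, mul_assoc, ← mul_pow, hui, one_pow,
      mul_one]
  have hpow : ε ^ M * η ^ M = 1 := by rw [← mul_pow, hui, one_pow]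
  -- Locally `β / H ^ M` is `x ^ (-M) b`.
  set b := η ^ M * τ β with hb
  have hβ : τ β = ε ^ M * b := by rw [hb, ← mul_assoc, hpow, one_mul]
  have hθβ : PowerSeries.X * τ (derivative β) = ε ^ M * euler _ b + b * euler _ (ε ^ M) := by
    rw [← euler_taylorAt, ← hτ, hβ, Derivation.leibniz, smul_eq_mul, smul_eq_mul]
  have hθh : euler _ (τ E.h) = PowerSeries.X * τ (derivative E.h) := euler_taylorAt _ _ _
  have hθf : euler _ (τ E.f) = PowerSeries.X * τ (derivative E.f) := euler_taylorAt _ _ _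
  have hΔ : τ E.Δ = PowerSeries.X * ε * τ E.Δ₁ := by rw [Δ_eq, map_mul, hε]
  have hΔ' : τ E.Δ = τ E.h ^ 2 + 4 * τ E.f := by
    rw [Δ, map_add, map_mul, map_pow, map_ofNat]
  have hN := congrArg τ heq
  rw [map_mul, map_pow, map_ofNat, map_add, map_mul, map_pow, hε, nabla, map_add, map_sub] at hN
  simp only [map_mul, map_add, map_natCast, map_ofNat] at hN
  -- At a finite point `(2 Y + h)³` brings in no power of `x`, so the extra twist is `0`.
  have hkey : euler _ b * (τ E.h ^ 2 + 4 * τ E.f) - ((M + 0 : ℕ) : PowerSeries (AdjoinRoot E.H)) *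
      b * (τ E.h ^ 2 + 4 * τ E.f) + 3 * b * (τ E.h * euler _ (τ E.h) + 2 * euler _ (τ E.f))
      = PowerSeries.X ^ (M + 1) * (- τ F) + 2 ^ (n + 3 + lam) * (PowerSeries.X * η ^ M * τ a) := by
    have hcancel : ∀ x y : PowerSeries (AdjoinRoot E.H), ε ^ (M + 1) * x = ε ^ (M + 1) * y →
        x = y := by
      intro x y hxy
      have h3 : ε ^ (M + 1) * η ^ (M + 1) = 1 := by rw [← mul_pow, hui, one_pow]
      linear_combination η ^ (M + 1) * hxy - (x - y) * h3
    apply hcancel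
    rw [← hΔ', hθh, hθf]
    push_cast
    rw [hβ] at hN
    have h3 := euler_pow_mul ε M
    linear_combination (-ε * PowerSeries.X) * hN - ε * τ E.Δ * hθβ - b * τ E.Δ * h3
      + (M : PowerSeries (AdjoinRoot E.H)) * ε ^ M * ε * b * τ E.Δ₁ * hH'
      - (M : PowerSeries (AdjoinRoot E.H)) * ε ^ M * b * (ε + euler _ ε) * hΔ
      - 2 ^ (n + 3 + lam) * ε * PowerSeries.X * τ a * hpow
  obtain ⟨c', d', hcd⟩ := local_integrality (adjoinRoot_two_torsionFree h2 hE.H_monic) hf hQ hh he'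
    (M := M) (w := 0) (n := n) (lam := lam) (by simpa using hlam) b _ _ hkey
  refine exists_eq_H_pow_add_two_pow ⟨u, hu⟩ hε M n β ?_
  rw [← exists_eq_X_pow_add_two_pow_iff, ← hτ]
  refine ⟨ε ^ M * c', ε ^ M * d', ?_⟩
  rw [hβ, hcd]
  ring

end CurveData
end DeformedCurve
end

/-! ### Integrality at infinity and the global logarithmic bound. -/

noncomputable section

namespace DeformedCurve

open Polynomial

section ReflectSeries

variable {R : Type*} [CommRing R]

/-- The expansion `x ^ N p(1 / x)` of a polynomial at infinity. -/
def reflectSeries (N : ℕ) (p : R[X]) : PowerSeries R := (reflect N p : R[X])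

theorem coeff_reflectSeries (N i : ℕ) (p : R[X]) :
    PowerSeries.coeff i (reflectSeries N p) = p.coeff (revAt N i) := by
  rw [reflectSeries, coeff_coe, coeff_reflect]

theorem coeff_reflectSeries' {N : ℕ} {p : R[X]} (hp : p.natDegree ≤ N) (i : ℕ) :
    PowerSeries.coeff i (reflectSeries N p) = if i ≤ N then p.coeff (N - i) else 0 := by
  rw [coeff_reflectSeries]
  split_ifs with h
  · rw [revAt_le h]
  · rw [revAt_eq_self_of_lt (not_le.1 h), coeff_eq_zero_of_natDegree_lt (by omega)]

theorem reflectSeries_add (N : ℕ) (p q : R[X]) :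
    reflectSeries N (p + q) = reflectSeries N p + reflectSeries N q := by
  ext i; simp [coeff_reflectSeries]

theorem reflectSeries_sub (N : ℕ) (p q : R[X]) :
    reflectSeries N (p - q) = reflectSeries N p - reflectSeries N q := by
  ext i; simp [coeff_reflectSeries]

theorem reflectSeries_C_mul (N : ℕ) (c : R) (p : R[X]) :
    reflectSeries N (C c * p) = PowerSeries.C c * reflectSeries N p := by
  ext i; simp [coeff_reflectSeries]

theorem reflectSeries_natCast_mul (N : ℕ) (c : ℕ) (p : R[X]) :
    reflectSeries N ((c : R[X]) * p) = (c : PowerSeries R) * reflectSeries N p := by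
  simpa using reflectSeries_C_mul N (c : R) p

theorem reflectSeries_mul {M N : ℕ} {p q : R[X]} (hp : p.natDegree ≤ M) (hq : q.natDegree ≤ N) :
    reflectSeries (M + N) (p * q) = reflectSeries M p * reflectSeries N q := by
  rw [reflectSeries, reflect_mul p q hp hq, coe_mul]; rfl

theorem reflectSeries_pow {M : ℕ} {p : R[X]} (hp : p.natDegree ≤ M) (n : ℕ) :
    reflectSeries (n * M) (p ^ n) = reflectSeries M p ^ n := by
  induction n with
  | zero =>
    simp [reflectSeries]
  | succ n ih =>
    rw [add_mul, one_mul, pow_succ, reflectSeries_mul _ hp, ih, pow_succ]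
    exact (natDegree_pow_le).trans (Nat.mul_le_mul_left _ hp)

theorem reflectSeries_add_left {N : ℕ} {p : R[X]} (hp : p.natDegree ≤ N) (k : ℕ) :
    reflectSeries (k + N) p = PowerSeries.X ^ k * reflectSeries N p := by
  ext i
  rw [coeff_reflectSeries' (by omega), PowerSeries.coeff_X_pow_mul', coeff_reflectSeries' hp]
  by_cases hk : k ≤ i
  · rw [if_pos hk]
    by_cases h : i ≤ k + N
    · rw [if_pos h, if_pos (by omega)]
      congr 1
      omega
    · rw [if_neg h, if_neg (by omega)]
  · rw [if_neg hk, if_pos (by omega), coeff_eq_zero_of_natDegree_lt (by omega)]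

theorem constantCoeff_reflectSeries (p : R[X]) (N : ℕ) :
    PowerSeries.constantCoeff (reflectSeries N p) = p.coeff N := by
  rw [← PowerSeries.coeff_zero_eq_constantCoeff_apply, coeff_reflectSeries, revAt_zero]

/-- Under `x = 1 / X` the operator `x d/dx` is `-X d/dX`; the summand with `N` comes from the factor
`x ^ N`. -/
theorem euler_reflectSeries {N : ℕ} {p : R[X]} (hp : p.natDegree ≤ N) :
    euler R (reflectSeries N p) =
      (N : PowerSeries R) * reflectSeries N p - reflectSeries N (X * derivative p) := by
  have hp' : (X * derivative p).natDegree ≤ N := by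
    rw [natDegree_le_iff_coeff_eq_zero]
    intro j hj
    cases j with
    | zero => simp
    | succ j => rw [coeff_X_mul, coeff_derivative, coeff_eq_zero_of_natDegree_lt (by omega),
        zero_mul]
  ext i
  rw [map_sub, ← map_natCast (PowerSeries.C (R := R)) N, PowerSeries.coeff_C_mul, euler_apply,
    coeff_reflectSeries' hp, coeff_reflectSeries' hp']
  have h1 : PowerSeries.coeff i (PowerSeries.X * PowerSeries.derivative R (reflectSeries N p))
      = i * PowerSeries.coeff i (reflectSeries N p) := by
    cases i with
    | zero => simp
    | succ i => rw [mul_comm, PowerSeries.coeff_succ_mul_X]; simp [PowerSeries.coeff_derivative, mul_comm]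
  rw [h1, coeff_reflectSeries' hp]
  split_ifs with h
  · obtain ⟨j, rfl⟩ := Nat.exists_eq_add_of_le h
    rw [Nat.add_sub_cancel_left]
    cases j with
    | zero => simp
    | succ j => rw [coeff_X_mul, coeff_derivative]; push_cast; ring
  · simp

end ReflectSeries

namespace CurveData

variable {R : Type*} [CommRing R] {E : CurveData R}

theorem natDegree_X_mul_derivative_le {N : ℕ} {p : R[X]} (hp : p.natDegree ≤ N) :
    (X * derivative p).natDegree ≤ N := by
  rw [natDegree_le_iff_coeff_eq_zero]
  intro j hj
  cases j with
  | zero => simp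
  | succ j => rw [coeff_X_mul, coeff_derivative, coeff_eq_zero_of_natDegree_lt (by omega), zero_mul]

theorem natDegree_Δ_le {g : ℕ} (hE : E.IsHyperelliptic g) : E.Δ.natDegree ≤ 2 * g + 1 := by
  rw [Δ]
  refine (natDegree_add_le _ _).trans (max_le ?_ ?_)
  · have := natDegree_pow_le (p := E.h) (n := 2)
    have := hE.natDegree_h
    omega
  · rw [← hE.natDegree_f]
    exact (natDegree_C_mul_le 4 E.f)

/-- The factor `X` makes each derivative occur as `X d/dX`, to which `euler_reflectSeries` applies,
and the factor `H` turns `Δ₁` into `Δ`. -/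
theorem reflectSeries_X_mul_H_mul_nabla {g : ℕ} (hE : E.IsHyperelliptic g) {m : ℕ} {β : R[X]}
    (hβ : β.natDegree ≤ m) (M : ℕ) :
    reflectSeries (m + E.H.natDegree + (2 * g + 2)) (X * E.H * E.nabla M β) =
      reflectSeries E.H.natDegree E.H *
        (reflectSeries (2 * g + 2) E.Δ * reflectSeries m (X * derivative β))
      - (M : PowerSeries R) * (reflectSeries m β *
        (reflectSeries E.H.natDegree (X * derivative E.H) * reflectSeries (2 * g + 2) E.Δ))
      + 3 * (reflectSeries m β * reflectSeries E.H.natDegree E.H *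
        (reflectSeries (g + 1) E.h * reflectSeries (g + 1) (X * derivative E.h)
          + 2 * reflectSeries (2 * g + 2) (X * derivative E.f))) := by
  have hΔ : E.Δ.natDegree ≤ 2 * g + 2 := (natDegree_Δ_le hE).trans (by omega)
  have hh : E.h.natDegree ≤ g + 1 := hE.natDegree_h.trans (by omega)
  have hf : E.f.natDegree ≤ 2 * g + 2 := by rw [hE.natDegree_f]; omega
  have h1 : reflectSeries (m + E.H.natDegree + (2 * g + 2))
      (X * derivative β * E.H * E.Δ) = _ :=
    (reflectSeries_mul ((natDegree_mul_le).trans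
      (add_le_add (natDegree_X_mul_derivative_le hβ) le_rfl)) hΔ).trans
      (by rw [reflectSeries_mul (natDegree_X_mul_derivative_le hβ) le_rfl])
  have h2 : reflectSeries (m + E.H.natDegree + (2 * g + 2))
      (β * (X * derivative E.H) * E.Δ) = _ :=
    (reflectSeries_mul ((natDegree_mul_le).trans
      (add_le_add hβ (natDegree_X_mul_derivative_le le_rfl))) hΔ).trans
      (by rw [reflectSeries_mul hβ (natDegree_X_mul_derivative_le le_rfl)])
  have h3 : reflectSeries (m + E.H.natDegree + (2 * g + 2))
      (β * E.H * (E.h * (X * derivative E.h))) = _ :=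
    (reflectSeries_mul ((natDegree_mul_le).trans (add_le_add hβ le_rfl))
      ((natDegree_mul_le).trans ((add_le_add hh (natDegree_X_mul_derivative_le hh)).trans
        (by omega)))).trans
      (by rw [reflectSeries_mul hβ le_rfl, show 2 * g + 2 = (g + 1) + (g + 1) by ring,
        reflectSeries_mul hh (natDegree_X_mul_derivative_le hh)])
  have h4 : reflectSeries (m + E.H.natDegree + (2 * g + 2))
      (β * E.H * (X * derivative E.f)) = _ :=
    (reflectSeries_mul ((natDegree_mul_le).trans (add_le_add hβ le_rfl))
      (natDegree_X_mul_derivative_le hf)).trans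
      (by rw [reflectSeries_mul hβ le_rfl])
  have h5 : X * E.H * E.nabla M β = X * derivative β * E.H * E.Δ
      - (M : R[X]) * (β * (X * derivative E.H) * E.Δ)
      + ((3 : ℕ) : R[X]) * (β * E.H * (E.h * (X * derivative E.h)))
      + ((6 : ℕ) : R[X]) * (β * E.H * (X * derivative E.f)) := by
    rw [nabla, Δ_eq]; push_cast; ring
  rw [h5, reflectSeries_add, reflectSeries_add, reflectSeries_sub, reflectSeries_natCast_mul,
    reflectSeries_natCast_mul, reflectSeries_natCast_mul, h1, h2, h3, h4]
  push_cast
  ring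

/-- The integrality of a solution of `∇ (β / H ^ M) + F = 2 ^ S a / H ^ M` at infinity. -/
theorem two_pow_dvd_coeff_of_nabla_eq (h2 : ∀ x : R, 2 * x = 0 → x = 0) {g : ℕ}
    (hE : E.IsHyperelliptic g) {M m n lam : ℕ} (hm : E.H.natDegree * M ≤ m)
    (hlam : 2 * (m - E.H.natDegree * M + 3 * g + 3) ≤ 2 ^ lam) {a β F : R[X]}
    (hβ : β.natDegree ≤ m) (hF : F.degree < (2 * g : ℕ))
    (heq : 2 ^ (n + 3 + lam) * a = E.nabla M β + E.H ^ M * F) (j : ℕ)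
    (hj : E.H.natDegree * M ≤ j) : (2 : R) ^ n ∣ β.coeff j := by
  rcases lt_or_ge m j with hjm | hjm
  · rw [coeff_eq_zero_of_natDegree_lt (by omega)]; exact dvd_zero _
  obtain ⟨l, rfl⟩ := Nat.exists_eq_add_of_le' hm
  rw [Nat.add_sub_cancel] at hlam
  set d := E.H.natDegree with hd
  have hh : E.h.natDegree ≤ g + 1 := hE.natDegree_h.trans (by omega)
  have hf : E.f.natDegree ≤ 2 * g + 2 := by rw [hE.natDegree_f]; omega
  -- In the coordinates `x = 1 / X` and `x ^ (g + 1) Y` the curve is again `y² + hr y = fr`. Here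
  -- `fr` has a simple zero because `f` is monic of degree `2 g + 1`, and `hr` vanishes because `deg
  -- h ≤ g`.
  set Hr := reflectSeries d E.H with hHr
  set fr := reflectSeries (2 * g + 2) E.f with hfr
  set hr := reflectSeries (g + 1) E.h with hhr
  set βr := reflectSeries (l + d * M) β with hβr
  obtain ⟨u, hu⟩ : IsUnit Hr := by
    rw [PowerSeries.isUnit_iff_constantCoeff, constantCoeff_reflectSeries, hd,
      coeff_natDegree, hE.H_monic.leadingCoeff]
    exact isUnit_one
  have hui : Hr * ((u⁻¹ : (PowerSeries R)ˣ) : PowerSeries R) = 1 := by rw [← hu]; simp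
  set η := ((u⁻¹ : (PowerSeries R)ˣ) : PowerSeries R)
  have hpow : ∀ i, Hr ^ i * η ^ i = 1 := fun i => by rw [← mul_pow, hui, one_pow]
  have hf1 : fr = PowerSeries.X * reflectSeries (2 * g + 1) E.f := by
    have h := reflectSeries_add_left hE.natDegree_f.le 1
    rw [pow_one] at h
    rw [← h, hfr]
    congr 1
    ring
  have hQ : IsUnit (PowerSeries.constantCoeff (reflectSeries (2 * g + 1) E.f)) := by
    rw [constantCoeff_reflectSeries, ← hE.natDegree_f, coeff_natDegree, hE.f_monic.leadingCoeff]
    exact isUnit_one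
  have hh1 : hr = PowerSeries.X * reflectSeries g E.h := by
    have h := reflectSeries_add_left hE.natDegree_h 1
    rw [pow_one] at h
    rw [← h, hhr]
    congr 1
    ring
  obtain ⟨v, hv⟩ : IsUnit (reflectSeries E.h.natDegree E.h) := by
    rw [PowerSeries.isUnit_iff_constantCoeff, constantCoeff_reflectSeries, coeff_natDegree]
    exact hE.isUnit_leadingCoeff_h
  have he : hr * ((v⁻¹ : (PowerSeries R)ˣ) : PowerSeries R) =
      PowerSeries.X ^ (g + 1 - E.h.natDegree) := by
    have h := reflectSeries_add_left (p := E.h) le_rfl (g + 1 - E.h.natDegree)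
    rw [Nat.sub_add_cancel hh, ← hv] at h
    rw [hhr, h, mul_assoc]
    simp
  obtain ⟨b, hb⟩ : ∃ b, b = η ^ M * βr := ⟨_, rfl⟩
  have hβb : βr = Hr ^ M * b := by rw [hb, ← mul_assoc, hpow, one_mul]
  have hΔr : reflectSeries (2 * g + 2) E.Δ = hr ^ 2 + 4 * fr := by
    have h4 : E.Δ = E.h * E.h + ((4 : ℕ) : R[X]) * E.f := by rw [Δ]; push_cast; ring
    rw [h4, reflectSeries_add, reflectSeries_natCast_mul,
      show 2 * g + 2 = (g + 1) + (g + 1) by ring, reflectSeries_mul hh hh, hfr,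
      show 2 * g + 2 = (g + 1) + (g + 1) by ring]
    push_cast
    ring
  have hN := congrArg (fun p => reflectSeries (l + d * M + d + (2 * g + 2)) (X * E.H * p)) heq
  have hXF : (X * F).natDegree ≤ 2 * g := by
    rw [natDegree_le_iff_coeff_eq_zero]
    intro i hi
    cases i with
    | zero => simp
    | succ i =>
      rw [coeff_X_mul]
      exact coeff_eq_zero_of_degree_lt (hF.trans_le (by exact_mod_cast (by omega)))
  have hFr : reflectSeries (l + d * M + d + (2 * g + 2)) (X * E.H * (E.H ^ M * F)) =
      Hr ^ (M + 1) * (PowerSeries.X ^ (l + 2) * reflectSeries (2 * g) (X * F)) := by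
    have h6 : X * E.H * (E.H ^ M * F) = E.H ^ (M + 1) * (X * F) := by ring
    rw [h6, show l + d * M + d + (2 * g + 2) = (M + 1) * d + ((l + 2) + 2 * g) by ring,
      reflectSeries_mul _ (hXF.trans (by omega)), reflectSeries_pow le_rfl,
      reflectSeries_add_left hXF]
    exact natDegree_pow_le
  have hC : X * E.H * (2 ^ (n + 3 + lam) * a) = C (2 ^ (n + 3 + lam)) * (X * E.H * a) := by
    rw [map_pow, map_ofNat]; ring
  rw [hC, reflectSeries_C_mul, map_pow, map_ofNat, mul_add, reflectSeries_add,
    reflectSeries_X_mul_H_mul_nabla hE hβ, hFr, hΔr] at hN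
  set A := reflectSeries (l + d * M + d + (2 * g + 2)) (X * E.H * a)
  set Fr := reflectSeries (2 * g) (X * F)
  have e1 := euler_reflectSeries (N := d) (p := E.H) le_rfl
  have e2 := euler_reflectSeries hh
  have e3 := euler_reflectSeries hf
  have e4 := euler_reflectSeries hβ
  rw [← hHr] at e1
  rw [← hhr] at e2
  rw [← hfr] at e3
  rw [← hβr, hβb, Derivation.leibniz, smul_eq_mul, smul_eq_mul] at e4
  have e5 := euler_pow_mul Hr M
  rw [← hd, ← hHr, ← hβr, ← hhr, hβb] at hN
  -- The function `β / H ^ M` contributes `x ^ (-l)` and `(2 Y + h)³` contributes `x ^ (-3 (g +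
  -- 1))`. The total twist `l + 3 g + 3` is split as `(l + 1) + (3 g + 2)`, so that the conclusion
  -- is a strict vanishing of `β / H ^ M` at infinity. The remainder `F` causes no pole because its
  -- degree is less than `2 g`.
  have hkey : euler R b * (hr ^ 2 + 4 * fr) - (((l + 1) + (3 * g + 2) : ℕ) : PowerSeries R) *
      b * (hr ^ 2 + 4 * fr) + 3 * b * (hr * euler R hr + 2 * euler R fr)
      = PowerSeries.X ^ ((l + 1) + 1) * Fr + 2 ^ (n + 3 + lam) * (- η ^ (M + 1) * A) := by
    have hcancel : ∀ x y : PowerSeries R, Hr ^ (M + 1) * x = Hr ^ (M + 1) * y → x = y := by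
      intro x y hxy
      linear_combination η ^ (M + 1) * hxy - (x - y) * hpow (M + 1)
    apply hcancel
    push_cast at e1 e2 e3 e4 ⊢
    linear_combination hN + Hr * (hr ^ 2 + 4 * fr) * e4 - (hr ^ 2 + 4 * fr) * b * e5
      - (M : PowerSeries R) * Hr ^ M * b * (hr ^ 2 + 4 * fr) * e1
      + 3 * Hr ^ (M + 1) * b * hr * e2 + 6 * Hr ^ (M + 1) * b * e3
      + 2 ^ (n + 3 + lam) * A * hpow (M + 1)
  obtain ⟨c', d', hcd⟩ := local_integrality h2 hf1 hQ hh1 he (M := l + 1) (w := 3 * g + 2)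
    (n := n) (lam := lam) (le_trans (by omega) hlam) b _ _ hkey
  have h7 : ∀ i < l + 1, (2 : R) ^ n ∣ PowerSeries.coeff i βr := by
    rw [← exists_eq_X_pow_add_two_pow_iff]
    exact ⟨Hr ^ M * c', Hr ^ M * d', by rw [hβb, hcd]; ring⟩
  have h8 := h7 (l + d * M - j) (by omega)
  rw [hβr, coeff_reflectSeries' hβ, if_pos (by omega)] at h8
  convert h8 using 2
  omega

/-- The logarithmic bound on the denominators of a solution of
`∇ (β / H ^ M) + F = a / H ^ M`. -/
theorem two_pow_dvd_of_nabla_eq (h2 : ∀ x : R, 2 * x = 0 → x = 0) {g : ℕ}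
    (hE : E.IsHyperelliptic g) (hcop : IsCoprime E.H (E.Qf * derivative E.H)) {M m n lam : ℕ}
    (hm : E.H.natDegree * M ≤ m) (hlam : 2 * M ≤ 2 ^ lam)
    (hlam' : 2 * (m - E.H.natDegree * M + 3 * g + 3) ≤ 2 ^ lam) {a β F : R[X]}
    (hβ : β.natDegree ≤ m) (hF : F.degree < (2 * g : ℕ))
    (heq : 2 ^ (n + 3 + lam) * a = E.nabla M β + E.H ^ M * F) : ∀ j, (2 : R) ^ n ∣ β.coeff j := by
  obtain ⟨β₁, β₂, h1⟩ := exists_eq_of_nabla_eq h2 hE hcop hlam heq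
  obtain ⟨I, hI'⟩ : ∃ I : Ideal R, I = Ideal.span {(2 : R) ^ n} := ⟨_, rfl⟩
  have hI : ∀ x, Ideal.Quotient.mk I x = 0 ↔ (2 : R) ^ n ∣ x := fun x => by
    rw [hI', Ideal.Quotient.eq_zero_iff_mem, Ideal.mem_span_singleton]
  -- Modulo `2 ^ n`, integrality along `H` makes `β` a multiple of the monic `H ^ M`, and
  -- integrality at infinity makes its degree smaller than that of `H ^ M`.
  suffices hz : β.map (Ideal.Quotient.mk I) = 0 by
    intro j
    rw [← hI, ← coeff_map, hz, coeff_zero]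
  rcases subsingleton_or_nontrivial (R ⧸ I) with _ | _
  · exact Subsingleton.elim _ _
  by_contra hne
  have hmon := (hE.H_monic.map (Ideal.Quotient.mk I)).pow M
  refine hmon.not_dvd_of_degree_lt hne ?_ ⟨β₁.map (Ideal.Quotient.mk I), ?_⟩
  · rw [degree_eq_natDegree hmon.ne_zero, (hE.H_monic.map _).natDegree_pow,
      hE.H_monic.natDegree_map, degree_lt_iff_coeff_zero]
    intro j hj
    rw [coeff_map, hI]
    exact two_pow_dvd_coeff_of_nabla_eq h2 hE hm hlam' hβ hF heq j (by linarith)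
  · have h3 : Ideal.Quotient.mk I 2 ^ n = 0 := by rw [← map_pow, hI]
    rw [h1, Polynomial.map_add, Polynomial.map_mul, Polynomial.map_mul, Polynomial.map_pow,
      Polynomial.map_pow, add_eq_left]
    rw [Polynomial.map_ofNat]
    have : ((2 : (R ⧸ I)[X])) ^ n = C (Ideal.Quotient.mk I 2 ^ n) := by
      rw [map_pow, map_ofNat, map_ofNat]
    rw [this, h3, C_0, zero_mul]

end CurveData
end DeformedCurve
end

/-! ### Weights, and the reduction of forms over a field. -/

noncomputable section

namespace DeformedCurve

open Polynomial

section Weight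

variable {R S : Type*} [CommRing R] [CommRing S]

/-- The monomials `Γ ^ i X ^ j` of `p` satisfy `α i + w j ≤ A`. -/
def WeightLE (α w : ℕ) (A : ℤ) (p : R[X][X]) : Prop :=
  ∀ i j, (p.coeff j).coeff i ≠ 0 → (α * i + w * j : ℤ) ≤ A

namespace WeightLE

variable {α w : ℕ} {A B : ℤ} {p q : R[X][X]}

theorem mono (h : WeightLE α w A p) (hAB : A ≤ B) : WeightLE α w B p :=
  fun i j hij => (h i j hij).trans hAB

theorem zero : WeightLE α w A (0 : R[X][X]) := fun i j h => by simp at h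

theorem add (hp : WeightLE α w A p) (hq : WeightLE α w A q) : WeightLE α w A (p + q) := by
  intro i j h
  by_cases h1 : (p.coeff j).coeff i = 0
  · refine hq i j fun h2 => h ?_
    rw [coeff_add, coeff_add, h1, h2, add_zero]
  · exact hp i j h1

theorem neg (hp : WeightLE α w A p) : WeightLE α w A (-p) :=
  fun i j h => hp i j fun h1 => h (by rw [coeff_neg, coeff_neg, h1, neg_zero])

theorem sub (hp : WeightLE α w A p) (hq : WeightLE α w A q) : WeightLE α w A (p - q) := by
  rw [sub_eq_add_neg]; exact hp.add hq.neg

theorem mul (hp : WeightLE α w A p) (hq : WeightLE α w B q) : WeightLE α w (A + B) (p * q) := by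
  intro i j h
  rw [coeff_mul, finsetSum_coeff] at h
  obtain ⟨⟨j₁, j₂⟩, hj, h⟩ := Finset.exists_ne_zero_of_sum_ne_zero h
  rw [coeff_mul] at h
  obtain ⟨⟨i₁, i₂⟩, hi, h⟩ := Finset.exists_ne_zero_of_sum_ne_zero h
  rw [Finset.HasAntidiagonal.mem_antidiagonal] at hi hj
  have h1 := hp i₁ j₁ (left_ne_zero_of_mul h)
  have h2 := hq i₂ j₂ (right_ne_zero_of_mul h)
  rw [← hi, ← hj]
  push_cast
  linarith

theorem C_C (a : R) : WeightLE α w 0 (C (C a) : R[X][X]) := by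
  intro i j h
  rw [coeff_C] at h
  split_ifs at h with hj
  · rw [coeff_C] at h
    split_ifs at h with hi
    · simp [hi, hj]
    · exact absurd rfl h
  · simp at h

theorem one : WeightLE α w 0 (1 : R[X][X]) := by
  simpa using C_C (α := α) (w := w) (1 : R)

theorem C_C_mul (a : R) (hp : WeightLE α w A p) : WeightLE α w A (C (C a) * p) := by
  simpa using (C_C a).mul hp

theorem natCast_mul (a : ℕ) (hp : WeightLE α w A p) : WeightLE α w A ((a : R[X][X]) * p) := by
  simpa using C_C_mul (a : R) hp

theorem pow (hp : WeightLE α w A p) (n : ℕ) : WeightLE α w (n * A) (p ^ n) := by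
  induction n with
  | zero => simpa using one
  | succ n ih =>
    rw [pow_succ]
    refine (ih.mul hp).mono (le_of_eq ?_)
    push_cast
    ring

theorem prod {ι : Type*} (s : Finset ι) (p : ι → R[X][X]) (A : ι → ℤ)
    (h : ∀ i ∈ s, WeightLE α w (A i) (p i)) : WeightLE α w (∑ i ∈ s, A i) (∏ i ∈ s, p i) := by
  classical
  induction s using Finset.induction_on with
  | empty => simpa using one
  | insert a s ha ih =>
    rw [Finset.prod_insert ha, Finset.sum_insert ha]
    exact (h a (Finset.mem_insert_self a s)).mul
      (ih fun i hi => h i (Finset.mem_insert_of_mem hi))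

theorem sum {ι : Type*} (s : Finset ι) (p : ι → R[X][X])
    (h : ∀ i ∈ s, WeightLE α w A (p i)) : WeightLE α w A (∑ i ∈ s, p i) := by
  classical
  induction s using Finset.induction_on with
  | empty => simpa using zero
  | insert a s ha ih =>
    rw [Finset.sum_insert ha]
    exact (h a (Finset.mem_insert_self a s)).add
      (ih fun i hi => h i (Finset.mem_insert_of_mem hi))

theorem X_pow (n : ℕ) : WeightLE α w (w * n) (X ^ n : R[X][X]) := by
  intro i j h
  rw [coeff_X_pow] at h
  split_ifs at h with hj
  · rw [coeff_one] at h
    split_ifs at h with hi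
    · simp [hi, hj]
    · exact absurd rfl h
  · simp at h

theorem derivative (hp : WeightLE α w A p) : WeightLE α w (A - w) (derivative p) := by
  intro i j h
  rw [coeff_derivative] at h
  have h1 : ((p.coeff (j + 1)) * ((j : R[X]) + 1)).coeff i =
      (p.coeff (j + 1)).coeff i * ((j : R) + 1) := by
    rw [show ((j : R[X]) + 1) = C ((j : R) + 1) by simp, coeff_mul_C]
  rw [h1] at h
  have h2 := hp i (j + 1) (left_ne_zero_of_mul h)
  push_cast at h2
  linarith

theorem map (hp : WeightLE α w A p) (φ : R →+* S) :
    WeightLE α w A (p.map (mapRingHom φ)) := by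
  intro i j h
  rw [coeff_map, coe_mapRingHom, coeff_map] at h
  exact hp i j fun h1 => h (by rw [h1, map_zero])

theorem of_map {φ : R →+* S} (hφ : Function.Injective φ)
    (hp : WeightLE α w A (p.map (mapRingHom φ))) : WeightLE α w A p := by
  intro i j h
  refine hp i j ?_
  rw [coeff_map, coe_mapRingHom, coeff_map]
  exact fun h1 => h (hφ (by rw [h1, map_zero]))

/-- A polynomial whose leading coefficient in `X` is constant in `Γ`. -/
theorem of_natDegree_le {κ d : ℕ} (hκ : α * κ ≤ w) (hd : p.natDegree ≤ d)
    (hc : ∀ j, (p.coeff j).natDegree ≤ κ) (hl : (p.coeff d).natDegree = 0) :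
    WeightLE α w (d * w) p := by
  intro i j h
  have hj : j ≤ d := (le_natDegree_of_ne_zero (fun h1 => h (by rw [h1, coeff_zero]))).trans hd
  have hi := le_natDegree_of_ne_zero h
  rcases hj.lt_or_eq with hj | rfl
  · have h1 : α * i ≤ w := (Nat.mul_le_mul_left α (hi.trans (hc j))).trans hκ
    have h2 : w * j + w ≤ w * d := by
      rw [← Nat.mul_succ]; exact Nat.mul_le_mul_left w hj
    have h3 : α * i + w * j ≤ d * w := by rw [mul_comm d]; omega
    exact_mod_cast h3
  · have h1 : i = 0 := by omega
    subst h1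
    simp [mul_comm]

theorem natDegree_le {n : ℕ} (hp : WeightLE 0 1 n p) : p.natDegree ≤ n := by
  rw [natDegree_le_iff_coeff_eq_zero]
  intro j hj
  ext i
  rw [coeff_zero]
  by_contra h
  have := hp i j h
  push_cast at this
  omega

end WeightLE

end Weight

section Elimination

variable {K : Type*} [Field K]

/-- Division with remainder by an operator that raises the degree by `n₀`. The leading coefficients
are constants, so no denominators in `Γ` arise and weights are preserved. It is used for
multiplication by `H` and for `∇` without poles. -/
theorem exists_eq_add_of_leading (L : K[X][X] → K[X][X]) (n₀ : ℕ)
    (hadd : ∀ u v, L (u + v) = L u + L v) (hmul : ∀ (c : K[X]) v, L (C c * v) = C c * L v)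
    (hdeg : ∀ j i, j + n₀ < i → (L (X ^ j)).coeff i = 0)
    (hlead : ∀ j, ∃ e : K, e ≠ 0 ∧ (L (X ^ j)).coeff (j + n₀) = C e)
    (N : ℕ) (a : K[X][X]) (ha : a.degree < N) :
    ∃ v F : K[X][X], a = L v + F ∧ F.degree < n₀ ∧
      ∀ (α w : ℕ) (A : ℤ), (∀ (v : K[X][X]) (B : ℤ), WeightLE α w B v →
        WeightLE α w (B + n₀ * w) (L v)) → WeightLE α w A a →
        WeightLE α w (A - n₀ * w) v ∧ WeightLE α w A F := by
  induction N generalizing a with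
  | zero =>
    have h0 : a = 0 := by
      rw [← degree_eq_bot]
      exact (Nat.WithBot.lt_zero_iff).1 (by simpa using ha)
    refine ⟨0, 0, ?_, by simp, fun _ _ _ _ _ => ⟨.zero, .zero⟩⟩
    have := hmul 0 0
    simp only [map_zero, zero_mul] at this
    rw [this, h0, add_zero]
  | succ N ih =>
    by_cases hN : N < n₀
    · refine ⟨0, a, ?_, ha.trans_le (by exact_mod_cast hN), fun _ _ _ _ h => ⟨.zero, h⟩⟩
      have := hmul 0 0
      simp only [map_zero, zero_mul] at this
      rw [this, zero_add]
    obtain ⟨j, rfl⟩ := Nat.exists_eq_add_of_le' (not_lt.1 hN)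
    obtain ⟨e, he, hje⟩ := hlead j
    set c : K[X] := C e⁻¹ * a.coeff (j + n₀) with hc
    have hce : c * C e = a.coeff (j + n₀) := by
      rw [hc, mul_right_comm, ← C_mul, inv_mul_cancel₀ he, C_1, one_mul]
    have hlt : (a - L (C c * X ^ j)).degree < (j + n₀ : ℕ) := by
      rw [degree_lt_iff_coeff_zero]
      intro i hi
      rw [coeff_sub, hmul, coeff_C_mul]
      rcases hi.lt_or_eq with hi | rfl
      · rw [hdeg j i hi, mul_zero, sub_zero]
        exact coeff_eq_zero_of_degree_lt (ha.trans_le (by exact_mod_cast hi))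
      · rw [hje, hce, sub_self]
    obtain ⟨v, F, h1, h2, h3⟩ := ih _ hlt
    refine ⟨C c * X ^ j + v, F, ?_, h2, ?_⟩
    · rw [hadd, add_assoc, ← h1]; ring
    · intro α w A hL ha'
      have h4 : WeightLE α w (A - n₀ * w) (C c * X ^ j) := by
        intro i l h
        rw [coeff_C_mul_X_pow] at h
        split_ifs at h with hl
        · subst hl
          rw [hc, coeff_C_mul] at h
          have h5 := ha' i (l + n₀) (right_ne_zero_of_mul h)
          push_cast at h5
          linarith
        · simp at h
      have h5 := h3 α w A hL (ha'.sub ((hL _ _ h4).mono (by linarith)))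
      exact ⟨h4.add h5.1, h5.2⟩

end Elimination

namespace CurveData

section Reduction

variable {R : Type*} [CommRing R] (E : CurveData R[X])

/-- Bounds on the weights of the data, and of a Bezout identity for `H` and `Q_f H'`. -/
structure IsBounded (g κ : ℕ) (r : R[X]) (s t : R[X][X]) : Prop where
  natDegree_H_le : E.H.natDegree ≤ g
  bezout : s * E.H + t * (E.Qf * derivative E.H) = C r
  weight_H : ∀ α w : ℕ, α * κ ≤ w → WeightLE α w (E.H.natDegree * w) E.H
  weight_Qf : ∀ α w : ℕ, α * κ ≤ w → WeightLE α w ((2 * g + 1 - E.H.natDegree) * w) E.Qf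
  weight_h₀ : ∀ α w : ℕ, α * κ ≤ w → WeightLE α w ((g - E.H.natDegree) * w) E.h₀
  weight_r : ∀ α w : ℕ, α * κ ≤ w → WeightLE α w (3 * g * w) (C r)
  weight_s : ∀ α w : ℕ, α * κ ≤ w → WeightLE α w (5 * g * w) s
  weight_t : ∀ α w : ℕ, α * κ ≤ w → WeightLE α w (5 * g * w) t

end Reduction

section Field

variable {K : Type*} [Field K] {E : CurveData K[X]} {g κ : ℕ} {r : K[X]}
  {s t : K[X][X]}

/-- The discriminant has degree `2 g + 1` and leading coefficient `4`, because `deg h² ≤ 2 g`. Thus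
`v' Δ` contributes `4 j` and `(3/2) v Δ'` contributes `6 (2 g + 1)`. -/
theorem natDegree_nabla_zero [CharZero K] (hg : 1 ≤ g) (hE : E.IsHyperelliptic g) (j : ℕ) :
    (∀ i, j + 2 * g < i → (E.nabla 0 (X ^ j)).coeff i = 0) ∧
      (E.nabla 0 (X ^ j)).coeff (j + 2 * g) = C ((4 * j + 6 * (2 * g + 1) : ℕ) : K) := by
  have hΔ0 : ∀ i, 2 * g + 1 < i → E.Δ.coeff i = 0 := fun i hi =>
    coeff_eq_zero_of_natDegree_lt ((natDegree_Δ_le hE).trans_lt hi)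
  have hΔ1 : E.Δ.coeff (2 * g + 1) = C 4 := by
    rw [Δ, coeff_add, coeff_eq_zero_of_natDegree_lt (p := E.h ^ 2), zero_add,
      show (4 : K[X][X]) = C (C 4) by rw [map_ofNat, map_ofNat], coeff_C_mul, ← hE.natDegree_f, coeff_natDegree,
      hE.f_monic.leadingCoeff, mul_one]
    have := natDegree_pow_le (p := E.h) (n := 2)
    have := hE.natDegree_h
    omega
  have hG : (E.h * derivative E.h + 2 * derivative E.f) = C (C 2⁻¹) * derivative E.Δ := by
    have h2 : C (C (2 : K)⁻¹) * (2 : K[X][X]) = 1 := by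
      rw [show (2 : K[X][X]) = C (C 2) by rw [map_ofNat, map_ofNat], ← C_mul, ← C_mul, inv_mul_cancel₀ two_ne_zero, C_1, C_1]
    have h3 : derivative E.Δ = 2 * (E.h * derivative E.h + 2 * derivative E.f) := by
      have h4 : derivative (4 : K[X][X]) = 0 := by simp
      rw [Δ, derivative_add, derivative_mul, h4, derivative_pow, map_natCast]
      push_cast
      ring
    rw [h3, ← mul_assoc, h2, one_mul]
  have key : ∀ i, (E.nabla 0 (X ^ j)).coeff (j + i) =
      C (j + 3 * 2⁻¹ * (i + 1) : K) * E.Δ.coeff (i + 1) := by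
    intro i
    have h1 : E.nabla 0 (X ^ j) =
        C (C (j : K)) * (X ^ (j - 1) * E.Δ) + C (C (3 * 2⁻¹ : K)) * (derivative E.Δ * X ^ j) := by
      rw [nabla, hG, derivative_X_pow]
      simp only [map_mul, map_natCast, map_ofNat]
      push_cast
      ring
    rw [h1, coeff_add, coeff_C_mul, coeff_C_mul, add_comm j i, coeff_mul_X_pow, coeff_derivative]
    have h2 : C (j : K) * (X ^ (j - 1) * E.Δ).coeff (i + j) = C (j : K) * E.Δ.coeff (i + 1) := by
      cases j with
      | zero => simp
      | succ j => rw [Nat.add_sub_cancel, mul_comm (X ^ j), show i + (j + 1) = (i + 1) + j by ring,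
          coeff_mul_X_pow]
    rw [h2]
    simp only [map_mul, map_add, map_natCast, map_ofNat, map_one]
    ring
  constructor
  · intro i hi
    obtain ⟨l, rfl⟩ := Nat.exists_eq_add_of_le (show j ≤ i by omega)
    rw [key, hΔ0 _ (by omega), mul_zero]
  · rw [key, hΔ1, ← C_mul]
    congr 1
    push_cast
    ring_nf

theorem weight_Δ₁ (hb : E.IsBounded g κ r s t) {α w : ℕ} (hw : α * κ ≤ w) :
    WeightLE α w ((2 * g + 1 - E.H.natDegree) * w) E.Δ₁ := by
  have h1 := (hb.weight_H α w hw).mul ((hb.weight_h₀ α w hw).pow 2)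
  have h2 := (hb.weight_Qf α w hw).natCast_mul 4
  rw [Δ₁]
  refine WeightLE.add (by simpa using h2) (h1.mono ?_)
  have : (0 : ℤ) ≤ w := by positivity
  push_cast
  linarith

theorem weight_h (hb : E.IsBounded g κ r s t) {α w : ℕ} (hw : α * κ ≤ w) :
    WeightLE α w (g * w) E.h :=
  ((hb.weight_H α w hw).mul (hb.weight_h₀ α w hw)).mono (le_of_eq (by ring))

theorem weight_f (hb : E.IsBounded g κ r s t) {α w : ℕ} (hw : α * κ ≤ w) :
    WeightLE α w ((2 * g + 1) * w) E.f :=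
  ((hb.weight_H α w hw).mul (hb.weight_Qf α w hw)).mono (le_of_eq (by ring))

theorem weight_nabla (hb : E.IsBounded g κ r s t) {α w : ℕ} (hw : α * κ ≤ w) (M : ℕ)
    {v : K[X][X]} {B : ℤ} (hv : WeightLE α w B v) :
    WeightLE α w (B + (2 * g : ℕ) * w) (E.nabla M v) := by
  have hh := weight_h hb hw
  have hf := weight_f hb hw
  have hΔ1 := weight_Δ₁ hb hw
  have hH := hb.weight_H α w hw
  have h3 : WeightLE α w (g * w + (g * w - w)) (E.h * derivative E.h) := hh.mul hh.derivative
  have hw0 : (0 : ℤ) ≤ w := by positivity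
  rw [nabla, Δ_eq]
  refine ((WeightLE.sub ?_ ?_).add ?_)
  · exact (hv.derivative.mul (hH.mul hΔ1)).mono (le_of_eq (by push_cast; ring))
  · exact (((hv.natCast_mul M).mul hH.derivative).mul hΔ1).mono (le_of_eq (by push_cast; ring))
  · have h4 : WeightLE α w (2 * g * w) (E.h * derivative E.h + 2 * derivative E.f) :=
      (h3.mono (by linarith)).add (by
        have := (hf.derivative.natCast_mul 2).mono (B := 2 * g * w) (le_of_eq (by ring))
        simpa using this)
    have h5 := (hv.natCast_mul 3).mul h4
    simpa using h5

/-- Reduction of a form to a combination of the `Xʲ Y dX`. -/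
theorem exists_reduction [CharZero K] (hg : 1 ≤ g) (hE : E.IsHyperelliptic g) (hb : E.IsBounded g κ r s t)
    (M : ℕ) (a : K[X][X]) :
    ∃ v F : K[X][X], C r ^ M * a = E.nabla M v + E.H ^ M * F ∧ F.degree < (2 * g : ℕ) ∧
      ∀ (α w : ℕ) (A : ℤ), α * κ ≤ w → WeightLE α w A a →
        WeightLE α w (A + 9 * g * w * M + 5 * g * w) v ∧
        WeightLE α w (A + 8 * g * w * M) F := by
  induction M generalizing a with
  | zero =>
    obtain ⟨v, F, h1, h2, h3⟩ := exists_eq_add_of_leading (E.nabla 0) (2 * g) (E.nabla_add 0)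
      (fun c v => E.nabla_C_mul 0 c v) (fun j => (natDegree_nabla_zero hg hE j).1)
      (fun j => ⟨_, by exact_mod_cast (show 4 * j + 6 * (2 * g + 1) ≠ 0 by omega),
        (natDegree_nabla_zero hg hE j).2⟩) (a.natDegree + 1) a
      ((degree_le_natDegree).trans_lt (by exact_mod_cast Nat.lt_succ_self _))
    · refine ⟨v, F, by simpa using h1, h2, fun α w A hw ha => ?_⟩
      obtain ⟨h4, h5⟩ := h3 α w A (fun v B hv => weight_nabla hb hw 0 hv) ha
      refine ⟨h4.mono ?_, h5.mono (by simp)⟩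
      push_cast
      have : (0 : ℤ) ≤ g * w := by positivity
      linarith
  | succ M ih =>
    obtain ⟨a₁, a₀, h1, -, h3⟩ := exists_eq_add_of_leading (fun v => E.H * v) E.H.natDegree
      (fun u v => mul_add _ u v) (fun c v => by ring)
      (fun j i hij => by
        rw [mul_comm]
        refine coeff_eq_zero_of_natDegree_lt (lt_of_le_of_lt natDegree_mul_le ?_)
        rwa [natDegree_X_pow])
      (fun j => ⟨1, one_ne_zero, by
        rw [add_comm, coeff_mul_X_pow, coeff_natDegree, hE.H_monic.leadingCoeff, C_1]⟩)
      (a.natDegree + 1) a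
      ((degree_le_natDegree).trans_lt (by exact_mod_cast Nat.lt_succ_self _))
    -- Modulo `H` one has `∇ v ≡ (6 - 4 (M + 1)) v Q_f H'`: the `4` comes from `Δ₁ ≡ 4 Q_f` and the
    -- `6` from `3 * 2 f'`. The factor is nonzero because `4` does not divide `6`.
    have hM : (6 - 4 * ((M + 1 : ℕ) : K)) ≠ 0 := by
      intro h
      have h' : ((6 : ℕ) : K) = ((4 * (M + 1) : ℕ) : K) := by
        push_cast at h ⊢
        linear_combination h
      have := Nat.cast_injective h'
      omega
    obtain ⟨v₁, hv₁⟩ : ∃ v₁ : K[X][X], v₁ = C (C (6 - 4 * ((M + 1 : ℕ) : K))⁻¹) * (t * a₀) := ⟨_, rfl⟩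
    have hv₁' : (6 - 4 * ((M + 1 : ℕ) : K[X][X])) * v₁ = t * a₀ := by
      rw [hv₁, ← mul_assoc, show (6 - 4 * ((M + 1 : ℕ) : K[X][X])) =
        C (C (6 - 4 * ((M + 1 : ℕ) : K))) by
          rw [map_sub, map_sub, map_mul, map_mul, map_natCast, map_natCast, map_ofNat, map_ofNat,
            map_ofNat, map_ofNat], ← C_mul, ← C_mul, mul_inv_cancel₀ hM, C_1, C_1, one_mul]
    -- With `v₁` chosen to match `t a₀` modulo `H`, everything left over is divisible by `H`; `a'`
    -- is the quotient, to which the induction hypothesis for one pole less applies.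
    set a' := C r * a₁ + s * a₀ - (derivative v₁ * E.Δ₁
      + (3 - ((M + 1 : ℕ) : K[X][X])) * (v₁ * (derivative E.H * E.h₀ ^ 2))
      + 3 * (v₁ * (E.H * (E.h₀ * derivative E.h₀))) + 6 * (v₁ * derivative E.Qf)) with ha'
    have hstep : C r * a = E.nabla (M + 1) v₁ + E.H * a' := by
      have hb1 := hb.bezout
      rw [nabla, Δ_eq, ha', Δ₁, h, f, derivative_mul (f := E.H), derivative_mul (f := E.H), h1]
      linear_combination (-a₀) * hb1 - E.Qf * derivative E.H * hv₁'
    obtain ⟨v₂, F, h4, h5, h6⟩ := ih a'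
    refine ⟨C (r ^ M) * v₁ + E.H * v₂, F, ?_, h5, ?_⟩
    · rw [nabla_add, nabla_C_mul, nabla_succ_H_mul, C_pow]
      linear_combination C r ^ M * hstep + E.H * h4
    · intro α w A hw ha
      have hw0 : (0 : ℤ) ≤ w := by positivity
      have hgw : (0 : ℤ) ≤ g * w := by positivity
      have hn : (E.H.natDegree : ℤ) * w ≤ g * w :=
        mul_le_mul_of_nonneg_right (by exact_mod_cast hb.natDegree_H_le) hw0
      have hn0 : (0 : ℤ) ≤ E.H.natDegree * w := by positivity
      have hg1 : (w : ℤ) ≤ g * w := by nlinarith [show (1 : ℤ) ≤ g by exact_mod_cast hg]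
      have hH := hb.weight_H α w hw
      obtain ⟨h7, h8⟩ := h3 α w A (fun v B hv => (hH.mul hv).mono (le_of_eq (by ring))) ha
      have h9 : WeightLE α w (A + 5 * g * w) v₁ :=
        hv₁ ▸ WeightLE.C_C_mul _ (((hb.weight_t α w hw).mul h8).mono (by linarith))
      have hh0 := hb.weight_h₀ α w hw
      have hQf := hb.weight_Qf α w hw
      -- The largest contributions, such as `v₁' Δ₁` and `v₁ Q_f'`, add at most `5 g w + 2 g w`; the
      -- bound `8 g w` per pole is a convenient excess.
      have h10 : WeightLE α w (A + 8 * g * w) a' := by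
        refine ((((hb.weight_r α w hw).mul h7).mono (by linarith)).add
          (((hb.weight_s α w hw).mul h8).mono (by linarith))).sub ?_
        refine (((WeightLE.mono (h9.derivative.mul (weight_Δ₁ hb hw)) (by linarith)).add ?_).add
          ?_).add ?_
        · have h := (h9.mul (hH.derivative.mul (hh0.pow 2)))
          have h := h.C_C_mul (3 - ((M + 1 : ℕ) : K))
          simp only [map_sub, map_natCast, map_ofNat] at h
          exact h.mono (by push_cast; linarith)
        · have h := (h9.mul (hH.mul (hh0.mul hh0.derivative))).natCast_mul 3
          exact (WeightLE.mono (by simpa using h) (by linarith))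
        · have h := (h9.mul hQf.derivative).natCast_mul 6
          exact (WeightLE.mono (by simpa using h) (by linarith))
      obtain ⟨h11, h12⟩ := h6 α w _ hw h10
      refine ⟨WeightLE.add ?_ ?_, h12.mono (le_of_eq (by push_cast; ring))⟩
      · rw [C_pow]
        refine (((hb.weight_r α w hw).pow M).mul h9).mono ?_
        have : (0 : ℤ) ≤ g * w * M := by positivity
        push_cast
        linarith
      · refine (hH.mul h11).mono ?_
        push_cast
        linarith

end Field

end CurveData
end DeformedCurve
end

/-! ### Degrees in `Γ`, the Bezout identity of the resultant, and the bounds for a family. -/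

noncomputable section

namespace DeformedCurve

open Polynomial

section DegΓ

variable {R : Type*} [CommRing R]

theorem coeff_coeff_swap (p : R[X][X]) (i j : ℕ) :
    ((Bivariate.swap p).coeff i).coeff j = (p.coeff j).coeff i := by
  induction p using Polynomial.induction_on' with
  | add p q hp hq => simp only [map_add, coeff_add, hp, hq]
  | monomial n a =>
    induction a using Polynomial.induction_on' with
    | add p q hp hq => simp only [map_add, coeff_add, hp, hq]
    | monomial m a =>
      rw [Bivariate.swap_monomial_monomial]
      simp only [coeff_monomial]
      split_ifs <;> simp_all [coeff_monomial]

/-- Exchanging the variables turns a degree in `Γ` into an ordinary degree, which is additive over a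
domain. -/
theorem natDegree_coeff_le_iff (p : R[X][X]) (d : ℕ) :
    (∀ j, (p.coeff j).natDegree ≤ d) ↔ (Bivariate.swap p).natDegree ≤ d := by
  simp only [natDegree_le_iff_coeff_eq_zero]
  constructor
  · intro h i hi
    ext j
    rw [coeff_coeff_swap, h j i hi, coeff_zero]
  · intro h j i hi
    rw [← coeff_coeff_swap, h i hi, coeff_zero]

theorem natDegree_coeff_le_degΓ (p : R[X][X]) (j : ℕ) : (p.coeff j).natDegree ≤ degΓ p := by
  by_cases h : p.coeff j = 0
  · rw [h, natDegree_zero]; exact Nat.zero_le _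
  · exact Finset.le_sup (f := fun n => (p.coeff n).natDegree) (mem_support_iff.2 h)

theorem natDegree_coeff_mul_le {p q : R[X][X]} {a b : ℕ} (hp : ∀ j, (p.coeff j).natDegree ≤ a)
    (hq : ∀ j, (q.coeff j).natDegree ≤ b) (j : ℕ) : ((p * q).coeff j).natDegree ≤ a + b := by
  rw [natDegree_coeff_le_iff] at hp hq
  refine (natDegree_coeff_le_iff (p * q) (a + b)).2 ?_ j
  rw [map_mul]
  exact natDegree_mul_le.trans (add_le_add hp hq)

theorem natDegree_coeff_derivative_le {p : R[X][X]} {a : ℕ} (hp : ∀ j, (p.coeff j).natDegree ≤ a)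
    (j : ℕ) : ((derivative p).coeff j).natDegree ≤ a := by
  rw [coeff_derivative, show ((j : R[X]) + 1) = C ((j : R) + 1) by simp]
  exact (natDegree_mul_C_le _ _).trans (hp _)

variable [IsDomain R]

/-- The degrees in `Γ` of two polynomials add up to at most the degree of the product. -/
theorem exists_natDegree_coeff_le {p q : R[X][X]} (hpq : p * q ≠ 0) {d : ℕ}
    (h : ∀ j, ((p * q).coeff j).natDegree ≤ d) :
    ∃ a b, a + b ≤ d ∧ (∀ j, (p.coeff j).natDegree ≤ a) ∧ ∀ j, (q.coeff j).natDegree ≤ b := by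
  refine ⟨(Bivariate.swap p).natDegree, (Bivariate.swap q).natDegree, ?_,
    (natDegree_coeff_le_iff _ _).2 le_rfl, (natDegree_coeff_le_iff _ _).2 le_rfl⟩
  rw [← natDegree_mul, ← map_mul]
  · exact (natDegree_coeff_le_iff _ _).1 h
  · exact (map_ne_zero_iff _ (AlgEquiv.injective _)).2 (left_ne_zero_of_mul hpq)
  · exact (map_ne_zero_iff _ (AlgEquiv.injective _)).2 (right_ne_zero_of_mul hpq)

end DegΓ

section Bezout

variable {R : Type*} [CommRing R]

theorem natDegree_det_le {n : ℕ} (A : Matrix (Fin n) (Fin n) R[X]) {d : ℕ}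
    (h : ∀ i j, (A i j).natDegree ≤ d) : A.det.natDegree ≤ n * d := by
  rw [Matrix.det_apply]
  refine natDegree_sum_le_of_forall_le _ _ fun σ _ => (natDegree_smul_le _ _).trans ?_
  refine (natDegree_prod_le _ _).trans ((Finset.sum_le_card_nsmul _ _ d fun i _ => h _ _).trans ?_)
  simp

theorem natDegree_adjugate_le {n : ℕ} (A : Matrix (Fin n) (Fin n) R[X]) {d : ℕ}
    (h : ∀ i j, (A i j).natDegree ≤ d) (i j : Fin n) : (A.adjugate i j).natDegree ≤ n * d := by
  rw [Matrix.adjugate_apply]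
  refine natDegree_det_le _ fun i' j' => ?_
  rw [Matrix.updateRow_apply]
  split_ifs
  · rw [Pi.single_apply]
    split_ifs <;> simp
  · exact h _ _

theorem natDegree_sylvester_le {f g : R[X][X]} {m n d : ℕ} (hf : ∀ j, (f.coeff j).natDegree ≤ d)
    (hg : ∀ j, (g.coeff j).natDegree ≤ d) (i j : Fin (m + n)) :
    (sylvester f g m n i j).natDegree ≤ d := by
  rw [sylvester, Matrix.of_apply]
  induction j using Fin.addCases with
  | left j =>
    simp only [Fin.addCases_left]
    split_ifs
    · exact hg _
    · simp
  | right j =>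
    simp only [Fin.addCases_right]
    split_ifs
    · exact hf _
    · simp

/-- The Bezout identity of the resultant, with bounds on the degrees. -/
theorem exists_mul_add_mul_eq_C_resultant_natDegree_le {f g : R[X][X]} {m n d : ℕ}
    (hfm : f.natDegree ≤ m) (hgn : g.natDegree ≤ n) (hmn : m ≠ 0 ∨ n ≠ 0)
    (hf : ∀ j, (f.coeff j).natDegree ≤ d) (hg : ∀ j, (g.coeff j).natDegree ≤ d) :
    ∃ p q : R[X][X], p.degree < (n : ℕ) ∧ q.degree < (m : ℕ) ∧
      f * p + g * q = C (resultant f g m n) ∧ (∀ j, (p.coeff j).natDegree ≤ (m + n) * d) ∧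
      (∀ j, (q.coeff j).natDegree ≤ (m + n) * d) ∧
      (resultant f g m n).natDegree ≤ (m + n) * d := by
  rcases subsingleton_or_nontrivial R with hR | hR
  · refine ⟨0, 0, ?_, ?_, Subsingleton.elim _ _, by simp, by simp, ?_⟩
    · simp
    · simp
    · rw [Subsingleton.elim (resultant f g m n) 0]; simp
  have h1 : (1 : R[X][X]) ∈ degreeLT (R[X]) (m + n) := by
    rw [mem_degreeLT, degree_one]
    exact_mod_cast (show 0 < m + n by omega)
  -- The adjugate of the Sylvester matrix applied to `1` gives both Bezout cofactors. Its entries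
  -- are minors of a matrix of size `m + n`, whence the degree bound `(m + n) d`.
  set Y := adjSylvester f g (m := m) (n := n) ⟨1, h1⟩ with hY
  have h2 : ((sylvesterMap f g hfm hgn Y)).1 = _ :=
    congrArg Subtype.val (LinearMap.congr_fun (sylveserMap_comp_adjSylvester f g hfm hgn) ⟨1, h1⟩)
  have h3 : ∀ i, ((((degreeLT.basis (R[X]) m).prod (degreeLT.basis (R[X]) n)).reindex
      finSumFinEquiv).repr Y i).natDegree ≤ (m + n) * d := by
    intro i
    rw [hY, adjSylvester, Matrix.repr_toLin, Matrix.mulVec, dotProduct]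
    refine natDegree_sum_le_of_forall_le _ _ fun j _ => ?_
    refine natDegree_mul_le.trans ?_
    have h4 : ((degreeLT.basis (R[X]) (m + n)).repr ⟨1, h1⟩ j).natDegree = 0 := by
      rw [degreeLT.basis_repr, coeff_one]
      split_ifs <;> simp
    rw [h4, add_zero]
    exact natDegree_adjugate_le _ (natDegree_sylvester_le hf hg) _ _
  have hcoef : ∀ {l : ℕ} (y : degreeLT (R[X]) l), (∀ i : Fin l, ((y : R[X][X]).coeff i).natDegree ≤
      (m + n) * d) → ∀ j, ((y : R[X][X]).coeff j).natDegree ≤ (m + n) * d := by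
    intro l y hy j
    by_cases hj : j < l
    · exact hy ⟨j, hj⟩
    · rw [coeff_eq_zero_of_degree_lt ((mem_degreeLT.1 y.2).trans_le (by exact_mod_cast not_lt.1 hj))]
      simp
  refine ⟨Y.2, Y.1, mem_degreeLT.1 Y.2.2, mem_degreeLT.1 Y.1.2, ?_, hcoef _ fun i => ?_,
    hcoef _ fun i => ?_, natDegree_det_le _ (natDegree_sylvester_le hf hg)⟩
  · simpa [Algebra.smul_def] using h2
  · have := h3 (finSumFinEquiv (.inr i))
    rw [Module.Basis.repr_reindex_apply, Equiv.symm_apply_apply, Module.Basis.prod_repr_inr] at this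
    exact this
  · have := h3 (finSumFinEquiv (.inl i))
    rw [Module.Basis.repr_reindex_apply, Equiv.symm_apply_apply, Module.Basis.prod_repr_inl] at this
    exact this

end Bezout

namespace Family

variable {k : Type*} [Field k] [CharP k 2] {g : ℕ} (E : Family k g)

/-- `h / H` -/
def h₀ : (Zq k)[X][X] := C (C (E.c : Zq k)) * ∏ i, E.fac i ^ (E.mult i - 1)

/-- `H ^ D / h` -/
def hc : (Zq k)[X][X] := C (C ((E.c⁻¹ : (Zq k)ˣ) : Zq k)) * ∏ i, E.fac i ^ (E.D - E.mult i)

/-- The polynomials defining the family, as a curve over `ℤ_q[Γ]`. -/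
def data : CurveData (Zq k)[X] := ⟨E.H, E.Qf, E.h₀⟩

theorem data_H : E.data.H = E.H := rfl

theorem data_f : E.data.f = E.f := rfl

theorem data_h : E.data.h = E.h := by
  rw [CurveData.h, data, H, h₀, h, mul_left_comm, ← Finset.prod_mul_distrib]
  congr 1
  refine Finset.prod_congr rfl fun i _ => ?_
  rw [← pow_succ', Nat.sub_add_cancel (E.mult_pos i)]

theorem mult_le (i : Fin E.num) : E.mult i ≤ E.D :=
  (Finset.le_sup (f := E.mult) (Finset.mem_univ i)).trans (le_max_right _ _)

theorem h_mul_hc : E.h * E.hc = E.H ^ E.D := by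
  rw [h, hc, H, mul_mul_mul_comm, ← C_mul, ← C_mul, Units.mul_inv, C_1, C_1, one_mul,
    ← Finset.prod_mul_distrib, ← Finset.prod_pow]
  refine Finset.prod_congr rfl fun i _ => ?_
  rw [← pow_add, Nat.add_sub_cancel' (E.mult_le i)]

theorem H_monic : E.H.Monic := monic_prod_of_monic _ _ fun i _ => E.fac_monic i

theorem f_monic : E.f.Monic := E.H_monic.mul E.Qf_monic

theorem f_natDegree : E.f.natDegree = 2 * g + 1 := E.natDegree_f

theorem natDegree_Qf : E.Qf.natDegree = 2 * g + 1 - E.H.natDegree := by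
  have := E.f_natDegree
  rw [f, E.H_monic.natDegree_mul E.Qf_monic] at this
  omega

theorem isUnit_leadingCoeff_h : IsUnit E.h.leadingCoeff := by
  have hm : (∏ i, E.fac i ^ E.mult i).Monic :=
    monic_prod_of_monic _ _ fun i _ => (E.fac_monic i).pow _
  rw [h, leadingCoeff_mul_monic hm, leadingCoeff_C]
  exact (E.c.isUnit).map C

theorem natDegree_h_eq : E.h.natDegree = E.H.natDegree + E.h₀.natDegree := by
  have hm : (∏ i, E.fac i ^ (E.mult i - 1)).Monic :=
    monic_prod_of_monic _ _ fun i _ => (E.fac_monic i).pow _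
  have h0 : E.h₀ ≠ 0 := by
    rw [h₀]
    exact mul_ne_zero (by simp) hm.ne_zero
  rw [← data_h]
  exact natDegree_mul E.H_monic.ne_zero h0

theorem natDegree_H_le : E.H.natDegree ≤ g := by
  have h1 : E.h.natDegree ≤ g := E.natDegree_h
  rw [natDegree_h_eq] at h1
  omega

theorem D_pos : 1 ≤ E.D := le_max_left _ _

theorem isHyperelliptic_map {A : Type*} [CommRing A] [Nontrivial A] (φ : (Zq k)[X] →+* A) :
    (E.data.map φ).IsHyperelliptic g where
  H_monic := E.H_monic.map φ
  f_monic := by rw [CurveData.map_f]; exact E.f_monic.map φ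
  natDegree_f := by
    rw [CurveData.map_f, data_f, E.f_monic.natDegree_map]; exact E.natDegree_f
  natDegree_h := by
    rw [CurveData.map_h, data_h]
    exact natDegree_map_le.trans E.natDegree_h
  isUnit_leadingCoeff_h := by
    rw [CurveData.map_h, data_h]
    have h1 := E.isUnit_leadingCoeff_h.map φ
    rwa [leadingCoeff_map_of_leadingCoeff_ne_zero _ h1.ne_zero]
  exists_h_mul := ⟨E.hc.map φ, E.D, by
    rw [CurveData.map_h, data_h, ← Polynomial.map_mul, h_mul_hc, Polynomial.map_pow]; rfl⟩

theorem natDegree_coeff_f_le (j : ℕ) : (E.f.coeff j).natDegree ≤ E.κ :=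
  (natDegree_coeff_le_degΓ _ _).trans (le_max_left _ _)

/-- Degrees in `Γ` add up in a product, so a factor of `f` has coefficients of degree at most `κ`.
Since its leading coefficient is constant, each power of `X` below the top one leaves room `w ≥ α κ`
for them. -/
theorem weight_of_dvd_f {p : (Zq k)[X][X]} (hp : p.Monic) (hd : p ∣ E.f) {α w : ℕ}
    (hw : α * E.κ ≤ w) : WeightLE α w (p.natDegree * w) p := by
  obtain ⟨q, hq⟩ := hd
  have h0 : p * q ≠ 0 := hq ▸ E.f_monic.ne_zero
  obtain ⟨a, b, hab, ha, -⟩ := exists_natDegree_coeff_le h0 (d := E.κ)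
    (fun j => by rw [← hq]; exact E.natDegree_coeff_f_le j)
  refine WeightLE.of_natDegree_le hw le_rfl (fun j => (ha j).trans (by omega)) ?_
  rw [coeff_natDegree, hp.leadingCoeff, natDegree_one]

theorem fac_dvd_H (i : Fin E.num) : E.fac i ∣ E.H := Finset.dvd_prod_of_mem _ (Finset.mem_univ i)

theorem weight_fac (i : Fin E.num) {α w : ℕ} (hw : α * E.κ ≤ w) :
    WeightLE α w ((E.fac i).natDegree * w) (E.fac i) :=
  E.weight_of_dvd_f (E.fac_monic i) ((E.fac_dvd_H i).trans (dvd_mul_right _ _)) hw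

theorem weight_prod_fac (e : Fin E.num → ℕ) {α w : ℕ} (hw : α * E.κ ≤ w) :
    WeightLE α w ((∏ i, E.fac i ^ e i).natDegree * w) (∏ i, E.fac i ^ e i) := by
  have h1 := WeightLE.prod Finset.univ (fun i => E.fac i ^ e i) _
    (fun i _ => (E.weight_fac i hw).pow (e i))
  refine h1.mono (le_of_eq ?_)
  rw [natDegree_prod_of_monic _ _ fun i _ => (E.fac_monic i).pow _]
  push_cast
  rw [Finset.sum_mul]
  refine Finset.sum_congr rfl fun i _ => ?_
  rw [(E.fac_monic i).natDegree_pow]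
  push_cast
  ring

theorem weight_h₀ {α w : ℕ} (hw : α * E.κ ≤ w) : WeightLE α w (E.h₀.natDegree * w) E.h₀ := by
  have h1 := (E.weight_prod_fac (fun i => E.mult i - 1) hw).C_C_mul (E.c : Zq k)
  rw [h₀, natDegree_C_mul_of_mul_ne_zero]
  · exact h1
  · have hm : (∏ i, E.fac i ^ (E.mult i - 1)).Monic :=
      monic_prod_of_monic _ _ fun i _ => (E.fac_monic i).pow _
    rw [hm.leadingCoeff, mul_one]
    simp

theorem weight_hc {α w : ℕ} (hw : α * E.κ ≤ w) : WeightLE α w (g * E.D * w) E.hc := by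
  have h1 := (E.weight_prod_fac (fun i => E.D - E.mult i) hw).C_C_mul
    ((E.c⁻¹ : (Zq k)ˣ) : Zq k)
  refine h1.mono ?_
  have h2 : (∏ i, E.fac i ^ (E.D - E.mult i)).natDegree ≤ E.H.natDegree * E.D := by
    rw [natDegree_prod_of_monic _ _ fun i _ => (E.fac_monic i).pow _, H,
      natDegree_prod_of_monic _ _ fun i _ => E.fac_monic i, Finset.sum_mul]
    refine Finset.sum_le_sum fun i _ => ?_
    rw [(E.fac_monic i).natDegree_pow, mul_comm]
    exact Nat.mul_le_mul_left _ (Nat.sub_le _ _)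
  have h3 := Nat.mul_le_mul_right w (h2.trans (Nat.mul_le_mul_right E.D E.natDegree_H_le))
  exact_mod_cast h3

theorem exists_isBounded : ∃ s t, E.data.IsBounded g E.κ E.r s t := by
  have hf0 : E.H * E.Qf ≠ 0 := E.f_monic.ne_zero
  obtain ⟨a, b, hab, ha, hb⟩ := exists_natDegree_coeff_le hf0 (d := E.κ) E.natDegree_coeff_f_le
  have hH : ∀ j, (E.H.coeff j).natDegree ≤ E.κ := fun j => (ha j).trans (by omega)
  -- The degrees in `Γ` of `H` and `Q_f` together are at most `κ`, and differentiation in `X` does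
  -- not increase them.
  have hQH : ∀ j, ((E.Qf * derivative E.H).coeff j).natDegree ≤ E.κ := fun j =>
    (natDegree_coeff_mul_le hb (natDegree_coeff_derivative_le ha) j).trans (by omega)
  have hn := E.natDegree_H_le
  have hbez : ∃ s t : (Zq k)[X][X], s * E.H + t * (E.Qf * derivative E.H) = C E.r ∧
      s.natDegree ≤ 2 * g ∧ t.natDegree ≤ 2 * g ∧ (∀ j, (s.coeff j).natDegree ≤ 3 * g * E.κ) ∧
      (∀ j, (t.coeff j).natDegree ≤ 3 * g * E.κ) ∧ E.r.natDegree ≤ 3 * g * E.κ := by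
    -- For `H = 1` both degrees may be `0`, the Sylvester matrix is then empty, and the identity
    -- with `s = 1`, `t = 0`, `r = 1` is given by hand.
    by_cases h0 : E.H.natDegree = 0
    · have h1 : E.H = 1 := eq_one_of_monic_natDegree_zero E.H_monic h0
      refine ⟨1, 0, ?_, by simp, by simp, fun j => ?_, by simp, ?_⟩
      · rw [r, h1]; simp
      · rw [coeff_one]; split_ifs <;> simp
      · rw [r, h1]; simp
    · have hdeg : (E.Qf * derivative E.H).natDegree ≤ 2 * g := by
        refine natDegree_mul_le.trans ?_
        have := natDegree_derivative_le E.H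
        rw [natDegree_Qf]
        omega
      obtain ⟨p, q, hp, hq, hpq, hp', hq', hr⟩ := exists_mul_add_mul_eq_C_resultant_natDegree_le
        (f := E.H) (g := E.Qf * derivative E.H) le_rfl le_rfl (Or.inl h0) hH hQH
      -- The Sylvester matrix has size at most `g + 2 g`.
      have hle : (E.H.natDegree + (E.Qf * derivative E.H).natDegree) * E.κ ≤ 3 * g * E.κ :=
        Nat.mul_le_mul_right _ (by omega)
      refine ⟨p, q, by rw [mul_comm, mul_comm q, hpq]; rfl, ?_, ?_, fun j => (hp' j).trans hle,
        fun j => (hq' j).trans hle, hr.trans hle⟩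
      · exact (natDegree_le_of_degree_le hp.le).trans hdeg
      · exact (natDegree_le_of_degree_le hq.le).trans (by omega)
  obtain ⟨s, t, hst, hs, ht, hs', ht', hr⟩ := hbez
  -- Degree at most `3 g κ` in `Γ` weighs `3 g w` and degree `d` in `X` weighs `d w`; with `d = 2 g`
  -- this is the `5 g w` for the cofactors.
  have key : ∀ {p : (Zq k)[X][X]} {d : ℕ}, p.natDegree ≤ d →
      (∀ j, (p.coeff j).natDegree ≤ 3 * g * E.κ) → ∀ α w : ℕ, α * E.κ ≤ w →
      WeightLE α w (((3 * g + d : ℕ) : ℤ) * w) p := by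
    intro p d hd hp α w hw i j hij
    have h1 := (le_natDegree_of_ne_zero hij).trans (hp j)
    have h2 : j ≤ d :=
      (le_natDegree_of_ne_zero (fun h => hij (by rw [h, coeff_zero]))).trans hd
    have h3 : α * i ≤ 3 * g * w :=
      calc α * i ≤ α * (3 * g * E.κ) := Nat.mul_le_mul_left _ h1
        _ = 3 * g * (α * E.κ) := by ring
        _ ≤ _ := Nat.mul_le_mul_left _ hw
    have h4 : w * j ≤ w * d := Nat.mul_le_mul_left _ h2
    have h5 : α * i + w * j ≤ (3 * g + d) * w := by nlinarith
    exact_mod_cast h5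
  refine ⟨s, t, E.natDegree_H_le, hst, fun α w hw => ?_, fun α w hw => ?_, fun α w hw => ?_,
    fun α w hw => ?_, fun α w hw => ?_, fun α w hw => ?_⟩
  · exact E.weight_of_dvd_f E.H_monic (dvd_mul_right _ _) hw
  · refine (E.weight_of_dvd_f E.Qf_monic (dvd_mul_left _ _) hw).mono (le_of_eq ?_)
    rw [natDegree_Qf, data_H]
    push_cast [show E.H.natDegree ≤ 2 * g + 1 by omega]
    ring
  · refine (E.weight_h₀ hw).mono ?_
    have h1 : E.h.natDegree ≤ g := E.natDegree_h
    rw [natDegree_h_eq] at h1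
    rw [data_H]
    refine mul_le_mul_of_nonneg_right ?_ (by positivity)
    have : ((E.H.natDegree + E.h₀.natDegree : ℕ) : ℤ) ≤ g := by exact_mod_cast h1
    push_cast at this
    linarith
  · refine (key (d := 0) (by simp) (fun j => ?_) α w hw).mono (le_of_eq (by push_cast; ring))
    rw [coeff_C]
    split_ifs
    · exact hr
    · simp
  · exact (key hs hs' α w hw).mono (le_of_eq (by push_cast; ring))
  · exact (key ht ht' α w hw).mono (le_of_eq (by push_cast; ring))

end Family
end DeformedCurve
end

/-! ### Reduction over `ℤ_q[Γ]` with logarithmic denominators. -/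

noncomputable section

namespace DeformedCurve

open Polynomial

section Scale

variable {k : Type*} [Field k] [CharP k 2]

theorem algebraMap_Qq_injective : Function.Injective (algebraMap (Zq k) (Qq k)) :=
  IsFractionRing.injective _ _

theorem Zq_two_torsionFree (x : Zq k) (hx : 2 * x = 0) : x = 0 := by
  apply algebraMap_Qq_injective
  have h := congrArg (algebraMap (Zq k) (Qq k)) hx
  rw [map_mul, map_two_Qq, map_zero] at h
  rw [map_zero]
  exact (mul_eq_zero.1 h).resolve_left two_ne_zero_Qq

theorem isUnit_Zq {x : Zq k} (hx : WittVector.constantCoeff x ≠ 0) : IsUnit x :=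
  WittVector.isUnit_of_coeff_zero_ne_zero x hx

instance : CharZero (Zq k) := by
  refine charZero_of_inj_zero fun n => ?_
  induction n using Nat.strong_induction_on with
  | _ n ih =>
    intro hn
    rcases Nat.even_or_odd' n with ⟨m, rfl | rfl⟩
    · rcases Nat.eq_zero_or_pos m with rfl | hm
      · rfl
      · push_cast at hn
        have := ih m (by omega) (Zq_two_torsionFree _ hn)
        omega
    · exfalso
      have h := congrArg (WittVector.constantCoeff (p := 2) (R := k)) hn
      rw [map_natCast, map_zero] at h
      push_cast at h
      rw [show (2 : k) = 0 by exact_mod_cast CharP.cast_eq_zero k 2] at h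
      simp at h

variable [PerfectRing k 2]

theorem eq_zero_of_forall_two_pow_dvd {x : Zq k} (hx : ∀ n : ℕ, 2 ^ n ∣ x) : x = 0 := by
  by_contra h
  obtain ⟨m, u, rfl⟩ := WittVector.exists_eq_pow_p_mul' (p := 2) x h
  obtain ⟨y, hy⟩ := hx (m + 1)
  have h2 : ((2 : ℕ) : Zq k) = 2 := by norm_num
  rw [h2, pow_succ, mul_assoc] at hy
  have h3 : (2 : Zq k) ^ m ≠ 0 := fun h4 => h (by rw [h2, h4, zero_mul])
  have h5 : IsUnit (2 : Zq k) := isUnit_of_mul_isUnit_left (mul_left_cancel₀ h3 hy ▸ u.isUnit)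
  have h6 := h5.map (WittVector.constantCoeff (p := 2) (R := k))
  rw [map_ofNat] at h6
  exact h6.ne_zero (by exact_mod_cast CharP.cast_eq_zero k 2)

theorem exists_two_pow_mul_eq (x : Qq k) :
    ∃ n : ℕ, ∃ z : Zq k, 2 ^ n * x = algebraMap (Zq k) (Qq k) z := by
  obtain ⟨t, z, rfl⟩ := OrdGE.exists x
  refine ⟨(-⌈t⌉).toNat, 2 ^ (⌈t⌉.toNat) * z, ?_⟩
  rw [map_mul, map_pow, map_two_Qq, ← mul_assoc, ← zpow_natCast, ← zpow_natCast,
    ← zpow_add₀ two_ne_zero_Qq]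
  congr 2
  omega

theorem exists_two_pow_mul_eq_map {A : Type*} [CommRing A] {B : Type*} [CommRing B] (φ : A →+* B)
    (h : ∀ x : B, ∃ n : ℕ, ∃ z : A, 2 ^ n * x = φ z) (p : B[X]) :
    ∃ n : ℕ, ∃ q : A[X], 2 ^ n * p = q.map φ := by
  induction p using Polynomial.induction_on' with
  | add p q hp hq =>
    obtain ⟨m, p', hp'⟩ := hp
    obtain ⟨n, q', hq'⟩ := hq
    refine ⟨m + n, 2 ^ n * p' + 2 ^ m * q', ?_⟩
    simp only [Polynomial.map_add, Polynomial.map_mul, Polynomial.map_pow, Polynomial.map_ofNat]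
    rw [← hp', ← hq']
    ring
  | monomial i x =>
    obtain ⟨n, z, hz⟩ := h x
    refine ⟨n, monomial i z, ?_⟩
    rw [map_monomial, ← hz, ← C_mul_monomial, map_pow, map_ofNat]

theorem exists_two_pow_mul_eq_map_map (p : (Qq k)[X][X]) :
    ∃ n : ℕ, ∃ q : (Zq k)[X][X],
      2 ^ n * p = q.map (mapRingHom (algebraMap (Zq k) (Qq k))) :=
  exists_two_pow_mul_eq_map _
    (fun x => exists_two_pow_mul_eq_map _ exists_two_pow_mul_eq x) p

end Scale

theorem two_pow_dvd_of_monic_mul {R : Type*} [CommRing R] {p q : R[X]} (hq : q.Monic) (n : ℕ)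
    (h : 2 ^ n ∣ q * p) : 2 ^ n ∣ p := by
  have hC : (2 : R[X]) ^ n = C (2 ^ n) := by rw [map_pow, map_ofNat]
  rw [hC] at h ⊢
  obtain ⟨I, hI'⟩ : ∃ I : Ideal R, I = Ideal.span {(2 : R) ^ n} := ⟨_, rfl⟩
  have hI : ∀ x : R[X], x.map (Ideal.Quotient.mk I) = 0 ↔ C ((2 : R) ^ n) ∣ x := fun x => by
    rw [C_dvd_iff_dvd_coeff, Polynomial.ext_iff]
    refine forall_congr' fun i => ?_
    rw [coeff_map, coeff_zero, hI', Ideal.Quotient.eq_zero_iff_mem, Ideal.mem_span_singleton]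
  rw [← hI] at h ⊢
  rw [Polynomial.map_mul] at h
  exact ((hq.map _).mul_right_eq_zero_iff).1 h

namespace Family

variable {k : Type*} [Field k] [CharP k 2] {g : ℕ} (E : Family k g)

theorem isBounded_map {s t : (Zq k)[X][X]} (h : E.data.IsBounded g E.κ E.r s t) :
    (E.data.map (mapRingHom (algebraMap (Zq k) (Qq k)))).IsBounded g E.κ
      (E.r.map (algebraMap (Zq k) (Qq k)))
      (s.map (mapRingHom (algebraMap (Zq k) (Qq k))))
      (t.map (mapRingHom (algebraMap (Zq k) (Qq k)))) := by
  have hn : (E.data.map (mapRingHom (algebraMap (Zq k) (Qq k)))).H.natDegree = E.H.natDegree :=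
    E.H_monic.natDegree_map _
  constructor
  · rw [hn]; exact h.natDegree_H_le
  · have h1 := congrArg (Polynomial.map (mapRingHom (algebraMap (Zq k) (Qq k)))) h.bezout
    simpa [derivative_map, CurveData.map] using h1
  · intro α w hw
    rw [hn]; exact (h.weight_H α w hw).map _
  · intro α w hw
    rw [hn]; exact (h.weight_Qf α w hw).map _
  · intro α w hw
    rw [hn]; exact (h.weight_h₀ α w hw).map _
  · intro α w hw
    simpa using (h.weight_r α w hw).map (algebraMap (Zq k) (Qq k))
  · exact fun α w hw => (h.weight_s α w hw).map _
  · exact fun α w hw => (h.weight_t α w hw).map _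

/-- The base change from `ℤ_q[Γ]` to `ℤ_q⟦Γ⟧`. -/
def toSeries (k : Type*) [Field k] [CharP k 2] : (Zq k)[X] →+* PowerSeries (Zq k) :=
  coeToPowerSeries.ringHom

theorem isUnit_toSeries_r : IsUnit (toSeries k E.r) := by
  rw [toSeries, PowerSeries.isUnit_iff_constantCoeff]
  have h1 : PowerSeries.constantCoeff (coeToPowerSeries.ringHom E.r) = E.r.eval 0 := by
    rw [coeToPowerSeries.ringHom_apply, constantCoeff_coe, coeff_zero_eq_eval_zero]
  rw [h1]
  exact isUnit_Zq E.resultant_ne_zero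

/-- Since `r(0)` is nonzero modulo `2`, the Bezout identity can be divided by `r` over `ℤ_q⟦Γ⟧`,
which supplies the coprimality needed for the local analysis. Divisibility by `2 ^ n` descends back
to `ℤ_q[Γ]` by `two_pow_dvd_of_toSeries`. -/
theorem isCoprime_toSeries : IsCoprime (E.data.map (toSeries k)).H
    ((E.data.map (toSeries k)).Qf * derivative (E.data.map (toSeries k)).H) := by
  obtain ⟨s, t, h⟩ := E.exists_isBounded
  obtain ⟨u, hu⟩ := E.isUnit_toSeries_r
  have h1 := congrArg (Polynomial.map (toSeries k)) h.bezout
  simp only [Polynomial.map_add, Polynomial.map_mul, map_C, ← derivative_map] at h1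
  refine ⟨C ((u⁻¹ : _ˣ) : PowerSeries (Zq k)) * s.map (toSeries k),
    C ((u⁻¹ : _ˣ) : PowerSeries (Zq k)) * t.map (toSeries k), ?_⟩
  calc _ = C ((u⁻¹ : _ˣ) : PowerSeries (Zq k)) * (s.map (toSeries k) * E.data.H.map (toSeries k) +
        t.map (toSeries k) * (E.data.Qf.map (toSeries k) *
          derivative (E.data.H.map (toSeries k)))) := by
        simp only [CurveData.map]; ring
    _ = 1 := by rw [h1, ← hu, ← C_mul, Units.inv_mul, C_1]

theorem two_pow_dvd_of_toSeries {p : (Zq k)[X][X]} {n : ℕ}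
    (h : ∀ j, 2 ^ n ∣ (p.map (toSeries k)).coeff j) : 2 ^ n ∣ p := by
  have hC : (2 : (Zq k)[X][X]) ^ n = C (C (2 ^ n)) := by simp only [map_pow, map_ofNat]
  rw [hC, C_dvd_iff_dvd_coeff]
  intro j
  rw [C_dvd_iff_dvd_coeff]
  intro i
  obtain ⟨z, hz⟩ := h j
  rw [coeff_map] at hz
  have h1 := congrArg (PowerSeries.coeff i) hz
  rw [coeff_two_pow_mul, toSeries, coeToPowerSeries.ringHom_apply, coeff_coe] at h1
  exact ⟨_, h1⟩

/-- The logarithmic bound on denominators over `ℤ_q[Γ]`. -/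
theorem two_pow_dvd_of_nabla_eq (hg : 1 ≤ g) {M m n lam : ℕ} (hm : g * M ≤ m)
    (hlam : 2 * (m + 3 * g + 3) ≤ 2 ^ lam) {a v F : (Zq k)[X][X]}
    (hv : v.natDegree ≤ m) (hF : F.degree < (2 * g : ℕ))
    (heq : 2 ^ (n + 3 + lam) * a = E.data.nabla M v + E.H ^ M * F) : 2 ^ n ∣ v ∧ 2 ^ n ∣ F := by
  have hH : (E.data.map (toSeries k)).H.natDegree ≤ g := by
    rw [show (E.data.map (toSeries k)).H = E.H.map (toSeries k) from rfl,
      E.H_monic.natDegree_map]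
    exact E.natDegree_H_le
  have h1 := congrArg (Polynomial.map (toSeries k)) heq
  rw [Polynomial.map_add, Polynomial.map_mul, Polynomial.map_pow, Polynomial.map_ofNat,
    ← CurveData.nabla_map, Polynomial.map_mul, Polynomial.map_pow] at h1
  have hHM := Nat.mul_le_mul_right M hH
  have h2 : 2 ^ n ∣ v := by
    refine two_pow_dvd_of_toSeries ?_
    have hM : M ≤ g * M := Nat.le_mul_of_pos_left M hg
    exact CurveData.two_pow_dvd_of_nabla_eq (M := M) (m := m) (n := n) (lam := lam)
        (powerSeries_two_torsionFree Zq_two_torsionFree) (E.isHyperelliptic_map _)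
        E.isCoprime_toSeries (by omega) (by omega) (by omega)
        (natDegree_map_le.trans hv) (degree_map_le.trans_lt hF) h1
  refine ⟨h2, two_pow_dvd_of_monic_mul (E.H_monic.pow M) n ?_⟩
  obtain ⟨v', rfl⟩ := h2
  have h3 : E.data.nabla M (2 ^ n * v') = 2 ^ n * E.data.nabla M v' := by
    have := E.data.nabla_C_mul M (2 ^ n) v'
    rwa [map_pow, map_ofNat] at this
  refine ⟨2 ^ (3 + lam) * a - E.data.nabla M v', ?_⟩
  rw [h3] at heq
  linear_combination -heq

/-- The left side of the bound is `0`, so it is divisible by every power of `2`; hence so are `v`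
and `F`, and `ℤ_q` is separated. -/
theorem eq_zero_of_nabla_eq [PerfectRing k 2] (hg : 1 ≤ g) {M : ℕ} {v F : (Zq k)[X][X]}
    (hF : F.degree < (2 * g : ℕ)) (heq : E.data.nabla M v + E.H ^ M * F = 0) :
    v = 0 ∧ F = 0 := by
  have key : ∀ n, 2 ^ n ∣ v ∧ 2 ^ n ∣ F := fun n =>
    E.two_pow_dvd_of_nabla_eq hg (M := M) (m := g * M + v.natDegree) (n := n)
      (lam := 2 * (g * M + v.natDegree + 3 * g + 3)) (a := 0) (by omega)
      Nat.lt_two_pow_self.le (by omega) hF (by rw [heq, mul_zero])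
  have hz : ∀ p : (Zq k)[X][X], (∀ n, 2 ^ n ∣ p) → p = 0 := by
    intro p hp
    refine Polynomial.ext fun j => Polynomial.ext fun i => ?_
    rw [coeff_zero, coeff_zero]
    refine eq_zero_of_forall_two_pow_dvd fun n => ?_
    obtain ⟨q, rfl⟩ := hp n
    have hC : (2 : (Zq k)[X][X]) ^ n = C (C (2 ^ n)) := by simp only [map_pow, map_ofNat]
    rw [hC, coeff_C_mul, coeff_C_mul]
    exact dvd_mul_right _ _
  exact ⟨hz v fun n => (key n).1, hz F fun n => (key n).2⟩

theorem exists_integral_reduction [PerfectRing k 2] (hg : 1 ≤ g) {M A lam : ℕ}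
    {a : (Zq k)[X][X]} (ha : WeightLE 0 1 A a) (hlam : 2 * (A + 9 * g * M + 8 * g + 3) ≤ 2 ^ lam) :
    ∃ v F : (Zq k)[X][X], 2 ^ (lam + 3) * (C E.r ^ M * a) = E.data.nabla M v + E.H ^ M * F ∧
      F.degree < (2 * g : ℕ) ∧ ∀ (α w : ℕ) (B : ℤ), α * E.κ ≤ w → WeightLE α w B a →
        WeightLE α w (B + 9 * g * w * M + 5 * g * w) v ∧
        WeightLE α w (B + 8 * g * w * M) F := by
  have : CharZero (Qq k) := charZero_of_injective_algebraMap (algebraMap_Qq_injective (k := k))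
  set ι := mapRingHom (algebraMap (Zq k) (Qq k)) with hι
  have hιi : Function.Injective ι := map_injective _ algebraMap_Qq_injective
  obtain ⟨s, t, hst⟩ := E.exists_isBounded
  obtain ⟨v, F, h1, h2, h3⟩ := CurveData.exists_reduction hg (E.isHyperelliptic_map ι)
    (E.isBounded_map hst) M (a.map ι)
  obtain ⟨n₁, v₁, hv₁⟩ := exists_two_pow_mul_eq_map_map v
  obtain ⟨n₂, F₁, hF₁⟩ := exists_two_pow_mul_eq_map_map F
  obtain ⟨n, hn⟩ : ∃ n, n = n₁ + n₂ := ⟨_, rfl⟩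
  set v₂ := 2 ^ (n₂ + 3 + lam) * v₁ with hv₂
  set F₂ := 2 ^ (n₁ + 3 + lam) * F₁ with hF₂
  have hvm : v₂.map ι = 2 ^ (n + 3 + lam) * v := by
    rw [hv₂, Polynomial.map_mul, Polynomial.map_pow, Polynomial.map_ofNat, ← hv₁, hn]; ring
  have hFm : F₂.map ι = 2 ^ (n + 3 + lam) * F := by
    rw [hF₂, Polynomial.map_mul, Polynomial.map_pow, Polynomial.map_ofNat, ← hF₁, hn]; ring
  have hC : ∀ n : ℕ, (2 : (Qq k)[X][X]) ^ n = C (C (2 ^ n)) := fun n => by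
    simp only [map_pow, map_ofNat]
  have hweight : ∀ (α w : ℕ) (B : ℤ), α * E.κ ≤ w → WeightLE α w B a →
        WeightLE α w (B + 9 * g * w * M + 5 * g * w) v₂ ∧
        WeightLE α w (B + 8 * g * w * M) F₂ := by
    intro α w B hw hB
    obtain ⟨h4, h5⟩ := h3 α w B hw (hB.map _)
    refine ⟨WeightLE.of_map (φ := algebraMap (Zq k) (Qq k)) algebraMap_Qq_injective ?_,
      WeightLE.of_map (φ := algebraMap (Zq k) (Qq k)) algebraMap_Qq_injective ?_⟩
    · rw [← hι, hvm, hC]; exact h4.C_C_mul _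
    · rw [← hι, hFm, hC]; exact h5.C_C_mul _
  have hFd : F₂.degree < (2 * g : ℕ) := by
    rw [← degree_map_eq_of_injective hιi, hFm, hC]
    rwa [degree_C_mul (by simp)]
  have heq : 2 ^ (n + 3 + lam) * (C E.r ^ M * a) = E.data.nabla M v₂ + E.H ^ M * F₂ := by
    apply map_injective ι hιi
    rw [Polynomial.map_add, ← CurveData.nabla_map, hvm, Polynomial.map_mul, Polynomial.map_mul,
      Polynomial.map_mul, hFm, hC, CurveData.nabla_C_mul, Polynomial.map_pow, Polynomial.map_pow,
      Polynomial.map_pow, Polynomial.map_ofNat, hC, map_C]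
    have h4 : C (E.r.map (algebraMap (Zq k) (Qq k))) ^ M * a.map ι = _ := h1
    have h5 : (E.data.map ι).H = E.H.map ι := rfl
    rw [h5] at h4
    rw [show ι E.r = E.r.map (algebraMap (Zq k) (Qq k)) from rfl, h4]
    ring
  have hnd : v₂.natDegree ≤ A + 9 * g * M + 5 * g := by
    have h4 := (hweight 0 1 A (by omega) ha).1
    refine WeightLE.natDegree_le (h4.mono (le_of_eq ?_))
    push_cast
    ring
  -- The power `2 ^ n` that clears the denominators over `ℚ_q` is uncontrolled, but the logarithmic
  -- bound shows that it can be divided out again; only `2 ^ (lam + 3)` remains.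
  obtain ⟨⟨v₃, hv₃⟩, ⟨F₃, hF₃⟩⟩ := E.two_pow_dvd_of_nabla_eq hg (M := M) (n := n) (lam := lam)
    (by nlinarith) (by omega) hnd hFd heq
  have hC' : (2 : (Zq k)[X][X]) ^ n = C (C (2 ^ n)) := by simp only [map_pow, map_ofNat]
  have hCi : C (C ((2 : Zq k) ^ n)) ≠ 0 := by simp
  have hmul : ∀ p : (Zq k)[X][X], ∀ i j, ((2 ^ n * p).coeff j).coeff i =
      2 ^ n * (p.coeff j).coeff i := by
    intro p i j
    rw [hC', coeff_C_mul, coeff_C_mul]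
  have hw' : ∀ {p q : (Zq k)[X][X]}, p = 2 ^ n * q → ∀ α w B, WeightLE α w B p →
      WeightLE α w B q := by
    intro p q hpq α w B hp i j hij
    refine hp i j ?_
    rw [hpq, hmul]
    exact mul_ne_zero (by simp) hij
  refine ⟨v₃, F₃, ?_, ?_, fun α w B hw hB => ⟨hw' hv₃ _ _ _ (hweight α w B hw hB).1,
    hw' hF₃ _ _ _ (hweight α w B hw hB).2⟩⟩
  · rw [hv₃, hF₃, hC', CurveData.nabla_C_mul] at heq
    apply mul_left_cancel₀ hCi
    rw [mul_add, ← mul_assoc _ (E.H ^ M), mul_comm _ (E.H ^ M), mul_assoc, ← heq, ← hC']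
    ring
  · rw [degree_lt_iff_coeff_zero] at hFd ⊢
    intro j hj
    have h4 := hFd j hj
    rw [hF₃, hC', coeff_C_mul] at h4
    exact (mul_eq_zero.1 h4).resolve_left (by simp)

end Family
end DeformedCurve
end

/-! ### Bounded polynomials and formal sums in dagger algebras. -/

noncomputable section

namespace DeformedCurve

open Polynomial

section OrdAll

variable {k : Type*} [Field k] [CharP k 2]

theorem OrdGE.neg {t : ℝ} {x : Qq k} (hx : OrdGE t x) : OrdGE t (-x) := by
  obtain ⟨z, rfl⟩ := hx
  exact ⟨-z, by rw [map_neg, mul_neg]⟩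

theorem OrdGE.two_zpow (n : ℤ) : OrdGE (n : ℝ) ((2 : Qq k) ^ n) := by
  simpa using OrdGE.of_zpow (k := k) (t := (n : ℝ)) le_rfl 1

theorem ordGE_natCast_iff {n : ℕ} {x : Qq k} :
    OrdGE (n : ℝ) x ↔ ∃ z : Zq k, x = algebraMap (Zq k) (Qq k) (2 ^ n * z) := by
  have : ⌈((n : ℕ) : ℝ)⌉ = (n : ℤ) := Int.ceil_natCast n
  simp only [OrdGE, this, map_mul, map_pow, map_two_Qq, zpow_natCast]

/-- A bound `d` on the degree of a polynomial, and `t` on the order of its coefficients. -/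
structure PolyBound {τ : Type*} (d : ℕ) (t : ℝ) (p : MvPolynomial τ (Qq k)) : Prop where
  degree_le : ∀ m, p.coeff m ≠ 0 → m.degree ≤ d
  ord : ∀ m, OrdGE t (p.coeff m)

namespace PolyBound

variable {τ : Type*} {d e : ℕ} {s t : ℝ} {p q : MvPolynomial τ (Qq k)}

theorem mono (hp : PolyBound d t p) (hd : d ≤ e) (ht : s ≤ t) : PolyBound e s p :=
  ⟨fun m hm => (hp.1 m hm).trans hd, fun m => (hp.2 m).mono ht⟩

theorem zero (d : ℕ) (t : ℝ) : PolyBound d t (0 : MvPolynomial τ (Qq k)) :=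
  ⟨fun m hm => by simp at hm, fun m => by simpa using OrdGE.zero t⟩

theorem add (hp : PolyBound d t p) (hq : PolyBound d t q) : PolyBound d t (p + q) := by
  refine ⟨fun m hm => ?_, fun m => by rw [MvPolynomial.coeff_add]; exact (hp.2 m).add (hq.2 m)⟩
  by_cases h : p.coeff m = 0
  · refine hq.1 m fun h' => hm ?_
    rw [MvPolynomial.coeff_add, h, h', add_zero]
  · exact hp.1 m h

theorem neg (hp : PolyBound d t p) : PolyBound d t (-p) := by
  refine ⟨fun m hm => hp.1 m ?_, fun m => by rw [MvPolynomial.coeff_neg]; exact (hp.2 m).neg⟩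
  rwa [MvPolynomial.coeff_neg, neg_ne_zero] at hm

theorem sub (hp : PolyBound d t p) (hq : PolyBound d t q) : PolyBound d t (p - q) := by
  rw [sub_eq_add_neg]; exact hp.add hq.neg

theorem sum {ι : Type*} (S : Finset ι) (p : ι → MvPolynomial τ (Qq k))
    (h : ∀ i ∈ S, PolyBound d t (p i)) : PolyBound d t (∑ i ∈ S, p i) := by
  classical
  induction S using Finset.induction_on with
  | empty => simpa using zero d t
  | insert a S ha ih =>
    rw [Finset.sum_insert ha]
    exact (h a (Finset.mem_insert_self a S)).add
      (ih fun i hi => h i (Finset.mem_insert_of_mem hi))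

theorem mul (hp : PolyBound d s p) (hq : PolyBound e t q) : PolyBound (d + e) (s + t) (p * q) := by
  classical
  refine ⟨fun m hm => ?_, fun m => ?_⟩
  · rw [MvPolynomial.coeff_mul] at hm
    obtain ⟨⟨a, b⟩, hab, h⟩ := Finset.exists_ne_zero_of_sum_ne_zero hm
    rw [Finset.HasAntidiagonal.mem_antidiagonal] at hab
    rw [← hab, map_add]
    exact add_le_add (hp.1 a (left_ne_zero_of_mul h)) (hq.1 b (right_ne_zero_of_mul h))
  · rw [MvPolynomial.coeff_mul]
    exact OrdGE.sum _ _ fun i _ => (hp.2 _).mul (hq.2 _)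

theorem C {a : Qq k} (ha : OrdGE t a) : PolyBound 0 t (MvPolynomial.C a : MvPolynomial τ (Qq k)) := by
  classical
  refine ⟨fun m hm => ?_, fun m => ?_⟩
  · rw [MvPolynomial.coeff_C] at hm
    split_ifs at hm with h
    · simp [← h]
    · exact absurd rfl hm
  · rw [MvPolynomial.coeff_C]
    split_ifs
    · exact ha
    · exact OrdGE.zero _

theorem one : PolyBound 0 0 (1 : MvPolynomial τ (Qq k)) := by
  simpa using C (τ := τ) (OrdGE.integral (k := k) 1)

theorem X (i : τ) : PolyBound 1 0 (MvPolynomial.X i : MvPolynomial τ (Qq k)) := by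
  classical
  refine ⟨fun m hm => ?_, fun m => ?_⟩
  · rw [MvPolynomial.coeff_X] at hm
    split_ifs at hm with h
    · simp [← h]
    · exact absurd rfl hm
  · rw [MvPolynomial.coeff_X]
    split_ifs
    · simpa using OrdGE.integral (k := k) 1
    · exact OrdGE.zero _

theorem pow (hp : PolyBound d 0 p) (n : ℕ) : PolyBound (n * d) 0 (p ^ n) := by
  induction n with
  | zero => simpa using one
  | succ n ih =>
    rw [pow_succ]
    exact (ih.mul hp).mono (by ring_nf; rfl) (by simp)

theorem natCast_mul (hp : PolyBound d t p) (n : ℕ) :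
    PolyBound d t ((n : MvPolynomial τ (Qq k)) * p) := by
  have h := (C (τ := τ) (OrdGE.integral (k := k) (n : Zq k))).mul hp
  simpa using h

theorem C_mul (hp : PolyBound d t p) {a : Qq k} (ha : OrdGE s a) :
    PolyBound d (s + t) (MvPolynomial.C a * p) := by
  simpa using (C (τ := τ) ha).mul hp

theorem rename {υ : Type*} (f : τ → υ) (hf : Function.Injective f) (hp : PolyBound d t p) :
    PolyBound d t (MvPolynomial.rename f p) := by
  refine ⟨fun m hm => ?_, fun m => ?_⟩
  · obtain ⟨u, rfl, hu⟩ := MvPolynomial.coeff_rename_ne_zero f p m hm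
    rw [Finsupp.degree_mapDomain]
    exact hp.1 u hu
  · by_cases hm : (MvPolynomial.rename f p).coeff m = 0
    · rw [hm]; exact OrdGE.zero _
    · obtain ⟨u, rfl, hu⟩ := MvPolynomial.coeff_rename_ne_zero f p m hm
      rw [MvPolynomial.coeff_rename_mapDomain f hf]
      exact hp.2 u

end PolyBound

end OrdAll

section PolyMap

variable {k : Type*} [Field k] [CharP k 2] {τ : Type*}

/-- The value of a polynomial in `ℤ_q[Γ]` at a variable. -/
def polyMap₁ (γ : τ) : (Zq k)[X] →+* MvPolynomial τ (Qq k) :=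
  eval₂RingHom (MvPolynomial.C.comp (algebraMap (Zq k) (Qq k))) (MvPolynomial.X γ)

/-- The value of a polynomial in `ℤ_q[Γ][X]` at two variables. -/
def polyMap (γ x : τ) : (Zq k)[X][X] →+* MvPolynomial τ (Qq k) :=
  eval₂RingHom (polyMap₁ γ) (MvPolynomial.X x)

theorem polyMap_C (γ x : τ) (p : (Zq k)[X]) : polyMap γ x (C p) = polyMap₁ (k := k) γ p := by
  simp [polyMap]

theorem polyBound_polyMap₁ (γ : τ) (p : (Zq k)[X]) :
    PolyBound p.natDegree 0 (polyMap₁ γ p) := by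
  rw [polyMap₁, coe_eval₂RingHom, eval₂_eq_sum_range]
  refine PolyBound.sum _ _ fun i hi => ?_
  have h1 := (PolyBound.C (τ := τ) (OrdGE.integral (p.coeff i))).mul ((PolyBound.X γ).pow i)
  exact h1.mono (by have := Finset.mem_range.1 hi; omega) (by simp)

theorem polyBound_polyMap (γ x : τ) {p : (Zq k)[X][X]} {d : ℕ} {w : ℕ} (hw : 1 ≤ w)
    (hp : WeightLE 1 w d p) : PolyBound d 0 (polyMap γ x p) := by
  have h0 : ∀ j, p.coeff j ≠ 0 → (p.coeff j).natDegree + j ≤ d := by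
    intro j hj
    have h := hp (p.coeff j).natDegree j (by
      rw [coeff_natDegree]; exact leadingCoeff_ne_zero.2 hj)
    have h2 : j ≤ w * j := Nat.le_mul_of_pos_left j hw
    have h3 : (p.coeff j).natDegree + w * j ≤ d := by
      rw [Nat.cast_one, one_mul] at h
      exact_mod_cast h
    omega
  rw [polyMap, coe_eval₂RingHom, eval₂_eq_sum]
  refine PolyBound.sum _ _ fun j hj => ?_
  have h1 := (polyBound_polyMap₁ γ (p.coeff j)).mul ((PolyBound.X (k := k) x).pow j)
  exact h1.mono (by have := h0 j (mem_support_iff.1 hj); omega) (by simp)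

theorem exists_polyBound_polyMap (γ x : τ) (p : (Zq k)[X][X]) :
    ∃ d, PolyBound d 0 (polyMap γ x p) := by
  refine ⟨p.support.sup (fun j => (p.coeff j).natDegree + j), ?_⟩
  refine polyBound_polyMap γ x le_rfl fun i j hij => ?_
  have h1 := le_natDegree_of_ne_zero hij
  have hj : j ∈ p.support := mem_support_iff.2 fun h => hij (by rw [h, coeff_zero])
  have h2 := Finset.le_sup (f := fun j => (p.coeff j).natDegree + j) hj
  have h3 : i + j ≤ p.support.sup (fun j => (p.coeff j).natDegree + j) := by
    refine le_trans ?_ h2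
    omega
  rw [Nat.cast_one, one_mul, one_mul]
  exact_mod_cast h3

end PolyMap

section Dagger

variable {k : Type*} [Field k] [CharP k 2] [PerfectRing k 2] {τ υ : Type*}

namespace Dagger

/-- The coefficients of an overconvergent power series. -/
def coeff (m : τ →₀ ℕ) (P : Dagger k τ) : Qq k := MvPowerSeries.coeff m P.1

/-- The overconvergent power series defined by a polynomial. -/
def ofPoly : MvPolynomial τ (Qq k) →ₐ[Qq k] Dagger k τ := MvPolynomial.aeval Dagger.var

theorem ofPoly_X (i : τ) : ofPoly (k := k) (MvPolynomial.X i) = var i := MvPolynomial.aeval_X _ _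

theorem val_ofPoly (p : MvPolynomial τ (Qq k)) : (ofPoly p).1 = (p : MvPowerSeries τ (Qq k)) := by
  have h : (val k τ).comp ofPoly = MvPolynomial.coeToMvPowerSeries.algHom (Qq k) := by
    refine MvPolynomial.algHom_ext fun i => ?_
    rw [AlgHom.comp_apply, ofPoly_X, MvPolynomial.coeToMvPowerSeries.algHom_apply]
    rw [MvPolynomial.coe_X, MvPowerSeries.map_X]
    rfl
  have h1 := congrArg (fun ψ => ψ p) h
  simp only [MvPolynomial.coeToMvPowerSeries.algHom_apply] at h1
  rw [Algebra.algebraMap_self, MvPowerSeries.map_id] at h1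
  exact h1

theorem coeff_ofPoly (m : τ →₀ ℕ) (p : MvPolynomial τ (Qq k)) :
    coeff m (ofPoly p) = p.coeff m := by
  rw [coeff, val_ofPoly, MvPolynomial.coeff_coe]

theorem ofPoly_polyMap₁ (γ : τ) (p : (Zq k)[X]) :
    ofPoly (polyMap₁ γ p) = p.eval₂ (coeffMap k (Dagger k τ)) (var γ) := by
  have h : ((ofPoly (k := k) (τ := τ)) : _ →+* _).comp (polyMap₁ γ) =
      eval₂RingHom (coeffMap k (Dagger k τ)) (var γ) := by
    refine Polynomial.ringHom_ext' (RingHom.ext fun a => ?_) ?_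
    · simp [polyMap₁, coeffMap, ofPoly]
    · simp [polyMap₁, ofPoly_X]
  exact congrArg (fun ψ => ψ p) h

theorem ofPoly_polyMap (γ x : τ) (p : (Zq k)[X][X]) :
    ofPoly (polyMap γ x p) = evalXΓ (coeffMap k (Dagger k τ)) (var γ) (var x) p := by
  have h : ((ofPoly (k := k) (τ := τ)) : _ →+* _).comp (polyMap γ x) =
      eval₂RingHom (eval₂RingHom (coeffMap k (Dagger k τ)) (var γ)) (var x) := by
    refine Polynomial.ringHom_ext' (RingHom.ext fun a => ?_) ?_
    · simp [polyMap, ofPoly_polyMap₁]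
    · simp [polyMap, ofPoly_X]
  exact congrArg (fun ψ => ψ p) h

theorem ext_coeff {P Q : Dagger k τ}
    (h : ∀ m, coeff m P = coeff m Q) : P = Q :=
  Subtype.ext (MvPowerSeries.ext h)

theorem coeff_add (m : τ →₀ ℕ) (P Q : Dagger k τ) : coeff m (P + Q) =
    coeff m P + coeff m Q := map_add _ P.1 Q.1

theorem coeff_mul [DecidableEq τ] (m : τ →₀ ℕ) (P Q : Dagger k τ) :
    coeff m (P * Q) = ∑ x ∈ Finset.HasAntidiagonal.antidiagonal m,
      coeff x.1 P * coeff x.2 Q := MvPowerSeries.coeff_mul m P.1 Q.1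

theorem coeff_neg (m : τ →₀ ℕ) (P : Dagger k τ) : coeff m (-P) =
    -coeff m P := map_neg (MvPowerSeries.coeff m) P.1

theorem pderiv_ofPoly (i : τ) (p : MvPolynomial τ (Qq k)) :
    Dagger.pderiv i (ofPoly p) = ofPoly (MvPolynomial.pderiv i p) := by
  refine ext_coeff fun m => ?_
  rw [coeff_ofPoly, MvPolynomial.coeff_pderiv, ← coeff_ofPoly]
  exact MvPowerSeries.coeff_pderiv _ _

theorem rename_ofPoly (e : τ ↪ υ) (p : MvPolynomial τ (Qq k)) :
    Dagger.rename e (ofPoly p) = ofPoly (MvPolynomial.rename e p) := by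
  induction p using MvPolynomial.induction_on with
  | C a =>
    rw [MvPolynomial.rename_C]
    simp only [ofPoly, MvPolynomial.aeval_C]
    exact rename_algebraMap e a
  | add p q hp hq => rw [map_add, map_add, map_add, map_add, hp, hq]
  | mul_X p i hp => rw [map_mul, map_mul, map_mul, map_mul, hp, ofPoly_X, rename_var,
      MvPolynomial.rename_X, ofPoly_X]

/-! ### Sums of polynomials -/

/-- `P = ∑ cₙ`, where `cₙ` has order at least `n` as a power series. -/
def HasSum (c : ℕ → MvPolynomial τ (Qq k)) (P : Dagger k τ) : Prop :=
  ∀ (m : τ →₀ ℕ) (N : ℕ), m.degree < N →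
    coeff m P = ∑ n ∈ Finset.range N, (c n).coeff m

/-- `cₙ` has order at least `n` as a power series. -/
def Tagged (c : ℕ → MvPolynomial τ (Qq k)) : Prop :=
  ∀ (n : ℕ) (m : τ →₀ ℕ), m.degree < n → (c n).coeff m = 0

/-- Bounds on the growth of a sequence of polynomials. -/
def Growth (ρ : ℝ) (c : ℕ → MvPolynomial τ (Qq k)) : Prop :=
  ∃ (a : ℕ) (C : ℝ), ∀ n : ℕ, PolyBound (a * (n + 1)) (ρ * n - C) (c n)

omit [PerfectRing k 2] in
theorem Tagged.sum_range {c : ℕ → MvPolynomial τ (Qq k)} (hc : Tagged c) {m : τ →₀ ℕ} {M N : ℕ}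
    (hM : m.degree < M) (hMN : M ≤ N) : ∑ n ∈ Finset.range N, (c n).coeff m =
      ∑ n ∈ Finset.range M, (c n).coeff m := by
  symm
  refine Finset.sum_subset (Finset.range_mono hMN) fun n _ hn => hc n m ?_
  rw [Finset.mem_range] at hn
  omega

theorem hasSum_of_succ {c : ℕ → MvPolynomial τ (Qq k)} (hc : Tagged c) {P : Dagger k τ}
    (f : (τ →₀ ℕ) → ℕ) (hf : ∀ m, m.degree < f m)
    (h : ∀ m, coeff m P = ∑ n ∈ Finset.range (f m), (c n).coeff m) :
    HasSum c P := by
  intro m N hmN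
  rw [h m]
  rcases le_total N (f m) with h1 | h1
  · exact hc.sum_range hmN h1
  · exact (hc.sum_range (hf m) h1).symm

theorem HasSum.tagged {c : ℕ → MvPolynomial τ (Qq k)} {P : Dagger k τ} (h : HasSum c P) :
    Tagged c := by
  intro n m hm
  have h1 := h m (n + 1) (by omega)
  rw [h m n hm, Finset.sum_range_succ, left_eq_add] at h1
  exact h1

theorem HasSum.unique {c : ℕ → MvPolynomial τ (Qq k)} {P Q : Dagger k τ} (hP : HasSum c P)
    (hQ : HasSum c Q) : P = Q :=
  ext_coeff fun m => by rw [hP m _ (Nat.lt_succ_self _), hQ m _ (Nat.lt_succ_self _)]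

/-- A monomial of degree `e` occurs in `c n` only if `e ≤ a (n + 1)`, and then its coefficient has
order at least `ρ n - C`. So the orders grow linearly in the degree, with slope `ρ / (a + 1)`. -/
theorem exists_hasSum {c : ℕ → MvPolynomial τ (Qq k)} (hc : Tagged c) {ρ : ℝ} (hρ : 0 < ρ)
    (hg : Growth ρ c) : ∃ P, HasSum c P := by
  obtain ⟨a, C, ha⟩ := hg
  let P : MvPowerSeries τ (Qq k) := fun m => ∑ n ∈ Finset.range (m.degree + 1), (c n).coeff m
  have hP : ∀ m, MvPowerSeries.coeff m P = ∑ n ∈ Finset.range (m.degree + 1), (c n).coeff m :=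
    fun m => rfl
  refine ⟨⟨P, ρ / (a + 1), by positivity, -ρ - C, fun m => ?_⟩,
    hasSum_of_succ hc (fun m => m.degree + 1) (fun m => Nat.lt_succ_self _) hP⟩
  rw [hP]
  refine OrdGE.sum _ _ fun n _ => ?_
  by_cases hn : (c n).coeff m = 0
  · rw [hn]; exact OrdGE.zero _
  · refine ((ha n).2 m).mono ?_
    have h1 : (m.degree : ℝ) ≤ a * (n + 1) := by exact_mod_cast (ha n).1 m hn
    have h2 : ρ / (a + 1) * m.degree ≤ ρ * (n + 1) := by
      rw [div_mul_eq_mul_div, div_le_iff₀ (by positivity), mul_assoc]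
      refine mul_le_mul_of_nonneg_left ?_ hρ.le
      nlinarith
    linarith

theorem hasSum_zero : HasSum (fun _ => 0) (0 : Dagger k τ) := fun m N _ => by
  simp only [MvPolynomial.coeff_zero, Finset.sum_const_zero]
  exact map_zero (MvPowerSeries.coeff m)

theorem HasSum.add {c d : ℕ → MvPolynomial τ (Qq k)} {P Q : Dagger k τ} (hP : HasSum c P)
    (hQ : HasSum d Q) : HasSum (fun n => c n + d n) (P + Q) := fun m N h => by
  simp only [coeff_add, hP m N h, hQ m N h, MvPolynomial.coeff_add, Finset.sum_add_distrib]

theorem HasSum.neg {c : ℕ → MvPolynomial τ (Qq k)} {P : Dagger k τ} (hP : HasSum c P) :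
    HasSum (fun n => -c n) (-P) := fun m N h => by
  simp only [coeff_neg, hP m N h, MvPolynomial.coeff_neg, Finset.sum_neg_distrib]

theorem HasSum.sub {c d : ℕ → MvPolynomial τ (Qq k)} {P Q : Dagger k τ} (hP : HasSum c P)
    (hQ : HasSum d Q) : HasSum (fun n => c n - d n) (P - Q) := by
  simp only [sub_eq_add_neg]
  exact hP.add hQ.neg

theorem HasSum.sum {ι : Type*} (S : Finset ι) {c : ι → ℕ → MvPolynomial τ (Qq k)}
    {P : ι → Dagger k τ} (h : ∀ i ∈ S, HasSum (c i) (P i)) :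
    HasSum (fun n => ∑ i ∈ S, c i n) (∑ i ∈ S, P i) := by
  classical
  induction S using Finset.induction_on with
  | empty => simpa using hasSum_zero
  | insert a S ha ih =>
    simp only [Finset.sum_insert ha]
    exact (h a (Finset.mem_insert_self a S)).add
      (ih fun i hi => h i (Finset.mem_insert_of_mem hi))

/-- Products `c i * d j` have order at least `i + j` as power series, so in a fixed degree summation
over a square agrees with summation along antidiagonals. -/
theorem HasSum.mul {c d : ℕ → MvPolynomial τ (Qq k)} {P Q : Dagger k τ} (hP : HasSum c P)
    (hQ : HasSum d Q) :
    HasSum (fun n => ∑ x ∈ Finset.HasAntidiagonal.antidiagonal n, c x.1 * d x.2) (P * Q) := by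
  classical
  intro m N hm
  have hle : ∀ x ∈ Finset.HasAntidiagonal.antidiagonal m, x.1.degree < N ∧ x.2.degree < N := by
    intro x hx
    rw [Finset.HasAntidiagonal.mem_antidiagonal] at hx
    have h1 : m.degree = x.1.degree + x.2.degree := by rw [← hx, map_add]
    omega
  have hvan : ∀ i j, m.degree < i + j → (c i * d j).coeff m = 0 := by
    intro i j hij
    rw [MvPolynomial.coeff_mul]
    refine Finset.sum_eq_zero fun x hx => ?_
    rw [Finset.HasAntidiagonal.mem_antidiagonal] at hx
    have h1 : m.degree = x.1.degree + x.2.degree := by rw [← hx, map_add]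
    rcases lt_or_ge x.1.degree i with h2 | h2
    · rw [hP.tagged i x.1 h2, zero_mul]
    · rw [hQ.tagged j x.2 (by omega), mul_zero]
  have h1 : coeff m (P * Q) =
      ∑ i ∈ Finset.range N, ∑ j ∈ Finset.range N, (c i * d j).coeff m := by
    rw [coeff_mul]
    simp only [MvPolynomial.coeff_mul]
    rw [Finset.sum_congr rfl fun x hx => by
      rw [hP x.1 N (hle x hx).1, hQ x.2 N (hle x hx).2, Finset.sum_mul_sum]]
    rw [Finset.sum_comm]
    refine Finset.sum_congr rfl fun i _ => ?_
    rw [Finset.sum_comm]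
  have h2 : ∀ n ∈ Finset.range N, (∑ x ∈ Finset.HasAntidiagonal.antidiagonal n, c x.1 * d x.2).coeff m =
      ∑ x ∈ (Finset.range N ×ˢ Finset.range N).filter (fun x => x.1 + x.2 = n),
        (c x.1 * d x.2).coeff m := by
    intro n hn
    rw [MvPolynomial.coeff_sum]
    refine Finset.sum_congr ?_ fun _ _ => rfl
    ext x
    rw [Finset.mem_range] at hn
    rw [Finset.HasAntidiagonal.mem_antidiagonal, Finset.mem_filter, Finset.mem_product,
      Finset.mem_range, Finset.mem_range]
    omega
  rw [h1, Finset.sum_congr rfl h2, ← Finset.sum_product']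
  have h3 := Finset.sum_fiberwise_of_maps_to (s := (Finset.range N ×ˢ Finset.range N))
    (t := Finset.range (N + N)) (g := fun x : ℕ × ℕ => x.1 + x.2) (by
      intro x hx
      rw [Finset.mem_product, Finset.mem_range, Finset.mem_range] at hx
      rw [Finset.mem_range]
      omega) (fun x => (c x.1 * d x.2).coeff m)
  rw [← h3]
  symm
  refine Finset.sum_subset (Finset.range_mono (by omega)) fun n _ hn => ?_
  refine Finset.sum_eq_zero fun x hx => hvan _ _ ?_
  rw [Finset.mem_filter] at hx
  rw [Finset.mem_range] at hn
  omega

theorem HasSum.ofPoly_mul {c : ℕ → MvPolynomial τ (Qq k)} {P : Dagger k τ} (hP : HasSum c P)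
    (p : MvPolynomial τ (Qq k)) : HasSum (fun n => p * c n) (ofPoly p * P) := by
  classical
  intro m N hm
  rw [coeff_mul]
  simp only [MvPolynomial.coeff_mul]
  rw [Finset.sum_comm]
  refine Finset.sum_congr rfl fun x hx => ?_
  rw [Finset.HasAntidiagonal.mem_antidiagonal] at hx
  have h1 : m.degree = x.1.degree + x.2.degree := by rw [← hx, map_add]
  rw [coeff_ofPoly, hP x.2 N (by omega), Finset.mul_sum]

theorem HasSum.cons {c : ℕ → MvPolynomial τ (Qq k)} {P : Dagger k τ} (hP : HasSum c P)
    (p : MvPolynomial τ (Qq k)) (hc : Tagged fun n => if n = 0 then p else c (n - 1)) :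
    HasSum (fun n => if n = 0 then p else c (n - 1)) (ofPoly p + P) := by
  refine hasSum_of_succ hc (fun m => m.degree + 1 + 1) (fun m => by omega) fun m => ?_
  rw [coeff_add, coeff_ofPoly, hP m _ (Nat.lt_succ_self _), Finset.sum_range_succ' _ (m.degree + 1),
    add_comm]
  simp only [Nat.add_sub_cancel, if_true, Nat.succ_ne_zero, if_false]

/-- Differentiation may lower the order of a term by one, so the order condition is asked again of
the derivatives. -/
theorem HasSum.pderiv {c : ℕ → MvPolynomial τ (Qq k)} {P : Dagger k τ} (hP : HasSum c P)
    (i : τ) (hc : Tagged fun n => MvPolynomial.pderiv i (c n)) :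
    HasSum (fun n => MvPolynomial.pderiv i (c n)) (Dagger.pderiv i P) := by
  refine hasSum_of_succ hc (fun m => m.degree + 1 + 1) (fun m => by omega) fun m => ?_
  have h1 : coeff m (Dagger.pderiv i P) =
      coeff (m + Finsupp.single i 1) P * ((m i : Qq k) + 1) := MvPowerSeries.coeff_pderiv P.1 m
  rw [h1, hP _ (m.degree + 1 + 1) (by rw [map_add, Finsupp.degree_single]; omega), Finset.sum_mul]
  exact Finset.sum_congr rfl fun n _ => (MvPolynomial.coeff_pderiv _ _).symm

theorem HasSum.rename (e : τ ↪ υ) {c : ℕ → MvPolynomial τ (Qq k)} {P : Dagger k τ}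
    (hP : HasSum c P) : HasSum (fun n => MvPolynomial.rename e (c n)) (Dagger.rename e P) := by
  intro m N hm
  have h0 : (Dagger.rename e P).1 = MvPowerSeries.rename e P.1 := rfl
  rw [coeff, h0]
  by_cases h : m ∈ Set.range (Finsupp.mapDomain e)
  · obtain ⟨n, rfl⟩ := h
    rw [Finsupp.degree_mapDomain] at hm
    rw [← Finsupp.embDomain_eq_mapDomain, MvPowerSeries.coeff_embDomain_rename]
    refine (hP n N hm).trans ?_
    refine Finset.sum_congr rfl fun i _ => ?_
    rw [Finsupp.embDomain_eq_mapDomain, MvPolynomial.coeff_rename_mapDomain e e.injective]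
  · rw [MvPowerSeries.coeff_rename_eq_zero _ _ h]
    symm
    refine Finset.sum_eq_zero fun i _ => MvPolynomial.coeff_rename_eq_zero _ _ _ fun u hu => ?_
    exact absurd ⟨u, hu⟩ h

-- The variable `X i` will stand for `1 / H` or `1 / r`. Its growing powers make the series formally
-- summable whatever the other factor is.
omit [PerfectRing k 2] in
theorem tagged_of_X_pow_mul {e : ℕ → ℕ} (he : ∀ n, n ≤ e n) (i : τ)
    (c : ℕ → MvPolynomial τ (Qq k)) : Tagged fun n => MvPolynomial.X i ^ e n * c n := by
  classical
  intro n m hm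
  beta_reduce
  rw [MvPolynomial.X_pow_eq_monomial, MvPolynomial.coeff_monomial_mul', if_neg]
  intro hle
  have h1 := Finsupp.degree_mono hle
  rw [Finsupp.degree_single] at h1
  have := he n
  omega

end Dagger
end Dagger
end DeformedCurve
end

/-! ### Integral elements, and the derivation of `T`. -/

noncomputable section

namespace DeformedCurve

open Polynomial

section Gauss

variable {k : Type*} [Field k] [CharP k 2] [PerfectRing k 2] {τ : Type*}

namespace Dagger

theorem gaussGE_iff {n : ℤ} {P : Dagger k τ} : GaussGE n P ↔ ∀ m, OrdGE (n : ℝ) (coeff m P) :=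
  Iff.rfl

theorem GaussGE.mono {m n : ℤ} (h : m ≤ n) {P : Dagger k τ} (hP : GaussGE n P) : GaussGE m P :=
  fun l => (hP l).mono (by exact_mod_cast h)

theorem GaussGE.zero (n : ℤ) : GaussGE n (0 : Dagger k τ) := fun m => by
  have : MvPowerSeries.coeff m (0 : Dagger k τ).1 = 0 := map_zero (MvPowerSeries.coeff m)
  rw [this]; exact OrdGE.zero _

theorem GaussGE.add {n : ℤ} {P Q : Dagger k τ} (hP : GaussGE n P) (hQ : GaussGE n Q) :
    GaussGE n (P + Q) := fun m => by
  change OrdGE _ (coeff m (P + Q))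
  rw [coeff_add]
  exact (hP m).add (hQ m)

theorem GaussGE.neg {n : ℤ} {P : Dagger k τ} (hP : GaussGE n P) : GaussGE n (-P) := fun m => by
  change OrdGE _ (coeff m (-P))
  rw [coeff_neg]
  exact (hP m).neg

theorem GaussGE.sub {n : ℤ} {P Q : Dagger k τ} (hP : GaussGE n P) (hQ : GaussGE n Q) :
    GaussGE n (P - Q) := by
  rw [sub_eq_add_neg]; exact hP.add hQ.neg

theorem GaussGE.mul {m n : ℤ} {P Q : Dagger k τ} (hP : GaussGE m P) (hQ : GaussGE n Q) :
    GaussGE (m + n) (P * Q) := fun l => by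
  classical
  change OrdGE _ (coeff l (P * Q))
  rw [coeff_mul]
  push_cast
  exact OrdGE.sum _ _ fun x _ => (hP x.1).mul (hQ x.2)

theorem gaussGE_ofPoly {n : ℤ} {p : MvPolynomial τ (Qq k)} :
    GaussGE n (ofPoly p) ↔ ∀ m, OrdGE (n : ℝ) (p.coeff m) := by
  simp only [gaussGE_iff, coeff_ofPoly]

theorem HasSum.gaussGE {c : ℕ → MvPolynomial τ (Qq k)} {P : Dagger k τ} (h : HasSum c P) {n : ℤ}
    (hc : ∀ i m, OrdGE (n : ℝ) ((c i).coeff m)) : GaussGE n P := fun m => by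
  change OrdGE _ (coeff m P)
  rw [h m _ (Nat.lt_succ_self _)]
  exact OrdGE.sum _ _ fun i _ => hc i m

theorem GaussGE.one : GaussGE 0 (1 : Dagger k τ) := by
  rw [← map_one ofPoly, gaussGE_ofPoly]
  simpa using PolyBound.one.2

/-- If `Q` is integral, then `1 + 2 Q` is invertible. -/
theorem exists_one_add_two_mul_mul_eq_one {Q : Dagger k τ} (hQ : GaussGE 0 Q) :
    ∃ R : Dagger k τ, (1 + 2 * Q) * R = 1 := by
  classical
  have hmax : ∀ {s t : ℝ} {x : Qq k}, OrdGE s x → OrdGE t x → OrdGE (max s t) x := by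
    intro s t x hs ht
    rcases le_total s t with h | h
    · rwa [max_eq_right h]
    · rwa [max_eq_left h]
  obtain ⟨δ, hδ, ε, hε⟩ := Q.2
  -- The slope is chosen so that `2 Q` satisfies a bound without additive constant. In degrees up to
  -- `2 (|ε| + 1) / δ` the factor `2` provides it, and beyond that `δ |m| + ε ≥ (δ / 2) |m|`.
  obtain ⟨δ', hδ', h1, h2⟩ : ∃ δ' > (0 : ℝ), δ' ≤ δ / 2 ∧ δ' * (2 * (|ε| + 1) / δ) ≤ 1 := by
    have h0 : (0 : ℝ) < |ε| + 1 := by positivity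
    refine ⟨min (δ / 2) (δ / (2 * (|ε| + 1))), by positivity, min_le_left _ _, ?_⟩
    calc _ ≤ δ / (2 * (|ε| + 1)) * (2 * (|ε| + 1) / δ) :=
          mul_le_mul_of_nonneg_right (min_le_right _ _) (by positivity)
      _ = 1 := by field_simp
  have hkey : ∀ m : τ →₀ ℕ, OrdGE (δ' * m.degree) (2 * coeff m Q) := by
    intro m
    have h3 := (OrdGE.two_zpow (k := k) 1).mul (hmax (hQ m) (hε m))
    rw [zpow_one] at h3
    refine h3.mono ?_
    have hm : (0 : ℝ) ≤ m.degree := Nat.cast_nonneg _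
    push_cast
    rcases le_total (m.degree : ℝ) (2 * (|ε| + 1) / δ) with h4 | h4
    · have := mul_le_mul_of_nonneg_left h4 hδ'.le
      have := le_max_left (0 : ℝ) (δ * m.degree + ε)
      linarith
    · rw [div_le_iff₀ hδ] at h4
      have h5 := mul_le_mul_of_nonneg_right h1 hm
      have h6 := le_max_right (0 : ℝ) (δ * m.degree + ε)
      have h7 := neg_abs_le ε
      nlinarith
  obtain ⟨z, hz⟩ : ∃ z : Zq k, coeff 0 Q = algebraMap (Zq k) (Qq k) z := by
    obtain ⟨z, hz⟩ := hQ 0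
    rw [Int.cast_zero, Int.ceil_zero, zpow_zero, one_mul] at hz
    exact ⟨z, hz⟩
  have hunit : IsUnit (1 + 2 * z) := by
    refine isUnit_Zq ?_
    rw [map_add, map_mul, map_one, map_ofNat,
      show (2 : k) = 0 by exact_mod_cast CharP.cast_eq_zero k 2, zero_mul, add_zero]
    exact one_ne_zero
  obtain ⟨u, hu⟩ := hunit
  set φ : MvPowerSeries τ (Qq k) := (1 + 2 * Q : Dagger k τ).1 with hφ
  have hφm : ∀ m, MvPowerSeries.coeff m φ =
      (if m = 0 then 1 else 0) + 2 * coeff m Q := by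
    intro m
    have h3 : φ = 1 + MvPowerSeries.C 2 * Q.1 := by
      rw [map_ofNat]; rfl
    rw [h3, map_add, MvPowerSeries.coeff_one, MvPowerSeries.coeff_C_mul]
    rfl
  have hφ0 : MvPowerSeries.coeff 0 φ = algebraMap (Zq k) (Qq k) u := by
    rw [hφm, hz, hu, if_pos rfl, map_add, map_mul, map_one, map_two_Qq]
  have hu' : algebraMap (Zq k) (Qq k) ((u⁻¹ : (Zq k)ˣ) : Zq k) * algebraMap (Zq k) (Qq k) u = 1 := by
    rw [← map_mul]; simp
  have hc0 : MvPowerSeries.constantCoeff φ ≠ 0 := by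
    rw [← MvPowerSeries.coeff_zero_eq_constantCoeff_apply, hφ0]
    exact right_ne_zero_of_mul_eq_one hu'
  have hmul := MvPowerSeries.mul_inv_cancel φ hc0
  -- A bound `δ' |m|` without constant is stable under products, and the constant coefficient of `1
  -- + 2 Q` is a unit of `ℤ_q`, so the recursion for the inverse series preserves the bound.
  have hR : ∀ n, ∀ m : τ →₀ ℕ, m.degree = n →
      OrdGE (δ' * n) (MvPowerSeries.coeff m φ⁻¹) := by
    intro n
    induction n using Nat.strong_induction_on with
    | _ n ih =>
      intro m hm
      have h3 := congrArg (MvPowerSeries.coeff m) hmul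
      rw [MvPowerSeries.coeff_mul, MvPowerSeries.coeff_one] at h3
      have hmem : ((0 : τ →₀ ℕ), m) ∈ Finset.HasAntidiagonal.antidiagonal m := by
        rw [Finset.HasAntidiagonal.mem_antidiagonal, zero_add]
      rw [← Finset.add_sum_erase _ _ hmem, hφ0] at h3
      have h4 : OrdGE (δ' * n) (if m = 0 then (1 : Qq k) else 0) := by
        split_ifs with h
        · have : n = 0 := by rw [← hm, h, map_zero]
          rw [this, Nat.cast_zero, mul_zero]
          simpa using OrdGE.integral (k := k) 1
        · exact OrdGE.zero _
      have h5 : OrdGE (δ' * n) (∑ x ∈ (Finset.HasAntidiagonal.antidiagonal m).erase (0, m),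
          MvPowerSeries.coeff x.1 φ * MvPowerSeries.coeff x.2 φ⁻¹) := by
        refine OrdGE.sum _ _ fun x hx => ?_
        rw [Finset.mem_erase, Finset.HasAntidiagonal.mem_antidiagonal] at hx
        obtain ⟨hne, hx⟩ := hx
        have hd : x.1.degree + x.2.degree = n := by rw [← hm, ← hx, map_add]
        have hx1 : x.1 ≠ 0 := by
          intro h0
          refine hne (Prod.ext h0 ?_)
          rw [h0, zero_add] at hx
          exact hx
        have hx1d : x.1.degree ≠ 0 := fun h0 => hx1 ((Finsupp.degree_eq_zero_iff _).1 h0)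
        have h6 := hkey x.1
        have h7 := ih x.2.degree (by omega) x.2 rfl
        rw [hφm, if_neg hx1, zero_add]
        have h8 := h6.mul h7
        rw [← mul_add, ← Nat.cast_add, hd] at h8
        exact h8
      have h9 := (OrdGE.integral (k := k) ((u⁻¹ : (Zq k)ˣ) : Zq k)).mul (h4.add h5.neg)
      rw [zero_add] at h9
      convert h9 using 1
      rw [← h3]
      linear_combination (-MvPowerSeries.coeff m φ⁻¹) * hu'
  refine ⟨⟨φ⁻¹, δ', hδ', 0, fun m => ?_⟩, Subtype.ext hmul⟩
  rw [add_zero]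
  exact hR _ m rfl

end Dagger
end Gauss

namespace Family

variable {k : Type*} [Field k] [CharP k 2] [PerfectRing k 2] {g : ℕ} (E : Family k g)

/-- The value in the polynomial ring in `Γ, z, X, Y, w` of a polynomial in `ℤ_q[Γ][X]`. -/
def polyW (k : Type*) [Field k] [CharP k 2] :
    (Zq k)[X][X] →+* MvPolynomial (Fin 2 ⊕ Fin 3) (Qq k) := polyMap (.inl 0) (.inr 0)

/-- The value in `T` of a polynomial in `Γ, z, X, Y, w`. -/
def toT : MvPolynomial (Fin 2 ⊕ Fin 3) (Qq k) →+* E.T :=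
  E.mkT.comp (Dagger.ofPoly : MvPolynomial (Fin 2 ⊕ Fin 3) (Qq k) →ₐ[Qq k] W k)

/-- `1 / r` in `T`. -/
def zT : E.T := E.mkT (Dagger.var (.inl 1))

theorem mkT_surjective : Function.Surjective E.mkT := Ideal.Quotient.mk_surjective

/-- The evaluation in `T`, as a ring homomorphism. -/
def evHom : (Zq k)[X][X] →+* E.T := eval₂RingHom (eval₂RingHom (coeffMap k E.T) E.ΓT) E.x

theorem mkT_comp_coeffMap : E.mkT.comp (coeffMap k (W k)) = coeffMap k E.T := rfl

theorem mkT_evalXΓ (p : (Zq k)[X][X]) :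
    E.mkT (evalXΓ (coeffMap k (W k)) (Dagger.var (.inl 0)) (Dagger.var (.inr 0)) p) =
      E.evHom p := by
  have h : E.mkT.comp (eval₂RingHom (eval₂RingHom (coeffMap k (W k)) (Dagger.var (.inl 0)))
      (Dagger.var (.inr 0))) = E.evHom := by
    refine Polynomial.ringHom_ext' (Polynomial.ringHom_ext' (RingHom.ext fun a => ?_) ?_) ?_
    · simp [evHom, ← mkT_comp_coeffMap]
    · simp [evHom, ΓT]
    · simp [evHom, x]
  exact congrArg (fun ψ => ψ p) h

theorem toT_polyW (p : (Zq k)[X][X]) : E.toT (polyW k p) = E.evHom p := by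
  rw [← mkT_evalXΓ, ← Dagger.ofPoly_polyMap]; rfl

theorem toT_C (a : Qq k) : E.toT (MvPolynomial.C a) = algebraMap (Qq k) E.T a := by
  change E.mkT (Dagger.ofPoly (MvPolynomial.C a)) = _
  rw [Dagger.ofPoly, MvPolynomial.aeval_C]
  rfl

theorem toT_X (i : Fin 2 ⊕ Fin 3) : E.toT (MvPolynomial.X i) = E.mkT (Dagger.var i) := by
  change E.mkT (Dagger.ofPoly (MvPolynomial.X i)) = _
  rw [Dagger.ofPoly_X]

theorem mkT_eq_zero {P : W k} (h : P ∈ E.idealT) : E.mkT P = 0 := Ideal.Quotient.eq_zero_iff_mem.2 h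

theorem mkT_incl_eval₂ (p : (Zq k)[X]) :
    E.mkT (p.eval₂ (coeffMap k (W k)) (Dagger.var (.inl 0))) = E.evHom (C p) := by
  rw [← mkT_evalXΓ, evalXΓ, eval₂_C]
  rfl

theorem zT_mul_r : E.zT * E.evHom (C E.r) = 1 := by
  have h := E.mkT_eq_zero (Ideal.subset_span (Set.mem_insert _ _))
  rw [map_sub, map_mul, map_one, sub_eq_zero, mkT_incl_eval₂] at h
  exact h

theorem invH_mul_H : E.invH * E.evHom E.H = 1 := by
  have h := E.mkT_eq_zero (Ideal.subset_span (Set.mem_insert_of_mem _ (Set.mem_insert _ _)))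
  rw [map_sub, map_mul, map_one, sub_eq_zero, mkT_evalXΓ] at h
  exact h

theorem y_sq : E.y ^ 2 = E.evHom E.f - E.evHom E.h * E.y := by
  have h := E.mkT_eq_zero (Ideal.subset_span (Set.mem_insert_of_mem _
    (Set.mem_insert_of_mem _ (Set.mem_singleton _))))
  rw [map_sub, map_add, map_pow, map_mul, mkT_evalXΓ, mkT_evalXΓ, sub_eq_zero] at h
  rw [← h]
  change E.y ^ 2 = E.y ^ 2 + E.evHom E.h * E.y - E.evHom E.h * E.y
  ring

/-- `2 Y + h ∈ T` -/
def Z : E.T := 2 * E.y + E.evHom E.h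

theorem Z_sq : E.Z ^ 2 = E.evHom E.data.Δ := by
  rw [CurveData.Δ, data_h, data_f, map_add, map_mul, map_pow, map_ofNat, Z]
  linear_combination 4 * E.y_sq

/-! ### Integral elements of `T` -/

theorem TOrdGE.add {n : ℤ} {s t : E.T} (hs : E.TOrdGE n s) (ht : E.TOrdGE n t) :
    E.TOrdGE n (s + t) := by
  obtain ⟨P, hP, rfl⟩ := hs
  obtain ⟨Q, hQ, rfl⟩ := ht
  exact ⟨P + Q, hP.add hQ, map_add _ _ _⟩

theorem TOrdGE.neg {n : ℤ} {s : E.T} (hs : E.TOrdGE n s) : E.TOrdGE n (-s) := by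
  obtain ⟨P, hP, rfl⟩ := hs
  exact ⟨-P, hP.neg, map_neg _ _⟩

theorem TOrdGE.mul {m n : ℤ} {s t : E.T} (hs : E.TOrdGE m s) (ht : E.TOrdGE n t) :
    E.TOrdGE (m + n) (s * t) := by
  obtain ⟨P, hP, rfl⟩ := hs
  obtain ⟨Q, hQ, rfl⟩ := ht
  exact ⟨P * Q, hP.mul hQ, map_mul _ _ _⟩

theorem TOrdGE_zero (n : ℤ) : E.TOrdGE n 0 := ⟨0, Dagger.GaussGE.zero n, map_zero E.mkT⟩

theorem TOrdGE_one : E.TOrdGE 0 1 := ⟨1, Dagger.GaussGE.one, map_one E.mkT⟩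

/-- The subring of integral elements of `T`. -/
def integralT : Subring E.T where
  carrier := {t | E.TOrdGE 0 t}
  mul_mem' := by
    intro s t hs ht
    have := TOrdGE.mul E hs ht
    rwa [add_zero] at this
  add_mem' := by
    intro s t hs ht
    exact TOrdGE.add E hs ht
  neg_mem' := by
    intro s hs
    exact TOrdGE.neg E hs
  zero_mem' := E.TOrdGE_zero 0
  one_mem' := E.TOrdGE_one

theorem toT_mem_integralT {d : ℕ} {p : MvPolynomial (Fin 2 ⊕ Fin 3) (Qq k)} (hp : PolyBound d 0 p) :
    E.toT p ∈ E.integralT :=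
  ⟨Dagger.ofPoly p, Dagger.gaussGE_ofPoly.2 (by simpa using hp.2), rfl⟩

theorem evHom_mem_integralT (p : (Zq k)[X][X]) : E.evHom p ∈ E.integralT := by
  obtain ⟨d, hd⟩ := exists_polyBound_polyMap (τ := Fin 2 ⊕ Fin 3) (.inl 0) (.inr 0) p
  rw [← toT_polyW]
  exact E.toT_mem_integralT hd

theorem invH_mem_integralT : E.invH ∈ E.integralT := by
  have := E.toT_mem_integralT (PolyBound.X (.inr 2))
  rwa [toT_X] at this

theorem y_mem_integralT : E.y ∈ E.integralT := by
  have := E.toT_mem_integralT (PolyBound.X (.inr 1))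
  rwa [toT_X] at this

theorem isUnit_one_add_two_mul {u : E.T} (hu : u ∈ E.integralT) : IsUnit (1 + 2 * u) := by
  obtain ⟨Q, hQ, rfl⟩ := hu
  obtain ⟨R, hR⟩ := Dagger.exists_one_add_two_mul_mul_eq_one hQ
  refine IsUnit.of_mul_eq_one (E.mkT R) ?_
  have := congrArg E.mkT hR
  rwa [map_mul, map_add, map_mul, map_one, map_ofNat] at this

theorem gaussGE_ofPoly_C {n : ℤ} {a : Qq k} (h : OrdGE (n : ℝ) a) :
    Dagger.GaussGE n (Dagger.ofPoly (MvPolynomial.C a) : W k) :=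
  Dagger.gaussGE_ofPoly.2 (PolyBound.C h).2

theorem TOrdGE_algebraMap {n : ℤ} {a : Qq k} (h : OrdGE (n : ℝ) a) :
    E.TOrdGE n (algebraMap (Qq k) E.T a) :=
  ⟨Dagger.ofPoly (MvPolynomial.C a), gaussGE_ofPoly_C h, E.toT_C a⟩

theorem two_mul_of_TOrdGE {t : E.T} (ht : E.TOrdGE 1 t) : ∃ u ∈ E.integralT, t = 2 * u := by
  refine ⟨algebraMap (Qq k) E.T 2⁻¹ * t, ?_, ?_⟩
  · have h1 := OrdGE.two_zpow (k := k) (-1)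
    rw [zpow_neg_one] at h1
    have h2 := TOrdGE.mul E (E.TOrdGE_algebraMap h1) ht
    rwa [neg_add_cancel] at h2
  · have h2 : (2 : E.T) = algebraMap (Qq k) E.T 2 := (map_ofNat _ 2).symm
    rw [h2, ← mul_assoc, ← map_mul, mul_inv_cancel₀ two_ne_zero_Qq, map_one, one_mul]

theorem TOrdGE_two_mul {u : E.T} (hu : u ∈ E.integralT) : E.TOrdGE 1 (2 * u) := by
  have h1 := OrdGE.two_zpow (k := k) 1
  rw [zpow_one] at h1
  have h2 := TOrdGE.mul E (E.TOrdGE_algebraMap h1) hu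
  rwa [add_zero, map_ofNat] at h2

/-- `1 / h ∈ T` -/
def invh : E.T := E.evHom E.hc * E.invH ^ E.D

theorem invh_mul_h : E.invh * E.evHom E.h = 1 := by
  rw [invh, mul_right_comm, mul_comm (E.evHom E.hc), ← map_mul, h_mul_hc, map_pow, ← mul_pow,
    mul_comm, invH_mul_H, one_pow]

theorem invh_mem_integralT : E.invh ∈ E.integralT :=
  mul_mem (E.evHom_mem_integralT _) (pow_mem E.invH_mem_integralT _)

/-- Dividing by `h`, which is invertible because it divides a power of `H`, gives `Z² / h² = 1 + 4 f
/ h²`, of the form `1 + 2 u` with `u` integral. -/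
theorem isUnit_Z : IsUnit E.Z := by
  have h1 : IsUnit (E.Z ^ 2 * E.invh ^ 2) := by
    have h2 : E.Z ^ 2 * E.invh ^ 2 = 1 + 2 * (2 * E.evHom E.f * E.invh ^ 2) := by
      rw [Z_sq, CurveData.Δ, data_h, data_f, map_add, map_mul, map_pow, map_ofNat]
      linear_combination (E.invh * E.evHom E.h + 1) * E.invh_mul_h
    rw [h2]
    refine E.isUnit_one_add_two_mul (mul_mem (mul_mem ?_ (E.evHom_mem_integralT _))
      (pow_mem E.invh_mem_integralT _))
    exact ofNat_mem E.integralT 2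
  exact (isUnit_pow_iff two_ne_zero).1 (isUnit_of_mul_isUnit_left h1)

/-! ### The derivation of `T` -/

theorem scaledDeriv_add (P Q : W k) :
    E.scaledDeriv (P + Q) = E.scaledDeriv P + E.scaledDeriv Q := by
  simp only [scaledDeriv, Dagger.pderiv_add, map_add]
  ring

theorem scaledDeriv_mul (P Q : W k) :
    E.scaledDeriv (P * Q) = E.mkT P * E.scaledDeriv Q + E.mkT Q * E.scaledDeriv P := by
  simp only [scaledDeriv, Dagger.pderiv_mul, map_add, map_mul]
  ring

theorem scaledDeriv_ofPoly (p : MvPolynomial (Fin 2 ⊕ Fin 3) (Qq k)) :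
    E.scaledDeriv (Dagger.ofPoly p) = E.Z * (E.toT (MvPolynomial.pderiv (.inr 0) p)
        - E.evHom (derivative E.H) * E.invH ^ 2 * E.toT (MvPolynomial.pderiv (.inr 2) p))
      + (E.evHom (derivative E.f) - E.evHom (derivative E.h) * E.y) *
        E.toT (MvPolynomial.pderiv (.inr 1) p) := by
  rw [scaledDeriv, Dagger.pderiv_ofPoly, Dagger.pderiv_ofPoly, Dagger.pderiv_ofPoly]
  rfl

end Family

section PderivPolyMap

variable {k : Type*} [Field k] [CharP k 2] {τ : Type*}

theorem pderiv_polyMap₁ {γ i : τ} (h : γ ≠ i) (p : (Zq k)[X]) :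
    MvPolynomial.pderiv i (polyMap₁ γ p) = 0 := by
  induction p using Polynomial.induction_on' with
  | add p q hp hq => rw [map_add, map_add, hp, hq, add_zero]
  | monomial n a =>
    simp [polyMap₁, MvPolynomial.pderiv_X_of_ne h]

theorem pderiv_polyMap_of_ne {γ x i : τ} (h : γ ≠ i) (hx : x ≠ i) (p : (Zq k)[X][X]) :
    MvPolynomial.pderiv i (polyMap γ x p) = 0 := by
  induction p using Polynomial.induction_on' with
  | add p q hp hq => rw [map_add, map_add, hp, hq, add_zero]
  | monomial n a =>
    rw [polyMap, coe_eval₂RingHom, eval₂_monomial, MvPolynomial.pderiv_mul, pderiv_polyMap₁ h,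
      MvPolynomial.pderiv_pow, MvPolynomial.pderiv_X_of_ne hx]
    simp

theorem pderiv_polyMap {γ x : τ} (h : γ ≠ x) (p : (Zq k)[X][X]) :
    MvPolynomial.pderiv x (polyMap γ x p) = polyMap γ x (derivative p) := by
  induction p using Polynomial.induction_on' with
  | add p q hp hq => simp only [map_add, hp, hq]
  | monomial n a =>
    rw [derivative_monomial, polyMap, coe_eval₂RingHom, eval₂_monomial, eval₂_monomial,
      MvPolynomial.pderiv_mul, pderiv_polyMap₁ h, MvPolynomial.pderiv_pow,
      MvPolynomial.pderiv_X_self, map_mul, map_natCast]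
    ring

end PderivPolyMap

namespace Family

variable {k : Type*} [Field k] [CharP k 2] [PerfectRing k 2] {g : ℕ} (E : Family k g)

theorem toT_pderiv_polyW (p : (Zq k)[X][X]) :
    E.toT (MvPolynomial.pderiv (.inr 0) (polyW k p)) = E.evHom (derivative p) := by
  rw [polyW, pderiv_polyMap (by simp), ← toT_polyW]; rfl

theorem scaledDeriv_polyW (p : (Zq k)[X][X]) :
    E.scaledDeriv (Dagger.ofPoly (polyW k p)) = E.Z * E.evHom (derivative p) := by
  rw [scaledDeriv_ofPoly, toT_pderiv_polyW, polyW, pderiv_polyMap_of_ne (by simp) (by simp),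
    pderiv_polyMap_of_ne (by simp) (by simp)]
  simp

theorem scaledDeriv_const (a : Qq k) : E.scaledDeriv (Dagger.ofPoly (MvPolynomial.C a)) = 0 := by
  rw [scaledDeriv_ofPoly]
  simp

theorem scaledDeriv_neg (P : W k) : E.scaledDeriv (-P) = -E.scaledDeriv P := by
  have h := E.scaledDeriv_mul (Dagger.ofPoly (MvPolynomial.C (-1))) P
  rw [scaledDeriv_const, mul_zero, add_zero, map_neg, map_one, map_neg, map_one, map_neg,
    map_one, neg_one_mul, neg_one_mul] at h
  exact h

/-- By the Leibniz rule it suffices to check the three generators of the ideal; thus the derivation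
is well defined on `T`. -/
theorem scaledDeriv_eq_zero_of_mem {P : W k} (hP : P ∈ E.idealT) : E.scaledDeriv P = 0 := by
  refine Submodule.span_induction (p := fun P _ => E.scaledDeriv P = 0) ?_ ?_ ?_ ?_ hP
  · intro P hP'
    rcases hP' with rfl | rfl | rfl
    · rw [← Dagger.ofPoly_polyMap₁, ← Dagger.ofPoly_X, ← map_one (Dagger.ofPoly), ← map_mul,
        ← map_sub, scaledDeriv_ofPoly]
      simp [pderiv_polyMap₁]
    · rw [← Dagger.ofPoly_polyMap, ← Dagger.ofPoly_X, ← map_one (Dagger.ofPoly), ← map_mul,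
        ← map_sub, scaledDeriv_ofPoly]
      have h0 := E.toT_pderiv_polyW E.H
      have h1 := E.toT_polyW E.H
      rw [polyW] at h0 h1
      have h2 := E.invH_mul_H
      have hX : E.toT (MvPolynomial.X (.inr 2)) = E.invH := E.toT_X _
      simp only [MvPolynomial.pderiv_mul, map_sub, map_mul, map_add, MvPolynomial.pderiv_X_self,
        MvPolynomial.pderiv_X_of_ne (show (Sum.inr 2 : Fin 2 ⊕ Fin 3) ≠ .inr 0 by simp),
        MvPolynomial.pderiv_X_of_ne (show (Sum.inr 2 : Fin 2 ⊕ Fin 3) ≠ .inr 1 by simp),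
        MvPolynomial.pderiv_one, map_zero, map_one, h0,
        pderiv_polyMap_of_ne (show (Sum.inl 0 : Fin 2 ⊕ Fin 3) ≠ .inr 1 by simp)
          (show (Sum.inr 0 : Fin 2 ⊕ Fin 3) ≠ .inr 1 by simp),
        pderiv_polyMap_of_ne (show (Sum.inl 0 : Fin 2 ⊕ Fin 3) ≠ .inr 2 by simp)
          (show (Sum.inr 0 : Fin 2 ⊕ Fin 3) ≠ .inr 2 by simp), h1, hX]
      linear_combination (-E.Z * E.evHom (derivative E.H) * E.invH) * h2
    · rw [← Dagger.ofPoly_polyMap, ← Dagger.ofPoly_polyMap, ← Dagger.ofPoly_X, ← map_mul,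
        ← map_pow, ← map_add, ← map_sub, scaledDeriv_ofPoly]
      have h0 := E.toT_pderiv_polyW E.h
      have h1 := E.toT_polyW E.h
      have h2 := E.toT_pderiv_polyW E.f
      rw [polyW] at h0 h1 h2
      have hX : E.toT (MvPolynomial.X (.inr 1)) = E.y := E.toT_X _
      simp only [MvPolynomial.pderiv_mul, MvPolynomial.pderiv_pow, map_sub, map_mul, map_add,
        MvPolynomial.pderiv_X_self,
        MvPolynomial.pderiv_X_of_ne (show (Sum.inr 1 : Fin 2 ⊕ Fin 3) ≠ .inr 0 by simp),
        MvPolynomial.pderiv_X_of_ne (show (Sum.inr 1 : Fin 2 ⊕ Fin 3) ≠ .inr 2 by simp),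
        map_zero, map_one, h0, h2,
        pderiv_polyMap_of_ne (show (Sum.inl 0 : Fin 2 ⊕ Fin 3) ≠ .inr 1 by simp)
          (show (Sum.inr 0 : Fin 2 ⊕ Fin 3) ≠ .inr 1 by simp),
        pderiv_polyMap_of_ne (show (Sum.inl 0 : Fin 2 ⊕ Fin 3) ≠ .inr 2 by simp)
          (show (Sum.inr 0 : Fin 2 ⊕ Fin 3) ≠ .inr 2 by simp), h1, hX, map_pow, map_natCast, Z]
      push_cast
      ring
  · have := E.scaledDeriv_const 0
    simpa using this
  · intro P Q _ _ hP hQ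
    rw [scaledDeriv_add, hP, hQ, add_zero]
  · intro a P hP' hP
    rw [smul_eq_mul, scaledDeriv_mul, hP, E.mkT_eq_zero hP', mul_zero, zero_mul, add_zero]

/-- The derivation `(2 Y + h) ∂/∂X` of `T`. -/
def delta (t : E.T) : E.T := E.scaledDeriv (Function.surjInv E.mkT_surjective t)

theorem delta_mkT (P : W k) : E.delta (E.mkT P) = E.scaledDeriv P := by
  have h1 : P - Function.surjInv E.mkT_surjective (E.mkT P) ∈ E.idealT := by
    rw [← Ideal.Quotient.eq]
    exact (Function.surjInv_eq E.mkT_surjective _).symm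
  have h2 := E.scaledDeriv_eq_zero_of_mem h1
  rw [sub_eq_add_neg, scaledDeriv_add, scaledDeriv_neg, ← sub_eq_add_neg, sub_eq_zero] at h2
  exact h2.symm

theorem delta_add (s t : E.T) : E.delta (s + t) = E.delta s + E.delta t := by
  obtain ⟨P, rfl⟩ := E.mkT_surjective s
  obtain ⟨Q, rfl⟩ := E.mkT_surjective t
  rw [← map_add, delta_mkT, delta_mkT, delta_mkT, scaledDeriv_add]

theorem delta_mul (s t : E.T) : E.delta (s * t) = s * E.delta t + t * E.delta s := by
  obtain ⟨P, rfl⟩ := E.mkT_surjective s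
  obtain ⟨Q, rfl⟩ := E.mkT_surjective t
  rw [← map_mul, delta_mkT, delta_mkT, delta_mkT, scaledDeriv_mul]

theorem delta_algebraMap (a : Qq k) : E.delta (algebraMap (Qq k) E.T a) = 0 := by
  rw [← toT_C]
  exact (E.delta_mkT _).trans (E.scaledDeriv_const a)

theorem delta_evHom (p : (Zq k)[X][X]) : E.delta (E.evHom p) = E.Z * E.evHom (derivative p) := by
  rw [← toT_polyW]
  exact (E.delta_mkT _).trans (E.scaledDeriv_polyW p)

theorem delta_y : E.delta E.y = E.evHom (derivative E.f) - E.evHom (derivative E.h) * E.y := by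
  rw [y, delta_mkT, ← Dagger.ofPoly_X, scaledDeriv_ofPoly, MvPolynomial.pderiv_X_self,
    MvPolynomial.pderiv_X_of_ne (show (Sum.inr 1 : Fin 2 ⊕ Fin 3) ≠ .inr 0 by simp),
    MvPolynomial.pderiv_X_of_ne (show (Sum.inr 1 : Fin 2 ⊕ Fin 3) ≠ .inr 2 by simp)]
  rw [map_zero, map_one, show E.mkT (Dagger.ofPoly (MvPolynomial.X (.inr 1))) = E.y from E.toT_X _]
  ring

theorem delta_Z : E.delta E.Z = E.evHom (E.h * derivative E.h + 2 * derivative E.f) := by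
  have h2 : (2 : E.T) = algebraMap (Qq k) E.T 2 := (map_ofNat _ 2).symm
  rw [Z, delta_add, delta_mul, delta_y, delta_evHom, h2, delta_algebraMap, ← h2, map_add, map_mul,
    map_mul, map_ofNat, Z]
  ring

theorem mem_exactForms_iff {t : E.T} : t ∈ E.exactForms ↔ ∃ u, E.Z * t = E.delta u := by
  constructor
  · rintro ⟨P, hP⟩
    exact ⟨E.mkT P, by rw [delta_mkT]; exact hP⟩
  · rintro ⟨u, hu⟩
    obtain ⟨P, rfl⟩ := E.mkT_surjective u
    rw [delta_mkT] at hu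
    exact ⟨P, hu⟩

/-- A polynomial has a primitive in `X` over `ℚ_q`. Hence in cohomology `2 Y` may be replaced by `Z`
in polynomial multiples of `Y dX`. -/
theorem evHom_mem_exactForms (p : (Zq k)[X][X]) : E.evHom p ∈ E.exactForms := by
  have : CharZero (Qq k) := charZero_of_injective_algebraMap (algebraMap_Qq_injective (k := k))
  induction p using Polynomial.induction_on' with
  | add p q hp hq => rw [map_add]; exact add_mem hp hq
  | monomial n a =>
    rw [mem_exactForms_iff]
    refine ⟨algebraMap (Qq k) E.T ((n : Qq k) + 1)⁻¹ * E.evHom (monomial (n + 1) a), ?_⟩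
    rw [delta_mul, delta_algebraMap, delta_evHom, derivative_monomial, mul_zero, add_zero,
      Nat.add_sub_cancel]
    have h1 : monomial n (a * ((n + 1 : ℕ) : (Zq k)[X])) =
        ((n + 1 : ℕ) : (Zq k)[X][X]) * monomial n a := by
      rw [← map_natCast (C : (Zq k)[X] →+* (Zq k)[X][X]), C_mul_monomial, mul_comm]
    have h2 : algebraMap (Qq k) E.T ((n : Qq k) + 1)⁻¹ * ((n + 1 : ℕ) : E.T) = 1 := by
      rw [← map_natCast (algebraMap (Qq k) E.T), ← map_mul]
      rw [Nat.cast_succ, inv_mul_cancel₀ (by exact_mod_cast Nat.succ_ne_zero n), map_one]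
    rw [h1, map_mul E.evHom, map_natCast]
    linear_combination (-E.Z * E.evHom (monomial n a)) * h2

/-- The form `∇ b · Z dX` is exact. -/
theorem Z_mul_mem_exactForms {b b' : E.T} (hb : E.delta b = E.Z * b') :
    E.Z * (b' * E.evHom E.data.Δ +
      3 * b * E.evHom (E.h * derivative E.h + 2 * derivative E.f)) ∈ E.exactForms := by
  rw [mem_exactForms_iff]
  -- This is `d (b Z³) = (b' Z³ + 3 b Z² Z') dX`, with `Z² = Δ` and `Z Z' = h h' + 2 f'`.
  refine ⟨b * (E.Z * (E.Z * E.Z)), ?_⟩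
  rw [delta_mul, delta_mul, delta_mul, delta_Z, hb, ← Z_sq]
  ring

end Family
end DeformedCurve
end

/-! ### Frobenius lifts and the series solution of a contracting quadratic equation. -/

noncomputable section

namespace DeformedCurve

open Polynomial

section Frobenius

/-- Lifting a Frobenius lift to a polynomial ring. -/
theorem two_dvd_expand_map_sub_sq {A : Type*} [CommRing A] {φ : A →+* A}
    (h : ∀ a, 2 ∣ φ a - a ^ 2) (p : A[X]) : 2 ∣ expand A 2 (p.map φ) - p ^ 2 := by
  induction p using Polynomial.induction_on' with
  | add p q hp hq =>
    have : expand A 2 ((p + q).map φ) - (p + q) ^ 2 =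
        (expand A 2 (p.map φ) - p ^ 2) + (expand A 2 (q.map φ) - q ^ 2) - 2 * (p * q) := by
      rw [Polynomial.map_add, map_add]; ring
    rw [this]
    exact dvd_sub (dvd_add hp hq) (dvd_mul_right _ _)
  | monomial n a =>
    rw [map_monomial, expand_monomial, monomial_pow, ← map_sub]
    obtain ⟨b, hb⟩ := h a
    refine ⟨monomial (n * 2) b, ?_⟩
    have h2 : (2 : A[X]) = C 2 := (map_ofNat C 2).symm
    rw [hb, h2, C_mul_monomial]

variable {k : Type*} [Field k] [CharP k 2]

/-- The Frobenius lift `Γ ↦ Γ²` on `ℤ_q[Γ]`. -/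
def frobPoly₁ (k : Type*) [Field k] [CharP k 2] : (Zq k)[X] →+* (Zq k)[X] :=
  (expand (Zq k) 2).toRingHom.comp (mapRingHom WittVector.frobenius)

/-- The Frobenius lift `Γ ↦ Γ²`, `X ↦ X²` on `ℤ_q[Γ][X]`. -/
def frobPoly (k : Type*) [Field k] [CharP k 2] : (Zq k)[X][X] →+* (Zq k)[X][X] :=
  (expand (Zq k)[X] 2).toRingHom.comp (mapRingHom (frobPoly₁ k))

theorem frobPoly₁_apply (p : (Zq k)[X]) :
    frobPoly₁ k p = expand (Zq k) 2 (p.map WittVector.frobenius) := rfl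

theorem frobPoly_apply (p : (Zq k)[X][X]) :
    frobPoly k p = expand (Zq k)[X] 2 (p.map (frobPoly₁ k)) := rfl

theorem WeightLE.frobPoly {α w : ℕ} {A : ℤ} {p : (Zq k)[X][X]} (hp : WeightLE α w A p) :
    WeightLE α w (2 * A) (DeformedCurve.frobPoly k p) := by
  intro i j hij
  rw [frobPoly_apply, coeff_expand two_pos] at hij
  split_ifs at hij with hj
  · rw [coeff_map, frobPoly₁_apply, coeff_expand two_pos] at hij
    split_ifs at hij with hi
    · obtain ⟨i, rfl⟩ := hi
      obtain ⟨j, rfl⟩ := hj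
      rw [Nat.mul_div_cancel_left _ two_pos, Nat.mul_div_cancel_left _ two_pos, coeff_map] at hij
      have := hp i j fun h0 => hij (by rw [h0, map_zero])
      push_cast at this ⊢
      linarith
    · exact absurd rfl hij
  · exact absurd (coeff_zero _) hij

theorem WeightLE.of_two_mul {α w : ℕ} {A : ℤ} {p : (Zq k)[X][X]} (hp : WeightLE α w A (2 * p)) :
    WeightLE α w A p := by
  intro i j hij
  refine hp i j fun h => hij (Zq_two_torsionFree _ ?_)
  have h2 : (2 : (Zq k)[X][X]) = C (C 2) := by rw [map_ofNat, map_ofNat]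
  rwa [h2, coeff_C_mul, coeff_C_mul] at h

variable [PerfectRing k 2]

theorem two_dvd_Zq {x : Zq k} (hx : x.coeff 0 = 0) : 2 ∣ x := by
  by_cases h : x = 0
  · rw [h]; exact dvd_zero _
  obtain ⟨m, u, rfl⟩ := WittVector.exists_eq_pow_p_mul' (p := 2) x h
  rcases m with _ | m
  · rw [pow_zero, one_mul] at hx
    exact absurd hx (u.isUnit.map (WittVector.constantCoeff (p := 2) (R := k))).ne_zero
  · rw [pow_succ', mul_assoc]
    exact ⟨_, by norm_num; rfl⟩

theorem two_dvd_frobenius_sub_sq (x : Zq k) : 2 ∣ WittVector.frobenius x - x ^ 2 := by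
  refine two_dvd_Zq ?_
  change WittVector.constantCoeff (WittVector.frobenius x - x ^ 2) = 0
  rw [map_sub, map_pow, sub_eq_zero]
  exact WittVector.coeff_frobenius_charP _ x 0

theorem exists_frobPoly_eq (p : (Zq k)[X][X]) : ∃ q, frobPoly k p = p ^ 2 + 2 * q := by
  obtain ⟨q, hq⟩ := two_dvd_expand_map_sub_sq (φ := frobPoly₁ k)
    (two_dvd_expand_map_sub_sq two_dvd_frobenius_sub_sq) p
  exact ⟨q, by rw [frobPoly_apply, ← hq]; ring⟩

end Frobenius

section Recursion

variable {R : Type*} [CommRing R]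

/-- The coefficients of the power series solution `G(ε)` of `G = a + ε (b G + c G²)`. -/
def quadSeq (a b c : R) : ℕ → R
  | 0 => a
  | n + 1 => b * quadSeq a b c n + c * ∑ i : Fin n.succ, quadSeq a b c i * quadSeq a b c (n - i)

theorem quadSeq_zero (a b c : R) : quadSeq a b c 0 = a := by rw [quadSeq]

theorem quadSeq_succ (a b c : R) (n : ℕ) : quadSeq a b c (n + 1) = b * quadSeq a b c n +
    c * ∑ x ∈ Finset.HasAntidiagonal.antidiagonal n, quadSeq a b c x.1 * quadSeq a b c x.2 := by
  rw [quadSeq, Finset.Nat.sum_antidiagonal_eq_sum_range_succ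
    fun i j => quadSeq a b c i * quadSeq a b c j, Finset.sum_range]

/-- If `a`, `b`, `c` count as homogeneous of degrees `1`, `2`, `1`, then the `n`-th coefficient of
the solution is homogeneous of degree `2 n + 1`. -/
theorem WeightLE.quadSeq {α w : ℕ} {A : ℤ} {a b c : R[X][X]} (ha : WeightLE α w A a)
    (hb : WeightLE α w (2 * A) b) (hc : WeightLE α w A c) (n : ℕ) :
    WeightLE α w ((2 * n + 1) * A) (DeformedCurve.quadSeq a b c n) := by
  induction n using Nat.strong_induction_on with
  | _ n ih =>
    rcases n with _ | n
    · rw [quadSeq_zero]; simpa using ha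
    · rw [quadSeq_succ]
      refine ((hb.mul (ih n (Nat.lt_succ_self n))).mono (by push_cast; linarith)).add ?_
      refine (hc.mul (WeightLE.sum (A := (2 * n + 2) * A) _ _ fun x hx => ?_)).mono
        (by push_cast; linarith)
      rw [Finset.HasAntidiagonal.mem_antidiagonal] at hx
      refine ((ih x.1 (by omega)).mul (ih x.2 (by omega))).mono (le_of_eq ?_)
      rw [← hx]; push_cast; ring

end Recursion

namespace Dagger

variable {k : Type*} [Field k] [CharP k 2] [PerfectRing k 2] {τ : Type*}

/-- The sum of `2ⁿ Aₙ W^(L (2 n + 1))`, where the `Aₙ` are the coefficients of the solution of a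
quadratic equation. -/
theorem exists_hasSum_quadSeq {a b c : (Zq k)[X][X]} {w A : ℕ} (hw : 1 ≤ w)
    (ha : WeightLE 1 w A a) (hb : WeightLE 1 w (2 * A) b) (hc : WeightLE 1 w A c) (γ x i : τ)
    {L : ℕ} (hL : 1 ≤ L) : ∃ G : Dagger k τ,
    HasSum (fun n => MvPolynomial.X i ^ (L * (2 * n + 1)) *
      (MvPolynomial.C (2 ^ n) * polyMap γ x (quadSeq a b c n))) G ∧ GaussGE 0 G ∧
    G = ofPoly (polyMap γ x a) * var i ^ L + 2 * (ofPoly (polyMap γ x b) * var i ^ (2 * L) * G +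
      ofPoly (polyMap γ x c) * var i ^ L * G ^ 2) := by
  obtain ⟨u, hu⟩ : ∃ u : ℕ → MvPolynomial τ (Qq k), u = fun n =>
    MvPolynomial.X i ^ (L * (2 * n + 1)) *
      (MvPolynomial.C (2 ^ n) * polyMap γ x (quadSeq a b c n)) := ⟨_, rfl⟩
  have hb1 : ∀ n, PolyBound (L * (2 * n + 1) * 1 + (0 + (2 * n + 1) * A)) (0 + (n + 0)) (u n) := by
    intro n
    rw [hu]
    refine ((PolyBound.X i).pow _).mul ((PolyBound.C ?_).mul (polyBound_polyMap γ x hw ?_))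
    · exact_mod_cast OrdGE.two_zpow (k := k) n
    · have := WeightLE.quadSeq ha hb hc n
      exact_mod_cast this
  have htag : Tagged u := by
    rw [hu]
    exact tagged_of_X_pow_mul (fun n => by nlinarith) i _
  have hgr : Growth 1 u := by
    refine ⟨2 * (L + A), 0, fun n => (hb1 n).mono ?_ (by linarith)⟩
    nlinarith
  obtain ⟨G, hG⟩ := exists_hasSum htag one_pos hgr
  rw [← hu]
  refine ⟨G, hG, hG.gaussGE fun n m => ((hb1 n).ord m).mono (by push_cast; positivity), ?_⟩
  have h1 := ((hG.ofPoly_mul (polyMap γ x b * MvPolynomial.X i ^ (2 * L))).add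
    ((hG.mul hG).ofPoly_mul (polyMap γ x c * MvPolynomial.X i ^ L))).ofPoly_mul (MvPolynomial.C 2)
  have h2 : (fun n => if n = 0 then polyMap γ x a * MvPolynomial.X i ^ L else
      (fun n => MvPolynomial.C 2 * (polyMap γ x b * MvPolynomial.X i ^ (2 * L) * u n +
        polyMap γ x c * MvPolynomial.X i ^ L *
          ∑ x ∈ Finset.HasAntidiagonal.antidiagonal n, u x.1 * u x.2)) (n - 1)) = u := by
    funext n
    rcases n with _ | n
    · rw [if_pos rfl, hu]
      beta_reduce
      rw [quadSeq_zero, pow_zero, map_one]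
      ring
    · rw [if_neg (Nat.succ_ne_zero n)]
      beta_reduce
      have hs : ∑ y ∈ Finset.HasAntidiagonal.antidiagonal n, u y.1 * u y.2 =
          MvPolynomial.X i ^ (L * (2 * n + 2)) * (MvPolynomial.C (2 ^ n) *
            polyMap γ x (∑ y ∈ Finset.HasAntidiagonal.antidiagonal n,
              quadSeq a b c y.1 * quadSeq a b c y.2)) := by
        rw [map_sum, Finset.mul_sum, Finset.mul_sum]
        refine Finset.sum_congr rfl fun y hy => ?_
        rw [Finset.HasAntidiagonal.mem_antidiagonal] at hy
        rw [← hy, pow_add, map_mul, map_mul, hu]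
        ring
      rw [Nat.add_sub_cancel, hs, hu]
      beta_reduce
      rw [quadSeq_succ, map_add, map_mul, map_mul, pow_succ, map_mul]
      ring
  have h3 := h1.cons (polyMap γ x a * MvPolynomial.X i ^ L) (by rw [h2]; exact htag)
  rw [h2] at h3
  have h4 := hG.unique h3
  rw [map_mul, map_mul, map_mul, map_pow, map_pow, ofPoly_X, map_ofNat, map_ofNat] at h4
  rw [pow_two G]
  exact h4

end Dagger
end DeformedCurve
end

/-! ### The image of `Y` under the Frobenius lift. -/

noncomputable section

namespace DeformedCurve

open Polynomial

/-- The equation for the image of `Y` under the Frobenius lift, in terms of a solution `G` of a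
contracting quadratic equation. -/
theorem frobY_equation {A : Type*} [CommRing A] (h2 : ∀ a b : A, 2 * a = 2 * b → a = b)
    {y h f u h₁ f₁ s G : A} (hy : y ^ 2 = f - h * y) (hu : u * h = 1) (hs : s = h₁ + f)
    (hG : G = -(f * h ^ 4 + h₁ * f * h ^ 2 + 2 * s * f * h ^ 2 - f₁ * h ^ 2 + 2 * s ^ 2 * f) * u ^ 5
      + 2 * (-((h₁ + 3 * f) * h ^ 8 + 4 * f * s * h ^ 6) * u ^ 10 * G
        + -((h ^ 2 + 4 * f) * h ^ 2) * u ^ 5 * G ^ 2)) {t : A}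
    (ht : t = y ^ 2 + 2 * (h * y + s * y * u + G * (2 * y + h))) :
    ((h ^ 2 + 2 * h₁ + 2 * f) * u + 4 * G) * (2 * y + h) = 2 * t + (h ^ 2 + 2 * h₁) ∧
      t ^ 2 + (h ^ 2 + 2 * h₁) * t - (f ^ 2 + 2 * f₁) = 0 := by
  have e1 : ((h ^ 2 + 2 * h₁ + 2 * f) * u + 4 * G) * (2 * y + h) = 2 * t + (h ^ 2 + 2 * h₁) := by
    rw [ht, hy, hs]
    linear_combination (h ^ 2 + 2 * h₁ + 2 * f + 2 * h * y) * hu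
  have e2 : h ^ 2 * u ^ 2 = 1 := by linear_combination (u * h + 1) * hu
  have e3 : h ^ 3 * u ^ 3 = 1 := by linear_combination u * h * e2 + hu
  have e4 : h ^ 4 * u ^ 4 = 1 := by linear_combination (h ^ 2 * u ^ 2 + 1) * e2
  have e5 : h ^ 5 * u ^ 5 = 1 := by linear_combination (u * h) * e4 + hu
  have e8 : h ^ 8 * u ^ 8 = 1 := by linear_combination (h ^ 4 * u ^ 4 + 1) * e4
  have e9 : h ^ 9 * u ^ 9 = 1 := by linear_combination (u * h) * e8 + hu
  have e10 : h ^ 10 * u ^ 10 = 1 := by linear_combination (u * h) * e9 + hu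
  -- This is the equation that `G` has to satisfy. In `hG` it is solved for `G` and padded by powers
  -- of `h u = 1`, so that `u` occurs with exponents `5`, `10`, `5`, as the homogeneous series
  -- solution requires.
  have e6 : h ^ 3 * G + (f * h ^ 2 + h₁ * f + 2 * s * f - f₁ + 2 * s ^ 2 * f * u ^ 2)
      + 2 * ((h₁ + 3 * f) * h + 4 * f * s * u) * G + 2 * (h ^ 2 + 4 * f) * G ^ 2 = 0 := by
    linear_combination h ^ 3 * hG - (f * h ^ 2 + h₁ * f + 2 * s * f - f₁) * e5
      - (2 * s ^ 2 * f * u ^ 2) * e3 - 2 * (h₁ + 3 * f) * h * G * e10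
      - 8 * f * s * u * G * e9 - 2 * (h ^ 2 + 4 * f) * G ^ 2 * e5
  -- Four times the quadratic equation is `(2 t + h^σ)² = (h^σ)² + 4 f^σ`. By `e1` the left side is
  -- the square of the coefficient of `2 y + h` times `h² + 4 f`, so `y` disappears.
  refine ⟨e1, h2 _ _ (h2 _ _ ?_)⟩
  have e7 : (2 * y + h) ^ 2 = h ^ 2 + 4 * f := by linear_combination 4 * hy
  have e8 : 2 * (2 * (t ^ 2 + (h ^ 2 + 2 * h₁) * t - (f ^ 2 + 2 * f₁))) =
      ((h ^ 2 + 2 * h₁ + 2 * f) * u + 4 * G) ^ 2 * (h ^ 2 + 4 * f) - (h ^ 2 + 2 * h₁) ^ 2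
        - 4 * (f ^ 2 + 2 * f₁) := by
    rw [← e7, ← mul_pow, e1]; ring
  rw [e8, mul_zero, mul_zero]
  have e9 : (h ^ 2 + 2 * h₁ + 2 * f) * u = h + 2 * s * u := by
    rw [hs]; linear_combination h * hu
  rw [e9]
  have e11 : (h + 2 * s * u) ^ 2 = h ^ 2 + 4 * s + 4 * s ^ 2 * u ^ 2 := by
    linear_combination (4 * s) * hu
  have e12 : (h + 2 * s * u) * (h ^ 2 + 4 * f) =
      h ^ 3 + 2 * s * h + 4 * f * h + 8 * f * s * u := by
    linear_combination (2 * s * h) * hu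
  have e13 : (h + 2 * s * u + 4 * G) ^ 2 * (h ^ 2 + 4 * f) =
      (h ^ 2 + 4 * s + 4 * s ^ 2 * u ^ 2) * (h ^ 2 + 4 * f) +
      8 * G * (h ^ 3 + 2 * s * h + 4 * f * h + 8 * f * s * u) + 16 * G ^ 2 * (h ^ 2 + 4 * f) := by
    rw [← e11, ← e12]; ring
  rw [e13, hs]
  rw [hs] at e6
  linear_combination 8 * e6 + 4 * (h₁ + f) ^ 2 * e2

namespace Family

variable {k : Type*} [Field k] [CharP k 2] {g : ℕ} (E : Family k g)

theorem WeightLE_two_mul {R : Type*} [CommRing R] {α w : ℕ} {A : ℤ} {p : R[X][X]}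
    (hp : WeightLE α w A p) : WeightLE α w A (2 * p) := by
  rw [two_mul]; exact hp.add hp

theorem weight_h {α w : ℕ} (hw : α * E.κ ≤ w) : WeightLE α w (g * w) E.h := by
  have h1 := E.weight_prod_fac E.mult hw
  refine (h1.C_C_mul _).mono ?_
  have h2 := E.natDegree_h
  rw [natDegree_C_mul_of_mul_ne_zero] at h2
  · exact_mod_cast Nat.mul_le_mul_right w h2
  · have hm : (∏ i, E.fac i ^ E.mult i).Monic :=
      monic_prod_of_monic _ _ fun i _ => (E.fac_monic i).pow _
    rw [hm.leadingCoeff, mul_one]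
    exact C_ne_zero.2 E.c.ne_zero

theorem weight_f {α w : ℕ} (hw : α * E.κ ≤ w) : WeightLE α w ((2 * g + 1) * w) E.f := by
  have h1 := E.weight_of_dvd_f E.f_monic dvd_rfl hw
  rw [f_natDegree] at h1
  exact_mod_cast h1

/-- The exponents of `1 / H` in the series for the image of `Y` under the Frobenius lift. -/
def frobExp : ℕ → ℕ
  | 0 => E.D
  | n + 1 => 5 * E.D * (2 * n + 1)

theorem le_frobExp (n : ℕ) : n ≤ E.frobExp n := by
  have := E.D_pos
  rcases n with _ | n
  · exact Nat.zero_le _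
  · rw [frobExp]; nlinarith

theorem frobExp_le (n : ℕ) : E.frobExp n ≤ 10 * E.D * (n + 1) := by
  rcases n with _ | n <;> rw [frobExp] <;> nlinarith

variable [PerfectRing k 2]

theorem evσ_eq (p : (Zq k)[X][X]) : E.evσ p = E.evHom (frobPoly k p) := by
  have h : eval₂RingHom (eval₂RingHom ((coeffMap k E.T).comp WittVector.frobenius) (E.ΓT ^ 2))
      (E.x ^ 2) = E.evHom.comp (frobPoly k) := by
    refine Polynomial.ringHom_ext' (Polynomial.ringHom_ext' (RingHom.ext fun a => ?_) ?_) ?_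
    · simp [evHom, frobPoly_apply, frobPoly₁_apply]
    · simp [evHom, frobPoly_apply, frobPoly₁_apply, eval₂_pow]
    · simp [evHom, frobPoly_apply]
  exact congrArg (fun ψ => ψ p) h

theorem two_mul_cancel_T {a b : E.T} (h : 2 * a = 2 * b) : a = b := by
  have h2 : algebraMap (Qq k) E.T 2⁻¹ * 2 = 1 := by
    rw [← map_ofNat (algebraMap (Qq k) E.T) 2, ← map_mul, inv_mul_cancel₀ two_ne_zero_Qq, map_one]
  calc a = algebraMap (Qq k) E.T 2⁻¹ * (2 * a) := by rw [← mul_assoc, h2, one_mul]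
    _ = b := by rw [h, ← mul_assoc, h2, one_mul]

/-- The difference of the two equations is `(t' - t)(t' + t + h^σ) = 0`. Both roots are `Y²` modulo
`2` and `h^σ ≡ h²`, so the second factor is `h²` times some `1 + 2 u` with `u` integral, a unit. -/
theorem IsFrobY.unique {t t' : E.T} (ht : E.IsFrobY t) (ht' : E.IsFrobY t') : t' = t := by
  obtain ⟨h1, h2⟩ := ht
  obtain ⟨h1', h2'⟩ := ht'
  obtain ⟨v, hv, h2⟩ := E.two_mul_of_TOrdGE h2
  obtain ⟨v', hv', h2'⟩ := E.two_mul_of_TOrdGE h2'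
  obtain ⟨q, hq⟩ := exists_frobPoly_eq E.h
  have hσ : E.evσ E.h = E.evHom E.h ^ 2 + 2 * E.evHom q := by
    rw [evσ_eq, hq, map_add, map_mul, map_pow, map_ofNat]
  have h3 : (t' - t) * (t' + t + E.evσ E.h) = 0 := by linear_combination h1' - h1
  have h4 : (t' + t + E.evσ E.h) * E.invh ^ 2 =
      1 + 2 * ((E.y ^ 2 + v + v' + E.evHom q) * E.invh ^ 2) := by
    rw [hσ]
    linear_combination (h2 + h2') * E.invh ^ 2 + (E.invh * E.evHom E.h + 1) * E.invh_mul_h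
  have h5 : IsUnit (1 + 2 * ((E.y ^ 2 + v + v' + E.evHom q) * E.invh ^ 2)) :=
    E.isUnit_one_add_two_mul (mul_mem (add_mem (add_mem (add_mem (pow_mem E.y_mem_integralT _) hv)
      hv') (E.evHom_mem_integralT _)) (pow_mem E.invh_mem_integralT _))
  rw [← h4] at h5
  have h6 := isUnit_of_mul_isUnit_left h5
  exact sub_eq_zero.1 ((h6.mul_left_eq_zero).1 h3)

/-- The ansatz is `t = Y² + 2 (h Y + s Y / h + G Z)` with `s = h₁ + f`, where `h^σ = h² + 2 h₁`. It
makes `2 t + h^σ` equal to `β Z` with `β = (h^σ + 2 f) / h + 4 G` free of `Y`, and it reduces the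
equation for `t` to a fixed point equation for `G` that contracts by `2`. -/
theorem exists_isFrobY (hg : 1 ≤ g) : ∃ (t : E.T) (B : ℕ → (Zq k)[X][X]) (β : W k), E.IsFrobY t ∧
    E.mkT β * E.Z = 2 * t + E.evσ E.h ∧
    Dagger.HasSum (fun n => MvPolynomial.X (.inr 2) ^ E.frobExp n *
      (MvPolynomial.C (2 ^ n) * polyW k (B n))) β ∧
    ∀ n α w : ℕ, α * E.κ ≤ w → WeightLE α w (28 * g * E.D * w * (n + 1)) (B n) := by
  obtain ⟨h₁, hh₁⟩ := exists_frobPoly_eq E.h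
  obtain ⟨f₁, hf₁⟩ := exists_frobPoly_eq E.f
  have hhw : ∀ {α w : ℕ}, α * E.κ ≤ w → WeightLE α w (2 * (g * w)) h₁ := by
    intro α w hw
    refine WeightLE.of_two_mul ?_
    rw [show 2 * h₁ = frobPoly k E.h - E.h ^ 2 by rw [hh₁]; ring]
    exact (E.weight_h hw).frobPoly.sub ((E.weight_h hw).pow 2)
  have hfw : ∀ {α w : ℕ}, α * E.κ ≤ w → WeightLE α w (2 * ((2 * g + 1) * w)) f₁ := by
    intro α w hw
    refine WeightLE.of_two_mul ?_
    rw [show 2 * f₁ = frobPoly k E.f - E.f ^ 2 by rw [hf₁]; ring]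
    exact (E.weight_f hw).frobPoly.sub ((E.weight_f hw).pow 2)
  obtain ⟨s, hs⟩ : ∃ s, s = h₁ + E.f := ⟨_, rfl⟩
  have hgw : ∀ w : ℕ, (w : ℤ) ≤ g * w ∧ (g * w : ℤ) ≤ g * E.D * w := by
    intro w
    have h1 := Nat.mul_le_mul_right w hg
    have h2 := Nat.mul_le_mul_right w (Nat.mul_le_mul_left g E.D_pos)
    rw [one_mul] at h1
    rw [mul_one] at h2
    exact ⟨by exact_mod_cast h1, by exact_mod_cast h2⟩
  have hsw : ∀ {α w : ℕ}, α * E.κ ≤ w → WeightLE α w ((2 * g + 1) * w) s := by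
    intro α w hw
    rw [hs]
    exact ((hhw hw).mono (by have := hgw w; linarith)).add (E.weight_f hw)
  obtain ⟨a, ha⟩ : ∃ a, a = -(E.f * E.h ^ 4 + h₁ * E.f * E.h ^ 2 + 2 * (s * E.f * E.h ^ 2)
    - f₁ * E.h ^ 2 + 2 * (s ^ 2 * E.f)) * E.hc ^ 5 := ⟨_, rfl⟩
  obtain ⟨b, hb⟩ : ∃ b, b = -((h₁ + (2 * E.f + E.f)) * E.h ^ 8 + 2 * (2 * (E.f * s * E.h ^ 6)))
    * E.hc ^ 10 := ⟨_, rfl⟩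
  obtain ⟨c, hc⟩ : ∃ c, c = -((E.h ^ 2 + 2 * (2 * E.f)) * E.h ^ 2) * E.hc ^ 5 := ⟨_, rfl⟩
  -- The factors built from `h`, `f`, `h₁`, `f₁` weigh at most `(6 g + 3) w ≤ 9 g w`, and `(H ^ D /
  -- h) ^ 5` weighs at most `5 g D w`.
  have haw : ∀ {α w : ℕ}, α * E.κ ≤ w → WeightLE α w (14 * g * E.D * w) a := by
    intro α w hw
    obtain ⟨i1, i2⟩ := hgw w
    have wh := E.weight_h hw
    have wf := E.weight_f hw
    have ws := hsw hw
    have wh₁ := hhw hw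
    have wf₁ := hfw hw
    rw [ha]
    refine (WeightLE.mul (A := (6 * g + 3) * w) (WeightLE.neg (WeightLE.add (WeightLE.sub
      (WeightLE.add (WeightLE.add ?_ ?_) (WeightLE_two_mul ?_)) ?_) (WeightLE_two_mul ?_)))
      ((E.weight_hc hw).pow 5)).mono ?_
    · exact (wf.mul (wh.pow 4)).mono (by push_cast; linarith)
    · exact ((wh₁.mul wf).mul (wh.pow 2)).mono (by push_cast; linarith)
    · exact ((ws.mul wf).mul (wh.pow 2)).mono (by push_cast; linarith)
    · exact (wf₁.mul (wh.pow 2)).mono (by push_cast; linarith)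
    · exact ((ws.pow 2).mul wf).mono (by push_cast; linarith)
    · push_cast; linarith
  have hbw : ∀ {α w : ℕ}, α * E.κ ≤ w → WeightLE α w (2 * (14 * g * E.D * w)) b := by
    intro α w hw
    obtain ⟨i1, i2⟩ := hgw w
    have wh := E.weight_h hw
    have wf := E.weight_f hw
    have ws := hsw hw
    have wh₁ := hhw hw
    rw [hb]
    refine (WeightLE.mul (A := (10 * g + 2) * w) (WeightLE.neg (WeightLE.add ?_
      (WeightLE_two_mul (WeightLE_two_mul ?_)))) ((E.weight_hc hw).pow 10)).mono ?_
    · refine (((wh₁.mono (B := (2 * g + 1) * w) (by linarith)).add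
        ((WeightLE_two_mul wf).add wf)).mul (wh.pow 8)).mono (by push_cast; linarith)
    · exact ((wf.mul ws).mul (wh.pow 6)).mono (by push_cast; linarith)
    · push_cast; linarith
  have hcw : ∀ {α w : ℕ}, α * E.κ ≤ w → WeightLE α w (14 * g * E.D * w) c := by
    intro α w hw
    obtain ⟨i1, i2⟩ := hgw w
    have wh := E.weight_h hw
    have wf := E.weight_f hw
    rw [hc]
    refine (WeightLE.mul (A := (4 * g + 1) * w) (WeightLE.neg (WeightLE.mul (A := (2 * g + 1) * w)
      (WeightLE.add ?_ (WeightLE_two_mul (WeightLE_two_mul ?_))) (wh.pow 2)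
      |>.mono ?_)) ((E.weight_hc hw).pow 5)).mono ?_
    · exact (wh.pow 2).mono (by push_cast; linarith)
    · exact wf
    · push_cast; linarith
    · push_cast; linarith
  obtain ⟨w, hw1, hwκ⟩ : ∃ w, 1 ≤ w ∧ 1 * E.κ ≤ w :=
    ⟨max 1 E.κ, le_max_left _ _, by rw [one_mul]; exact le_max_right _ _⟩
  obtain ⟨G, hG, hG0, hGeq⟩ := Dagger.exists_hasSum_quadSeq (A := 14 * g * E.D * w) hw1
    (by exact_mod_cast haw hwκ) (by exact_mod_cast hbw hwκ) (by exact_mod_cast hcw hwκ)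
    (.inl 0) (.inr 0) (.inr 2 : Fin 2 ⊕ Fin 3) (L := 5 * E.D) (by have := E.D_pos; omega)
  have hGT : E.mkT G = -(E.evHom E.f * E.evHom E.h ^ 4 + E.evHom h₁ * E.evHom E.f * E.evHom E.h ^ 2
      + 2 * E.evHom s * E.evHom E.f * E.evHom E.h ^ 2 - E.evHom f₁ * E.evHom E.h ^ 2
      + 2 * E.evHom s ^ 2 * E.evHom E.f) * E.invh ^ 5
      + 2 * (-((E.evHom h₁ + 3 * E.evHom E.f) * E.evHom E.h ^ 8
        + 4 * E.evHom E.f * E.evHom s * E.evHom E.h ^ 6) * E.invh ^ 10 * E.mkT G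
        + -((E.evHom E.h ^ 2 + 4 * E.evHom E.f) * E.evHom E.h ^ 2) * E.invh ^ 5 * E.mkT G ^ 2) := by
    have h1 := congrArg E.mkT hGeq
    have hpoly : ∀ p, E.mkT (Dagger.ofPoly (polyMap (.inl 0) (.inr 0) p)) = E.evHom p :=
      E.toT_polyW
    have hI : E.mkT (Dagger.var (.inr 2)) = E.invH := rfl
    rw [map_add, map_mul, map_mul, map_ofNat, map_add, map_mul, map_mul, map_mul, map_mul, hpoly,
      hpoly, hpoly, map_pow, map_pow, map_pow, hI, ha, hb, hc] at h1
    simp only [map_add, map_mul, map_neg, map_sub, map_pow, map_ofNat] at h1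
    have hu5 : E.evHom E.hc ^ 5 * E.invH ^ (5 * E.D) = E.invh ^ 5 := by rw [invh]; ring
    have hu10 : E.evHom E.hc ^ 10 * E.invH ^ (2 * (5 * E.D)) = E.invh ^ 10 := by rw [invh]; ring
    linear_combination h1 - (E.evHom E.f * E.evHom E.h ^ 4
      + E.evHom h₁ * E.evHom E.f * E.evHom E.h ^ 2
      + 2 * E.evHom s * E.evHom E.f * E.evHom E.h ^ 2 - E.evHom f₁ * E.evHom E.h ^ 2
      + 2 * E.evHom s ^ 2 * E.evHom E.f) * hu5
      - 2 * ((E.evHom h₁ + 3 * E.evHom E.f) * E.evHom E.h ^ 8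
        + 4 * E.evHom E.f * E.evHom s * E.evHom E.h ^ 6) * E.mkT G * hu10
      - 2 * ((E.evHom E.h ^ 2 + 4 * E.evHom E.f) * E.evHom E.h ^ 2) * E.mkT G ^ 2 * hu5
  have hsT : E.evHom s = E.evHom h₁ + E.evHom E.f := by rw [hs, map_add]
  obtain ⟨t, ht⟩ : ∃ t, t = E.y ^ 2 + 2 * (E.evHom E.h * E.y + E.evHom s * E.y * E.invh +
    E.mkT G * (2 * E.y + E.evHom E.h)) := ⟨_, rfl⟩
  obtain ⟨e1, e2⟩ := frobY_equation (fun _ _ => E.two_mul_cancel_T) E.y_sq E.invh_mul_h hsT hGT ht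
  have hσh : E.evσ E.h = E.evHom E.h ^ 2 + 2 * E.evHom h₁ := by
    rw [evσ_eq, hh₁, map_add, map_mul, map_pow, map_ofNat]
  have hσf : E.evσ E.f = E.evHom E.f ^ 2 + 2 * E.evHom f₁ := by
    rw [evσ_eq, hf₁, map_add, map_mul, map_pow, map_ofNat]
  -- The leading term is `(h^σ + 2 f) / h`. From there the index is shifted by one, since `4 * 2 ^ n
  -- Aₙ = 2 ^ (n + 1) * (2 Aₙ)`.
  refine ⟨t, fun n => Nat.casesOn n ((frobPoly k E.h + 2 * E.f) * E.hc)
    fun n => 2 * quadSeq a b c n, Dagger.ofPoly (MvPolynomial.X (.inr 2) ^ E.D *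
      (MvPolynomial.C (2 ^ 0) * polyW k ((frobPoly k E.h + 2 * E.f) * E.hc))) +
      Dagger.ofPoly (MvPolynomial.C 4) * G, ⟨?_, ?_⟩, ?_, ?_, ?_⟩
  rotate_left
  · rw [ht, add_sub_cancel_left]
    have hG1 : E.mkT G ∈ E.integralT := ⟨G, hG0, rfl⟩
    have hZ : E.Z ∈ E.integralT := add_mem (mul_mem (ofNat_mem _ 2) E.y_mem_integralT)
      (E.evHom_mem_integralT _)
    exact E.TOrdGE_two_mul (add_mem (add_mem (mul_mem (E.evHom_mem_integralT _) E.y_mem_integralT)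
      (mul_mem (mul_mem (E.evHom_mem_integralT _) E.y_mem_integralT) E.invh_mem_integralT))
      (mul_mem hG1 hZ))
  · rw [hσh, ← e1, map_add]
    have h1 : E.mkT (Dagger.ofPoly (MvPolynomial.X (.inr 2) ^ E.D *
        (MvPolynomial.C (2 ^ 0) * polyW k ((frobPoly k E.h + 2 * E.f) * E.hc)))) =
        (E.evHom E.h ^ 2 + 2 * E.evHom h₁ + 2 * E.evHom E.f) * E.invh := by
      change E.toT _ = _
      rw [pow_zero, map_one, one_mul, map_mul, map_pow, toT_polyW, toT_X, hh₁, map_mul, map_add,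
        map_add, map_mul, map_mul, map_pow, map_ofNat, invh, invH]
      ring
    have h4 : E.mkT (Dagger.ofPoly (MvPolynomial.C 4)) = 4 := by
      change E.toT _ = _
      rw [toT_C, map_ofNat]
    rw [h1, map_mul, h4, Z]
  · have h1 := hG.ofPoly_mul (MvPolynomial.C 4)
    have h2 : (fun n => if n = 0 then MvPolynomial.X (.inr 2) ^ E.D *
        (MvPolynomial.C (2 ^ 0) * polyW k ((frobPoly k E.h + 2 * E.f) * E.hc)) else
        (fun n => MvPolynomial.C 4 * (MvPolynomial.X (.inr 2) ^ (5 * E.D * (2 * n + 1)) *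
          (MvPolynomial.C (2 ^ n) * polyMap (.inl 0) (.inr 0) (quadSeq a b c n)))) (n - 1)) =
        fun n => MvPolynomial.X (.inr 2) ^ E.frobExp n * (MvPolynomial.C (2 ^ n) *
          polyW k (Nat.casesOn n ((frobPoly k E.h + 2 * E.f) * E.hc)
            fun n => 2 * quadSeq a b c n)) := by
      funext n
      rcases n with _ | n
      · rfl
      · rw [if_neg (Nat.succ_ne_zero n)]
        beta_reduce
        rw [Nat.add_sub_cancel, frobExp, map_mul, map_ofNat, polyW]
        simp only [map_pow, map_ofNat]
        ring
    rw [← h2]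
    refine h1.cons _ ?_
    rw [h2]
    exact Dagger.tagged_of_X_pow_mul E.le_frobExp _ _
  · intro n α w hw
    obtain ⟨i1, i2⟩ := hgw w
    rcases n with _ | n
    · refine (((E.weight_h hw).frobPoly.mono (B := (2 * g + 1) * w) (by linarith)).add
        (WeightLE_two_mul (E.weight_f hw))).mul (E.weight_hc hw) |>.mono ?_
      push_cast; linarith
    · refine (WeightLE_two_mul (WeightLE.quadSeq (haw hw) (hbw hw) (hcw hw) n)).mono ?_
      have h3 : (0 : ℤ) ≤ g * E.D * w := by positivity
      push_cast; nlinarith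
  · rw [hσh, hσf]
    exact e2

end Family
end DeformedCurve
end

/-! ### Reduction of the terms of the Frobenius series. -/

noncomputable section

namespace DeformedCurve

open Polynomial

section LinBound

variable {k : Type*} [Field k] [CharP k 2] {τ : Type*}

/-- The polynomials `qₙ` are integral, of degrees that grow at most linearly. -/
def LinBound (q : ℕ → MvPolynomial τ (Qq k)) : Prop := ∃ a : ℕ, ∀ n, PolyBound (a * (n + 1)) 0 (q n)

namespace LinBound

variable {p q : ℕ → MvPolynomial τ (Qq k)}

theorem mul (hp : LinBound p) (hq : LinBound q) : LinBound fun n => p n * q n := by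
  obtain ⟨a, ha⟩ := hp
  obtain ⟨b, hb⟩ := hq
  exact ⟨a + b, fun n => ((ha n).mul (hb n)).mono (le_of_eq (by ring)) (by simp)⟩

theorem const {d : ℕ} {p : MvPolynomial τ (Qq k)} (hp : PolyBound d 0 p) : LinBound fun _ => p :=
  ⟨d, fun n => hp.mono (Nat.le_mul_of_pos_right _ n.succ_pos) le_rfl⟩

theorem X_pow {e : ℕ → ℕ} {b : ℕ} (he : ∀ n, e n ≤ b * (n + 1)) (i : τ) :
    LinBound fun n => (MvPolynomial.X i : MvPolynomial τ (Qq k)) ^ e n :=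
  ⟨b, fun n => ((PolyBound.X i).pow _).mono (by rw [mul_one]; exact he n) le_rfl⟩

theorem natCast_mul (hp : LinBound p) (e : ℕ → ℕ) :
    LinBound fun n => (e n : MvPolynomial τ (Qq k)) * p n := by
  obtain ⟨a, ha⟩ := hp
  exact ⟨a, fun n => (ha n).natCast_mul _⟩

theorem geom {e : ℕ → ℕ} {b d : ℕ} (he : ∀ n, e n ≤ b * (n + 1)) {p : MvPolynomial τ (Qq k)}
    (hp : PolyBound d 0 p) : LinBound fun n => ∑ l ∈ Finset.range (e n), p ^ l := by
  refine ⟨b * d, fun n => PolyBound.sum _ _ fun l hl => (hp.pow l).mono ?_ le_rfl⟩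
  have := Nat.mul_le_mul_right d (((Finset.mem_range.1 hl).le).trans (he n))
  linarith

theorem polyMap {p : ℕ → (Zq k)[X][X]} {w A : ℕ} (hw : 1 ≤ w)
    (hp : ∀ n : ℕ, WeightLE 1 w (A * (n + 1)) (p n)) (γ x : τ) :
    LinBound fun n => DeformedCurve.polyMap γ x (p n) :=
  ⟨A, fun n => polyBound_polyMap γ x hw (by exact_mod_cast hp n)⟩

end LinBound

theorem OrdGE.two_zpow_sub {t : ℝ} (n S : ℕ) (h : t ≤ n - S) :
    OrdGE t ((2 : Qq k) ^ ((n : ℤ) - S)) := by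
  refine (OrdGE.two_zpow _).mono ?_
  push_cast
  exact h

variable [PerfectRing k 2]

/-- A loss of at most `n / 2 + c / 2` leaves the order of the `n`-th term at least `n / 2 - c / 2`,
which still grows linearly. -/
theorem LinBound.exists_hasSum {q : ℕ → MvPolynomial τ (Qq k)} (hq : LinBound q) {S e : ℕ → ℕ}
    {b c : ℕ} (hS : ∀ n, 2 * S n ≤ n + c) (he : ∀ n, n ≤ e n) (he' : ∀ n, e n ≤ b * (n + 1))
    (i : τ) : ∃ P : Dagger k τ, Dagger.HasSum (fun n => MvPolynomial.X i ^ e n *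
      (MvPolynomial.C ((2 : Qq k) ^ ((n : ℤ) - S n)) * q n)) P := by
  refine Dagger.exists_hasSum (Dagger.tagged_of_X_pow_mul he i _) (ρ := 1 / 2) (by norm_num) ?_
  obtain ⟨a, ha⟩ := hq
  refine ⟨b + a, c / 2, fun n => ((PolyBound.X i).pow _).mul ((ha n).C_mul
    (OrdGE.two_zpow_sub n (S n) (t := 1 / 2 * n - c / 2) ?_)) |>.mono ?_ (by linarith)⟩
  · have : (2 * S n : ℝ) ≤ n + c := by exact_mod_cast hS n
    linarith
  · have := he' n
    linarith

end LinBound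

section Misc

variable {k : Type*} [Field k] [CharP k 2]

theorem rename_polyMap₁ {τ υ : Type*} (f : τ → υ) (γ : τ) (p : (Zq k)[X]) :
    MvPolynomial.rename f (polyMap₁ γ p) = polyMap₁ (f γ) p := by
  induction p using Polynomial.induction_on' with
  | add p q hp hq => rw [map_add, map_add, map_add, hp, hq]
  | monomial n a => simp [polyMap₁]

theorem WeightLE.natDegree_coeff_le {R : Type*} [CommRing R] {w A : ℕ} {p : R[X][X]}
    (hp : WeightLE 1 w A p) (j : ℕ) : (p.coeff j).natDegree ≤ A := by
  refine natDegree_le_iff_coeff_eq_zero.2 fun i hi => ?_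
  by_contra h
  have := hp i j h
  push_cast at this
  have h2 : (0 : ℤ) ≤ w * j := by positivity
  have h3 : (A : ℤ) < i := by exact_mod_cast hi
  linarith

theorem two_mul_clog_succ_le (n : ℕ) : 2 * Nat.clog 2 (n + 1) ≤ n + 2 := by
  have key : ∀ m : ℕ, 2 * m + 2 ≤ 2 ^ (m + 1) := by
    intro m
    induction m with
    | zero => norm_num
    | succ m ih => rw [pow_succ]; omega
  have h1 : Nat.clog 2 (n + 1) ≤ n / 2 + 1 :=
    Nat.clog_le_of_le_pow (le_trans (by omega) (key (n / 2)))
  omega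

theorem sum_fin_of_degree_lt {R : Type*} [CommRing R] {p : R[X]} {n : ℕ} (hp : p.degree < n) :
    p = ∑ j : Fin n, C (p.coeff j) * X ^ (j : ℕ) := by
  rcases Nat.eq_zero_or_pos n with rfl | hn
  · have : p = 0 := by
      by_contra h
      exact absurd hp (not_lt.2 (zero_le_degree_iff.2 h))
    simp [this]
  · have hd : p.natDegree < n := by
      by_cases h0 : p = 0
      · rwa [h0, natDegree_zero]
      · exact (natDegree_lt_iff_degree_lt h0).2 hp
    conv_lhs => rw [p.as_sum_range' n hd]
    rw [Finset.sum_range]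
    exact Finset.sum_congr rfl fun j _ => (C_mul_X_pow_eq_monomial).symm

end Misc

namespace Family

variable {k : Type*} [Field k] [CharP k 2] {g : ℕ} (E : Family k g)

/-- Each multiplicity is at most `deg h`. Therefore the logarithmic losses can be expressed through
`g` alone. -/
theorem D_le (hg : 1 ≤ g) : E.D ≤ g := by
  refine max_le hg (Finset.sup_le fun i _ => ?_)
  have h2 := E.natDegree_h
  have hm : (∏ i, E.fac i ^ E.mult i).Monic :=
    monic_prod_of_monic _ _ fun i _ => (E.fac_monic i).pow _
  rw [natDegree_C_mul_of_mul_ne_zero, natDegree_prod_of_monic _ _ fun i _ => (E.fac_monic i).pow _]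
    at h2
  · refine le_trans ?_ ((Finset.single_le_sum (f := fun i => (E.fac i ^ E.mult i).natDegree)
      (fun _ _ => Nat.zero_le _) (Finset.mem_univ i)).trans h2)
    rw [(E.fac_monic i).natDegree_pow]
    exact Nat.le_mul_of_pos_right _ (E.fac_natDegree_pos i)
  · rw [hm.leadingCoeff, mul_one]
    exact C_ne_zero.2 E.c.ne_zero

/-- The loss of precision in the reduction of the `n`-th term of the series for the image of `Y`
under the Frobenius lift. -/
def loss (g n : ℕ) : ℕ := 9 + 2 * Nat.clog 2 (g + 1) + Nat.clog 2 (n + 1) + 3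

theorem two_mul_loss_le (g n : ℕ) : 2 * loss g n ≤ n + (26 + 4 * Nat.clog 2 (g + 1)) := by
  have := two_mul_clog_succ_le n
  rw [loss]
  omega

variable [PerfectRing k 2]

theorem exists_reduction_frob (hg : 1 ≤ g) {B : ℕ → (Zq k)[X][X]}
    (hB : ∀ n α w : ℕ, α * E.κ ≤ w → WeightLE α w (28 * g * E.D * w * (n + 1)) (B n))
    {i : ℕ} (hi : i < 2 * g) : ∃ v F : ℕ → (Zq k)[X][X], ∀ n,
      2 ^ loss g n * (C E.r ^ E.frobExp n * (X ^ (2 * i + 1) * B n)) =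
        E.data.nabla (E.frobExp n) (v n) + E.H ^ E.frobExp n * F n ∧
      (F n).degree < (2 * g : ℕ) ∧ ∀ w : ℕ, E.κ ≤ w →
        WeightLE 1 w ((127 * g * E.D * w : ℕ) * (n + 1)) (v n) ∧
        WeightLE 1 w ((112 * g * E.D * w : ℕ) * (n + 1)) (F n) := by
  have key : ∀ n, ∃ v F : (Zq k)[X][X],
      2 ^ loss g n * (C E.r ^ E.frobExp n * (X ^ (2 * i + 1) * B n)) =
        E.data.nabla (E.frobExp n) v + E.H ^ E.frobExp n * F ∧
      F.degree < (2 * g : ℕ) ∧ ∀ w : ℕ, E.κ ≤ w →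
        WeightLE 1 w ((127 * g * E.D * w : ℕ) * (n + 1)) v ∧
        WeightLE 1 w ((112 * g * E.D * w : ℕ) * (n + 1)) F := by
    intro n
    have hD := E.D_pos
    have hgD : ∀ w : ℕ, (g : ℤ) * w ≤ g * E.D * w * (n + 1) := by
      intro w
      have h1 : g * w ≤ g * w * (E.D * (n + 1)) :=
        Nat.le_mul_of_pos_right _ (Nat.mul_pos hD n.succ_pos)
      have h2 : ((g * w : ℕ) : ℤ) ≤ ((g * w * (E.D * (n + 1)) : ℕ) : ℤ) := by exact_mod_cast h1
      push_cast at h2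
      linarith
    have ha : ∀ α w : ℕ, α * E.κ ≤ w →
        WeightLE α w (32 * g * E.D * w * (n + 1)) (X ^ (2 * i + 1) * B n) := by
      intro α w hw
      refine ((WeightLE.X_pow _).mul (hB n α w hw)).mono ?_
      have h1 := hgD w
      have h2 : ((2 * i + 1 : ℕ) : ℤ) * w ≤ 4 * g * w :=
        mul_le_mul_of_nonneg_right (by push_cast; omega) (by positivity)
      linarith
    have he : g * E.frobExp n ≤ 10 * (g * E.D * (n + 1)) := by
      have := Nat.mul_le_mul_left g (E.frobExp_le n)
      linarith
    have hgD1 : g ≤ g * E.D * (n + 1) := by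
      have := hgD 1
      push_cast at this
      have h2 : ((g : ℕ) : ℤ) ≤ ((g * E.D * (n + 1) : ℕ) : ℤ) := by push_cast; linarith
      exact_mod_cast h2
    -- With `K = g D (n + 1) ≥ 1` the left side is at most `2 (32 + 90 + 8 + 3) K = 266 K ≤ 2 ^ 9
    -- K`, and `K ≤ g² (n + 1)`.
    have hlam : 2 * (32 * (g * E.D * (n + 1)) + 9 * g * E.frobExp n + 8 * g + 3) ≤
        2 ^ (9 + 2 * Nat.clog 2 (g + 1) + Nat.clog 2 (n + 1)) := by
      have h1 : g ≤ 2 ^ Nat.clog 2 (g + 1) :=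
        (Nat.le_succ g).trans (Nat.le_pow_clog one_lt_two _)
      have h2 : n + 1 ≤ 2 ^ Nat.clog 2 (n + 1) := Nat.le_pow_clog one_lt_two _
      have h3 : g * E.D * (n + 1) ≤ g * g * (n + 1) :=
        Nat.mul_le_mul_right _ (Nat.mul_le_mul_left _ (E.D_le hg))
      have h4 : g * g * (n + 1) ≤ 2 ^ (2 * Nat.clog 2 (g + 1) + Nat.clog 2 (n + 1)) := by
        rw [pow_add, two_mul, pow_add]
        exact Nat.mul_le_mul (Nat.mul_le_mul h1 h1) h2
      rw [add_assoc 9, pow_add 2 9]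
      nlinarith
    obtain ⟨v, F, h1, h2, h3⟩ := E.exists_integral_reduction hg (M := E.frobExp n)
      (A := 32 * (g * E.D * (n + 1)))
      ((ha 0 1 (by simp)).mono (le_of_eq (by push_cast; ring))) hlam
    refine ⟨v, F, h1, h2, fun w hw => ?_⟩
    obtain ⟨h4, h5⟩ := h3 1 w _ (by simpa using hw) (ha 1 w (by simpa using hw))
    have h6 : (g * w * E.frobExp n : ℤ) ≤ 10 * (g * E.D * w * (n + 1)) := by
      have := Nat.mul_le_mul_right w he
      have h7 : ((g * E.frobExp n * w : ℕ) : ℤ) ≤ ((10 * (g * E.D * (n + 1)) * w : ℕ) : ℤ) := by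
        exact_mod_cast this
      push_cast at h7
      linarith
    have h7 := hgD w
    -- The weight `32` of the term and the exponent bound `10 D (n + 1)` give `127 = 32 + 9 * 10 +
    -- 5` and `112 = 32 + 8 * 10`.
    exact ⟨h4.mono (by push_cast; linarith), h5.mono (by push_cast; linarith)⟩
  choose v F h using key
  exact ⟨v, F, h⟩

end Family
end DeformedCurve
end

/-! ### Summation of the reduced terms. -/

noncomputable section

namespace DeformedCurve

open Polynomial

namespace Family

variable {k : Type*} [Field k] [CharP k 2] {g : ℕ} (E : Family k g)

theorem polyW_C (p : (Zq k)[X]) : polyW k (C p) = polyMap₁ (.inl 0) p := polyMap_C _ _ _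

theorem sum_polyW_rename {F : (Zq k)[X][X]} {n e : ℕ} (hF : F.degree < (n : ℕ)) (a : Qq k) :
    ∑ j : Fin n, polyW k (X ^ (j : ℕ)) * MvPolynomial.rename
      (Function.Embedding.inl : Fin 2 ↪ Fin 2 ⊕ Fin 3) (MvPolynomial.X 1 ^ e *
        (MvPolynomial.C a * polyMap₁ 0 (F.coeff j))) =
      MvPolynomial.X (.inl 1) ^ e * (MvPolynomial.C a * polyW k F) := by
  conv_rhs => rw [sum_fin_of_degree_lt hF, map_sum, Finset.mul_sum, Finset.mul_sum]
  refine Finset.sum_congr rfl fun j _ => ?_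
  rw [map_mul, map_mul, map_pow (MvPolynomial.rename _), MvPolynomial.rename_X,
    MvPolynomial.rename_C, rename_polyMap₁, map_mul (polyW k), polyW_C,
    Function.Embedding.inl_apply, Function.Embedding.inl_apply]
  ring

/-- The reduction of a single term of the series for the image of `Y`. -/
theorem reduction_term {e n S m : ℕ} {a v F : (Zq k)[X][X]}
    (h : 2 ^ S * (C E.r ^ e * a) = E.data.nabla e v + E.H ^ e * F)
    (hF : F.degree < (m : ℕ)) {a' : MvPolynomial (Fin 2 ⊕ Fin 3) (Qq k)} (ha' : polyW k a = a') :
    MvPolynomial.X (.inr 2) ^ e * (MvPolynomial.C (2 ^ n) * a')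
      - (polyW k E.data.Δ * (MvPolynomial.X (.inl 1) ^ e * (MvPolynomial.C ((2 : Qq k) ^ ((n : ℤ) - S))
          * (MvPolynomial.X (.inr 2) ^ e * polyW k (derivative v))))
        - polyW k (derivative E.H * E.data.Δ₁) * (MvPolynomial.X (.inl 1) ^ e *
          (MvPolynomial.C ((2 : Qq k) ^ ((n : ℤ) - S)) *
            ((e : MvPolynomial _ _) * (MvPolynomial.X (.inr 2) ^ e * polyW k v))))
        + polyW k (3 * (E.h * derivative E.h + 2 * derivative E.f)) * (MvPolynomial.X (.inl 1) ^ e *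
          (MvPolynomial.C ((2 : Qq k) ^ ((n : ℤ) - S)) *
            (MvPolynomial.X (.inr 2) ^ e * polyW k v))))
      - ∑ j : Fin m, polyW k (X ^ (j : ℕ)) * MvPolynomial.rename
        (Function.Embedding.inl : Fin 2 ↪ Fin 2 ⊕ Fin 3) (MvPolynomial.X 1 ^ e *
        (MvPolynomial.C ((2 : Qq k) ^ ((n : ℤ) - S)) * polyMap₁ 0 (F.coeff j)))
      = (MvPolynomial.X (.inr 2) * polyW k E.H - 1) * (MvPolynomial.X (.inl 1) ^ e *
          (MvPolynomial.C ((2 : Qq k) ^ ((n : ℤ) - S)) * (polyW k F *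
            ∑ l ∈ Finset.range e, (MvPolynomial.X (.inr 2) * polyW k E.H) ^ l)))
        - (MvPolynomial.X (.inl 1) * polyW k (C E.r) - 1) * (MvPolynomial.X (.inr 2) ^ e *
          (MvPolynomial.C (2 ^ n) * (a' *
            ∑ l ∈ Finset.range e, (MvPolynomial.X (.inl 1) * polyW k (C E.r)) ^ l))) := by
  have hP : MvPolynomial.C (2 ^ n) = MvPolynomial.C ((2 : Qq k) ^ ((n : ℤ) - S)) *
      (2 : MvPolynomial (Fin 2 ⊕ Fin 3) (Qq k)) ^ S := by
    have h2 : (2 : MvPolynomial (Fin 2 ⊕ Fin 3) (Qq k)) = MvPolynomial.C 2 := (map_ofNat _ 2).symm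
    rw [h2, ← map_pow, ← map_mul, ← zpow_natCast, ← zpow_natCast, ← zpow_add₀ two_ne_zero_Qq,
      sub_add_cancel]
  have h5 := congrArg (polyW k) h
  rw [CurveData.nabla, data_H, data_h, data_f, map_mul, map_pow, map_ofNat, map_mul, map_pow,
    ha', map_add, map_add, map_sub, map_mul, map_mul, map_mul, map_mul, map_natCast, map_mul,
    map_mul, map_mul, map_ofNat, map_pow] at h5
  -- The geometric sums exhibit `(w H) ^ e - 1` and `(z r) ^ e - 1` as explicit multiples of the
  -- relations, so that the identity can be summed over `n` before passing to `T`.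
  have g1 := mul_geom_sum (MvPolynomial.X (.inr 2) * polyW k E.H) e
  have g2 := mul_geom_sum (MvPolynomial.X (.inl 1) * polyW k (C E.r)) e
  rw [mul_pow] at g1 g2
  rw [sum_polyW_rename hF, map_mul (polyW k) (derivative E.H), map_mul (polyW k) 3, map_ofNat, hP]
  linear_combination (MvPolynomial.X (.inl 1) ^ e * MvPolynomial.X (.inr 2) ^ e
    * MvPolynomial.C ((2 : Qq k) ^ ((n : ℤ) - S))) * h5
    - (MvPolynomial.X (.inl 1) ^ e * MvPolynomial.C ((2 : Qq k) ^ ((n : ℤ) - S))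
      * polyW k F) * g1 + (MvPolynomial.X (.inr 2) ^ e *
      MvPolynomial.C ((2 : Qq k) ^ ((n : ℤ) - S)) * 2 ^ S * a') * g2

theorem pderiv_X_term (a : Qq k) (e : ℕ) (v : (Zq k)[X][X]) :
    MvPolynomial.pderiv (.inr 0) (MvPolynomial.X (.inl 1) ^ e *
      (MvPolynomial.C a * (MvPolynomial.X (.inr 2) ^ e * polyW k v))) =
      MvPolynomial.X (.inl 1) ^ e *
        (MvPolynomial.C a * (MvPolynomial.X (.inr 2) ^ e * polyW k (derivative v))) := by
  rw [MvPolynomial.pderiv_mul, MvPolynomial.pderiv_mul, MvPolynomial.pderiv_mul,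
    MvPolynomial.pderiv_pow, MvPolynomial.pderiv_pow, MvPolynomial.pderiv_C,
    MvPolynomial.pderiv_X_of_ne (by simp), MvPolynomial.pderiv_X_of_ne (by simp), polyW,
    pderiv_polyMap (by simp)]
  ring

theorem pderiv_Y_term (a : Qq k) (e : ℕ) (v : (Zq k)[X][X]) :
    MvPolynomial.pderiv (.inr 1) (MvPolynomial.X (.inl 1) ^ e *
      (MvPolynomial.C a * (MvPolynomial.X (.inr 2) ^ e * polyW k v))) = 0 := by
  rw [MvPolynomial.pderiv_mul, MvPolynomial.pderiv_mul, MvPolynomial.pderiv_mul,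
    MvPolynomial.pderiv_pow, MvPolynomial.pderiv_pow, MvPolynomial.pderiv_C,
    MvPolynomial.pderiv_X_of_ne (by simp), MvPolynomial.pderiv_X_of_ne (by simp), polyW,
    pderiv_polyMap_of_ne (by simp) (by simp)]
  ring

theorem pderiv_w_term (a : Qq k) (e : ℕ) (v : (Zq k)[X][X]) :
    MvPolynomial.pderiv (.inr 2) (MvPolynomial.X (.inl 1) ^ e *
      (MvPolynomial.C a * (MvPolynomial.X (.inr 2) ^ e * polyW k v))) =
      MvPolynomial.X (.inl 1) ^ e * (MvPolynomial.C a *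
        ((e : MvPolynomial _ _) * MvPolynomial.X (.inr 2) ^ (e - 1) * polyW k v)) := by
  rw [MvPolynomial.pderiv_mul, MvPolynomial.pderiv_mul, MvPolynomial.pderiv_mul,
    MvPolynomial.pderiv_pow, MvPolynomial.pderiv_pow, MvPolynomial.pderiv_C,
    MvPolynomial.pderiv_X_of_ne (by simp), MvPolynomial.pderiv_X_self, polyW,
    pderiv_polyMap_of_ne (by simp) (by simp)]
  ring

variable [PerfectRing k 2]

/-- The series is differentiated term by term. The derivative of `w ^ e`, where `w` stands for `1 /
H`, is `-e H' w ^ (e + 1)`; this accounts for the third series, with the factors `e n`. -/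
theorem delta_hasSum {S e : ℕ → ℕ} (he : ∀ n, n ≤ e n) {v : ℕ → (Zq k)[X][X]} {b bX eb : W k}
    (hb : Dagger.HasSum (fun n => MvPolynomial.X (.inl 1) ^ e n *
      (MvPolynomial.C ((2 : Qq k) ^ ((n : ℤ) - S n)) *
        (MvPolynomial.X (.inr 2) ^ e n * polyW k (v n)))) b)
    (hbX : Dagger.HasSum (fun n => MvPolynomial.X (.inl 1) ^ e n *
      (MvPolynomial.C ((2 : Qq k) ^ ((n : ℤ) - S n)) *
        (MvPolynomial.X (.inr 2) ^ e n * polyW k (derivative (v n))))) bX)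
    (heb : Dagger.HasSum (fun n => MvPolynomial.X (.inl 1) ^ e n *
      (MvPolynomial.C ((2 : Qq k) ^ ((n : ℤ) - S n)) *
        ((e n : MvPolynomial _ _) * (MvPolynomial.X (.inr 2) ^ e n * polyW k (v n))))) eb) :
    E.delta (E.mkT b) = E.Z * (E.mkT bX - E.evHom (derivative E.H) * E.invH * E.mkT eb) := by
  have hpX : Dagger.pderiv (.inr 0) b = bX := by
    have h2 := hb.pderiv (.inr 0) (by simp only [pderiv_X_term]; exact hbX.tagged)
    simp only [pderiv_X_term] at h2
    exact h2.unique hbX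
  have hpY : Dagger.pderiv (.inr 1) b = 0 := by
    have h2 := hb.pderiv (.inr 1) (by simp only [pderiv_Y_term]; exact Dagger.hasSum_zero.tagged)
    simp only [pderiv_Y_term] at h2
    exact h2.unique Dagger.hasSum_zero
  have hpw : Dagger.ofPoly (MvPolynomial.X (.inr 2)) * Dagger.pderiv (.inr 2) b = eb := by
    have h2 := (hb.pderiv (.inr 2) (by
      simp only [pderiv_w_term]
      exact Dagger.tagged_of_X_pow_mul he _ _)).ofPoly_mul (MvPolynomial.X (.inr 2))
    refine h2.unique ?_
    convert heb using 1
    funext n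
    rw [pderiv_w_term]
    rcases Nat.eq_zero_or_pos (e n) with h3 | h3
    · rw [h3, Nat.cast_zero]; ring
    · obtain ⟨m, hm⟩ := Nat.exists_eq_succ_of_ne_zero h3.ne'
      rw [hm]
      simp only [Nat.succ_eq_add_one, Nat.add_sub_cancel, pow_succ]
      ring
  rw [delta_mkT, scaledDeriv, hpX, hpY, ← hpw, map_mul, map_zero]
  change E.Z * (_ - E.evHom _ * _ * _) + _ * 0 = E.Z * (_ - _ * _ * (E.toT _ * _))
  rw [toT_X]
  change E.Z * (_ - E.evHom _ * _ * _) + _ * 0 = E.Z * (_ - _ * _ * (E.invH * _))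
  ring

theorem mkT_toT (p : MvPolynomial (Fin 2 ⊕ Fin 3) (Qq k)) :
    E.mkT (Dagger.ofPoly p) = E.toT p := rfl

/-- The reduction of the series `X ^ (2 i + 1) β` in the cohomology. -/
theorem exists_sum_reduction {B : ℕ → (Zq k)[X][X]} {β : W k}
    (hβ : Dagger.HasSum (fun n => MvPolynomial.X (.inr 2) ^ E.frobExp n *
      (MvPolynomial.C (2 ^ n) * polyW k (B n))) β)
    (hB : ∀ n α w : ℕ, α * E.κ ≤ w → WeightLE α w (28 * g * E.D * w * (n + 1)) (B n))
    {i : ℕ} {v F : ℕ → (Zq k)[X][X]} (hvF : ∀ n,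
      2 ^ loss g n * (C E.r ^ E.frobExp n * (X ^ (2 * i + 1) * B n)) =
        E.data.nabla (E.frobExp n) (v n) + E.H ^ E.frobExp n * F n ∧
      (F n).degree < (2 * g : ℕ) ∧ ∀ w : ℕ, E.κ ≤ w →
        WeightLE 1 w ((127 * g * E.D * w : ℕ) * (n + 1)) (v n) ∧
        WeightLE 1 w ((112 * g * E.D * w : ℕ) * (n + 1)) (F n)) :
    ∃ φ : Fin (2 * g) → Dagger k (Fin 2),
      (∀ j : Fin (2 * g), Dagger.HasSum (fun n => MvPolynomial.X 1 ^ E.frobExp n *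
        (MvPolynomial.C ((2 : Qq k) ^ ((n : ℤ) - loss g n)) * polyMap₁ 0 ((F n).coeff j))) (φ j)) ∧
      E.Z * (E.x ^ (2 * i + 1) * E.mkT β - ∑ j : Fin (2 * g), E.mkT (incl k (φ j)) * E.x ^ (j : ℕ)) ∈
        E.exactForms := by
  have hw1 : 1 ≤ max 1 E.κ := le_max_left _ _
  have hwκ : E.κ ≤ max 1 E.κ := le_max_right _ _
  have hwκ' : 1 * E.κ ≤ max 1 E.κ := by rw [one_mul]; exact hwκ
  have he := E.le_frobExp
  have he' := E.frobExp_le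
  have hS := two_mul_loss_le g
  have hv : LinBound fun n => polyW k (v n) :=
    LinBound.polyMap hw1 (fun n => ((hvF n).2.2 _ hwκ).1) _ _
  have hv' : LinBound fun n => polyW k (derivative (v n)) :=
    LinBound.polyMap (A := 127 * g * E.D * max 1 E.κ) hw1 (fun n =>
      ((hvF n).2.2 _ hwκ).1.derivative.mono (by
      have : (0 : ℤ) ≤ (max 1 E.κ : ℕ) := Int.natCast_nonneg _
      linarith)) _ _
  have hF : LinBound fun n => polyW k (F n) :=
    LinBound.polyMap hw1 (fun n => ((hvF n).2.2 _ hwκ).2) _ _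
  have hBl : LinBound fun n => polyW k (B n) :=
    LinBound.polyMap (A := 28 * g * E.D * max 1 E.κ) hw1
      (fun n => by exact_mod_cast hB n 1 _ hwκ') _ _
  have hX : ∀ i : Fin 2 ⊕ Fin 3, LinBound fun n =>
      (MvPolynomial.X i : MvPolynomial (Fin 2 ⊕ Fin 3) (Qq k)) ^ E.frobExp n :=
    LinBound.X_pow he'
  have hconst : ∀ p : (Zq k)[X][X], ∃ d, PolyBound d 0 (polyW k p) :=
    exists_polyBound_polyMap _ _
  obtain ⟨dr, hdr⟩ := hconst (C E.r)
  obtain ⟨dH, hdH⟩ := hconst E.H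
  obtain ⟨dX, hdX⟩ := hconst (X ^ (2 * i + 1))
  have hφF : ∀ j : ℕ, LinBound fun n => (polyMap₁ 0 ((F n).coeff j) :
      MvPolynomial (Fin 2) (Qq k)) := fun j =>
    ⟨112 * g * E.D * max 1 E.κ, fun n => (polyBound_polyMap₁ _ _).mono
      (WeightLE.natDegree_coeff_le (w := max 1 E.κ) (by
        have := ((hvF n).2.2 _ hwκ).2
        exact_mod_cast this) j) le_rfl⟩
  obtain ⟨b, hb⟩ := ((hX (.inr 2)).mul hv).exists_hasSum hS he he' (.inl 1)
  obtain ⟨bX, hbX⟩ := ((hX (.inr 2)).mul hv').exists_hasSum hS he he' (.inl 1)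
  obtain ⟨eb, heb⟩ := (((hX (.inr 2)).mul hv).natCast_mul E.frobExp).exists_hasSum hS he he'
    (.inl 1)
  obtain ⟨α, hα⟩ := (((LinBound.const hdX).mul hBl).mul (LinBound.geom he'
    ((PolyBound.X (.inl 1)).mul hdr |>.mono le_rfl (by simp)))).exists_hasSum
    (S := fun _ => 0) (c := 0) (fun n => by simp) he he' (.inr 2)
  obtain ⟨α', hα'⟩ := (hF.mul (LinBound.geom he'
    ((PolyBound.X (.inr 2)).mul hdH |>.mono le_rfl (by simp)))).exists_hasSum hS he he' (.inl 1)
  have hφ' := fun j : Fin (2 * g) => (hφF j).exists_hasSum hS he he' 1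
  choose φ hφ using hφ'
  refine ⟨φ, hφ, ?_⟩
  -- This is `reduction_term` summed over `n`. The multipliers of the relations are themselves
  -- overconvergent, so the right side vanishes in `T`.
  have hkey : Dagger.ofPoly (polyW k (X ^ (2 * i + 1))) * β
      - (Dagger.ofPoly (polyW k E.data.Δ) * bX
        - Dagger.ofPoly (polyW k (derivative E.H * E.data.Δ₁)) * eb
        + Dagger.ofPoly (polyW k (3 * (E.h * derivative E.h + 2 * derivative E.f))) * b)
      - ∑ j : Fin (2 * g), Dagger.ofPoly (polyW k (X ^ (j : ℕ))) * incl k (φ j)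
      = Dagger.ofPoly (MvPolynomial.X (.inr 2) * polyW k E.H - 1) * α'
        - Dagger.ofPoly (MvPolynomial.X (.inl 1) * polyW k (C E.r) - 1) * α := by
    have h1 := ((hβ.ofPoly_mul (polyW k (X ^ (2 * i + 1)))).sub
      (((hbX.ofPoly_mul (polyW k E.data.Δ)).sub
        (heb.ofPoly_mul (polyW k (derivative E.H * E.data.Δ₁)))).add
        (hb.ofPoly_mul (polyW k (3 * (E.h * derivative E.h + 2 * derivative E.f)))))).sub
      (Dagger.HasSum.sum Finset.univ fun j _ =>
        ((hφ j).rename Function.Embedding.inl).ofPoly_mul (polyW k (X ^ (j : ℕ))))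
    have h2 := (hα'.ofPoly_mul (MvPolynomial.X (.inr 2) * polyW k E.H - 1)).sub
      (hα.ofPoly_mul (MvPolynomial.X (.inl 1) * polyW k (C E.r) - 1))
    refine h1.unique ?_
    convert h2 using 1
    funext n
    obtain ⟨h3, h4, -⟩ := hvF n
    have h5 := E.reduction_term (n := n) h3 h4 (map_mul (polyW k) _ _)
    rw [Nat.cast_zero, sub_zero, zpow_natCast, ← h5]
    ring
  have hdelta := E.delta_hasSum he hb hbX heb
  have h1 := E.Z_mul_mem_exactForms hdelta
  have h2 := congrArg E.mkT hkey
  have hzr : E.mkT (Dagger.ofPoly (MvPolynomial.X (.inl 1) * polyW k (C E.r) - 1)) = 0 := by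
    rw [mkT_toT, map_sub, map_mul, toT_X, toT_polyW, map_one]
    exact sub_eq_zero.2 E.zT_mul_r
  have hwH : E.mkT (Dagger.ofPoly (MvPolynomial.X (.inr 2) * polyW k E.H - 1)) = 0 := by
    rw [mkT_toT, map_sub, map_mul, toT_X, toT_polyW, map_one]
    exact sub_eq_zero.2 E.invH_mul_H
  have hevX : E.evHom X = E.x := eval₂_X _ _
  have hpoly : ∀ p, E.mkT (Dagger.ofPoly (polyW k p)) = E.evHom p := E.toT_polyW
  simp only [map_sub E.mkT, map_add E.mkT, map_mul E.mkT, map_sum E.mkT, hzr, hwH, hpoly,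
    map_pow, hevX, zero_mul, sub_zero] at h2
  have h3 : E.x ^ (2 * i + 1) * E.mkT β - ∑ j : Fin (2 * g), E.mkT (incl k (φ j)) * E.x ^ (j : ℕ) =
      (E.mkT bX - E.evHom (derivative E.H) * E.invH * E.mkT eb) * E.evHom E.data.Δ +
      3 * E.mkT b * E.evHom (E.h * derivative E.h + 2 * derivative E.f) := by
    have h4 : E.evHom E.data.Δ = E.evHom E.H * E.evHom E.data.Δ₁ := by
      rw [← map_mul, CurveData.Δ_eq]; rfl
    have h5 : ∑ j : Fin (2 * g), E.mkT (incl k (φ j)) * E.x ^ (j : ℕ) =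
        ∑ j : Fin (2 * g), E.x ^ (j : ℕ) * E.mkT (incl k (φ j)) :=
      Finset.sum_congr rfl fun j _ => mul_comm _ _
    rw [h5, h4]
    rw [h4, map_mul E.evHom, map_mul E.evHom, map_ofNat] at h2
    linear_combination h2 + (E.evHom (derivative E.H) * E.evHom E.data.Δ₁ * E.mkT eb) *
      E.invH_mul_H
  rw [h3]
  exact h1

end Family
end DeformedCurve
end

/-! ### The Frobenius matrix and its approximation. -/

noncomputable section

namespace DeformedCurve

open Polynomial

theorem Dagger.HasSum.gaussGE_sub {k : Type*} [Field k] [CharP k 2] [PerfectRing k 2] {τ : Type*}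
    {c : ℕ → MvPolynomial τ (Qq k)} {P : Dagger k τ} (h : Dagger.HasSum c P) {n₀ : ℕ} {N : ℤ}
    (hc : ∀ n, n₀ ≤ n → ∀ m, OrdGE (N : ℝ) ((c n).coeff m)) :
    Dagger.GaussGE N (P - Dagger.ofPoly (∑ n ∈ Finset.range n₀, c n)) := by
  intro m
  change OrdGE _ (Dagger.coeff m (P - Dagger.ofPoly (∑ n ∈ Finset.range n₀, c n)))
  rw [sub_eq_add_neg, Dagger.coeff_add, Dagger.coeff_neg, Dagger.coeff_ofPoly,
    h m (n₀ + (m.degree + 1)) (by omega), MvPolynomial.coeff_sum, Finset.sum_range_add,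
    add_neg_cancel_comm]
  exact OrdGE.sum _ _ fun n _ => hc _ (Nat.le_add_right _ _) _

namespace Family

theorem natDegree_r_le {k : Type*} [Field k] [CharP k 2] {g : ℕ} (E : Family k g) :
    E.r.natDegree ≤ 3 * g * E.κ := by
  obtain ⟨s, t, h⟩ := E.exists_isBounded
  have h1 : WeightLE 1 E.κ ((3 * g * E.κ : ℕ) : ℤ) (C E.r) := by
    exact_mod_cast h.weight_r 1 E.κ (by simp)
  have := h1.natDegree_coeff_le 0
  rwa [coeff_C_zero] at this

theorem gaussGE_two_mul {k : Type*} [Field k] [CharP k 2] [PerfectRing k 2] {τ : Type*} {N : ℤ}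
    {P : Dagger k τ} (hP : Dagger.GaussGE (N - 1) P) : Dagger.GaussGE N (2 * P) := by
  have h2 : (2 : Dagger k τ) = Dagger.ofPoly (MvPolynomial.C 2) := by
    rw [map_ofNat, map_ofNat]
  have h1 : Dagger.GaussGE 1 (2 : Dagger k τ) := by
    rw [h2]
    refine Dagger.gaussGE_ofPoly.2 (PolyBound.C ?_).ord
    have := OrdGE.two_zpow (k := k) 1
    rwa [zpow_one] at this
  have := h1.mul hP
  rwa [add_sub_cancel] at this

variable {k : Type*} [Field k] [CharP k 2] {g : ℕ} (E : Family k g) [PerfectRing k 2]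

/-- `1 / r ∈ S` -/
def zS : E.S := E.mkS (Dagger.var 1)

theorem mkS_surjective : Function.Surjective E.mkS := Ideal.Quotient.mk_surjective

/-- The value in `S` of a polynomial in `Γ, z`. -/
def toS : MvPolynomial (Fin 2) (Qq k) →+* E.S :=
  E.mkS.comp (Dagger.ofPoly : MvPolynomial (Fin 2) (Qq k) →ₐ[Qq k] Dagger k (Fin 2))

/-- The value in `S` of a polynomial in `Γ`. -/
def evS : (Qq k)[X] →+* E.S := eval₂RingHom (algebraMap (Qq k) E.S) E.ΓS

theorem toS_X (i : Fin 2) : E.toS (MvPolynomial.X i) = E.mkS (Dagger.var i) := by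
  change E.mkS (Dagger.ofPoly (MvPolynomial.X i)) = _
  rw [Dagger.ofPoly_X]

theorem toS_C (a : Qq k) : E.toS (MvPolynomial.C a) = algebraMap (Qq k) E.S a := by
  change E.mkS (Dagger.ofPoly (MvPolynomial.C a)) = _
  rw [Dagger.ofPoly, MvPolynomial.aeval_C]
  rfl

theorem mkS_eval₂ (p : (Zq k)[X]) :
    E.mkS (p.eval₂ (coeffMap k (Dagger k (Fin 2))) (Dagger.var 0)) =
      E.evS (p.map (algebraMap (Zq k) (Qq k))) := by
  rw [hom_eval₂, evS, coe_eval₂RingHom, eval₂_map]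
  rfl

theorem toS_polyMap₁ (p : (Zq k)[X]) :
    E.toS (polyMap₁ 0 p) = E.evS (p.map (algebraMap (Zq k) (Qq k))) := by
  rw [← mkS_eval₂, ← Dagger.ofPoly_polyMap₁]
  rfl

theorem rS_eq : E.rS = E.evS (E.r.map (algebraMap (Zq k) (Qq k))) := by
  rw [rS, evS, coe_eval₂RingHom, eval₂_map]
  rfl

theorem zS_mul_rS : E.zS * E.rS = 1 := by
  have h : E.mkS (Dagger.var 1 * E.r.eval₂ (coeffMap k (Dagger k (Fin 2))) (Dagger.var 0) - 1) = 0 :=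
    Ideal.Quotient.eq_zero_iff_mem.2 (Ideal.subset_span (Set.mem_singleton _))
  rw [map_sub, map_mul, map_one, sub_eq_zero, mkS_eval₂, ← rS_eq] at h
  exact h

theorem SOrdGE.mul {m n : ℤ} {s t : E.S} (hs : E.SOrdGE m s) (ht : E.SOrdGE n t) :
    E.SOrdGE (m + n) (s * t) := by
  obtain ⟨P, hP, rfl⟩ := hs
  obtain ⟨Q, hQ, rfl⟩ := ht
  exact ⟨P * Q, hP.mul hQ, map_mul _ _ _⟩

/-- Truncation of the series for the entries of the Frobenius matrix. -/
theorem exists_polynomial_approx {φ : Dagger k (Fin 2)} {e S : ℕ → ℕ} {q : ℕ → (Zq k)[X]}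
    {b d n₀ dr : ℕ} {N : ℤ} (hφ : Dagger.HasSum (fun n => MvPolynomial.X 1 ^ e n *
      (MvPolynomial.C ((2 : Qq k) ^ ((n : ℤ) - S n)) * polyMap₁ 0 (q n))) φ)
    (he : ∀ n, e n ≤ b * (n + 1)) (hq : ∀ n, (q n).natDegree ≤ d * (n + 1))
    (hr : E.r.natDegree ≤ dr) (hN : ∀ n : ℕ, n₀ ≤ n → N + S n ≤ n + 1) :
    ∃ p : (Qq k)[X], p.natDegree ≤ dr * (b * n₀) + d * n₀ ∧
      E.SOrdGE N (E.rS ^ (b * n₀) * E.mkS (2 * φ) - p.eval₂ (algebraMap (Qq k) E.S) E.ΓS) := by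
  obtain ⟨c, hc⟩ : ∃ c : ℕ → MvPolynomial (Fin 2) (Qq k), c = fun n => MvPolynomial.X 1 ^ e n *
      (MvPolynomial.C ((2 : Qq k) ^ ((n : ℤ) - S n)) * polyMap₁ 0 (q n)) := ⟨_, rfl⟩
  rw [← hc] at hφ
  refine ⟨∑ n ∈ Finset.range n₀, C (2 * (2 : Qq k) ^ ((n : ℤ) - S n)) *
    ((E.r.map (algebraMap (Zq k) (Qq k))) ^ (b * n₀ - e n) *
      (q n).map (algebraMap (Zq k) (Qq k))), ?_, ?_⟩
  · refine natDegree_sum_le_of_forall_le _ _ fun n hn => (natDegree_C_mul_le _ _).trans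
      (natDegree_mul_le.trans (add_le_add (natDegree_pow_le.trans ?_)
        ((natDegree_map_le).trans ((hq n).trans ?_))))
    · rw [mul_comm dr]
      exact Nat.mul_le_mul (Nat.sub_le _ _) (natDegree_map_le.trans hr)
    · exact Nat.mul_le_mul_left _ (Finset.mem_range.1 hn)
  · have hhead : E.rS ^ (b * n₀) * E.mkS (2 * Dagger.ofPoly (∑ n ∈ Finset.range n₀, c n)) =
        E.evS (∑ n ∈ Finset.range n₀, C (2 * (2 : Qq k) ^ ((n : ℤ) - S n)) *
          ((E.r.map (algebraMap (Zq k) (Qq k))) ^ (b * n₀ - e n) *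
          (q n).map (algebraMap (Zq k) (Qq k)))) := by
      rw [map_mul E.mkS, map_ofNat]
      change _ * (2 * E.toS _) = _
      rw [map_sum, map_sum, Finset.mul_sum, Finset.mul_sum]
      refine Finset.sum_congr rfl fun n hn => ?_
      have h1 : e n ≤ b * n₀ := (he n).trans (Nat.mul_le_mul_left _ (Finset.mem_range.1 hn))
      have h2 : E.rS ^ e n * E.zS ^ e n = 1 := by rw [← mul_pow, mul_comm, zS_mul_rS, one_pow]
      have h3 : E.evS (C (2 * (2 : Qq k) ^ ((n : ℤ) - S n))) =
          2 * algebraMap (Qq k) E.S ((2 : Qq k) ^ ((n : ℤ) - S n)) := by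
        rw [evS, coe_eval₂RingHom, eval₂_C, map_mul, map_ofNat]
      rw [hc]
      beta_reduce
      rw [map_mul, map_mul, map_pow, toS_X, toS_C, toS_polyMap₁, map_mul E.evS, map_mul E.evS, h3,
        map_pow, ← rS_eq]
      change _ * (2 * (E.zS ^ _ * _)) = _
      obtain ⟨m, hm⟩ := Nat.exists_eq_add_of_le h1
      rw [hm, pow_add, Nat.add_sub_cancel_left]
      linear_combination (2 * E.rS ^ m * algebraMap (Qq k) E.S ((2 : Qq k) ^ ((n : ℤ) - S n)) *
        E.evS ((q n).map (algebraMap (Zq k) (Qq k)))) * h2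
    -- The factor `2` gains one, so order `N - 1` suffices for the tail.
    have htail : Dagger.GaussGE N (2 * (φ - Dagger.ofPoly (∑ n ∈ Finset.range n₀, c n))) := by
      refine gaussGE_two_mul (hφ.gaussGE_sub fun n hn m => ?_)
      rw [hc]
      refine (((PolyBound.X 1).pow _).mul ((polyBound_polyMap₁ 0 _).C_mul
        (OrdGE.two_zpow_sub n (S n) (t := ((N - 1 : ℤ) : ℝ)) ?_)) |>.mono le_rfl (by simp)).ord m
      have : ((N + S n : ℤ) : ℝ) ≤ ((n + 1 : ℤ) : ℝ) := by exact_mod_cast hN n hn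
      push_cast at this ⊢
      linarith
    have hrS : E.SOrdGE 0 (E.rS ^ (b * n₀)) := by
      rw [rS_eq, ← toS_polyMap₁, ← map_pow]
      exact ⟨_, Dagger.gaussGE_ofPoly.2 (by simpa using ((polyBound_polyMap₁ 0 E.r).pow _).ord), rfl⟩
    have h1 := SOrdGE.mul E hrS ⟨_, htail, rfl⟩
    rw [zero_add] at h1
    convert h1 using 1
    change _ - E.evS _ = _
    rw [← hhead, mul_sub, map_sub, mul_sub]

theorem sOrdGE_of_hasSum {φ : Dagger k (Fin 2)} {e S : ℕ → ℕ} {q : ℕ → (Zq k)[X]} {N : ℤ}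
    (hφ : Dagger.HasSum (fun n => MvPolynomial.X 1 ^ e n *
      (MvPolynomial.C ((2 : Qq k) ^ ((n : ℤ) - S n)) * polyMap₁ 0 (q n))) φ)
    (hN : ∀ n : ℕ, N + S n ≤ n + 1) : E.SOrdGE N (E.mkS (2 * φ)) := by
  refine ⟨_, gaussGE_two_mul (hφ.gaussGE fun n m => ?_), rfl⟩
  refine (((PolyBound.X 1).pow _).mul ((polyBound_polyMap₁ 0 _).C_mul
    (OrdGE.two_zpow_sub n (S n) (t := ((N - 1 : ℤ) : ℝ)) ?_)) |>.mono le_rfl (by simp)).ord m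
  have : ((N + S n : ℤ) : ℝ) ≤ ((n + 1 : ℤ) : ℝ) := by exact_mod_cast hN n
  push_cast at this ⊢
  linarith

theorem isFrobMatrix_iff {t : E.T} {F : Matrix (Fin (2 * g)) (Fin (2 * g)) E.S} :
    E.IsFrobMatrix t F ↔ ∀ i : Fin (2 * g), (E.x ^ 2) ^ (i : ℕ) * t * (2 * E.x)
      - ∑ j : Fin (2 * g), F i j • (E.x ^ (j : ℕ) * E.y) ∈ E.exactForms := by
  refine forall_congr' fun i => ?_
  rw [← Submodule.ker_mkQ E.exactForms, LinearMap.mem_ker, map_sub, map_sum, sub_eq_zero]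
  simp only [map_smul]
  rfl

/-- The number of terms of the series that determine the Frobenius matrix modulo `2 ^ N`. -/
def numTerms (g N : ℕ) : ℕ := 2 * N + 24 + 4 * Nat.clog 2 (g + 1)

/-- One has `F₂(XⁱY dX) = X^(2i+1) * 2t dX` and `2 t = β Z - h^σ`, where the polynomial part is
exact. The reduction of `X^(2i+1) β Z dX` is `∑ φᵢⱼ Xʲ Z dX`, which is `∑ 2 φᵢⱼ XʲY dX` up to exact
forms, so the entries are `2 φᵢⱼ`. -/
theorem exists_isFrobMatrix (hg : 1 ≤ g) :
    ∃ (t : E.T) (F : Matrix (Fin (2 * g)) (Fin (2 * g)) E.S), E.IsFrobY t ∧ E.IsFrobMatrix t F ∧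
      (∀ (N : ℕ) (i j : Fin (2 * g)), ∃ p : (Qq k)[X],
        p.natDegree ≤ 142 * g * E.κ * E.D * numTerms g N ∧
          E.SOrdGE (N : ℤ) (E.rS ^ (10 * E.D * numTerms g N) * F i j
            - p.eval₂ (algebraMap (Qq k) E.S) E.ΓS)) ∧
      ∀ i j : Fin (2 * g), E.SOrdGE (-((12 + 2 * Nat.clog 2 (g + 1) : ℕ) : ℤ)) (F i j) := by
  obtain ⟨t, B, β, ht, hβt, hβ, hB⟩ := E.exists_isFrobY hg
  have h1 := fun i : Fin (2 * g) => E.exists_reduction_frob hg hB i.2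
  choose v F hvF using h1
  have h2 := fun i : Fin (2 * g) => E.exists_sum_reduction hβ hB (hvF i)
  choose φ hφ hex using h2
  refine ⟨t, Matrix.of fun i j => E.mkS (2 * φ i j), ht, ?_, ?_, ?_⟩
  · rw [isFrobMatrix_iff]
    intro i
    have h3 := sub_mem (hex i) (E.evHom_mem_exactForms (X ^ (2 * (i : ℕ) + 1) * frobPoly k E.h))
    have h4 : ∑ j : Fin (2 * g), E.mkS (φ i j) • E.evHom (X ^ (j : ℕ) * E.h) ∈ E.exactForms :=
      sum_mem fun j _ => Submodule.smul_mem _ _ (E.evHom_mem_exactForms _)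
    have h5 := add_mem h3 h4
    have hX : E.evHom X = E.x := eval₂_X _ _
    convert h5 using 1
    simp only [Matrix.of_apply, mkS_smul]
    simp only [map_mul, map_pow, hX, mul_sub, map_ofNat, ← evσ_eq]
    have h6 : E.Z * ∑ j : Fin (2 * g), E.mkT (incl k (φ i j)) * E.x ^ (j : ℕ) -
        ∑ j : Fin (2 * g), E.mkT (incl k (φ i j)) * (E.x ^ (j : ℕ) * E.evHom E.h) =
        ∑ j : Fin (2 * g), 2 * E.mkT (incl k (φ i j)) * (E.x ^ (j : ℕ) * E.y) := by
      rw [Finset.mul_sum, ← Finset.sum_sub_distrib]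
      refine Finset.sum_congr rfl fun j _ => ?_
      rw [Z]; ring
    rw [← h6]
    linear_combination (-E.x ^ (2 * (i : ℕ) + 1)) * hβt
  · intro N i j
    -- The tail needs `N + loss ≤ n + 1`. Since `2 * loss ≤ n + 26 + 4 log`, this follows from `n ≥
    -- 2 N + 24 + 4 log`, the value of `numTerms`.
    obtain ⟨p, hp1, hp2⟩ := E.exists_polynomial_approx (hφ i j) E.frobExp_le
      (d := 112 * g * E.D * E.κ) (n₀ := numTerms g N) (N := N)
      (fun n => WeightLE.natDegree_coeff_le (by exact_mod_cast ((hvF i n).2.2 _ le_rfl).2) _)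
      E.natDegree_r_le (fun n hn => by
        have := two_mul_loss_le g n
        rw [numTerms] at hn
        omega)
    -- Here `142 = 3 * 10 + 112`: the power of `r` contributes `3 g κ * 10 D` per term, the
    -- remainder polynomials `112 g D κ`.
    exact ⟨p, hp1.trans (le_of_eq (by ring)), hp2⟩
  · intro i j
    refine E.sOrdGE_of_hasSum (hφ i j) fun n => ?_
    have := two_mul_loss_le g n
    push_cast
    omega

end Family
end DeformedCurve
end

/-! ### Polynomial approximation, and closedness of the ideal `(z r - 1)`. -/

noncomputable section

namespace DeformedCurve

open Polynomial

section Approx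

variable {k : Type*} [Field k] [CharP k 2] {τ : Type*}

theorem ordGE_zero_iff {x : Qq k} : OrdGE 0 x ↔ ∃ z : Zq k, x = algebraMap (Zq k) (Qq k) z := by
  have := ordGE_natCast_iff (n := 0) (x := x)
  simpa using this

theorem PolyBound.monomial {d : ℕ} {t : ℝ} {m : τ →₀ ℕ} {a : Qq k} (hm : m.degree ≤ d)
    (ha : OrdGE t a) : PolyBound d t (MvPolynomial.monomial m a) := by
  classical
  refine ⟨fun l hl => ?_, fun l => ?_⟩
  · rw [MvPolynomial.coeff_monomial] at hl
    split_ifs at hl with h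
    · rwa [← h]
    · exact absurd rfl hl
  · rw [MvPolynomial.coeff_monomial]
    split_ifs
    · exact ha
    · exact OrdGE.zero _

/-- A coefficient of degree greater than `a (M + 1)` is absent from the `M`-th approximation, hence
has order at least `M - K`. Taking `M` as large as the degree permits gives linear growth. -/
theorem isOverconvergent_of_approx {P : MvPowerSeries τ (Qq k)} {a K : ℕ}
    (h : ∀ M : ℕ, ∃ p : MvPolynomial τ (Qq k), PolyBound (a * (M + 1)) 0 p ∧
      ∀ m, OrdGE ((M : ℝ) - K) (MvPowerSeries.coeff m P - p.coeff m)) : IsOverconvergent P := by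
  refine ⟨1 / (a + 1), by positivity, -K - 2, fun m => ?_⟩
  rcases Nat.lt_or_ge a m.degree with hm | hm
  · obtain ⟨M, hM⟩ : ∃ M : ℕ, a * (M + 1) < m.degree ∧ m.degree ≤ (a + 1) * (M + 2) := by
      refine ⟨m.degree / (a + 1) - 1, ?_, ?_⟩
      · have h1 := Nat.div_mul_le_self m.degree (a + 1)
        have h2 : 1 ≤ m.degree / (a + 1) := by
          rw [Nat.one_le_div_iff (by omega)]; omega
        rw [Nat.sub_add_cancel h2]
        nlinarith
      · have h1 := Nat.lt_div_mul_add (a := m.degree) (b := a + 1) (by omega)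
        have h2 : 1 ≤ m.degree / (a + 1) := by
          rw [Nat.one_le_div_iff (by omega)]; omega
        obtain ⟨q, hq⟩ := Nat.exists_eq_add_of_le h2
        rw [hq] at h1 ⊢
        rw [Nat.add_sub_cancel_left]
        nlinarith
    obtain ⟨p, hp, hp'⟩ := h M
    have h1 : p.coeff m = 0 := by
      by_contra h0
      exact absurd (hp.degree_le m h0) (not_le.2 hM.1)
    have h2 := hp' m
    rw [h1, sub_zero] at h2
    refine h2.mono ?_
    have h3 : (m.degree : ℝ) ≤ (a + 1) * (M + 2) := by exact_mod_cast hM.2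
    rw [div_mul_eq_mul_div, one_mul]
    have h4 : (m.degree : ℝ) / (a + 1) ≤ M + 2 := by
      rw [div_le_iff₀ (by positivity)]; linarith
    linarith
  · obtain ⟨p, hp, hp'⟩ := h 0
    have h1 := (hp' m).add ((hp.ord m).mono (s := ((0 : ℕ) : ℝ) - K) (by simp))
    rw [sub_add_cancel] at h1
    refine h1.mono ?_
    have h3 : (m.degree : ℝ) ≤ a := by exact_mod_cast hm
    have h4 : 1 / ((a : ℝ) + 1) * m.degree ≤ 1 := by
      rw [div_mul_eq_mul_div, one_mul, div_le_one (by positivity)]; linarith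
    push_cast
    linarith

variable [PerfectRing k 2]

namespace Dagger

/-- `P` can be approximated modulo `2 ^ N` by integral polynomials of degree at most
`a (N + 1)`. -/
def Approx (a : ℕ) (P : Dagger k τ) : Prop :=
  ∀ N : ℕ, ∃ p : MvPolynomial τ (Qq k), PolyBound (a * (N + 1)) 0 p ∧ GaussGE (N : ℤ) (P - ofPoly p)

theorem Approx.mono {a b : ℕ} (h : a ≤ b) {P : Dagger k τ} (hP : Approx a P) : Approx b P := by
  intro N
  obtain ⟨p, hp, hp'⟩ := hP N
  exact ⟨p, hp.mono (Nat.mul_le_mul_right _ h) le_rfl, hp'⟩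

/-- Truncation in total degree `a (N + 1)` works once `a δ ≥ 1 + |ε|`, because the remaining
coefficients then have order at least `N`. -/
theorem exists_approx [Finite τ] {P : Dagger k τ} (hP : GaussGE 0 P) : ∃ a, Approx a P := by
  obtain ⟨δ, hδ, ε, h⟩ := P.2
  obtain ⟨a, ha⟩ := exists_nat_ge ((1 + |ε|) / δ)
  refine ⟨a, fun N => ⟨MvPowerSeries.truncTotal (a * (N + 1)) P.1, ⟨fun m hm => ?_, fun m => ?_⟩,
    fun m => ?_⟩⟩
  · rw [MvPowerSeries.coeff_truncTotal_eq_ite] at hm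
    split_ifs at hm with h1
    · exact h1.le
    · exact absurd rfl hm
  · rw [MvPowerSeries.coeff_truncTotal_eq_ite]
    split_ifs with h1
    · have := hP m
      rwa [Int.cast_zero] at this
    · exact OrdGE.zero _
  · change OrdGE _ (coeff m (P - ofPoly _))
    rw [sub_eq_add_neg, coeff_add, coeff_neg, coeff_ofPoly, MvPowerSeries.coeff_truncTotal_eq_ite]
    split_ifs with h1
    · change OrdGE _ (coeff m P + -coeff m P)
      rw [add_neg_cancel]
      exact OrdGE.zero _
    · rw [neg_zero, add_zero]
      refine (h m).mono ?_
      have h2 : ((a * (N + 1) : ℕ) : ℝ) ≤ m.degree := by exact_mod_cast not_lt.1 h1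
      rw [div_le_iff₀ hδ] at ha
      have h3 := mul_le_mul_of_nonneg_left h2 hδ.le
      have h4 := mul_le_mul_of_nonneg_right ha (show (0 : ℝ) ≤ N + 1 by positivity)
      have h5 := neg_abs_le ε
      have h6 : |ε| ≤ |ε| * (N + 1) := le_mul_of_one_le_right (abs_nonneg _) (by simp)
      push_cast at h3 ⊢
      nlinarith

theorem pderiv_sub (i : τ) (P Q : Dagger k τ) :
    Dagger.pderiv i (P - Q) = Dagger.pderiv i P - Dagger.pderiv i Q :=
  Subtype.ext (map_sub _ _ _)

theorem GaussGE.pderiv {N : ℤ} {P : Dagger k τ} (h : GaussGE N P) (i : τ) :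
    GaussGE N (Dagger.pderiv i P) := by
  intro m
  change OrdGE _ (MvPowerSeries.coeff m (MvPowerSeries.pderiv (Qq k) i P.1))
  rw [MvPowerSeries.coeff_pderiv]
  have h1 := (h (m + Finsupp.single i 1)).mul (OrdGE.integral (k := k) ((m i : Zq k) + 1))
  rw [map_add (algebraMap (Zq k) (Qq k)), map_one, map_natCast, add_zero] at h1
  exact h1

theorem GaussGE.pderiv_sub_ofPoly {P : Dagger k τ} {p : MvPolynomial τ (Qq k)} {N : ℤ} (i : τ)
    (h : GaussGE N (P - ofPoly p)) :
    GaussGE N (Dagger.pderiv i P - ofPoly (MvPolynomial.pderiv i p)) := by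
  rw [← pderiv_ofPoly, ← pderiv_sub]
  exact h.pderiv i

end Dagger

end Approx

namespace Family

variable {k : Type*} [Field k] [CharP k 2] {g : ℕ} (E : Family k g)

/-- The relation `z r - 1` as a polynomial. -/
def relS : MvPolynomial (Fin 2) (Qq k) := MvPolynomial.X 1 * polyMap₁ 0 E.r - 1

/-- Elimination of `z` from an integral polynomial modulo `z r - 1`. -/
theorem exists_eq_relS_mul_add {d : ℕ} {p : MvPolynomial (Fin 2) (Qq k)} (hp : PolyBound d 0 p) :
    ∃ (κ : MvPolynomial (Fin 2) (Qq k)) (t : (Zq k)[X]),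
      PolyBound (d * (E.r.natDegree + 2)) 0 κ ∧
      p = E.relS * κ + polyMap₁ 0 t * MvPolynomial.X 1 ^ d := by
  have key : ∀ m : Fin 2 →₀ ℕ, ∃ (κ : MvPolynomial (Fin 2) (Qq k)) (t : (Zq k)[X]),
      PolyBound (d * (E.r.natDegree + 2)) 0 κ ∧
      MvPolynomial.monomial m (p.coeff m) = E.relS * κ + polyMap₁ 0 t * MvPolynomial.X 1 ^ d := by
    intro m
    by_cases hm : p.coeff m = 0
    · exact ⟨0, 0, PolyBound.zero _ _, by rw [hm]; simp⟩
    have hd := hp.degree_le m hm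
    obtain ⟨a, ha⟩ := ordGE_zero_iff.1 (hp.ord m)
    have hm2 : m.degree = m 0 + m 1 := by
      rw [Finsupp.degree_eq_sum, Fin.sum_univ_two]
    -- Modulo `z r - 1` a smaller power of `z` equals `z ^ d` times a power of `r`; all monomials
    -- are brought to the exponent `d` in this way, with integral multipliers of bounded degree.
    have hz := mul_geom_sum (MvPolynomial.X 1 * polyMap₁ 0 E.r : MvPolynomial (Fin 2) (Qq k))
      (d - m 1)
    refine ⟨-(MvPolynomial.monomial m (p.coeff m) * ∑ l ∈ Finset.range (d - m 1),
      (MvPolynomial.X 1 * polyMap₁ 0 E.r) ^ l), C a * X ^ m 0 * E.r ^ (d - m 1), ?_, ?_⟩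
    · refine (((PolyBound.monomial hd (hp.ord m)).mul (PolyBound.sum (d := d * (1 + E.r.natDegree))
        (t := 0) _ _ fun l hl => ?_)).neg).mono (le_of_eq (by ring)) (by simp)
      refine (((PolyBound.X 1).mul (polyBound_polyMap₁ 0 E.r)).mono le_rfl (by simp)
        |>.pow l).mono ?_ le_rfl
      exact Nat.mul_le_mul_right _ ((Finset.mem_range.1 hl).le.trans (Nat.sub_le _ _))
    · have h1 : MvPolynomial.monomial m (p.coeff m) = MvPolynomial.C (algebraMap (Zq k) (Qq k) a) *
          MvPolynomial.X 0 ^ m 0 * MvPolynomial.X 1 ^ m 1 := by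
        rw [ha, MvPolynomial.monomial_eq, Finsupp.prod_fintype _ _ (by simp), Fin.prod_univ_two,
          mul_assoc]
      have h2 : polyMap₁ (0 : Fin 2) (C a * X ^ m 0 * E.r ^ (d - m 1)) =
          MvPolynomial.C (algebraMap (Zq k) (Qq k) a) * MvPolynomial.X 0 ^ m 0 *
            polyMap₁ 0 E.r ^ (d - m 1) := by
        rw [map_mul, map_mul, map_pow, map_pow]
        simp [polyMap₁]
      have h3 : (MvPolynomial.X 1 : MvPolynomial (Fin 2) (Qq k)) ^ d =
          MvPolynomial.X 1 ^ m 1 * MvPolynomial.X 1 ^ (d - m 1) := by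
        rw [← pow_add, Nat.add_sub_cancel' (by omega)]
      rw [h2, h3, h1, relS]
      rw [mul_pow] at hz
      linear_combination (MvPolynomial.C (algebraMap (Zq k) (Qq k) a) *
        MvPolynomial.X 0 ^ m 0 * MvPolynomial.X 1 ^ m 1) * hz
  choose κ t hκ h using key
  refine ⟨∑ m ∈ p.support, κ m, ∑ m ∈ p.support, t m, PolyBound.sum _ _ fun m _ => hκ m, ?_⟩
  conv_lhs => rw [p.as_sum]
  rw [Finset.sum_congr rfl fun m _ => h m, Finset.sum_add_distrib, ← Finset.mul_sum, map_sum,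
    Finset.sum_mul]

variable [PerfectRing k 2]

theorem ofPoly_relS : Dagger.ofPoly E.relS =
    Dagger.var 1 * E.r.eval₂ (coeffMap k (Dagger k (Fin 2))) (Dagger.var 0) - 1 := by
  rw [relS, map_sub, map_mul, map_one, Dagger.ofPoly_X, Dagger.ofPoly_polyMap₁]

/-- The quotient `σ / (z r - 1)` exists as a formal power series, since `z r - 1` has constant term
`-1` and an integral inverse. It is approximated by the polynomials `κ` of linearly growing degree,
hence is overconvergent, so `σ` lies in the ideal. -/
theorem mkS_eq_zero_of_approx {σ : Dagger k (Fin 2)} {a K : ℕ}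
    (h : ∀ M : ℕ, ∃ κ : MvPolynomial (Fin 2) (Qq k), PolyBound (a * (M + 1)) 0 κ ∧
      Dagger.GaussGE ((M : ℤ) - K) (σ - Dagger.ofPoly (E.relS * κ))) : E.mkS σ = 0 := by
  obtain ⟨q, hq⟩ : ∃ q : MvPolynomial (Fin 2) (Zq k),
      q = MvPolynomial.X 1 * E.r.eval₂ MvPolynomial.C (MvPolynomial.X 0) - 1 := ⟨_, rfl⟩
  have hq1 : MvPolynomial.map (algebraMap (Zq k) (Qq k)) q = E.relS := by
    have h1 : (MvPolynomial.map (algebraMap (Zq k) (Qq k))).comp MvPolynomial.C =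
        (MvPolynomial.C (σ := Fin 2)).comp (algebraMap (Zq k) (Qq k)) :=
      RingHom.ext fun x => MvPolynomial.map_C _ _
    rw [hq, map_sub, map_mul, map_one, MvPolynomial.map_X, hom_eval₂, MvPolynomial.map_X, relS, h1]
    rfl
  have hq2 : IsUnit (q : MvPowerSeries (Fin 2) (Zq k)) := by
    rw [MvPowerSeries.isUnit_iff_constantCoeff]
    have : MvPowerSeries.constantCoeff (q : MvPowerSeries (Fin 2) (Zq k)) = -1 := by
      rw [← MvPowerSeries.coeff_zero_eq_constantCoeff_apply, MvPolynomial.coeff_coe,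
        ← MvPolynomial.constantCoeff_eq, hq]
      simp
    rw [this]
    exact isUnit_one.neg
  obtain ⟨u, hu⟩ := hq2.exists_left_inv
  obtain ⟨v, hv⟩ : ∃ v, v = MvPowerSeries.map (algebraMap (Zq k) (Qq k)) u := ⟨_, rfl⟩
  have hv0 : ∀ m, OrdGE 0 (MvPowerSeries.coeff m v) := by
    intro m
    rw [hv, MvPowerSeries.coeff_map]
    exact OrdGE.integral _
  have hv1 : v * (Dagger.ofPoly E.relS).1 = 1 := by
    rw [Dagger.val_ofPoly, ← hq1, hv, ← map_one (MvPowerSeries.map (algebraMap (Zq k) (Qq k))), ← hu,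
      map_mul]
    congr 1
  have hκ : IsOverconvergent (v * σ.1) := by
    refine isOverconvergent_of_approx (a := a) (K := K) fun M => ?_
    obtain ⟨κ, h1, h2⟩ := h M
    refine ⟨κ, h1, fun m => ?_⟩
    have h3 : v * (σ - Dagger.ofPoly (E.relS * κ)).1 = v * σ.1 - (κ : MvPowerSeries _ _) := by
      have h4 : (σ - Dagger.ofPoly (E.relS * κ)).1 =
          σ.1 - (Dagger.ofPoly E.relS).1 * (κ : MvPowerSeries _ _) := by
        rw [map_mul, ← Dagger.val_ofPoly κ]
        rfl
      rw [h4, mul_sub, ← mul_assoc, hv1, one_mul]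
    rw [← MvPolynomial.coeff_coe, ← map_sub, ← h3, MvPowerSeries.coeff_mul]
    refine OrdGE.sum _ _ fun x _ => ?_
    have h5 := (hv0 x.1).mul (h2 x.2)
    rw [zero_add] at h5
    exact_mod_cast h5
  refine Ideal.Quotient.eq_zero_iff_mem.2 (Ideal.mem_span_singleton'.2 ⟨⟨v * σ.1, hκ⟩, ?_⟩)
  rw [← ofPoly_relS]
  refine Subtype.ext ?_
  change v * σ.1 * (Dagger.ofPoly E.relS).1 = σ.1
  rw [mul_right_comm, hv1, one_mul]

end Family
end DeformedCurve
end

/-! ### Evaluation of relations in a differential ring where denominators can be cleared. -/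

noncomputable section

namespace DeformedCurve

open Polynomial

namespace Family

variable {k : Type*} [Field k] [CharP k 2] {g : ℕ} (E : Family k g)

/-- A differential ring containing `ℤ_q[Γ, X]` in which `r` and `H` are invertible. -/
structure Realization (R A : Type*) [CommRing R] [CommRing A] [Algebra R A] where
  /-- the embedding of `ℤ_q[Γ, X]` -/
  ι : (Zq k)[X][X] →+* A
  /-- the embedding of `ℚ_q` -/
  c : Qq k →+* A
  /-- the inverse of `r` -/
  rinv : A
  /-- the inverse of `H` -/
  Hinv : A
  /-- the derivation `∂/∂X` -/
  D : Derivation R A A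
  ι_injective : Function.Injective ι
  c_algebraMap : ∀ a, c (algebraMap (Zq k) (Qq k) a) = ι (C (C a))
  rinv_mul : rinv * ι (C E.r) = 1
  Hinv_mul : Hinv * ι E.H = 1
  D_c : ∀ a, D (c a) = 0
  D_ι : ∀ p, D (ι p) = ι (derivative p)

/-- The polynomial representing `(2 Y + h) ∂p/∂X`. -/
def scaledDerivPoly (p : MvPolynomial (Fin 2 ⊕ Fin 3) (Qq k)) :
    MvPolynomial (Fin 2 ⊕ Fin 3) (Qq k) :=
  (2 * MvPolynomial.X (.inr 1) + polyW k E.h) *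
      (MvPolynomial.pderiv (.inr 0) p
        - polyW k (derivative E.H) * MvPolynomial.X (.inr 2) ^ 2 * MvPolynomial.pderiv (.inr 2) p)
    + (polyW k (derivative E.f) - polyW k (derivative E.h) * MvPolynomial.X (.inr 1)) *
      MvPolynomial.pderiv (.inr 1) p

theorem scaledDerivPoly_add (p q : MvPolynomial (Fin 2 ⊕ Fin 3) (Qq k)) :
    E.scaledDerivPoly (p + q) = E.scaledDerivPoly p + E.scaledDerivPoly q := by
  simp only [scaledDerivPoly, map_add]
  ring

theorem scaledDerivPoly_mul (p q : MvPolynomial (Fin 2 ⊕ Fin 3) (Qq k)) :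
    E.scaledDerivPoly (p * q) = p * E.scaledDerivPoly q + q * E.scaledDerivPoly p := by
  simp only [scaledDerivPoly, MvPolynomial.pderiv_mul]
  ring

namespace Realization

variable {E} {R A : Type*} [CommRing R] [CommRing A] [Algebra R A] (ρ : E.Realization R A)

/-- The quadratic extension of `A` generated by `Y`. -/
abbrev Quad : Type _ := QuadraticAlgebra A (ρ.ι E.f) (-ρ.ι E.h)

/-- The values of the variables `Γ, z, X, Y, w`. -/
def point : Fin 2 ⊕ Fin 3 → ρ.Quad :=
  Sum.elim ![⟨ρ.ι (C X), 0⟩, ⟨ρ.rinv, 0⟩] ![⟨ρ.ι X, 0⟩, ⟨0, 1⟩, ⟨ρ.Hinv, 0⟩]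

/-- The evaluation of polynomials in `Γ, z, X, Y, w`. -/
def eval : MvPolynomial (Fin 2 ⊕ Fin 3) (Qq k) →+* ρ.Quad :=
  MvPolynomial.eval₂Hom ((algebraMap A ρ.Quad).comp ρ.c) ρ.point

theorem eval_X (i : Fin 2 ⊕ Fin 3) : ρ.eval (MvPolynomial.X i) = ρ.point i :=
  MvPolynomial.eval₂Hom_X' _ _ _

theorem eval_C (a : Qq k) : ρ.eval (MvPolynomial.C a) = ⟨ρ.c a, 0⟩ :=
  MvPolynomial.eval₂Hom_C _ _ _

theorem eval_polyW (p : (Zq k)[X][X]) : ρ.eval (polyW k p) = ⟨ρ.ι p, 0⟩ := by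
  have h : ρ.eval.comp (polyW k) = (algebraMap A ρ.Quad).comp ρ.ι := by
    refine Polynomial.ringHom_ext' (Polynomial.ringHom_ext' (RingHom.ext fun a => ?_) ?_) ?_
    · have h1 := ρ.eval_C (algebraMap (Zq k) (Qq k) a)
      rw [ρ.c_algebraMap] at h1
      have h2 : polyW k (C (C a)) = MvPolynomial.C (algebraMap (Zq k) (Qq k) a) := by
        simp [polyW, polyMap, polyMap₁]
      exact (congrArg ρ.eval h2).trans h1
    · have h2 : polyW k (C X) = MvPolynomial.X (.inl 0) := by simp [polyW, polyMap, polyMap₁]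
      exact (congrArg ρ.eval h2).trans (ρ.eval_X (.inl 0))
    · have h2 : polyW k X = MvPolynomial.X (.inr 0) := by simp [polyW, polyMap]
      exact (congrArg ρ.eval h2).trans (ρ.eval_X (.inr 0))
  exact congrArg (fun ψ => ψ p) h

theorem D_Hinv : ρ.D ρ.Hinv = -(ρ.ι (derivative E.H) * ρ.Hinv ^ 2) := by
  have h := congrArg ρ.D ρ.Hinv_mul
  rw [Derivation.leibniz, ρ.D_ι, Derivation.map_one_eq_zero, smul_eq_mul, smul_eq_mul] at h
  linear_combination ρ.Hinv * h - ρ.D ρ.Hinv * ρ.Hinv_mul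

theorem D_rinv : ρ.D ρ.rinv = 0 := by
  have h := congrArg ρ.D ρ.rinv_mul
  rw [Derivation.leibniz, ρ.D_ι, Derivation.map_one_eq_zero, smul_eq_mul, smul_eq_mul,
    derivative_C, map_zero] at h
  linear_combination ρ.rinv * h - ρ.D ρ.rinv * ρ.rinv_mul

/-- The derivation `(2 Y + h) ∂/∂X`. -/
def deriv : Derivation R ρ.Quad ρ.Quad := quadDeriv ρ.D (ρ.ι E.f) (ρ.ι E.h)

theorem deriv_re (u : ρ.Quad) : (ρ.deriv u).re =
    ρ.ι E.h * ρ.D u.re + 2 * ρ.ι E.f * ρ.D u.im + u.im * ρ.D (ρ.ι E.f) := rfl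

theorem deriv_im (u : ρ.Quad) : (ρ.deriv u).im =
    2 * ρ.D u.re - ρ.ι E.h * ρ.D u.im - u.im * ρ.D (ρ.ι E.h) := rfl

theorem two_mul_Y_add_h : (2 * ⟨0, 1⟩ + ⟨ρ.ι E.h, 0⟩ : ρ.Quad) = ⟨ρ.ι E.h, 2⟩ := by
  rw [two_mul]
  ext1 <;> simp [one_add_one_eq_two]

theorem eval_scaledDerivPoly_X (i : Fin 2 ⊕ Fin 3) :
    ρ.eval (E.scaledDerivPoly (MvPolynomial.X i)) = ρ.deriv (ρ.point i) := by
  have h2 : ρ.eval 2 = 2 := map_ofNat _ _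
  have hY : ρ.eval (MvPolynomial.X (.inr 1)) = ⟨0, 1⟩ := ρ.eval_X _
  have hw : ρ.eval (MvPolynomial.X (.inr 2)) = ⟨ρ.Hinv, 0⟩ := ρ.eval_X _
  have key : ∀ a b c : MvPolynomial (Fin 2 ⊕ Fin 3) (Qq k),
      ρ.eval ((2 * MvPolynomial.X (.inr 1) + polyW k E.h) *
      (a - polyW k (derivative E.H) * MvPolynomial.X (.inr 2) ^ 2 * b)
    + (polyW k (derivative E.f) - polyW k (derivative E.h) * MvPolynomial.X (.inr 1)) * c) =
      ⟨ρ.ι E.h, 2⟩ * (ρ.eval a - ⟨ρ.ι (derivative E.H), 0⟩ * ⟨ρ.Hinv, 0⟩ ^ 2 * ρ.eval b) +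
      (⟨ρ.ι (derivative E.f), 0⟩ - ⟨ρ.ι (derivative E.h), 0⟩ * ⟨0, 1⟩) * ρ.eval c := by
    intro a b c
    simp only [map_add, map_sub, map_mul, map_pow, h2, hY, hw, eval_polyW, two_mul_Y_add_h]
  rw [scaledDerivPoly, key]
  rcases i with i | i
  · rw [MvPolynomial.pderiv_X_of_ne (by simp), MvPolynomial.pderiv_X_of_ne (by simp),
      MvPolynomial.pderiv_X_of_ne (by simp), map_zero, mul_zero, mul_zero, sub_zero, mul_zero,
      add_zero]
    have h1 : ρ.D (ρ.ι (C X)) = 0 := by rw [ρ.D_ι, derivative_C, map_zero]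
    fin_cases i <;> ext1 <;> simp [point, deriv_re, deriv_im, h1, D_rinv]
  · fin_cases i
    · have h1 : ρ.D (ρ.ι X) = 1 := by rw [ρ.D_ι, derivative_X, map_one]
      ext1 <;> simp [point, deriv_re, deriv_im, h1, MvPolynomial.pderiv_X]
    · ext1 <;> simp [point, deriv_re, deriv_im, ρ.D_ι, MvPolynomial.pderiv_X]
    · ext1 <;> simp [point, deriv_re, deriv_im, ρ.D_Hinv, MvPolynomial.pderiv_X,
        pow_two]

theorem eval_scaledDerivPoly (p : MvPolynomial (Fin 2 ⊕ Fin 3) (Qq k)) :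
    ρ.eval (E.scaledDerivPoly p) = ρ.deriv (ρ.eval p) := by
  induction p using MvPolynomial.induction_on with
  | C a =>
    have h : E.scaledDerivPoly (MvPolynomial.C a) = 0 := by simp [scaledDerivPoly]
    rw [h, map_zero, eval_C]
    ext1 <;> simp [deriv_re, deriv_im, ρ.D_c]
  | add p q hp hq => rw [scaledDerivPoly_add, map_add, map_add, map_add, hp, hq]
  | mul_X p i hp =>
    rw [scaledDerivPoly_mul, map_add, map_mul, map_mul, map_mul, hp, eval_scaledDerivPoly_X,
      Derivation.leibniz, eval_X, smul_eq_mul, smul_eq_mul]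

theorem one_def : (1 : ρ.Quad) = ⟨1, 0⟩ := rfl

theorem eval_rel_r : ρ.eval (MvPolynomial.X (.inl 1) * polyW k (C E.r) - 1) = 0 := by
  rw [map_sub, map_mul, map_one, eval_X, eval_polyW, one_def]
  ext1 <;> simp [point, ρ.rinv_mul]

theorem eval_rel_H : ρ.eval (MvPolynomial.X (.inr 2) * polyW k E.H - 1) = 0 := by
  rw [map_sub, map_mul, map_one, eval_X, eval_polyW, one_def]
  ext1 <;> simp [point, ρ.Hinv_mul]

theorem eval_rel_Y : ρ.eval (MvPolynomial.X (.inr 1) ^ 2 + polyW k E.h * MvPolynomial.X (.inr 1)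
    - polyW k E.f) = 0 := by
  rw [map_sub, map_add, map_mul, map_pow, eval_X, eval_polyW, eval_polyW, pow_two]
  ext1 <;> simp [point]

/-! ### Clearing denominators -/

/-- `(r H) ^ d u` has integral polynomial coordinates of bounded degrees. -/
def Cleared (d : ℕ) (u : ρ.Quad) : Prop :=
  ∃ V₀ V₁ : (Zq k)[X][X], WeightLE 0 1 ((2 * g + 1) * d : ℤ) V₀ ∧
    WeightLE 0 1 ((2 * g + 1) * d - (g + 1) : ℤ) V₁ ∧
    ρ.ι (C E.r * E.H) ^ d • u = ⟨ρ.ι V₀, ρ.ι V₁⟩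

variable {ρ}

theorem weight_H' : WeightLE 0 1 (g : ℤ) E.H :=
  (E.weight_of_dvd_f E.H_monic (Dvd.intro _ rfl) (α := 0) (w := 1) (by simp)).mono
    (by have := E.natDegree_H_le; push_cast; omega)

theorem weight_C (p : (Zq k)[X]) : WeightLE 0 1 0 (C p : (Zq k)[X][X]) := by
  intro i j hij
  rw [coeff_C] at hij
  split_ifs at hij with h
  · simp [h]
  · simp at hij

theorem weight_rH : WeightLE 0 1 (g : ℤ) (C E.r * E.H) :=
  ((weight_C E.r).mul weight_H').mono (by simp)

theorem weight_X : WeightLE 0 1 1 (X : (Zq k)[X][X]) := by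
  have := WeightLE.X_pow (R := Zq k) (α := 0) (w := 1) 1
  simpa using this

theorem Cleared.add {d : ℕ} {u v : ρ.Quad} (hu : ρ.Cleared d u) (hv : ρ.Cleared d v) :
    ρ.Cleared d (u + v) := by
  obtain ⟨V₀, V₁, h0, h1, h2⟩ := hu
  obtain ⟨W₀, W₁, k0, k1, k2⟩ := hv
  refine ⟨V₀ + W₀, V₁ + W₁, h0.add k0, h1.add k1, ?_⟩
  rw [smul_add, h2, k2, map_add, map_add]
  rfl

theorem Cleared.zero (d : ℕ) : ρ.Cleared d 0 :=
  ⟨0, 0, WeightLE.zero, WeightLE.zero, by rw [smul_zero, map_zero]; rfl⟩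

theorem Cleared.sum {ι' : Type*} {d : ℕ} (s : Finset ι') (u : ι' → ρ.Quad)
    (h : ∀ i ∈ s, ρ.Cleared d (u i)) : ρ.Cleared d (∑ i ∈ s, u i) := by
  classical
  induction s using Finset.induction_on with
  | empty => simpa using Cleared.zero d
  | insert a s ha ih =>
    rw [Finset.sum_insert ha]
    exact (h a (Finset.mem_insert_self a s)).add (ih fun i hi => h i (Finset.mem_insert_of_mem hi))

/-- The offset `g + 1` on the `Y`-coordinate makes the degree bounds multiplicative: the product of
two `Y`-coordinates gains `2 (g + 1)`, which pays for the degree `2 g + 1` of `f`, and, together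
with `deg h ≤ g`, for the remaining terms. -/
theorem Cleared.mul {d e : ℕ} {u v : ρ.Quad} (hu : ρ.Cleared d u) (hv : ρ.Cleared e v) :
    ρ.Cleared (d + e) (u * v) := by
  obtain ⟨V₀, V₁, h0, h1, h2⟩ := hu
  obtain ⟨W₀, W₁, k0, k1, k2⟩ := hv
  refine ⟨V₀ * W₀ + E.f * (V₁ * W₁), V₀ * W₁ + V₁ * W₀ - E.h * (V₁ * W₁), ?_, ?_, ?_⟩
  · refine ((h0.mul k0).mono ?_).add (((E.weight_f (α := 0) (w := 1) (by simp)).mul (h1.mul k1)).mono ?_)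
    · push_cast; linarith
    · push_cast; linarith
  · refine (((h0.mul k1).mono ?_).add ((h1.mul k0).mono ?_)).sub
      (((E.weight_h (α := 0) (w := 1) (by simp)).mul (h1.mul k1)).mono ?_)
    · push_cast; linarith
    · push_cast; linarith
    · push_cast; linarith
  · rw [pow_add, ← smul_mul_smul_comm, h2, k2]
    ext1 <;> simp <;> ring

theorem Cleared.of_point (i : Fin 2 ⊕ Fin 3) : ρ.Cleared 1 (ρ.point i) := by
  have hr : ρ.ι (C E.r) * ρ.rinv = 1 := by rw [mul_comm, ρ.rinv_mul]
  have hH : ρ.ι E.H * ρ.Hinv = 1 := by rw [mul_comm, ρ.Hinv_mul]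
  rcases i with i | i
  · fin_cases i
    · refine ⟨C E.r * E.H * C X, 0, (weight_rH.mul (weight_C _)).mono (by push_cast; linarith),
        WeightLE.zero, ?_⟩
      ext1 <;> simp [point]
    · refine ⟨E.H, 0, weight_H'.mono (by push_cast; linarith), WeightLE.zero, ?_⟩
      ext1
      · simp [point]; linear_combination ρ.ι E.H * hr
      · simp [point]
  · fin_cases i
    · refine ⟨C E.r * E.H * X, 0, (weight_rH.mul weight_X).mono (by push_cast; linarith),
        WeightLE.zero, ?_⟩
      ext1 <;> simp [point]
    · refine ⟨0, C E.r * E.H, WeightLE.zero, weight_rH.mono (by push_cast; linarith), ?_⟩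
      ext1 <;> simp [point]
    · refine ⟨C E.r, 0, (weight_C _).mono (by push_cast; positivity), WeightLE.zero, ?_⟩
      ext1
      · simp [point]; linear_combination ρ.ι (C E.r) * hH
      · simp [point]

theorem Cleared.const (a : Zq k) : ρ.Cleared 0 (ρ.eval (MvPolynomial.C (algebraMap (Zq k) (Qq k) a))) := by
  refine ⟨C (C a), 0, (weight_C _).mono (by simp), WeightLE.zero, ?_⟩
  rw [eval_C, ρ.c_algebraMap]
  ext1 <;> simp

theorem Cleared.pow {d : ℕ} {u : ρ.Quad} (hu : ρ.Cleared d u) (n : ℕ) : ρ.Cleared (n * d) (u ^ n) := by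
  induction n with
  | zero =>
    have := Cleared.const (ρ := ρ) 1
    simpa using this
  | succ n ih =>
    rw [pow_succ, Nat.succ_mul]
    exact ih.mul hu

theorem Cleared.mono {d e : ℕ} (hde : d ≤ e) {u : ρ.Quad} (hu : ρ.Cleared d u) : ρ.Cleared e u := by
  have h1 : ρ.Cleared 1 1 := by
    refine ⟨C E.r * E.H, 0, weight_rH.mono (by push_cast; linarith), WeightLE.zero, ?_⟩
    rw [one_def]
    ext1 <;> simp
  have h2 := hu.mul (h1.pow (e - d))
  rwa [one_pow, mul_one, mul_one, Nat.add_sub_cancel' hde] at h2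

theorem Cleared.of_polyBound {d : ℕ} {p : MvPolynomial (Fin 2 ⊕ Fin 3) (Qq k)}
    (hp : PolyBound d 0 p) : ρ.Cleared d (ρ.eval p) := by
  classical
  rw [p.as_sum, map_sum]
  refine Cleared.sum _ _ fun m hm => ?_
  obtain ⟨a, ha⟩ := ordGE_zero_iff.1 (hp.ord m)
  have hd := hp.degree_le m (MvPolynomial.mem_support_iff.1 hm)
  have h1 : ∀ s : Finset (Fin 2 ⊕ Fin 3),
      ρ.Cleared (∑ i ∈ s, m i) (∏ i ∈ s, ρ.point i ^ m i) := by
    intro s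
    induction s using Finset.induction_on with
    | empty =>
      have := Cleared.const (ρ := ρ) 1
      simpa using this
    | insert i s hi ih =>
      rw [Finset.sum_insert hi, Finset.prod_insert hi]
      have := (Cleared.of_point (ρ := ρ) i).pow (m i)
      rw [mul_one] at this
      exact this.mul ih
  rw [ha, MvPolynomial.monomial_eq, Finsupp.prod_fintype _ _ (by simp), map_mul, map_prod]
  simp only [map_pow, eval_X]
  have h2 := ((Cleared.const (ρ := ρ) a).mul (h1 Finset.univ))
  rw [zero_add, ← Finsupp.degree_eq_sum] at h2
  exact h2.mono hd

end Realization
end Family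
end DeformedCurve
end

/-! ### A realization by power series, and relations cleared of denominators. -/

noncomputable section

namespace DeformedCurve

open Polynomial

section TaylorAt

variable {R L : Type*} [CommRing R] [CommRing L]

theorem taylorAt_injective {φ : R →+* L} (hφ : Function.Injective φ) (a : L) :
    Function.Injective (taylorAt φ a) := by
  have h : taylorAt φ a = (coeToPowerSeries.ringHom (R := L)).comp
      ((taylorAlgHom a : L[X] →+* L[X]).comp (mapRingHom φ)) := by
    refine Polynomial.ringHom_ext' (RingHom.ext fun x => ?_) ?_
    · simp [taylorAt]
    · simp [taylorAt, add_comm]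
  rw [h, RingHom.coe_comp, RingHom.coe_comp]
  exact (coe_injective L).comp ((taylor_injective a).comp (map_injective φ hφ))

end TaylorAt

namespace Family

variable {k : Type*} [Field k] [CharP k 2] {g : ℕ} (E : Family k g)

theorem r_ne_zero : E.r ≠ 0 := by
  intro h
  have h1 := E.isUnit_toSeries_r
  rw [h, map_zero] at h1
  exact not_isUnit_zero h1

/-- Taylor expansion in `X` at a point where `H` does not vanish, over the field of rational
functions in `Γ`. It is injective on polynomials, so identities between polynomials can be read off
from it. -/
theorem exists_realization [PerfectRing k 2] :
    Nonempty (E.Realization (FractionRing (Qq k)[X])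
      (PowerSeries (FractionRing (Qq k)[X]))) := by
  have : CharZero (Qq k) := charZero_of_injective_algebraMap (algebraMap_Qq_injective (k := k))
  obtain ⟨φ, hφ⟩ : ∃ φ : (Zq k)[X] →+* FractionRing (Qq k)[X],
      φ = (algebraMap (Qq k)[X] (FractionRing (Qq k)[X])).comp
        (mapRingHom (algebraMap (Zq k) (Qq k))) := ⟨_, rfl⟩
  have hφi : Function.Injective φ := by
    rw [hφ, RingHom.coe_comp]
    exact (IsFractionRing.injective _ _).comp (map_injective _ algebraMap_Qq_injective)
  have hc : CharZero (FractionRing (Qq k)[X]) := charZero_of_injective_ringHom hφi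
  obtain ⟨a, ha⟩ : ∃ a, (E.H.map φ).eval a ≠ 0 := by
    by_contra! h
    exact (E.H_monic.map φ).ne_zero (Polynomial.funext fun a => by rw [h, eval_zero])
  have hu : ∀ p : (Zq k)[X][X], (p.map φ).eval a ≠ 0 → ∃ q, q * taylorAt φ a p = 1 := by
    intro p hp
    have h1 : IsUnit (taylorAt φ a p) := by
      rw [PowerSeries.isUnit_iff_constantCoeff, constantCoeff_taylorAt, ← eval_map]
      exact hp.isUnit
    exact h1.exists_left_inv
  obtain ⟨r', hr⟩ := hu (C E.r) (by
    rw [map_C, eval_C, Ne, map_eq_zero_iff φ hφi]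
    exact E.r_ne_zero)
  obtain ⟨H', hH⟩ := hu E.H ha
  refine ⟨⟨taylorAt φ a, (PowerSeries.C).comp
    ((algebraMap (Qq k)[X] (FractionRing (Qq k)[X])).comp C), r', H',
    PowerSeries.derivative (FractionRing (Qq k)[X]),
    taylorAt_injective hφi a, fun b => ?_, hr, hH, fun b => ?_, fun p => ?_⟩⟩
  · simp [taylorAt, hφ]
  · exact PowerSeries.derivative_C
  · exact derivative_taylorAt φ a p

theorem H_mul_derivative_pow (d : ℕ) : E.H * derivative ((C E.r * E.H) ^ d) =
    d * (C E.r * E.H) ^ d * derivative E.H := by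
  cases d with
  | zero => simp
  | succ d =>
    rw [derivative_pow, derivative_C_mul, Nat.add_sub_cancel, pow_succ, map_natCast]
    ring

/-- A relation `∑ tⱼ zᵈ Xʲ Y = ∂(p (2 Y + h)³) / (2 Y + h) + 2 ^ N e`, cleared of denominators. -/
theorem Realization.exists_nabla_eq {R A : Type*} [CommRing R] [CommRing A] [Algebra R A]
    (ρ : E.Realization R A) {d N : ℕ} {p e a b c : MvPolynomial (Fin 2 ⊕ Fin 3) (Qq k)}
    {t : (Zq k)[X][X]} (hp : PolyBound d 0 p) (he : PolyBound d 0 e)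
    (heq : polyW k t * MvPolynomial.X (.inl 1) ^ d * MvPolynomial.X (.inr 1) =
      polyW k E.data.Δ * E.scaledDerivPoly p +
      3 * p * (2 * MvPolynomial.X (.inr 1) + polyW k E.h) *
        polyW k (E.h * derivative E.h + 2 * derivative E.f) +
      (MvPolynomial.X (.inl 1) * polyW k (C E.r) - 1) * a +
      (MvPolynomial.X (.inr 2) * polyW k E.H - 1) * b +
      (MvPolynomial.X (.inr 1) ^ 2 + polyW k E.h * MvPolynomial.X (.inr 1) - polyW k E.f) * c +
      2 ^ N * e) :
    ∃ V U : (Zq k)[X][X], WeightLE 0 1 ((2 * g + 1) * d : ℤ) U ∧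
      E.H ^ d * t = E.data.nabla d V + 2 ^ N * U := by
  obtain ⟨V₀, V₁, -, -, hV⟩ := Realization.Cleared.of_polyBound (ρ := ρ) hp
  obtain ⟨U₀, U₁, -, hU, hU'⟩ := Realization.Cleared.of_polyBound (ρ := ρ) he
  refine ⟨2 * V₀ - E.h * V₁, U₁, hU.mono (by linarith), ρ.ι_injective ?_⟩
  have h2 : ρ.eval 2 = 2 := map_ofNat _ _
  have h3 : ρ.eval 3 = 3 := map_ofNat _ _
  have h1 := congrArg (fun q => (ρ.eval q).im) heq
  have hY : ρ.eval (MvPolynomial.X (.inr 1)) = ⟨0, 1⟩ := ρ.eval_X _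
  have hz : ρ.eval (MvPolynomial.X (.inl 1)) = ⟨ρ.rinv, 0⟩ := ρ.eval_X _
  simp only [map_add ρ.eval, map_mul ρ.eval, ρ.eval_rel_r, ρ.eval_rel_H, ρ.eval_rel_Y, zero_mul,
    add_zero, map_pow ρ.eval, h2, h3, ρ.eval_polyW, ρ.eval_scaledDerivPoly, hY, hz,
    ρ.two_mul_Y_add_h] at h1
  have hpow : ∀ (x : A) n,
      ((⟨x, 0⟩ : ρ.Quad) ^ n) = ⟨x ^ n, 0⟩ := by
    intro x n
    exact (map_pow (algebraMap A ρ.Quad) x n).symm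
  have htwo : (2 : ρ.Quad) = ⟨2, 0⟩ := (map_ofNat (algebraMap A ρ.Quad) 2).symm
  have hthree : (3 : ρ.Quad) = ⟨3, 0⟩ := (map_ofNat (algebraMap A ρ.Quad) 3).symm
  rw [htwo, hthree, hpow, hpow] at h1
  obtain ⟨u, hu⟩ : ∃ u, u = ρ.eval p := ⟨_, rfl⟩
  obtain ⟨w, hw⟩ : ∃ w, w = ρ.eval e := ⟨_, rfl⟩
  rw [← hu, ← hw] at h1
  rw [← hu] at hV
  rw [← hw] at hU'
  have hV0 : ρ.ι (C E.r * E.H) ^ d * u.re = ρ.ι V₀ := congrArg QuadraticAlgebra.re hV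
  have hV1 : ρ.ι (C E.r * E.H) ^ d * u.im = ρ.ι V₁ := congrArg QuadraticAlgebra.im hV
  have hU1 : ρ.ι (C E.r * E.H) ^ d * w.im = ρ.ι U₁ := congrArg QuadraticAlgebra.im hU'
  -- Only the `Y`-coordinates are compared. Both `u (2 Y + h)` and the derivative of `u` have
  -- `Y`-coordinates that depend on `u` only through `v = 2 u.re - h u.im`, so what appears is `∇
  -- v`.
  have h4 : ρ.ι t * ρ.rinv ^ d = ρ.ι E.data.Δ * ρ.D (2 * u.re - ρ.ι E.h * u.im) +
      3 * (2 * u.re - ρ.ι E.h * u.im) * ρ.ι (E.h * derivative E.h + 2 * derivative E.f)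
      + 2 ^ N * w.im := by
    have h5 : ρ.D (2 * u.re - ρ.ι E.h * u.im) =
        2 * ρ.D u.re - ρ.ι E.h * ρ.D u.im - u.im * ρ.D (ρ.ι E.h) := by
      rw [two_mul, two_mul, map_sub, map_add, Derivation.leibniz, smul_eq_mul, smul_eq_mul]
      ring
    rw [h5]
    simp [ρ.deriv_im] at h1
    simp only [map_add, map_mul, map_ofNat] at h1 ⊢
    linear_combination h1
  obtain ⟨v, hv⟩ : ∃ v, v = 2 * u.re - ρ.ι E.h * u.im := ⟨_, rfl⟩
  rw [← hv] at h4
  have hVv : ρ.ι ((C E.r * E.H) ^ d) * v = ρ.ι (2 * V₀ - E.h * V₁) := by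
    rw [map_sub, map_mul, map_mul, map_ofNat, ← hV0, ← hV1, hv, map_pow]
    ring
  have hD := congrArg ρ.D hVv
  rw [Derivation.leibniz, ρ.D_ι, ρ.D_ι, smul_eq_mul, smul_eq_mul] at hD
  have hH := congrArg ρ.ι (E.H_mul_derivative_pow d)
  -- Since `r` does not involve `X`, multiplying by `(r H) ^ d` turns `∇ v` into the numerator
  -- `nabla d` of a polynomial, and `z ^ d` absorbs the power of `r` on the left.
  have hr : ρ.ι ((C E.r * E.H) ^ d) * ρ.rinv ^ d = ρ.ι (E.H ^ d) := by
    rw [map_pow, map_mul, ← mul_pow, map_pow]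
    congr 1
    linear_combination ρ.ι E.H * ρ.rinv_mul
  obtain ⟨V, hVdef⟩ : ∃ V, V = 2 * V₀ - E.h * V₁ := ⟨_, rfl⟩
  rw [← hVdef] at hVv hD ⊢
  have hΔ := congrArg ρ.ι E.data.Δ_eq
  rw [map_mul, show E.data.H = E.H from rfl] at hΔ
  rw [map_mul, ← hr, CurveData.nabla, show E.data.H = E.H from rfl, E.data_h, E.data_f]
  rw [map_mul, map_mul, map_mul, map_natCast] at hH
  rw [← map_pow] at hU1
  simp only [map_add, map_sub, map_mul, map_ofNat, map_natCast, map_pow ρ.ι (2 : (Zq k)[X][X])]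
  simp only [map_add, map_mul, map_ofNat] at h4
  linear_combination ρ.ι ((C E.r * E.H) ^ d) * h4 + ρ.ι E.data.Δ * hD +
    3 * (ρ.ι E.h * ρ.ι (derivative E.h) + 2 * ρ.ι (derivative E.f)) * hVv + 2 ^ N * hU1 -
    v * ρ.ι (derivative ((C E.r * E.H) ^ d)) * hΔ - v * ρ.ι E.data.Δ₁ * hH -
    d * ρ.ι (derivative E.H) * ρ.ι E.data.Δ₁ * hVv

end Family
end DeformedCurve
end

/-! ### Compatible approximations, and divisibility of the coefficients of a relation. -/

noncomputable section

namespace DeformedCurve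

open Polynomial

section ApproxAt

variable {k : Type*} [Field k] [CharP k 2] {τ υ : Type*}

theorem PolyBound.pderiv {d : ℕ} {p : MvPolynomial τ (Qq k)} (hp : PolyBound d 0 p) (i : τ) :
    PolyBound d 0 (MvPolynomial.pderiv i p) := by
  refine ⟨fun m hm => ?_, fun m => ?_⟩
  · rw [MvPolynomial.coeff_pderiv] at hm
    have h1 := hp.1 _ (left_ne_zero_of_mul hm)
    rw [map_add, Finsupp.degree_single] at h1
    omega
  · rw [MvPolynomial.coeff_pderiv]
    have h1 := (hp.2 (m + Finsupp.single i 1)).mul (OrdGE.integral (k := k) ((m i : Zq k) + 1))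
    rw [map_add (algebraMap (Zq k) (Qq k)), map_one, map_natCast, add_zero] at h1
    exact h1

variable [PerfectRing k 2]

namespace Dagger

/-- The polynomial `p` of degree at most `d` is congruent to `P` modulo `2 ^ N`. -/
structure ApproxAt (N d : ℕ) (P : Dagger k τ) (p : MvPolynomial τ (Qq k)) : Prop where
  gauss : GaussGE 0 P
  bound : PolyBound d 0 p
  congr : GaussGE (N : ℤ) (P - ofPoly p)

namespace ApproxAt

variable {N d e : ℕ} {P Q : Dagger k τ} {p q : MvPolynomial τ (Qq k)}

theorem mono (h : ApproxAt N d P p) (hde : d ≤ e) : ApproxAt N e P p :=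
  ⟨h.gauss, h.bound.mono hde le_rfl, h.congr⟩

theorem ofPoly (hp : PolyBound d 0 p) : ApproxAt N d (ofPoly p) p :=
  ⟨gaussGE_ofPoly.2 (by simpa using hp.2), hp, by rw [sub_self]; exact GaussGE.zero _⟩

theorem add (hP : ApproxAt N d P p) (hQ : ApproxAt N d Q q) : ApproxAt N d (P + Q) (p + q) := by
  refine ⟨hP.gauss.add hQ.gauss, hP.bound.add hQ.bound, ?_⟩
  rw [map_add, add_sub_add_comm]
  exact hP.congr.add hQ.congr

theorem sub (hP : ApproxAt N d P p) (hQ : ApproxAt N d Q q) : ApproxAt N d (P - Q) (p - q) := by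
  refine ⟨hP.gauss.sub hQ.gauss, hP.bound.sub hQ.bound, ?_⟩
  rw [map_sub, sub_sub_sub_comm]
  exact hP.congr.sub hQ.congr

theorem mul (hP : ApproxAt N d P p) (hQ : ApproxAt N e Q q) :
    ApproxAt N (d + e) (P * Q) (p * q) := by
  refine ⟨by simpa using hP.gauss.mul hQ.gauss, by simpa using hP.bound.mul hQ.bound, ?_⟩
  have h : P * Q - Dagger.ofPoly (p * q) = (P - Dagger.ofPoly p) * Q +
      Dagger.ofPoly p * (Q - Dagger.ofPoly q) := by rw [map_mul]; ring
  rw [h]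
  have h1 := hP.congr.mul hQ.gauss
  have h2 := (gaussGE_ofPoly (n := 0).2 (by simpa using hP.bound.2)).mul hQ.congr
  rw [add_zero] at h1
  rw [zero_add] at h2
  exact h1.add h2

theorem sum {ι : Type*} (s : Finset ι) (P : ι → Dagger k τ) (p : ι → MvPolynomial τ (Qq k))
    (h : ∀ i ∈ s, ApproxAt N d (P i) (p i)) : ApproxAt N d (∑ i ∈ s, P i) (∑ i ∈ s, p i) := by
  classical
  induction s using Finset.induction_on with
  | empty =>
    have := ApproxAt.ofPoly (N := N) (PolyBound.zero (k := k) (τ := τ) d 0)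
    simpa using this
  | insert a s ha ih =>
    rw [Finset.sum_insert ha, Finset.sum_insert ha]
    exact (h a (Finset.mem_insert_self a s)).add (ih fun i hi => h i (Finset.mem_insert_of_mem hi))

theorem pderiv (hP : ApproxAt N d P p) (i : τ) :
    ApproxAt N d (Dagger.pderiv i P) (MvPolynomial.pderiv i p) :=
  ⟨hP.gauss.pderiv i, hP.bound.pderiv i, GaussGE.pderiv_sub_ofPoly i hP.congr⟩

theorem rename (e : τ ↪ υ) (hP : ApproxAt N d P p) :
    ApproxAt N d (Dagger.rename e P) (MvPolynomial.rename e p) := by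
  have h : ∀ {n : ℤ} {Q : Dagger k τ}, GaussGE n Q → GaussGE n (Dagger.rename e Q) := by
    intro n Q hQ m
    change OrdGE _ (MvPowerSeries.coeff m (MvPowerSeries.rename e Q.1))
    by_cases hm : m ∈ Set.range (Finsupp.mapDomain e)
    · obtain ⟨l, rfl⟩ := hm
      rw [← Finsupp.embDomain_eq_mapDomain, MvPowerSeries.coeff_embDomain_rename]
      exact hQ l
    · rw [MvPowerSeries.coeff_rename_eq_zero _ _ hm]
      exact OrdGE.zero _
  refine ⟨h hP.gauss, hP.bound.rename e e.injective, ?_⟩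
  rw [← rename_ofPoly, ← map_sub]
  exact h hP.congr

/-- A polynomial congruent to `0` modulo `2 ^ N` is a multiple of `2 ^ N`. -/
theorem exists_eq_two_pow_mul (h : ApproxAt N d 0 p) :
    ∃ q : MvPolynomial τ (Qq k), PolyBound d 0 q ∧ p = 2 ^ N * q := by
  have h1 : PolyBound d N p := by
    refine ⟨h.bound.1, fun m => ?_⟩
    have h2 := h.congr.neg
    rw [zero_sub, neg_neg, gaussGE_ofPoly] at h2
    exact_mod_cast h2 m
  have h3 := h1.C_mul (OrdGE.two_zpow (-(N : ℤ)))
  refine ⟨_, h3.mono le_rfl (by push_cast; simp), ?_⟩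
  rw [← mul_assoc, ← map_ofNat MvPolynomial.C, ← map_pow, ← map_mul, zpow_neg, zpow_natCast,
    mul_inv_cancel₀ (pow_ne_zero _ two_ne_zero_Qq), map_one, one_mul]

end ApproxAt

theorem exists_gaussGE (P : Dagger k τ) : ∃ n : ℕ, GaussGE (-(n : ℤ)) P := by
  obtain ⟨δ, hδ, ε, h⟩ := P.2
  obtain ⟨n, hn⟩ := exists_nat_ge (-ε)
  refine ⟨n, fun m => (h m).mono ?_⟩
  have : 0 ≤ δ * (m.degree : ℝ) := by positivity
  push_cast
  linarith

theorem exists_two_pow_mul_gaussGE {ι : Type*} [Finite ι] (P : ι → Dagger k τ) :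
    ∃ n : ℕ, ∀ i, GaussGE 0 (2 ^ n * P i) := by
  cases nonempty_fintype ι
  choose n hn using fun i => exists_gaussGE (P i)
  refine ⟨Finset.univ.sup n, fun i => ?_⟩
  have h2 : GaussGE (Finset.univ.sup n : ℕ) (2 ^ Finset.univ.sup n : Dagger k τ) := by
    have h3 := gaussGE_ofPoly.2 (PolyBound.C (τ := τ) (OrdGE.two_zpow (k := k) (Finset.univ.sup n : ℕ))).2
    rwa [zpow_natCast, map_pow, map_pow, map_ofNat, map_ofNat] at h3
  refine (h2.mul (hn i)).mono ?_
  have := Finset.le_sup (f := n) (Finset.mem_univ i)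
  omega

theorem exists_common_approx {ι : Type*} [Finite ι] [Finite τ] {P : ι → Dagger k τ}
    (hP : ∀ i, GaussGE 0 (P i)) : ∃ a : ℕ, ∀ N i, ∃ p, ApproxAt N (a * (N + 1)) (P i) p := by
  cases nonempty_fintype ι
  choose a ha using fun i => exists_approx (hP i)
  refine ⟨Finset.univ.sup a, fun N i => ?_⟩
  obtain ⟨p, hp, hp'⟩ := (ha i).mono (Finset.le_sup (Finset.mem_univ i)) N
  exact ⟨p, hP i, hp, hp'⟩

end Dagger

end ApproxAt

namespace Family

variable {k : Type*} [Field k] [CharP k 2] {g : ℕ} (E : Family k g)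

/-- The error `U` is itself reduced, at the cost `2 ^ (lam + 3) r ^ d`. The combined relation has
zero left side, so its remainder vanishes by `eq_zero_of_nabla_eq`; this gives `r ^ d tⱼ = 2 ^ n
Fⱼ`, and `r` is a unit in `ℤ_q⟦Γ⟧`. -/
theorem two_pow_dvd_of_exists_nabla_eq [PerfectRing k 2] (hg : 1 ≤ g) {d n lam : ℕ}
    {t : Fin (2 * g) → (Zq k)[X]} {V U : (Zq k)[X][X]}
    (hlam : 2 * ((2 * g + 1) * d + 9 * g * d + 8 * g + 3) ≤ 2 ^ lam)
    (hU : WeightLE 0 1 ((2 * g + 1) * d : ℤ) U)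
    (heq : E.H ^ d * ∑ j : Fin (2 * g), C (t j) * X ^ (j : ℕ) =
      E.data.nabla d V + 2 ^ (n + lam + 3) * U) (j : Fin (2 * g)) : 2 ^ n ∣ t j := by
  obtain ⟨v, F, h1, h2, -⟩ := E.exists_integral_reduction hg (M := d) (A := (2 * g + 1) * d)
    (by exact_mod_cast hU) hlam
  have hC : ∀ n : ℕ, (2 : (Zq k)[X][X]) ^ n = C (2 ^ n) := fun n => by
    rw [map_pow, map_ofNat]
  have hdeg : (C (2 ^ (n + lam + 3)) * F -
      C (2 ^ (lam + 3) * E.r ^ d) * ∑ j : Fin (2 * g), C (t j) * X ^ (j : ℕ)).degree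
        < ((2 * g : ℕ) : WithBot ℕ) := by
    refine lt_of_le_of_lt (degree_sub_le _ _) (max_lt ?_ ?_)
    · exact (by rw [← smul_eq_C_mul]; exact degree_smul_le _ _ : _ ≤ _).trans_lt h2
    · exact (by rw [← smul_eq_C_mul]; exact degree_smul_le _ _ : _ ≤ _).trans_lt (degree_sum_fin_lt _)
  have h3 := (E.eq_zero_of_nabla_eq hg (M := d)
    (v := C (2 ^ (lam + 3) * E.r ^ d) * V + C (2 ^ (n + lam + 3)) * v) hdeg (by
      rw [CurveData.nabla_add, CurveData.nabla_C_mul, CurveData.nabla_C_mul]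
      rw [hC] at h1 heq
      have h4 : (C (2 ^ (n + lam + 3)) : (Zq k)[X][X]) = C (2 ^ n) * C (2 ^ (lam + 3)) := by
        rw [← map_mul, ← pow_add, add_assoc]
      rw [h4] at heq ⊢
      rw [map_mul, map_pow C E.r]
      generalize (C (2 ^ n) : (Zq k)[X][X]) = a at *
      generalize (C (2 ^ (lam + 3)) : (Zq k)[X][X]) = b at *
      linear_combination (-a * b) * h1 - b * C E.r ^ d * heq)).2
  have h5 := congrArg (fun p => coeff p j) h3
  simp only [coeff_sub, coeff_C_mul, coeff_zero, finsetSum_coeff, coeff_X_pow] at h5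
  rw [Finset.sum_eq_single j (fun i _ hi => by
    rw [if_neg (fun h => hi (Fin.ext h.symm)), mul_zero]) (by simp), if_pos rfl, mul_one] at h5
  have h6 : E.r ^ d * t j = 2 ^ n * F.coeff j := by
    have h7 : (2 : (Zq k)[X]) ^ (lam + 3) ≠ 0 := pow_ne_zero _ (by
      intro h
      have := congrArg (fun p => coeff p 0) h
      simp at this)
    refine mul_left_cancel₀ h7 ?_
    linear_combination -h5
  have h8 : 2 ^ n ∣ (C (t j) : (Zq k)[X][X]) := by
    refine two_pow_dvd_of_toSeries fun i => ?_
    rw [map_C, coeff_C]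
    split_ifs
    · have h9 := congrArg (toSeries k) h6
      rw [map_mul, map_pow, map_mul, map_pow, map_ofNat] at h9
      exact ((E.isUnit_toSeries_r.pow d).dvd_mul_left).1 ⟨_, h9⟩
    · exact dvd_zero _
  rw [hC, C_dvd_iff_dvd_coeff] at h8
  simpa using h8 0

end Family
end DeformedCurve
end

/-! ### Lifting a cohomological relation to power series. -/

noncomputable section

namespace DeformedCurve

open Polynomial

namespace Family

variable {k : Type*} [Field k] [CharP k 2] [PerfectRing k 2] {g : ℕ} (E : Family k g)

/-- The value in `ℚ_q⟨Γ, z, X, Y, w⟩†` of a polynomial in `Γ` and `X`. -/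
def evW (p : (Zq k)[X][X]) : W k := Dagger.ofPoly (polyW k p)

theorem mkT_evW (p : (Zq k)[X][X]) : E.mkT (evW p) = E.evHom p := E.toT_polyW p

/-- The lift of `scaledDeriv` to `ℚ_q⟨Γ, z, X, Y, w⟩†`. -/
def scaledDerivW (P : W k) : W k :=
  (2 * Dagger.var (.inr 1) + evW E.h) *
      (Dagger.pderiv (.inr 0) P
        - evW (derivative E.H) * Dagger.var (.inr 2) ^ 2 * Dagger.pderiv (.inr 2) P)
    + (evW (derivative E.f) - evW (derivative E.h) * Dagger.var (.inr 1)) *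
      Dagger.pderiv (.inr 1) P

theorem mkT_scaledDerivW (P : W k) : E.mkT (E.scaledDerivW P) = E.scaledDeriv P := by
  simp only [scaledDerivW, map_add, map_mul, map_sub, map_pow, map_ofNat, mkT_evW]
  rfl

theorem scaledDerivW_two_pow_mul (n : ℕ) (P : W k) :
    E.scaledDerivW (2 ^ n * P) = 2 ^ n * E.scaledDerivW P := by
  have h : ∀ i, Dagger.pderiv i (2 ^ n * P) = 2 ^ n * Dagger.pderiv i P := by
    intro i
    have h1 : (2 ^ n : W k) = Dagger.ofPoly (MvPolynomial.C (2 ^ n)) := by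
      rw [map_pow, map_pow, map_ofNat, map_ofNat]
    rw [Dagger.pderiv_mul, h1, Dagger.pderiv_ofPoly, MvPolynomial.pderiv_C, map_zero, mul_zero,
      add_zero]
  simp only [scaledDerivW, h]
  ring

/-- The relation expressing that `∑ σⱼ Xʲ Y dX = d (P (2 Y + h)³)`. -/
def IsRelation (σ : Fin (2 * g) → Dagger k (Fin 2)) (P A B C' : W k) : Prop :=
  ∑ j : Fin (2 * g), incl k (σ j) * evW (X ^ (j : ℕ)) * Dagger.var (.inr 1) =
    evW E.data.Δ * E.scaledDerivW P +
    3 * P * (2 * Dagger.var (.inr 1) + evW E.h) *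
      evW (E.h * derivative E.h + 2 * derivative E.f) +
    (Dagger.var (.inl 1) * evW (C E.r) - 1) * A +
    (Dagger.var (.inr 2) * evW E.H - 1) * B +
    (Dagger.var (.inr 1) ^ 2 + evW E.h * Dagger.var (.inr 1) - evW E.f) * C'

theorem idealT_eq : E.idealT = Ideal.span
    {Dagger.var (.inl 1) * evW (C E.r) - 1, Dagger.var (.inr 2) * evW E.H - 1,
      Dagger.var (.inr 1) ^ 2 + evW E.h * Dagger.var (.inr 1) - evW E.f} := by
  rw [idealT, evW, evW, evW, evW, polyW, polyMap_C, Dagger.ofPoly_polyMap₁, Dagger.ofPoly_polyMap,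
    Dagger.ofPoly_polyMap, Dagger.ofPoly_polyMap]

/-- As `Z` is a unit, every primitive can be written as `q Z³`, and its differential is again
expressed by `∇`. Lifting to `W k` makes the multiples of the three relations explicit. -/
theorem exists_isRelation {σ : Fin (2 * g) → Dagger k (Fin 2)}
    (h : ∑ j : Fin (2 * g), E.mkS (σ j) • (E.x ^ (j : ℕ) * E.y) ∈ E.exactForms) :
    ∃ P A B C', E.IsRelation σ P A B C' := by
  rw [mem_exactForms_iff] at h
  obtain ⟨u, hu⟩ := h
  obtain ⟨ζ, hζ⟩ := E.isUnit_Z.exists_left_inv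
  obtain ⟨q, hq⟩ : ∃ q, q = u * ζ ^ 3 := ⟨_, rfl⟩
  have hqu : u = q * (E.Z * (E.Z * E.Z)) := by
    rw [hq]
    linear_combination (-u) * (1 + ζ * E.Z + (ζ * E.Z) ^ 2) * hζ
  obtain ⟨P, hP⟩ := E.mkT_surjective q
  have h1 : ∑ j : Fin (2 * g), E.mkS (σ j) • (E.x ^ (j : ℕ) * E.y) =
      E.evHom E.data.Δ * E.delta q +
        3 * q * E.Z * E.evHom (E.h * derivative E.h + 2 * derivative E.f) := by
    refine E.isUnit_Z.mul_left_cancel ?_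
    rw [hu, hqu, delta_mul, delta_mul, delta_mul, delta_Z, ← Z_sq]
    ring
  have h2 : ∑ j : Fin (2 * g), incl k (σ j) * evW (X ^ (j : ℕ)) * Dagger.var (.inr 1) -
      (evW E.data.Δ * E.scaledDerivW P +
      3 * P * (2 * Dagger.var (.inr 1) + evW E.h) *
        evW (E.h * derivative E.h + 2 * derivative E.f)) ∈ E.idealT := by
    refine Ideal.Quotient.eq_zero_iff_mem.1 ?_
    change E.mkT _ = 0
    rw [map_sub, sub_eq_zero, map_sum, map_add]
    simp only [map_mul, mkT_evW, map_add, map_ofNat E.mkT, mkT_scaledDerivW]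
    rw [← delta_mkT, hP]
    have hx : ∀ j : ℕ, E.evHom (X ^ j) = E.x ^ j := fun j => by
      rw [map_pow]; congr 1; simp [evHom]
    have hl : ∑ j : Fin (2 * g), E.mkT (incl k (σ j)) * E.evHom (X ^ (j : ℕ)) *
        E.mkT (Dagger.var (.inr 1)) = ∑ j : Fin (2 * g), E.mkS (σ j) • (E.x ^ (j : ℕ) * E.y) :=
      Finset.sum_congr rfl fun j _ => by rw [mkS_smul, hx, mul_assoc, y]
    rw [hl, h1, Z, y]
    simp only [map_add, map_mul]
  rw [idealT_eq, Ideal.mem_span_insert] at h2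
  obtain ⟨A, R, hR, h3⟩ := h2
  rw [Ideal.mem_span_insert] at hR
  obtain ⟨B, R', hR', h4⟩ := hR
  obtain ⟨C', h5⟩ := Ideal.mem_span_singleton'.1 hR'
  refine ⟨P, A, B, C', ?_⟩
  rw [IsRelation]
  linear_combination h3 + h4 - h5

variable {E} in
theorem IsRelation.two_pow_mul {σ : Fin (2 * g) → Dagger k (Fin 2)} {P A B C' : W k}
    (h : E.IsRelation σ P A B C') (n : ℕ) :
    E.IsRelation (fun j => 2 ^ n * σ j) (2 ^ n * P) (2 ^ n * A) (2 ^ n * B) (2 ^ n * C') := by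
  have h1 : ∑ j : Fin (2 * g), incl k (2 ^ n * σ j) * evW (X ^ (j : ℕ)) * Dagger.var (.inr 1) =
      2 ^ n * ∑ j : Fin (2 * g), incl k (σ j) * evW (X ^ (j : ℕ)) * Dagger.var (.inr 1) := by
    rw [Finset.mul_sum]
    refine Finset.sum_congr rfl fun j _ => ?_
    rw [map_mul, map_pow, map_ofNat]
    ring
  rw [IsRelation] at h ⊢
  rw [h1, h, scaledDerivW_two_pow_mul]
  ring

end Family
end DeformedCurve
end

/-! ### Linear independence of the forms and uniqueness of the matrix. -/

noncomputable section

namespace DeformedCurve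

open Polynomial

namespace Family

variable {k : Type*} [Field k] [CharP k 2] [PerfectRing k 2] {g : ℕ} (E : Family k g)

theorem exists_approxAt_scaledDerivW : ∃ c : ℕ, ∀ {N d : ℕ} {P : W k}
    {p : MvPolynomial (Fin 2 ⊕ Fin 3) (Qq k)}, Dagger.ApproxAt N d P p →
    Dagger.ApproxAt N (c + d) (E.scaledDerivW P) (E.scaledDerivPoly p) := by
  obtain ⟨c₁, h₁⟩ := exists_polyBound_polyMap (τ := Fin 2 ⊕ Fin 3) (.inl 0) (.inr 0) E.h
  obtain ⟨c₂, h₂⟩ := exists_polyBound_polyMap (τ := Fin 2 ⊕ Fin 3) (.inl 0) (.inr 0) (derivative E.H)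
  obtain ⟨c₃, h₃⟩ := exists_polyBound_polyMap (τ := Fin 2 ⊕ Fin 3) (.inl 0) (.inr 0) (derivative E.f)
  obtain ⟨c₄, h₄⟩ := exists_polyBound_polyMap (τ := Fin 2 ⊕ Fin 3) (.inl 0) (.inr 0) (derivative E.h)
  refine ⟨c₁ + c₂ + c₃ + c₄ + 10, fun {N d P p} hP => ?_⟩
  have hX : ∀ i : Fin 2 ⊕ Fin 3, Dagger.ApproxAt (k := k) N 1 (Dagger.var i) (MvPolynomial.X i) :=
    fun i => by
      rw [← Dagger.ofPoly_X]
      exact .ofPoly (PolyBound.X i)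
  have e₁ : Dagger.ApproxAt N c₁ (evW E.h) (polyW k E.h) := .ofPoly h₁
  have e₂ : Dagger.ApproxAt N c₂ (evW (derivative E.H)) (polyW k (derivative E.H)) := .ofPoly h₂
  have e₃ : Dagger.ApproxAt N c₃ (evW (derivative E.f)) (polyW k (derivative E.f)) := .ofPoly h₃
  have e₄ : Dagger.ApproxAt N c₄ (evW (derivative E.h)) (polyW k (derivative E.h)) := .ofPoly h₄
  have hY2 : Dagger.ApproxAt (k := k) N (c₁ + 1) (2 * Dagger.var (.inr 1))
      (2 * MvPolynomial.X (.inr 1 : Fin 2 ⊕ Fin 3)) := by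
    rw [two_mul, two_mul]
    exact ((hX _).add (hX _)).mono (by omega)
  have hw2 : Dagger.ApproxAt (k := k) N 2 (Dagger.var (.inr 2) ^ 2)
      (MvPolynomial.X (.inr 2 : Fin 2 ⊕ Fin 3) ^ 2) := by
    rw [pow_two, pow_two]
    exact (hX _).mul (hX _)
  refine Dagger.ApproxAt.add (((hY2.add (e₁.mono (by omega))).mul
    (((hP.pderiv (.inr 0)).mono (by omega)).sub ((e₂.mul hw2).mul (hP.pderiv (.inr 2))))).mono
    (by omega)) ((((e₃.mono (e := c₃ + c₄ + 1) (by omega)).sub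
      ((e₄.mul (hX _)).mono (by omega))).mul (hP.pderiv (.inr 1))).mono (by omega))

/-- All series in the relation are replaced by integral polynomials of degree linear in `N` modulo
`2 ^ N`. The defect is `2 ^ N` times an integral polynomial of comparable degree, and the polynomial
relation is evaluated in a realization. -/
theorem IsRelation.exists_nabla_eq {σ : Fin (2 * g) → Dagger k (Fin 2)} {P A B C' : W k}
    (h : E.IsRelation σ P A B C') (hσ : ∀ j, Dagger.GaussGE 0 (σ j))
    (hW : ∀ i, Dagger.GaussGE 0 (![P, A, B, C'] i)) :
    ∃ b : ℕ, ∀ N : ℕ, ∃ (κ : Fin (2 * g) → MvPolynomial (Fin 2) (Qq k))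
      (t : Fin (2 * g) → (Zq k)[X]) (V U : (Zq k)[X][X]),
      (∀ j, PolyBound (b * (N + 1) * (E.r.natDegree + 2)) 0 (κ j) ∧
        Dagger.GaussGE (N : ℤ) (σ j - Dagger.ofPoly
          (E.relS * κ j + polyMap₁ 0 (t j) * MvPolynomial.X 1 ^ (b * (N + 1))))) ∧
      WeightLE 0 1 ((2 * g + 1) * (b * (N + 1) : ℕ) : ℤ) U ∧
      E.H ^ (b * (N + 1)) * ∑ j : Fin (2 * g), C (t j) * X ^ (j : ℕ) =
        E.data.nabla (b * (N + 1)) V + 2 ^ N * U := by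
  obtain ⟨a₁, ha₁⟩ := Dagger.exists_common_approx hσ
  obtain ⟨a₂, ha₂⟩ := Dagger.exists_common_approx hW
  obtain ⟨c₀, h₀⟩ := E.exists_approxAt_scaledDerivW
  have hc : ∀ p : (Zq k)[X][X], ∃ c, ∀ N, Dagger.ApproxAt N c (evW p) (polyW k p) := fun p => by
    obtain ⟨c, hc⟩ := exists_polyBound_polyMap (τ := Fin 2 ⊕ Fin 3) (.inl 0) (.inr 0) p
    exact ⟨c, fun N => .ofPoly hc⟩
  obtain ⟨c₁, h₁⟩ := hc E.data.Δ
  obtain ⟨c₂, h₂⟩ := hc E.h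
  obtain ⟨c₃, h₃⟩ := hc (E.h * derivative E.h + 2 * derivative E.f)
  obtain ⟨c₄, h₄⟩ := hc (C E.r)
  obtain ⟨c₅, h₅⟩ := hc E.H
  obtain ⟨c₆, h₆⟩ := hc E.f
  choose c₇ h₇ using fun j : Fin (2 * g) => hc (X ^ (j : ℕ))
  obtain ⟨c, hcdef⟩ : ∃ c, c = c₀ + c₁ + c₂ + c₃ + c₄ + c₅ + c₆ + Finset.univ.sup c₇ + 10 := ⟨_, rfl⟩
  have hc₇ : ∀ j, c₇ j ≤ Finset.univ.sup c₇ := fun j => Finset.le_sup (Finset.mem_univ j)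
  refine ⟨a₁ + a₂ + c, fun N => ?_⟩
  obtain ⟨d, hd⟩ : ∃ d, d = (a₁ + a₂ + c) * (N + 1) := ⟨_, rfl⟩
  have hd' : a₁ * (N + 1) + a₂ * (N + 1) + c ≤ d := by rw [hd]; nlinarith
  choose s hs using ha₁ N
  obtain ⟨p, hp⟩ := ha₂ N 0
  obtain ⟨α, hα⟩ := ha₂ N 1
  obtain ⟨β, hβ⟩ := ha₂ N 2
  obtain ⟨γ, hγ⟩ := ha₂ N 3
  -- Eliminating `z` up to the single power `z ^ d` leaves a polynomial `t j` in `Γ` alone, to which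
  -- the divisibility statement over `ℤ_q[Γ]` applies.
  choose κ t hκ hst using fun j => E.exists_eq_relS_mul_add
    ((hs j).bound.mono (show _ ≤ d by omega) le_rfl)
  have hX : ∀ i : Fin 2 ⊕ Fin 3, Dagger.ApproxAt (k := k) N 1 (Dagger.var i) (MvPolynomial.X i) :=
    fun i => by
      rw [← Dagger.ofPoly_X]
      exact .ofPoly (PolyBound.X i)
  have hone : Dagger.ApproxAt (k := k) (τ := Fin 2 ⊕ Fin 3) N 0 1 1 := by
    rw [← map_one Dagger.ofPoly]
    exact .ofPoly PolyBound.one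
  have hL : Dagger.ApproxAt N d
      (∑ j : Fin (2 * g), incl k (σ j) * evW (X ^ (j : ℕ)) * Dagger.var (.inr 1))
      (∑ j : Fin (2 * g), MvPolynomial.rename Sum.inl (s j) * polyW k (X ^ (j : ℕ)) *
        MvPolynomial.X (.inr 1)) :=
    .sum _ _ _ fun j _ => ((((hs j).rename Function.Embedding.inl).mul (h₇ j N)).mul (hX _)).mono
      (by have := hc₇ j; omega)
  have hY2 : Dagger.ApproxAt (k := k) N (c₂ + 1) (2 * Dagger.var (.inr 1))
      (2 * MvPolynomial.X (.inr 1 : Fin 2 ⊕ Fin 3)) := by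
    rw [two_mul, two_mul]
    exact ((hX _).add (hX _)).mono (by omega)
  have h3p : Dagger.ApproxAt N (a₂ * (N + 1)) (3 * P) (3 * p) := by
    have e₁ : 3 * P = P + P + P := by ring
    have e₂ : 3 * p = p + p + p := by ring
    rw [e₁, e₂]
    exact (hp.add hp).add hp
  have hYY : Dagger.ApproxAt (k := k) N (c₂ + c₆ + 2) (Dagger.var (.inr 1) ^ 2)
      (MvPolynomial.X (.inr 1 : Fin 2 ⊕ Fin 3) ^ 2) := by
    rw [pow_two, pow_two]
    exact ((hX _).mul (hX _)).mono (by omega)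
  have hr₁ := (((h₁ N).mul (h₀ hp)).mono (show _ ≤ d by omega)).add
    (((h3p.mul (hY2.add ((h₂ N).mono (by omega)))).mul (h₃ N)).mono (show _ ≤ d by omega))
  have hr₂ := hr₁.add ((((((hX (.inl 1)).mul (h₄ N)).sub (hone.mono (by omega))).mul hα)).mono
    (show _ ≤ d by omega))
  have hr₃ := hr₂.add ((((((hX (.inr 2)).mul (h₅ N)).sub (hone.mono (by omega))).mul hβ)).mono
    (show _ ≤ d by omega))
  have hr₄ := hr₃.add ((((hYY.add (((h₂ N).mul (hX (.inr 1))).mono (by omega))).sub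
    ((h₆ N).mono (by omega))).mul hγ).mono (show _ ≤ d by omega))
  have hE := hL.sub hr₄
  have h0 := sub_eq_zero.2 h
  simp only [Matrix.cons_val] at hE
  rw [h0] at hE
  obtain ⟨e, he, heq⟩ := hE.exists_eq_two_pow_mul
  obtain ⟨ρ⟩ := E.exists_realization
  obtain ⟨V, U, hU, hVU⟩ := Realization.exists_nabla_eq E ρ (d := d) (N := N) (p := p) (e := e)
    (t := ∑ j : Fin (2 * g), C (t j) * X ^ (j : ℕ))
    (a := α - ∑ j : Fin (2 * g), MvPolynomial.rename Sum.inl (κ j) * polyW k (X ^ (j : ℕ)) *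
        MvPolynomial.X (.inr 1)) (b := β) (c := γ) (hp.bound.mono (by omega) le_rfl) he (by
      have h8 : ∑ j : Fin (2 * g), MvPolynomial.rename Sum.inl (s j) * polyW k (X ^ (j : ℕ)) *
          MvPolynomial.X (.inr 1) = (MvPolynomial.X (.inl 1) * polyW k (C E.r) - 1) *
          ∑ j : Fin (2 * g), MvPolynomial.rename Sum.inl (κ j) * polyW k (X ^ (j : ℕ)) *
            MvPolynomial.X (.inr 1) + polyW k (∑ j : Fin (2 * g), C (t j) * X ^ (j : ℕ)) *
            MvPolynomial.X (.inl 1) ^ d * MvPolynomial.X (.inr 1) := by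
        rw [map_sum, Finset.mul_sum, Finset.sum_mul, Finset.sum_mul, ← Finset.sum_add_distrib]
        refine Finset.sum_congr rfl fun j _ => ?_
        rw [hst j, map_add, map_mul, map_mul, map_pow, rename_polyMap₁, relS, map_sub, map_mul,
          rename_polyMap₁, map_one, MvPolynomial.rename_X, map_mul, polyW, polyMap_C, polyMap_C]
        ring
      rw [h8] at heq
      linear_combination heq)
  refine ⟨κ, t, V, U, fun j => ⟨?_, ?_⟩, ?_, ?_⟩
  · rw [← hd]; exact hκ j
  · rw [← hd, ← hst j]; exact (hs j).congr
  · rw [← hd]; exact hU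
  · rw [← hd]; exact hVU

/-- The forms `Xʲ Y dX`, `0 ≤ j < 2 g`, are linearly independent in cohomology. -/
theorem eq_zero_of_sum_mem_exactForms (hg : 1 ≤ g) {s : Fin (2 * g) → E.S}
    (h : ∑ j : Fin (2 * g), s j • (E.x ^ (j : ℕ) * E.y) ∈ E.exactForms) (j : Fin (2 * g)) :
    s j = 0 := by
  choose σ hσ using fun j => E.mkS_surjective (s j)
  simp only [← hσ] at h
  obtain ⟨P, A, B, C', hrel⟩ := E.exists_isRelation h
  obtain ⟨n₁, hn₁⟩ := Dagger.exists_two_pow_mul_gaussGE σ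
  obtain ⟨n₂, hn₂⟩ := Dagger.exists_two_pow_mul_gaussGE ![P, A, B, C']
  have h2 : ∀ {τ : Type} (n : ℕ) {Q : Dagger k τ}, Dagger.GaussGE 0 Q →
      Dagger.GaussGE 0 (2 ^ n * Q) := by
    intro τ n Q hQ
    have h3 : Dagger.GaussGE 0 (2 ^ n : Dagger k τ) := by
      have h4 := Dagger.gaussGE_ofPoly.2
        (PolyBound.C (τ := τ) (OrdGE.two_zpow (k := k) (n : ℤ))).2
      rw [zpow_natCast, map_pow, map_pow, map_ofNat, map_ofNat] at h4
      exact h4.mono (by omega)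
    simpa using h3.mul hQ
  obtain ⟨b, hb⟩ := IsRelation.exists_nabla_eq E (hrel.two_pow_mul (n₁ + n₂))
    (fun j => by rw [add_comm, pow_add, mul_assoc]; exact h2 _ (hn₁ j))
    (fun i => by
      have h3 := h2 n₁ (hn₂ i)
      rw [← mul_assoc, ← pow_add] at h3
      fin_cases i <;> exact h3)
  -- With `d = b (N + 1)` the quantity to be bounded by `2 ^ lam` is at most `c (N + 1)`, so `lam =
  -- c + clog (N + 1)` is enough.
  obtain ⟨c, hc⟩ : ∃ c, c = 2 * ((2 * g + 1) * b + 9 * g * b + 8 * g + 3) := ⟨_, rfl⟩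
  have h0 : E.mkS (2 ^ (n₁ + n₂) * σ j) = 0 := by
    refine E.mkS_eq_zero_of_approx (a := b * (2 * c + 9) * (E.r.natDegree + 2)) (K := 0)
      fun M => ?_
    -- The loss is at most `lam + 3 ≤ c + N / 2 + 4`, so this `N` leaves precision at least `M`,
    -- while `N + 1 ≤ (2 c + 9)(M + 1)` keeps the degrees linear in `M`.
    obtain ⟨N, hN⟩ : ∃ N, N = 2 * (M + c + 4) := ⟨_, rfl⟩
    obtain ⟨lam, hlam⟩ : ∃ lam, lam = c + Nat.clog 2 (N + 1) := ⟨_, rfl⟩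
    have h4 := two_mul_clog_succ_le N
    obtain ⟨n, hn⟩ := Nat.exists_eq_add_of_le (show lam + 3 ≤ N by omega)
    obtain ⟨κ, t, V, U, h5, h6, h7⟩ := hb N
    have h8 : 2 * ((2 * g + 1) * (b * (N + 1)) + 9 * g * (b * (N + 1)) + 8 * g + 3) ≤ 2 ^ lam := by
      have h9 : N + 1 ≤ 2 ^ Nat.clog 2 (N + 1) := Nat.le_pow_clog (by norm_num) _
      rw [hlam, pow_add]
      refine le_trans ?_ (Nat.mul_le_mul (Nat.lt_two_pow_self (n := c)).le h9)
      rw [hc]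
      nlinarith
    have h9 := E.two_pow_dvd_of_exists_nabla_eq hg (n := n) h8 h6
      (by rw [show n + lam + 3 = N by omega]; exact h7) j
    refine ⟨κ j, (h5 j).1.mono ?_ le_rfl, ?_⟩
    · have h10 : N + 1 ≤ (2 * c + 9) * (M + 1) := by rw [hN]; nlinarith
      calc b * (N + 1) * (E.r.natDegree + 2)
          ≤ b * ((2 * c + 9) * (M + 1)) * (E.r.natDegree + 2) := by gcongr
        _ = _ := by ring
    · obtain ⟨q, hq⟩ := h9
      have h11 : 2 ^ (n₁ + n₂) * σ j - Dagger.ofPoly (E.relS * κ j) =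
          (2 ^ (n₁ + n₂) * σ j - Dagger.ofPoly
          (E.relS * κ j + polyMap₁ 0 (t j) * MvPolynomial.X 1 ^ (b * (N + 1)))) +
          Dagger.ofPoly (polyMap₁ 0 (t j) * MvPolynomial.X 1 ^ (b * (N + 1))) := by
        rw [map_add]; ring
      rw [h11]
      refine ((h5 j).2.mono (by push_cast; omega)).add ?_
      have h12 : polyMap₁ (0 : Fin 2) (t j) * MvPolynomial.X 1 ^ (b * (N + 1)) =
          MvPolynomial.C (2 ^ (n : ℤ)) *
            (polyMap₁ 0 q * MvPolynomial.X 1 ^ (b * (N + 1))) := by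
        rw [hq, map_mul, map_pow, map_ofNat, zpow_natCast, map_pow, map_ofNat, mul_assoc]
      rw [h12]
      have h13 := ((polyBound_polyMap₁ (0 : Fin 2) q).mul
        ((PolyBound.X 1).pow (b * (N + 1)))).C_mul (OrdGE.two_zpow (k := k) (n : ℤ))
      refine (Dagger.gaussGE_ofPoly (n := (n : ℤ)).2 ?_).mono (by push_cast; omega)
      simpa using h13.2
  have h3 : (2 : E.S) ^ (n₁ + n₂) * s j = 0 := by
    rw [← hσ j, ← h0, map_mul, map_pow, map_ofNat]
  have h4 : (2 : E.S) = algebraMap (Qq k) E.S 2 := (map_ofNat _ 2).symm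
  have h5 : IsUnit ((2 : E.S) ^ (n₁ + n₂)) := by
    rw [h4]
    exact ((IsUnit.mk0 _ two_ne_zero_Qq).map _).pow _
  exact (h5.mul_right_eq_zero).1 h3

theorem IsFrobMatrix.unique (hg : 1 ≤ g) {t : E.T}
    {F F' : Matrix (Fin (2 * g)) (Fin (2 * g)) E.S} (hF : E.IsFrobMatrix t F)
    (hF' : E.IsFrobMatrix t F') : F' = F := by
  rw [isFrobMatrix_iff] at hF hF'
  ext i j
  rw [← sub_eq_zero]
  refine E.eq_zero_of_sum_mem_exactForms hg (s := fun j => F' i j - F i j) ?_ j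
  have h := sub_mem (hF i) (hF' i)
  rw [sub_sub_sub_cancel_left, ← Finset.sum_sub_distrib] at h
  simpa only [sub_smul] using h

end Family
end DeformedCurve
end

/-! ### Explicit constants. -/

theorem mainTheorem7 :
    ∃ (A : ℝ) (χ₁ : ℕ → ℕ → ℕ → ℕ) (χ₂ : ℕ → ℕ → ℕ → ℕ → ℕ) (φ : ℕ → ℕ),
      (∀ g D N : ℕ, 1 ≤ g → 1 ≤ D →
        (χ₁ g D N : ℝ) ≤ A * (D * max (N : ℝ) (Real.logb 2 (g + 1)))) ∧
      (∀ g κ D N : ℕ, 1 ≤ g → 1 ≤ D →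
        (χ₂ g κ D N : ℝ) ≤ A * (g * κ * D * max (N : ℝ) (Real.logb 2 (g + 1)))) ∧
      (∀ g : ℕ, 1 ≤ g → (φ g : ℝ) ≤ A * Real.logb 2 (g + 1)) ∧
      ∀ (k : Type*) [Field k] [CharP k 2] [Finite k] (g : ℕ), 1 ≤ g →
        ∀ E : DeformedCurve.Family k g,
          ∃ (t : E.T) (F : Matrix (Fin (2 * g)) (Fin (2 * g)) E.S),
            E.IsFrobY t ∧ (∀ t' : E.T, E.IsFrobY t' → t' = t) ∧
            E.IsFrobMatrix t F ∧
            (∀ F' : Matrix (Fin (2 * g)) (Fin (2 * g)) E.S, E.IsFrobMatrix t F' → F' = F) ∧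
            (∀ (N : ℕ) (i j : Fin (2 * g)),
              ∃ p : Polynomial (DeformedCurve.Qq k), p.natDegree ≤ χ₂ g E.κ E.D N ∧
                E.SOrdGE (N : ℤ) (E.rS ^ χ₁ g E.D N * F i j
                  - p.eval₂ (algebraMap (DeformedCurve.Qq k) E.S) E.ΓS)) ∧
            ∀ i j : Fin (2 * g), E.SOrdGE (-(φ g : ℤ)) (F i j) := by
  have hlog : ∀ g : ℕ, 1 ≤ g → 1 ≤ Real.logb 2 (g + 1) ∧
      (Nat.clog 2 (g + 1) : ℝ) ≤ 2 * Real.logb 2 (g + 1) := by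
    intro g hg
    have h1 : (2 : ℝ) ≤ g + 1 := by
      have : (1 : ℝ) ≤ g := by exact_mod_cast hg
      linarith
    have h2 : 1 ≤ Real.logb 2 (g + 1) := by
      rw [Real.le_logb_iff_rpow_le (by norm_num) (by linarith), Real.rpow_one]
      exact h1
    refine ⟨h2, ?_⟩
    have h3 := Real.natCeil_logb_natCast 2 (g + 1)
    have h4 := Nat.ceil_lt_add_one (show 0 ≤ Real.logb 2 (g + 1) by linarith)
    push_cast at h3
    rw [h3] at h4
    linarith
  have hnum : ∀ g N : ℕ, 1 ≤ g → (DeformedCurve.Family.numTerms g N : ℝ) ≤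
      34 * max (N : ℝ) (Real.logb 2 (g + 1)) := by
    intro g N hg
    obtain ⟨h1, h2⟩ := hlog g hg
    have h3 := le_max_left (N : ℝ) (Real.logb 2 (g + 1))
    have h4 := le_max_right (N : ℝ) (Real.logb 2 (g + 1))
    rw [DeformedCurve.Family.numTerms]
    push_cast
    linarith
  -- The number of terms is at most `(2 + 24 + 8) max(N, log₂ (g + 1))`, as `log₂ (g + 1) ≥ 1`, and
  -- `4828 = 142 * 34`.
  refine ⟨4828, fun g D N => 10 * D * DeformedCurve.Family.numTerms g N,
    fun g κ D N => 142 * g * κ * D * DeformedCurve.Family.numTerms g N,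
    fun g => 12 + 2 * Nat.clog 2 (g + 1), fun g D N hg _ => ?_, fun g κ D N hg _ => ?_,
    fun g hg => ?_, ?_⟩
  · have h1 := mul_le_mul_of_nonneg_left (hnum g N hg) (show (0 : ℝ) ≤ 10 * D by positivity)
    have h2 : (0 : ℝ) ≤ D * max (N : ℝ) (Real.logb 2 (g + 1)) := by positivity
    push_cast
    linarith
  · have h1 := mul_le_mul_of_nonneg_left (hnum g N hg)
      (show (0 : ℝ) ≤ 142 * g * κ * D by positivity)
    push_cast
    linarith
  · obtain ⟨h1, h2⟩ := hlog g hg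
    push_cast
    linarith
  · intro k _ _ _ g hg E
    obtain ⟨t, F, ht, hF, hp, hφ⟩ := E.exists_isFrobMatrix hg
    exact ⟨t, F, ht, fun t' ht' => DeformedCurve.Family.IsFrobY.unique E ht ht', hF,
      fun F' hF' => DeformedCurve.Family.IsFrobMatrix.unique E hg hF hF', hp, hφ⟩
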